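/- **Notation.** Let $a,N\in\mathbb R$ and let $F,G$ be finite (possibly empty) sets of positive integers, with cardinalities $k_1=|F|$, $k_3=|G|$. Put $(z)_j=z(z+1)\cdots(z+j-1)$, and for a finite set $E$ of positive integers put $I(E)=\{1,\dots,\max E\}\setminus\{\max E-f: f\in E\}$, with $I(\emptyset)=\emptyset$ and $\max\emptyset=-1$. Let $U=I(F)$, $V=I(G)$, $m_1=|U|$, $m_3=|V|$, $m=2(m_1+m_3)$. Let $$\theta_x=x(x+2a+1),\quad \sigma_x=-(2x+2a-1),\quad N_{x,j}=(x-j-N)_j,\quad D_{x,j}=(-1)^j(x-j+2a+N+2)_j,$$ $$\xi^1_{x,j}=\frac{N_{x,j}}{D_{x,j}},\quad \xi^2_{x,j}=(-1)^j\xi^1_{x,j},\quad \xi^3_{x,j}=1,\quad \xi^4_{x,j}=(-1)^j .$$ Let $R^{\alpha,\beta,M}_n$ be the dual Hahn polynomial, $R_n^{\alpha,\beta,M}(t(t+\alpha+\beta+1))={}_3F_2(-n,-t,t+\alpha+\beta+1;\alpha+1,-M;1)$, and $$Y_u(x)=R_u^{-a,-a,2a+N}(x+2a)\ (u\in U),\qquad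 Z_v(x)=R_v^{-a,-a,-2-N}(x+2a)\ (v\in V).$$ Assume that these polynomials are defined, i.e. $(1-a)_u(-2a-N)_u\neq0$ for $u\in U$ and $(1-a)_v(N+2)_v\ne0$ for $v\in V$, and that $v-u+a+N+1\neq 0$ for all $u\in U$, $v\in V$. Let $\Omega(x)$ be the determinant of the $m\times m$ matrix whose rows are, in this order and with the elements of $U$ and $V$ in increasing order, $(\xi^{i}_{x-j,m-j}Y_u(\theta_{x-j}))_{j=1}^m$, $u\in U$, for $i=1$ and then for $i=2$, and $(\xi^{i}_{x-j,m-j}Z_v(\theta_{x-j}))_{j=1}^m$, $v\in V$, for $i=3$ and then for $i=4$. Denote by $i(h)$ the value of $i$ in the $h$-th row and by $(\Omega(x))_{h,j}$ the minor obtained by deleting row $h$ and column $j$. Let $\Omega_1(x)$ be the determinant of the matrix of size $m_1+m_3$ with rows $(\xi^1_{x-2j+1,m-2j+1}Y_u(\theta_{x-2j+1}))_{j=1}^{m_1+m_3}$, $u\in U$, and then $(Z_v(\theta_{x-2j+1}))_{j=1}^{m_1+m_3}$, $v\in V$. Let $$H(x)=\frac{\sigma_{x-m_1-m_3+1}(D_{x-1,m-1})^{m_1}}{p(x)q(x)(N_{x-m+1,1})^{m_1}},$$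 $$p(x)=\prod_{j=1}^{m_1-1}D_{x-1,2j}N_{x-m+2j+1,2j},\qquad q(x)=\prod_{i=1}^{\lfloor (m_1+m_3)/2\rfloor}\ \prod_{j=1}^{m-4i+1}\sigma_{x-m+2i+j}.$$ **Theorem.** The rational function $\Omega$ is not identically zero, and there is exactly one polynomial $R$ with $$\sigma_{x-\frac{m-1}2}R(x)+\sigma_{x+1-\frac{m-1}2}R(x+1)=H(x)\Omega_1(x).$$ For this $R$ put $S(x)=\sigma_{x-\frac{m-1}{2}}R(x)/\Omega(x)$ and $M_h(x)=\sum_{j=1}^m(-1)^{h+j}\xi^{i(h)}_{x,m-j}S(x+j)(\Omega(x+j))_{h,j}$ for $h=1,\dots,m$. Then: 1. $S(x)\Omega(x)$ is a polynomial. 2. There are polynomials $\tilde M_1,\dots,\tilde M_m$ with $M_h(x)=\sigma_{x+1}\tilde M_h(\theta_x)$ for $h=1,\dots,m$. 3. There is a polynomial $P_S$ with $P_S(\theta_x)-P_S(\theta_{x-1})=S(x)\Omega(x)+S(x+m)\Omega(x+m)$. 4. Write $\Delta f(x)=f(x+1)-f(x)$, $\nabla f(x)=f(x)-f(x-1)$,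 $D_H=(x+a+1)(x-N)\Delta-x(x-a-N-1)\nabla$, $\mathcal D_1=\frac{2a+1}2+x\nabla$, $\mathcal D_2=\frac{2a+1}2+(x-N)\Delta$, $\mathcal D_3=\frac{2a+1}2+(x+a+1)\Delta$, $\mathcal D_4=\frac{2a+1}2+(x-a-N-1)\nabla$, $U=\{u_1<\dots<u_{m_1}\}$ and $V=\{v_1<\dots<v_{m_3}\}$. For all $\tilde M_h$, $P_S$ as in 2 and 3, the difference operator $$D_S=\tfrac12P_S(D_H)+\sum_{h=1}^{m_1}\tilde M_h(D_H)(\mathcal D_1+\mathcal D_2)Y_{u_h}(D_H)+\sum_{h=1}^{m_3}\tilde M_{2m_1+h}(D_H)(\mathcal D_3+\mathcal D_4)Z_{v_h}(D_H)$$ has order exactly $$2\left(\sum_{f\in F}f+\sum_{f\in G}f-\binom{k_1}2-\binom{k_3}2+1\right).$$ Here a difference operator $\sum_{l=s}^{r}h_l(x)\,\mathrm{Sh}_l$, where $\mathrm{Sh}_l f(x)=f(x+l)$ and the $h_l$ are polynomials with $h_s,h_r\neq0$, has order $r-s$. 5. $D_S$ has the Krall–Hahn orthogonal polynomials as eigenfunctions,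 in the following sense. Let $\hat a=a-\max F-\max G-2$ and $\hat N=N+2\max G+2$, and let $\rho_{\hat a,\hat N}$ be the Hahn functional with parameters $\hat a,\hat a,\hat N$. That is: if $\hat N\in\{0,1,2,\dots\}$, $\hat a\neq-1,\dots,-\hat N$ and $2\hat a\ne-1,\dots,-2\hat N-1$, it is the measure $\sum_{x=0}^{\hat N}\binom{\hat N}{x}(\hat a+1)_x(\hat a+1)_{\hat N-x}\delta_x$; if $\hat N\notin\{0,1,2,\dots\}$ and $\hat a,2\hat a,2\hat a+\hat N+1\ne-1,-2,\dots$, it is a moment functional with respect to which the Hahn polynomials $h_n^{\hat a,\hat a,\hat N}$, $n\ge0$, are orthogonal with non-null norms. If $p_0,\dots,p_n$ are polynomials, $\deg p_k=k$, orthogonal with non-null norms with respect to $$\prod_{f\in F}(\hat a+\hat N+1+f-x)(x+\hat a+1+f)\prod_{f\in G}(\hat N-f-x)(x-f)\,\rho_{\hat a,\hat N},$$ then each polynomial $p_k(x+\max G+1)$, $0\le k\le n$, is an eigenfunction of $D_S$. -/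

import Mathlib

open Polynomial

namespace KrallHahn

noncomputable section

/-! Rational functions of `x` over `ℝ` are elements of `RatFunc ℝ`. The objects below that depend
on `x` are written as functions of an argument `y : RatFunc ℝ`; taking `y = RatFunc.X` gives the
function itself, and `y = RatFunc.X + c` its translate by `c`. -/

/-- The Pochhammer symbol `(z)_j = z (z+1) ⋯ (z+j-1)`. -/
def poch {R : Type*} [CommRing R] (z : R) (j : ℕ) : R := (ascPochhammer R j).eval z

/-! ### Finite sets of positive integers -/

/-- The involution `I(F) = {1, …, max F} \ {max F - f : f ∈ F}`, with `I(∅) = ∅`. -/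
def invol (F : Finset ℕ) : Finset ℕ :=
  Finset.Icc 1 (F.sup id) \ F.image (fun f => F.sup id - f)

/-- The number `max F + 1`, with the convention `max ∅ = -1`. -/
def maxSucc (F : Finset ℕ) : ℕ := F.sup (fun f => f + 1)

/-- `m₁` (for `F`) and `m₃` (for `G`): the number of elements of `I(F)`. -/
abbrev cnt (F : Finset ℕ) : ℕ := (invol F).card

/-- `m = 2 (m₁ + m₃)`. -/
abbrev size (F G : Finset ℕ) : ℕ := (cnt F + cnt F) + (cnt G + cnt G)

/-- The elements of `I(F)` in increasing order. -/
def node (F : Finset ℕ) : Fin (cnt F) → ℕ := fun r => (invol F).orderEmbOfFin rfl r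

/-! ### Hahn and dual Hahn polynomials -/

/-- The Hahn polynomial `h_n^{a,b,N}`. -/
def hahn (a b N : ℝ) (n : ℕ) : ℝ[X] :=
  ∑ j ∈ Finset.range (n + 1),
    C (poch (N - n + 1) (n - j) * poch (a + b + 1) (j + n) /
      (poch (2 + a + b + N) n * poch (a + 1) j * (n - j).factorial * j.factorial)) *
      poch (-X : ℝ[X]) j

/-- The dual Hahn polynomial `R_n^{α,β,M}`, that is, the polynomial of degree `n` with
`R_n (t (t + α + β + 1)) = ₃F₂(-n, -t, t + α + β + 1; α + 1, -M; 1)`. -/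
def dualHahn (α β M : ℝ) (n : ℕ) : ℝ[X] :=
  ∑ j ∈ Finset.range (n + 1),
    C ((-1) ^ j * poch (-(n : ℝ)) j / (poch (α + 1) j * poch (-M) j * j.factorial)) *
      ∏ i ∈ Finset.range j, (X - C ((i : ℝ) * (α + β + 1 + i)))

/-- The denominators in `dualHahn α β M n` do not vanish. -/
def DualHahnDefined (α M : ℝ) (n : ℕ) : Prop := poch (α + 1) n ≠ 0 ∧ poch (-M) n ≠ 0

/-- `Y_u(x) = R_u^{-a,-a,2a+N}(x + 2a)`. -/
def polyY (a N : ℝ) (u : ℕ) : ℝ[X] := (dualHahn (-a) (-a) (2 * a + N) u).comp (X + C (2 * a))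

/-- `Z_u(x) = R_u^{-a,-a,-2-N}(x + 2a)`. -/
def polyZ (a N : ℝ) (u : ℕ) : ℝ[X] := (dualHahn (-a) (-a) (-2 - N) u).comp (X + C (2 * a))

/-! ### The auxiliary functions (in the symmetric case `b = a`) -/

/-- `θ_y = y (y + 2a + 1)`. -/
def theta (a : ℝ) (y : RatFunc ℝ) : RatFunc ℝ := y * (y + RatFunc.C (2 * a + 1))

/-- `σ_y = θ_{y-3/2} - θ_{y-1/2} = -(2y + 2a - 1)`. -/
def sigma (a : ℝ) (y : RatFunc ℝ) : RatFunc ℝ := -(2 * y + RatFunc.C (2 * a - 1))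

/-- `N_{y,j} = (y - j - N)_j`. -/
def numN (N : ℝ) (y : RatFunc ℝ) (j : ℕ) : RatFunc ℝ := poch (y - j - RatFunc.C N) j

/-- `D_{y,j} = (-1)^j (y - j + 2a + N + 2)_j`. -/
def denD (a N : ℝ) (y : RatFunc ℝ) (j : ℕ) : RatFunc ℝ :=
  (-1) ^ j * poch (y - j + RatFunc.C (2 * a + N + 2)) j

/-- `ξ¹_{y,j} = N_{y,j} / D_{y,j}`. -/
def xi1 (a N : ℝ) (y : RatFunc ℝ) (j : ℕ) : RatFunc ℝ := numN N y j / denD a N y j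

/-- `ξ²_{y,j} = (-1)^j ξ¹_{y,j}`. -/
def xi2 (a N : ℝ) (y : RatFunc ℝ) (j : ℕ) : RatFunc ℝ := (-1) ^ j * xi1 a N y j

/-- `ξ³_{y,j} = 1`. -/
def xi3 (_ : RatFunc ℝ) (_ : ℕ) : RatFunc ℝ := 1

/-- `ξ⁴_{y,j} = (-1)^j`. -/
def xi4 (_ : RatFunc ℝ) (j : ℕ) : RatFunc ℝ := (-1) ^ j

/-! ### The quasi-Casoratian determinants -/

/-- The function `ξ^{i(h)}` of the `h`-th row: four consecutive blocks with `m₁, m₁, m₃, m₃` rows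
and `i(h) = 1, 2, 3, 4`. -/
def xiRow (a N : ℝ) (F G : Finset ℕ) : Fin (size F G) → RatFunc ℝ → ℕ → RatFunc ℝ :=
  Fin.append (Fin.append (fun _ : Fin (cnt F) => xi1 a N) (fun _ : Fin (cnt F) => xi2 a N))
    (Fin.append (fun _ : Fin (cnt G) => xi3) (fun _ : Fin (cnt G) => xi4))

/-- The polynomial of the `h`-th row: `Y_u` (`u ∈ I(F)`) in the first two blocks, `Z_u`
(`u ∈ I(G)`) in the last two. -/
def polyRow (a N : ℝ) (F G : Finset ℕ) : Fin (size F G) → ℝ[X] :=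
  Fin.append
    (Fin.append (fun r : Fin (cnt F) => polyY a N (node F r)) (fun r => polyY a N (node F r)))
    (Fin.append (fun r : Fin (cnt G) => polyZ a N (node G r)) (fun r => polyZ a N (node G r)))

/-- The matrix of `Ω(y)`; its `(h, j)` entry (`1 ≤ j ≤ m`) is
`ξ^{i(h)}_{y-j,m-j} Y_h(θ_{y-j})`. As `m` is even, the rows of the second and of the fourth block
are those of the first and of the third one, multiplied entrywise by `(-1)^j`. -/
def omegaMat (a N : ℝ) (F G : Finset ℕ) (y : RatFunc ℝ) :
    Matrix (Fin (size F G)) (Fin (size F G)) (RatFunc ℝ) :=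
  Matrix.of fun h j₀ =>
    let j : ℕ := (j₀ : ℕ) + 1
    xiRow a N F G h (y - j) (size F G - j) * aeval (theta a (y - j)) (polyRow a N F G h)

/-- `Ω(y)`. -/
def omega (a N : ℝ) (F G : Finset ℕ) (y : RatFunc ℝ) : RatFunc ℝ := (omegaMat a N F G y).det

/-- `Ω₁(y)`, of size `m₁ + m₃`: its columns (`1 ≤ j ≤ m₁ + m₃`) have the entries
`ξ¹_{y-2j+1,m-2j+1} Y_u(θ_{y-2j+1})` for `u ∈ I(F)`, and then
`ξ³_{y-2j+1,m-2j+1} Z_u(θ_{y-2j+1})` for `u ∈ I(G)`. -/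
def omega1 (a N : ℝ) (F G : Finset ℕ) (y : RatFunc ℝ) : RatFunc ℝ :=
  Matrix.det (Matrix.of fun (h j₀ : Fin (cnt F + cnt G)) =>
    let j : ℕ := (j₀ : ℕ) + 1
    let z : RatFunc ℝ := y - 2 * j + 1
    let l : ℕ := size F G + 1 - 2 * j
    Fin.append
      (fun r : Fin (cnt F) => xi1 a N z l * aeval (theta a z) (polyY a N (node F r)))
      (fun r : Fin (cnt G) => xi3 z l * aeval (theta a z) (polyZ a N (node G r))) h)

/-! ### The polynomial `R` and the function `S` -/

/-- `p(y) = ∏_{j=1}^{m₁-1} D_{y-1,2j} N_{y-m+2j+1,2j}`. -/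
def pFun (a N : ℝ) (F G : Finset ℕ) (y : RatFunc ℝ) : RatFunc ℝ :=
  ∏ j ∈ Finset.Icc 1 (cnt F - 1),
    denD a N (y - 1) (2 * j) * numN N (y - size F G + 2 * j + 1) (2 * j)

/-- `q(y) = ∏_{i=1}^{⌊(m₁+m₃)/2⌋} ∏_{j=1}^{m-4i+1} σ_{y-m+2i+j}`. -/
def qFun (a : ℝ) (F G : Finset ℕ) (y : RatFunc ℝ) : RatFunc ℝ :=
  ∏ i ∈ Finset.Icc 1 ((cnt F + cnt G) / 2), ∏ j ∈ Finset.Icc 1 (size F G - 4 * i + 1),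
    sigma a (y - size F G + 2 * i + j)

/-- `H(y) = σ_{y-m₁-m₃+1} (D_{y-1,m-1})^{m₁} / (p(y) q(y) (N_{y-m+1,1})^{m₁})`. -/
def hFun (a N : ℝ) (F G : Finset ℕ) (y : RatFunc ℝ) : RatFunc ℝ :=
  sigma a (y - cnt F - cnt G + 1) * denD a N (y - 1) (size F G - 1) ^ cnt F /
    (pFun a N F G y * qFun a F G y * numN N (y - size F G + 1) 1 ^ cnt F)

/-- The polynomial `σ_{y-(m-1)/2} R(y)`. -/
def sigmaR (a : ℝ) (F G : Finset ℕ) (R : ℝ[X]) (y : RatFunc ℝ) : RatFunc ℝ :=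
  sigma a (y - RatFunc.C (((size F G : ℝ) - 1) / 2)) * aeval y R

/-- The difference equation
`σ_{x-(m-1)/2} R(x) + σ_{x+1-(m-1)/2} R(x+1) = H(x) Ω₁(x)` for the polynomial `R`. -/
def SolvesR (a N : ℝ) (F G : Finset ℕ) (R : ℝ[X]) : Prop :=
  sigmaR a F G R RatFunc.X + sigmaR a F G R (RatFunc.X + 1) =
    hFun a N F G RatFunc.X * omega1 a N F G RatFunc.X

/-- `S(y) = σ_{y-(m-1)/2} R(y) / Ω(y)`. -/
def sFun (a N : ℝ) (F G : Finset ℕ) (R : ℝ[X]) (y : RatFunc ℝ) : RatFunc ℝ :=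
  sigmaR a F G R y / omega a N F G y

/-! ### The functions `M_h` and the three hypotheses -/

/-- `M_h(y) = ∑_{j=1}^m (-1)^{h+j} ξ^{i(h)}_{y,m-j} S(y+j) (Ω(y+j))_{h,j}`. The signed minor
`(-1)^{h+j} (Ω)_{h,j}` is the cofactor of the position `(h, j)`, i.e. the entry `(j, h)` of the
adjugate matrix. -/
def mFun (a N : ℝ) (F G : Finset ℕ) (S : RatFunc ℝ → RatFunc ℝ) (h : Fin (size F G))
    (y : RatFunc ℝ) : RatFunc ℝ :=
  ∑ j₀ : Fin (size F G),
    let j : ℕ := (j₀ : ℕ) + 1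
    xiRow a N F G h y (size F G - j) * S (y + j) * (omegaMat a N F G (y + j)).adjugate j₀ h

/-- `S Ω` is a polynomial. -/
def HypPoly (a N : ℝ) (F G : Finset ℕ) (S : RatFunc ℝ → RatFunc ℝ) : Prop :=
  ∃ s : ℝ[X], S RatFunc.X * omega a N F G RatFunc.X = algebraMap ℝ[X] (RatFunc ℝ) s

/-- `M_h(x) = σ_{x+1} M̃_h(θ_x)` for all `h`. -/
def HypM (a N : ℝ) (F G : Finset ℕ) (S : RatFunc ℝ → RatFunc ℝ)
    (Mt : Fin (size F G) → ℝ[X]) : Prop :=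
  ∀ h, mFun a N F G S h RatFunc.X =
    sigma a (RatFunc.X + 1) * aeval (theta a RatFunc.X) (Mt h)

/-- `P_S(θ_x) - P_S(θ_{x-1}) = S(x) Ω(x) + S(x+m) Ω(x+m)`. -/
def HypP (a N : ℝ) (F G : Finset ℕ) (S : RatFunc ℝ → RatFunc ℝ) (P : ℝ[X]) : Prop :=
  aeval (theta a RatFunc.X) P - aeval (theta a (RatFunc.X - 1)) P =
    S RatFunc.X * omega a N F G RatFunc.X +
      S (RatFunc.X + (size F G : RatFunc ℝ)) *
        omega a N F G (RatFunc.X + (size F G : RatFunc ℝ))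

/-! ### Difference operators on polynomials -/

/-- The shift operator `p(x) ↦ p(x + c)`. -/
def shift (c : ℝ) : Module.End ℝ ℝ[X] := taylor c

/-- Multiplication by the polynomial `f`. -/
def mulBy (f : ℝ[X]) : Module.End ℝ ℝ[X] := LinearMap.mulLeft ℝ f

/-- `T = ∑_{l=s}^r h_l Sh_l` with polynomials `h_l`, `h_s ≠ 0`, `h_r ≠ 0` and `r - s = k`: the
operator `T` is a difference operator of order `k`. -/
def HasOrder (T : Module.End ℝ ℝ[X]) (k : ℤ) : Prop :=
  ∃ (s r : ℤ) (h : ℤ → ℝ[X]), s ≤ r ∧ h s ≠ 0 ∧ h r ≠ 0 ∧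
    T = ∑ l ∈ Finset.Icc s r, mulBy (h l) * shift (l : ℝ) ∧ r - s = k

/-- Forward difference `Δ p = p(x+1) - p(x)`. -/
def fwd : Module.End ℝ ℝ[X] := shift 1 - 1

/-- Backward difference `∇ p = p(x) - p(x-1)`. -/
def bwd : Module.End ℝ ℝ[X] := 1 - shift (-1)

/-- The second-order difference operator `(x+a+1)(x-N) Δ - x (x-a-N-1) ∇` of the Hahn polynomials
`h_n^{a,a,N}`, with eigenvalues `θ_n`. -/
def opH (a N : ℝ) : Module.End ℝ ℝ[X] :=
  mulBy ((X + C (a + 1)) * (X - C N)) * fwd - mulBy (X * (X - C (a + N + 1))) * bwd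

/-- `𝒟₁ = (2a+1)/2 + x ∇`. -/
def opD1 (a : ℝ) : Module.End ℝ ℝ[X] := mulBy (C ((2 * a + 1) / 2)) + mulBy X * bwd

/-- `𝒟₂ = (2a+1)/2 + (x - N) Δ`. -/
def opD2 (a N : ℝ) : Module.End ℝ ℝ[X] := mulBy (C ((2 * a + 1) / 2)) + mulBy (X - C N) * fwd

/-- `𝒟₃ = (2a+1)/2 + (x + a + 1) Δ`. -/
def opD3 (a : ℝ) : Module.End ℝ ℝ[X] :=
  mulBy (C ((2 * a + 1) / 2)) + mulBy (X + C (a + 1)) * fwd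

/-- `𝒟₄ = (2a+1)/2 + (x - a - N - 1) ∇`. -/
def opD4 (a N : ℝ) : Module.End ℝ ℝ[X] :=
  mulBy (C ((2 * a + 1) / 2)) + mulBy (X - C (a + N + 1)) * bwd

/-- `D_S = ½ P_S(D_H) + ∑_{h=1}^{m₁} M̃_h(D_H) (𝒟₁ + 𝒟₂) Y_h(D_H)
  + ∑_{h=1}^{m₃} M̃_{2m₁+h}(D_H) (𝒟₃ + 𝒟₄) Z_h(D_H)`. -/
def opS (a N : ℝ) (F G : Finset ℕ) (Mt : Fin (size F G) → ℝ[X]) (P : ℝ[X]) :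
    Module.End ℝ ℝ[X] :=
  (1 / 2 : ℝ) • aeval (opH a N) P +
    ∑ h : Fin (cnt F), aeval (opH a N) (Mt (Fin.castAdd _ (Fin.castAdd _ h))) *
      (opD1 a + opD2 a N) * aeval (opH a N) (polyY a N (node F h)) +
    ∑ h : Fin (cnt G), aeval (opH a N) (Mt (Fin.natAdd _ (Fin.castAdd _ h))) *
      (opD3 a + opD4 a N) * aeval (opH a N) (polyZ a N (node G h))

/-! ### The Krall–Hahn weight and its orthogonal polynomials -/

/-- `L` is integration against `ρ_{a,b,N}`. If `N` is a nonnegative integer, this is the Hahn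
measure, with mass `N! Γ(a+x+1) Γ(N-x+b+1) / (x! (N-x)!)` at `x = 0, …, N`, divided here by the
constant `Γ(a+1) Γ(b+1)`. Otherwise it is a moment functional with respect to which the Hahn
polynomials are orthogonal. -/
def IsHahnFunctional (a b N : ℝ) (L : ℝ[X] →ₗ[ℝ] ℝ) : Prop :=
  (∃ M : ℕ, N = M ∧
    (∀ i : ℕ, 1 ≤ i → i ≤ M → a ≠ -i ∧ b ≠ -i) ∧
    (∀ i : ℕ, 1 ≤ i → i ≤ 2 * M + 1 → a + b ≠ -i) ∧
    ∀ p : ℝ[X], L p = ∑ x ∈ Finset.range (M + 1),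
      (M.choose x : ℝ) * poch (a + 1) x * poch (b + 1) (M - x) * p.eval (x : ℝ)) ∨
  ((∀ M : ℕ, N ≠ M) ∧
    (∀ i : ℕ, 1 ≤ i → a ≠ -i ∧ b ≠ -i ∧ a + b ≠ -i ∧ a + b + N + 1 ≠ -i) ∧
    (∀ n k : ℕ, n ≠ k → L (hahn a b N n * hahn a b N k) = 0) ∧
    ∀ n : ℕ, L (hahn a b N n * hahn a b N n) ≠ 0)

/-- The polynomial factor
`∏_{f∈F} (a+N+1+f-x)(x+a+1+f) ∏_{f∈G} (N-f-x)(x-f)` of the Krall–Hahn weight. -/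
def krallFactor (a N : ℝ) (F G : Finset ℕ) : ℝ[X] :=
  (∏ f ∈ F, (C (a + N + 1 + f) - X) * (X + C (a + 1 + f))) *
    ∏ f ∈ G, (C (N - f) - X) * (X - C (f : ℝ))

/-- `p_0, …, p_n` are orthogonal polynomials for the functional `Φ`: `deg p_k = k`, and they are
mutually orthogonal with non-null norms. -/
def IsOrthogonalUpTo (Φ : ℝ[X] → ℝ) (n : ℕ) (p : ℕ → ℝ[X]) : Prop :=
  (∀ k ≤ n, (p k).degree = k) ∧
  (∀ k ≤ n, ∀ l ≤ n, k ≠ l → Φ (p k * p l) = 0) ∧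
  ∀ k ≤ n, Φ (p k * p k) ≠ 0

end

end KrallHahn

/-!
In the variable `z = x + a + 1/2` the numbers `θ_x = z² - (a + 1/2)²` form the quadratic lattice
`z²`, and for large `x` the quotient `N_{x,j} / D_{x,j}` is, up to a factor common to a row, the
value of `Γ(z + 1/2 - ν) / Γ(z + 1/2 + ν)` with `ν = N + a + 1`. Each row of `Ω` occurs twice, with
and without the alternating sign, so that the sums and differences of the two copies live on the
columns of one parity. The inverse of the matrix of `Ω` is therefore given by two Casoratian
matrices of size `M = m₁ + m₃` on windows of points with step `2`. Identities between rational
functions are proved by comparing values at large real arguments (`Ev.unique`).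

A Casoratian determinant on a window can be computed by divided differences along the columns. The operator `dW` maps
polynomials in `z²` to polynomials in `z²`, and so does its conjugate `dN` by the weight. Hence the
determinant is divisible by the factors `qqP` and `ppP` (`exists_det_fhatP_eq`), and by symmetry
the quotient is a polynomial in the square of the centre of the window. Its leading coefficient is a
product of leading coefficients of the rows and a Vandermonde determinant (`leadLe_gW`); the nodes
are distinct because `v - u + a + N + 1 ≠ 0`. So the quotient `gCore` is nonzero and its degree is
known (`exists_leadLe_gCore`). This yields `Ω ≠ 0`; moreover `H Ω₁` is a constant times an odd
polynomial. The map `p ↦ p + p(· + 1)` is invertible and respects the symmetry, which gives `R`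
(`existsUnique_solvesR`); and `dW` is surjective, which gives `P_S` (`exists_hypP`). The function
`M_h` is a sum of cofactors over all windows through a point, that is, a formal adjoint applied
to `1`; adjoints of `dW` and `aW` preserve odd polynomials, so `M_h` is an odd polynomial in `z`
(`exists_isMt`). In `D_S` the term `P_S(D_H) / 2` has the largest degree, and it determines the order
(`hasOrder_opSR`).

For the eigenfunctions let the parameters be generic first. If the coefficients of
`q_n = ∑_j c_j h_{n-2j}` annihilate all rows, then `D_S q_n` is a multiple of `q_n` for large `n`
(`exists_eigenfunction`): the operators `𝒟_i` act by first-order relations in `n`, and `M̃_h` is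
evaluated through inverses of window matrices. The same `q_n` are orthogonal to all polynomials of
degree less than `n` for the Krall–Hahn functional (`krall_orthogonal`): multiplying the translated
Hahn functional by all linear factors of the four families gives the Hahn functional with parameters
`a`, `N`, for which `h_n` is orthogonal; the factors that the weight omits are restored one at a
time, and the functional with one factor omitted is evaluated by means of the dual Hahn recurrence,
which turns the condition into the vanishing of a row combination.

This says nothing about the finitely many small degrees. But it shows that the defect
of symmetry `f, g ↦ W (D_S f * g) - W (f * D_S g)` has finite rank. As `D_S` is a difference
operator, the defect is also a sum of eigenvectors of the commutator with the multiplication by `X`,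
one for each shift, while that commutator has no eigenvectors of finite rank. So the defect vanishes (`symm_of_eigenfunctions`). The nondegeneracy that this needs follows from the Pearson
equation (`Pearson.nondegenerate`). Symmetry is a closed condition, and generic parameters
`(a + t, N + t³)` with `t → 0` lead to all others (`opSR_symm`). Finally, a symmetric operator that
does not raise degrees has the orthogonal polynomials as eigenfunctions
(`exists_eigenvalue_of_symm`).
-/

open Polynomial Filter Topology

namespace KrallHahn

noncomputable section

/-! ### Even polynomials and divided difference operators -/

/-- The polynomial `g` with `p(z) = z g(z²)` for an odd polynomial `p`. -/
def oddPart (p : ℝ[X]) : ℝ[X] := contract 2 (divX p)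

lemma coeff_oddPart (p : ℝ[X]) (k : ℕ) : (oddPart p).coeff k = p.coeff (2 * k + 1) := by
  rw [oddPart, coeff_contract (by norm_num), coeff_divX, mul_comm]

lemma coeff_comp_neg_X (p : ℝ[X]) (n : ℕ) : (p.comp (-X)).coeff n = (-1) ^ n * p.coeff n := by
  have h : (-X : ℝ[X]) = C (-1) * X := by simp
  rw [h, comp_C_mul_X_coeff, mul_comm]

lemma eval_oddPart {p : ℝ[X]} (h : ∀ z, p.eval (-z) = -p.eval z) (z : ℝ) :
    p.eval z = z * (oddPart p).eval (z ^ 2) := by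
  have hc : p.comp (-X) = -p := by
    apply Polynomial.funext; intro r; simp [h]
  have : p = X * expand ℝ 2 (oddPart p) := by
    ext n
    rcases n with _ | n
    · have := coeff_comp_neg_X p 0
      rw [hc] at this
      simp at this ⊢
      linarith
    · rw [coeff_X_mul, coeff_expand (by norm_num)]
      split_ifs with hd
      · obtain ⟨k, rfl⟩ := hd
        rw [coeff_oddPart]; congr 1; simp
      · have := coeff_comp_neg_X p (n + 1)
        rw [hc, coeff_neg, Even.neg_one_pow (by grind)] at this
        linarith
  conv_lhs => rw [this]
  simp [expand_eval]

/-- The polynomial `g` with `p(z) = g(z²)` for an even polynomial `p`. -/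
def evenPart (p : ℝ[X]) : ℝ[X] := contract 2 p

lemma coeff_evenPart (p : ℝ[X]) (k : ℕ) : (evenPart p).coeff k = p.coeff (2 * k) := by
  rw [evenPart, coeff_contract (by norm_num), mul_comm]

lemma eval_evenPart {p : ℝ[X]} (h : ∀ z, p.eval (-z) = p.eval z) (z : ℝ) :
    p.eval z = (evenPart p).eval (z ^ 2) := by
  have hc : p.comp (-X) = p := by
    apply Polynomial.funext; intro r; simp [h]
  have : p = expand ℝ 2 (evenPart p) := by
    ext n
    rw [coeff_expand (by norm_num)]
    split_ifs with hd
    · obtain ⟨k, rfl⟩ := hd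
      rw [coeff_evenPart]; congr 1; simp
    · have := coeff_comp_neg_X p n
      rw [hc, Odd.neg_one_pow (by grind)] at this
      linarith
  conv_lhs => rw [this]
  simp [expand_eval]

lemma oddPart_add (p q : ℝ[X]) : oddPart (p + q) = oddPart p + oddPart q := by
  ext k; simp [coeff_oddPart]

lemma oddPart_C_mul (c : ℝ) (p : ℝ[X]) : oddPart (C c * p) = C c * oddPart p := by
  ext k; simp [coeff_oddPart]

lemma evenPart_add (p q : ℝ[X]) : evenPart (p + q) = evenPart p + evenPart q := by
  ext k; simp [coeff_evenPart]

lemma evenPart_C_mul (c : ℝ) (p : ℝ[X]) : evenPart (C c * p) = C c * evenPart p := by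
  ext k; simp [coeff_evenPart]

/-- `ψ((z+1)²)` as a polynomial in `z`. -/
def upSq (ψ : ℝ[X]) : ℝ[X] := ψ.comp ((X + C 1) ^ 2)

/-- `ψ((z-1)²)` as a polynomial in `z`. -/
def dnSq (ψ : ℝ[X]) : ℝ[X] := ψ.comp ((X + C (-1)) ^ 2)

/-- The divided difference operator of the quadratic lattice `z²`:
`(dW ψ)(z²) = (ψ((z+1)²) - ψ((z-1)²)) / (4z)`. -/
def dW (ψ : ℝ[X]) : ℝ[X] := C (1 / 4) * oddPart (upSq ψ + C (-1) * dnSq ψ)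

/-- The averaging operator of the quadratic lattice `z²`:
`(aW ψ)(z²) = (ψ((z+1)²) + ψ((z-1)²)) / 2`. -/
def aW (ψ : ℝ[X]) : ℝ[X] := C (1 / 2) * evenPart (upSq ψ + dnSq ψ)

lemma eval_upSq (ψ : ℝ[X]) (z : ℝ) : (upSq ψ).eval z = ψ.eval ((z + 1) ^ 2) := by simp [upSq]
lemma eval_dnSq (ψ : ℝ[X]) (z : ℝ) : (dnSq ψ).eval z = ψ.eval ((z - 1) ^ 2) := by
  simp [dnSq, sub_eq_add_neg]

lemma eval_dW (ψ : ℝ[X]) (z : ℝ) :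
    4 * z * (dW ψ).eval (z ^ 2) = ψ.eval ((z + 1) ^ 2) - ψ.eval ((z - 1) ^ 2) := by
  have h := eval_oddPart (p := upSq ψ + C (-1) * dnSq ψ) (fun z => by
    simp only [eval_add, eval_mul, eval_C, eval_upSq, eval_dnSq]
    rw [show (-z + 1) ^ 2 = (z - 1) ^ 2 by ring, show (-z - 1) ^ 2 = (z + 1) ^ 2 by ring]
    ring) z
  simp only [eval_add, eval_mul, eval_C, eval_upSq, eval_dnSq] at h
  simp only [dW, eval_mul, eval_C]
  linarith

lemma eval_aW (ψ : ℝ[X]) (z : ℝ) :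
    2 * (aW ψ).eval (z ^ 2) = ψ.eval ((z + 1) ^ 2) + ψ.eval ((z - 1) ^ 2) := by
  have h := eval_evenPart (p := upSq ψ + dnSq ψ) (fun z => by
    simp only [eval_add, eval_upSq, eval_dnSq]
    rw [show (-z + 1) ^ 2 = (z - 1) ^ 2 by ring, show (-z - 1) ^ 2 = (z + 1) ^ 2 by ring]
    ring) z
  simp only [eval_add, eval_upSq, eval_dnSq] at h
  simp only [aW, eval_mul, eval_C]
  linarith

lemma upSq_add (p q : ℝ[X]) : upSq (p + q) = upSq p + upSq q := by simp [upSq]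
lemma dnSq_add (p q : ℝ[X]) : dnSq (p + q) = dnSq p + dnSq q := by simp [dnSq]

lemma dW_add (p q : ℝ[X]) : dW (p + q) = dW p + dW q := by
  simp only [dW, upSq_add, dnSq_add, ← mul_add, ← oddPart_add]
  congr 2; ring
lemma dW_C_mul (c : ℝ) (p : ℝ[X]) : dW (C c * p) = C c * dW p := by
  simp only [dW, upSq, dnSq, mul_comp, C_comp]
  rw [mul_left_comm (C c) (C _), ← oddPart_C_mul c]
  congr 2; ring
lemma aW_add (p q : ℝ[X]) : aW (p + q) = aW p + aW q := by
  simp only [aW, upSq_add, dnSq_add, ← mul_add, ← evenPart_add]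
  congr 2; ring
lemma aW_C_mul (c : ℝ) (p : ℝ[X]) : aW (C c * p) = C c * aW p := by
  simp only [aW, upSq, dnSq, mul_comp, C_comp]
  rw [mul_left_comm (C c) (C _), ← evenPart_C_mul c]
  congr 2; ring

/-- `ψ` has degree at most `k` and the coefficient of degree `k` is `L`; the integer `k` may be
negative, and then `ψ = 0` and `L = 0`. -/
def LeadLe (ψ : ℝ[X]) (k : ℤ) (L : ℝ) : Prop :=
  (∀ i : ℕ, k < i → ψ.coeff i = 0) ∧ (∀ i : ℕ, k = i → ψ.coeff i = L) ∧ (k < 0 → L = 0)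

lemma LeadLe.add {p q : ℝ[X]} {k : ℤ} {L L' : ℝ} (hp : LeadLe p k L) (hq : LeadLe q k L') :
    LeadLe (p + q) k (L + L') := by
  refine ⟨fun i hi => ?_, fun i hi => ?_, fun h => ?_⟩
  · simp [hp.1 i hi, hq.1 i hi]
  · simp [hp.2.1 i hi, hq.2.1 i hi]
  · simp [hp.2.2 h, hq.2.2 h]

lemma LeadLe.C_mul {p : ℝ[X]} {k : ℤ} {L : ℝ} (c : ℝ) (hp : LeadLe p k L) :
    LeadLe (C c * p) k (c * L) := by
  refine ⟨fun i hi => ?_, fun i hi => ?_, fun h => ?_⟩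
  · simp [hp.1 i hi]
  · simp [hp.2.1 i hi]
  · simp [hp.2.2 h]

lemma LeadLe.mono {p : ℝ[X]} {k k' : ℤ} {L : ℝ} (hp : LeadLe p k L) (h : k < k') :
    LeadLe p k' 0 :=
  ⟨fun i hi => hp.1 i (h.trans hi), fun i hi => hp.1 i (hi ▸ h), fun _ => rfl⟩

lemma LeadLe.X_mul {p : ℝ[X]} {k : ℤ} {L : ℝ} (hp : LeadLe p k L) :
    LeadLe (X * p) (k + 1) L := by
  refine ⟨fun i hi => ?_, fun i hi => ?_, fun h => hp.2.2 (by omega)⟩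
  · rcases i with _ | i
    · simp
    · rw [coeff_X_mul]; exact hp.1 i (by push_cast at hi; omega)
  · rcases i with _ | i
    · simp; rw [hp.2.2 (by push_cast at hi; omega)]
    · rw [coeff_X_mul]; exact hp.2.1 i (by push_cast at hi; omega)

lemma leadLe_of_natDegree {p : ℝ[X]} {k : ℕ} (h : p.natDegree ≤ k) : LeadLe p k (p.coeff k) := by
  refine ⟨fun i hi => coeff_eq_zero_of_natDegree_lt (by omega), fun i hi => ?_, fun h => by omega⟩
  obtain rfl : k = i := by exact_mod_cast hi
  rfl

lemma LeadLe.natDegree_le {p : ℝ[X]} {k : ℕ} {L : ℝ} (h : LeadLe p k L) : p.natDegree ≤ k :=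
  natDegree_le_iff_coeff_eq_zero.2 fun i hi => h.1 i (by exact_mod_cast hi)

lemma LeadLe.coeff_eq {p : ℝ[X]} {k : ℕ} {L : ℝ} (h : LeadLe p k L) : p.coeff k = L :=
  h.2.1 k rfl

lemma LeadLe.zero (k : ℤ) : LeadLe 0 k 0 := by simp [LeadLe]

/-- Linear operators on polynomials obey a degree bound as soon as they do so on monomials. -/
lemma leadLe_of_monomials (T : ℝ[X] → ℝ[X]) (hadd : ∀ p q, T (p + q) = T p + T q)
    (hC : ∀ c p, T (C c * p) = C c * T p) (s : ℤ) (ℓ : ℤ → ℝ)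
    (hmon : ∀ k : ℕ, LeadLe (T (X ^ k)) (k + s) (ℓ k)) {ψ : ℝ[X]} {k : ℤ} {L : ℝ}
    (hψ : LeadLe ψ k L) : (k + s < 0 → ℓ k = 0 ∨ k < 0) → LeadLe (T ψ) (k + s) (ℓ k * L) := by
  intro hneg
  have h0 : T 0 = 0 := by simpa using hC 0 0
  rcases lt_or_ge k 0 with hk | hk
  · have : ψ = 0 := by ext i; exact hψ.1 i (by omega)
    rw [this, h0, hψ.2.2 hk, mul_zero]; exact LeadLe.zero _
  lift k to ℕ using hk
  clear hneg
  induction k generalizing ψ L with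
  | zero =>
    have : ψ = C L * X ^ 0 := by
      rw [eq_C_of_natDegree_le_zero hψ.natDegree_le, hψ.coeff_eq]; simp
    rw [this, hC, mul_comm (ℓ _)]; exact (hmon 0).C_mul L
  | succ k ih =>
    have hL := hψ.coeff_eq
    have hdec : ψ = (ψ + C (-L) * X ^ (k + 1)) + C L * X ^ (k + 1) := by simp
    have hd : LeadLe (ψ + C (-L) * X ^ (k + 1)) k ((ψ + C (-L) * X ^ (k + 1)).coeff k) := by
      apply leadLe_of_natDegree
      apply natDegree_le_iff_coeff_eq_zero.2
      intro i hi
      rcases eq_or_lt_of_le (Nat.succ_le_of_lt hi) with rfl | hi'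
      · have : ψ.coeff (k + 1) = L := by exact_mod_cast hL
        simp [this]
      · have := hψ.1 i (by exact_mod_cast hi')
        simp [this, coeff_X_pow, hi'.ne']
    rw [hdec, hadd, hC, show ℓ ((k + 1 : ℕ) : ℤ) * L = 0 + L * ℓ ((k + 1 : ℕ) : ℤ) by ring]
    exact ((ih hd).mono (by push_cast; omega)).add ((hmon (k + 1)).C_mul L)

lemma natDegree_X_add_C_pow_le (c : ℝ) (n : ℕ) : ((X + C c) ^ n).natDegree ≤ n := by
  rw [natDegree_pow, natDegree_X_add_C, mul_one]

lemma LeadLe.dW {ψ : ℝ[X]} {k : ℤ} {L : ℝ} (h : LeadLe ψ k L) :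
    LeadLe (dW ψ) (k - 1) (k * L) := by
  refine leadLe_of_monomials KrallHahn.dW dW_add dW_C_mul (-1) (fun k => (k : ℝ)) ?_ h ?_
  · intro k
    have hc : ∀ i : ℕ, (KrallHahn.dW (X ^ k)).coeff i = 1 / 4 *
        (((2 * k).choose (2 * i + 1) : ℝ) *
          (1 ^ (2 * k - (2 * i + 1)) - (-1) ^ (2 * k - (2 * i + 1)))) := by
      intro i
      rw [KrallHahn.dW, coeff_C_mul, coeff_oddPart]
      simp only [upSq, dnSq, pow_comp, X_comp, ← pow_mul, coeff_add, coeff_C_mul,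
        coeff_X_add_C_pow]
      ring
    refine ⟨fun i hi => ?_, fun i hi => ?_, fun hi => ?_⟩
    · rw [hc, Nat.choose_eq_zero_of_lt (by omega)]; simp
    · rw [hc]
      obtain rfl : k = i + 1 := by omega
      rw [show 2 * (i + 1) - (2 * i + 1) = 1 by omega, show 2 * (i + 1) = 2 * i + 1 + 1 by omega,
        Nat.choose_succ_self_right]
      push_cast; ring
    · obtain rfl : k = 0 := by omega
      simp
  · intro h; simp; omega

lemma LeadLe.aW {ψ : ℝ[X]} {k : ℤ} {L : ℝ} (h : LeadLe ψ k L) : LeadLe (aW ψ) k L := by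
  have := leadLe_of_monomials KrallHahn.aW aW_add aW_C_mul 0 (fun k => 1) ?_ h (by omega)
  · simpa using this
  · intro k
    have hc : ∀ i : ℕ, (KrallHahn.aW (X ^ k)).coeff i = 1 / 2 *
        (((2 * k).choose (2 * i) : ℝ) *
          (1 ^ (2 * k - (2 * i)) + (-1) ^ (2 * k - (2 * i)))) := by
      intro i
      rw [KrallHahn.aW, coeff_C_mul, coeff_evenPart]
      simp only [upSq, dnSq, pow_comp, X_comp, ← pow_mul, coeff_add, coeff_X_add_C_pow]
      ring
    refine ⟨fun i hi => ?_, fun i hi => ?_, fun hi => ?_⟩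
    · rw [hc, Nat.choose_eq_zero_of_lt (by omega)]; simp
    · obtain rfl : k = i := by omega
      rw [hc]; simp; norm_num
    · omega

/-- The divided difference operator conjugated by `Γ(z+1/2-ν)/Γ(z+1/2+ν)`:
`4z (dN ν ψ)(z²) = (z+1/2-ν)(z-1/2-ν) ψ((z+1)²) - (z+1/2+ν)(z-1/2+ν) ψ((z-1)²)`. -/
def dN (ν : ℝ) (ψ : ℝ[X]) : ℝ[X] := (X + C (ν ^ 2 - 1 / 4)) * dW ψ + C (-ν) * aW ψ

lemma eval_dN (ν : ℝ) (ψ : ℝ[X]) (z : ℝ) :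
    4 * z * (dN ν ψ).eval (z ^ 2) =
      (z + 1 / 2 - ν) * (z - 1 / 2 - ν) * ψ.eval ((z + 1) ^ 2) -
        (z + 1 / 2 + ν) * (z - 1 / 2 + ν) * ψ.eval ((z - 1) ^ 2) := by
  have h1 := eval_dW ψ z
  have h2 := eval_aW ψ z
  simp only [dN, eval_add, eval_mul, eval_C, eval_X]
  linear_combination (z ^ 2 + (ν ^ 2 - 1 / 4)) * h1 + (-2 * ν * z) * h2

lemma LeadLe.dN {ψ : ℝ[X]} {k : ℤ} {L : ℝ} (ν : ℝ) (h : LeadLe ψ k L) :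
    LeadLe (dN ν ψ) k ((k - ν) * L) := by
  have h1 := h.dW.X_mul
  have h2 := (h.dW.mono (k' := k) (by omega)).C_mul (ν ^ 2 - 1 / 4)
  have h3 := h.aW.C_mul (-ν)
  rw [sub_add_cancel] at h1
  have := (h1.add h2).add h3
  rw [KrallHahn.dN, add_mul]
  convert this using 1; ring

/-! ### Pochhammer symbols -/

lemma poch_zero {R : Type*} [CommRing R] (z : R) : poch z 0 = 1 := by simp [poch]

lemma poch_succ {R : Type*} [CommRing R] (z : R) (n : ℕ) :
    poch z (n + 1) = poch z n * (z + n) := by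
  simp [poch, ascPochhammer_succ_eval]

lemma poch_eq_prod {R : Type*} [CommRing R] (z : R) (n : ℕ) :
    poch z n = ∏ i ∈ Finset.range n, (z + i) := by
  induction n with
  | zero => simp [poch_zero]
  | succ n ih => rw [poch_succ, ih, Finset.prod_range_succ]

lemma poch_add {R : Type*} [CommRing R] (z : R) (m n : ℕ) :
    poch z (m + n) = poch z m * poch (z + m) n := by
  induction n with
  | zero => simp [poch_zero]
  | succ n ih => rw [← add_assoc, poch_succ, ih, poch_succ]; push_cast; ring

lemma poch_succ_left {R : Type*} [CommRing R] (z : R) (n : ℕ) :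
    poch z (n + 1) = z * poch (z + 1) n := by
  rw [add_comm n 1, poch_add]; simp [poch_succ, poch_zero]

lemma poch_neg {R : Type*} [CommRing R] (z : R) (n : ℕ) :
    poch (-z) n = (-1) ^ n * poch (z - n + 1) n := by
  have h1 : (-1 : R) ^ n = ∏ _i ∈ Finset.range n, (-1 : R) := by simp
  rw [poch_eq_prod, poch_eq_prod, ← Finset.prod_range_reflect, h1, ← Finset.prod_mul_distrib]
  refine Finset.prod_congr rfl fun i hi => ?_
  have : i < n := Finset.mem_range.1 hi
  rw [Nat.sub_sub, Nat.cast_sub (by omega)]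
  push_cast; ring

lemma map_poch {R S : Type*} [CommRing R] [CommRing S] (f : R →+* S) (z : R) (n : ℕ) :
    f (poch z n) = poch (f z) n := by
  simp [poch_eq_prod, map_prod]

lemma poch_pos {z : ℝ} (hz : 0 < z) (n : ℕ) : 0 < poch z n := by
  rw [poch_eq_prod]; exact Finset.prod_pos fun i _ => by positivity

lemma gamma_add_nat {z : ℝ} (hz : 0 < z) (n : ℕ) :
    Real.Gamma (z + n) = poch z n * Real.Gamma z := by
  induction n with
  | zero => simp [poch_zero]
  | succ n ih =>
    push_cast
    rw [← add_assoc, Real.Gamma_add_one (by positivity), ih, poch_succ]; ring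

/-- The polynomial `(X + α)_n`. -/
def pochP (α : ℝ) (n : ℕ) : ℝ[X] := poch (X + C α) n

lemma eval_pochP (α : ℝ) (n : ℕ) (c : ℝ) : (pochP α n).eval c = poch (c + α) n := by
  rw [pochP, ← coe_evalRingHom, map_poch]; simp

lemma pochP_dvd (α : ℝ) {k j : ℕ} (h : k ≤ j) : pochP α k ∣ pochP α j := by
  obtain ⟨d, rfl⟩ := Nat.exists_eq_add_of_le h
  rw [pochP, pochP, poch_add]; exact dvd_mul_right _ _

lemma pochP_sub_dvd (β : ℝ) {k j : ℕ} (h : k ≤ j) :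
    pochP (β - 2 * k) (2 * k) ∣ pochP (β - 2 * j) (2 * j) := by
  obtain ⟨d, rfl⟩ := Nat.exists_eq_add_of_le' h
  rw [pochP, pochP, mul_add, poch_add]
  refine Dvd.intro_left _ (congrArg _ (congrArg (fun z => poch z _) ?_))
  push_cast
  simp only [map_sub, map_mul, map_add, map_natCast, map_ofNat]
  ring

/-! ### Casoratian determinants on windows of a quadratic lattice -/

/-- The coefficients of the iterated divided difference:
`F_j(z) = ∑_k tau j k z * F_0(z + j - 2k)` when `F_{j+1}(z) = (F_j(z+1) - F_j(z-1)) / (4z)`. -/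
def tau : ℕ → ℕ → ℝ → ℝ
  | 0, 0, _ => 1
  | 0, _ + 1, _ => 0
  | j + 1, 0, z => tau j 0 (z + 1) / (4 * z)
  | j + 1, k + 1, z => (tau j (k + 1) (z + 1) - tau j k (z - 1)) / (4 * z)

lemma tau_eq_zero {j k : ℕ} (h : j < k) (z : ℝ) : tau j k z = 0 := by
  induction j generalizing k z with
  | zero => obtain ⟨k, rfl⟩ := Nat.exists_eq_succ_of_ne_zero h.ne'; rfl
  | succ j ih =>
    obtain ⟨k, rfl⟩ := Nat.exists_eq_succ_of_ne_zero (by omega : k ≠ 0)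
    simp [tau, ih (show j < k + 1 by omega), ih (show j < k by omega)]

lemma tau_diag (j : ℕ) (z : ℝ) : tau j j z = ∏ i ∈ Finset.range j, (-(4 * (z - i))⁻¹) := by
  induction j generalizing z with
  | zero => simp [tau]
  | succ j ih =>
    rw [tau, tau_eq_zero (Nat.lt_succ_self j), ih, Finset.prod_range_succ']
    push_cast
    simp only [sub_zero, zero_sub, div_eq_mul_inv, neg_mul, mul_neg]
    congr 2
    exact Finset.prod_congr rfl fun i _ => by ring_nf

/-- A sum in a form that does not depend on the truncation. -/
lemma tau_sum {F : ℕ → ℝ → ℝ} {J : ℕ} {r : ℝ}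
    (hF : ∀ j < J, ∀ z, r < z → F (j + 1) z = (F j (z + 1) - F j (z - 1)) / (4 * z))
    {j : ℕ} (hj : j ≤ J) {z : ℝ} (hz : r + j < z) {n : ℕ} (hn : j < n) :
    F j z = ∑ k ∈ Finset.range n, tau j k z * F 0 (z + j - 2 * k) := by
  induction j generalizing z n with
  | zero =>
    obtain ⟨n, rfl⟩ := Nat.exists_eq_succ_of_ne_zero hn.ne'
    rw [Finset.sum_range_succ']
    simp [tau]
  | succ j ih =>
    push_cast at hz
    obtain ⟨n, rfl⟩ := Nat.exists_eq_succ_of_ne_zero (by omega : n ≠ 0)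
    rw [hF j (by omega) z (by linarith [(Nat.cast_nonneg j : (0 : ℝ) ≤ j)]),
      ih (by omega) (by linarith) (show j < n + 1 by omega),
      ih (by omega) (by linarith) (show j < n by omega),
      Finset.sum_range_succ', Finset.sum_range_succ', sub_div, add_div, Finset.sum_div,
      Finset.sum_div, add_sub_right_comm, ← Finset.sum_sub_distrib]
    congr 1
    · refine Finset.sum_congr rfl fun k _ => ?_
      rw [tau]; push_cast
      rw [show z + 1 + (j : ℝ) - 2 * (k + 1) = z + (j + 1) - 2 * (k + 1) by ring,
        show z - 1 + (j : ℝ) - 2 * k = z + (j + 1) - 2 * (k + 1) by ring]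
      ring
    · rw [tau]; push_cast
      rw [show z + 1 + (j : ℝ) - 2 * 0 = z + (j + 1) - 2 * 0 by ring]
      ring

/-- The weight `Γ(z+1/2-ν)/Γ(z+1/2+ν)`. -/
def gE (ν z : ℝ) : ℝ := Real.Gamma (z + 1 / 2 - ν) / Real.Gamma (z + 1 / 2 + ν)

/-- The polynomials obtained by iterating the conjugated divided difference operators. -/
def itN (ν : ℝ) : ℕ → ℝ[X] → ℝ[X]
  | 0, ψ => ψ
  | j + 1, ψ => dN (ν + j) (itN ν j ψ)

lemma gE_itN_succ (ν : ℝ) (ψ : ℝ[X]) (j : ℕ) {z : ℝ} (hz : |ν| + j + 1 < z) :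
    gE (ν + (j + 1 : ℕ)) z * (itN ν (j + 1) ψ).eval (z ^ 2) =
      (gE (ν + j) (z + 1) * (itN ν j ψ).eval ((z + 1) ^ 2) -
        gE (ν + j) (z - 1) * (itN ν j ψ).eval ((z - 1) ^ 2)) / (4 * z) := by
  have hν := abs_le.1 (le_refl |ν|)
  have hj : (0 : ℝ) ≤ j := j.cast_nonneg
  have e1 : Real.Gamma (z + 1 + 1 / 2 - (ν + j)) =
      (z + 1 / 2 - (ν + j)) * ((z - 1 / 2 - (ν + j)) * Real.Gamma (z - 1 / 2 - (ν + j))) := by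
    rw [← Real.Gamma_add_one (by linarith), show z - 1 / 2 - (ν + j) + 1 = z + 1 / 2 - (ν + j) by
      ring, ← Real.Gamma_add_one (by linarith)]
    ring_nf
  have e2 : Real.Gamma (z + 1 + 1 / 2 + (ν + j)) =
      (z + 1 / 2 + (ν + j)) * ((z - 1 / 2 + (ν + j)) * Real.Gamma (z - 1 + 1 / 2 + (ν + j))) := by
    rw [show z - 1 + 1 / 2 + (ν + j) = z - 1 / 2 + (ν + j) by ring,
      ← Real.Gamma_add_one (by linarith), show z - 1 / 2 + (ν + j) + 1 = z + 1 / 2 + (ν + j) by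
      ring, ← Real.Gamma_add_one (by linarith)]
    ring_nf
  have hg : Real.Gamma (z - 1 + 1 / 2 + (ν + j)) ≠ 0 := (Real.Gamma_pos_of_pos (by linarith)).ne'
  have hz0 : z ≠ 0 := by linarith
  have hd := eval_dN (ν + j) (itN ν j ψ) z
  have hA : z + 1 / 2 + (ν + j) ≠ 0 := by linarith
  have hB : z - 1 / 2 + (ν + j) ≠ 0 := by linarith
  rw [itN, eq_div_iff (by positivity)]
  simp only [gE]
  push_cast
  rw [show z + 1 / 2 + (ν + (j + 1)) = z + 1 + 1 / 2 + (ν + j) by ring, e1, e2,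
    show z + 1 / 2 - (ν + (j + 1)) = z - 1 / 2 - (ν + j) by ring,
    show z - 1 + 1 / 2 - (ν + (j : ℝ)) = z - 1 / 2 - (ν + j) by ring]
  generalize Real.Gamma (z - 1 + 1 / 2 + (ν + j)) = g at *
  generalize Real.Gamma (z - 1 / 2 - (ν + j)) = g' at *
  generalize z - 1 / 2 + (ν + j) = B at *
  generalize z + 1 / 2 + (ν + j) = A at *
  field_simp
  linear_combination 4 * g' * hd

/-- The points `c + (M - 1) - 2j`, `j < M`, of the window with centre `c = X`. -/
def ptP (M j : ℕ) : ℝ[X] := X + C ((M : ℝ) - 1 - 2 * j)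

/-- The weight `Γ(z+1/2-ν)/Γ(z+1/2+ν)` at the `j`-th point of a window, multiplied by a factor
that depends on the window only and makes it a polynomial in the centre. -/
def ehP (ν : ℝ) (M j : ℕ) : ℝ[X] :=
  pochP (3 / 2 - M - ν) (2 * (M - 1 - j)) * pochP (M - 1 / 2 + ν - 2 * j) (2 * j)

/-- The Casoratian matrix on a window: the rows `i` with `b i = true` carry the weight. -/
def fhatP (ν : ℝ) (M : ℕ) (b : Fin M → Bool) (ψ : Fin M → ℝ[X]) :
    Matrix (Fin M) (Fin M) ℝ[X] :=
  Matrix.of fun i j => (if b i then ehP ν M j else 1) * (ψ i).comp (ptP M j ^ 2)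

/-- The matrix obtained from `fhatP` by taking divided differences along the columns. -/
def entP (ν : ℝ) (M : ℕ) (b : Fin M → Bool) (ψ : Fin M → ℝ[X]) :
    Matrix (Fin M) (Fin M) ℝ[X] :=
  Matrix.of fun i j =>
    if b i then pochP (3 / 2 - M - ν) (2 * (M - 1 - j)) *
      (itN ν j (ψ i)).comp ((X + C ((M : ℝ) - 1 - j)) ^ 2)
    else (dW^[j] (ψ i)).comp ((X + C ((M : ℝ) - 1 - j)) ^ 2)

/-- The number of weighted rows. -/
def nU {M : ℕ} (b : Fin M → Bool) : ℕ := (Finset.univ.filter fun i => b i = true).card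

/-- The Vandermonde determinant of the squares of the points of a window, up to a constant. -/
def qqP (M : ℕ) : ℝ[X] :=
  ∏ j ∈ Finset.range M, ∏ i ∈ Finset.range j, (X + C ((M : ℝ) - 1 - j - i))

/-- The factor of the Casoratian determinant that is due to `m` weighted rows. -/
def ppP (ν : ℝ) (M m : ℕ) : ℝ[X] :=
  ∏ i ∈ Finset.range m,
    (pochP (3 / 2 - M - ν) (2 * i) * pochP (M - 1 / 2 + ν - 2 * i) (2 * i))

/-- The constant that relates the two determinants. -/
def kap (M : ℕ) : ℝ := ∏ j ∈ Finset.range M, ∏ _i ∈ Finset.range j, (-4 : ℝ)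

lemma kap_ne_zero (M : ℕ) : kap M ≠ 0 :=
  Finset.prod_ne_zero_iff.2 fun _ _ => Finset.prod_ne_zero_iff.2 fun _ _ => by norm_num

lemma ehP_eval (ν : ℝ) {M j : ℕ} (hj : j < M) {c : ℝ} (hc : 2 * M + |ν| + 2 < c) :
    (ehP ν M j).eval c = Real.Gamma (c + M - 1 / 2 + ν) / Real.Gamma (c - M + 3 / 2 - ν) *
      gE ν (c + M - 1 - 2 * j) := by
  have hν := abs_le.1 (le_refl |ν|)
  have hjM : (j : ℝ) + 1 ≤ M := by exact_mod_cast hj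
  have h1 := gamma_add_nat (z := c - M + 3 / 2 - ν) (by linarith) (2 * (M - 1 - j))
  have h2 := gamma_add_nat (z := c + M - 1 / 2 + ν - 2 * j) (by linarith) (2 * j)
  have g1 : Real.Gamma (c - M + 3 / 2 - ν) ≠ 0 := (Real.Gamma_pos_of_pos (by linarith)).ne'
  have g2 : Real.Gamma (c + M - 1 / 2 + ν - 2 * j) ≠ 0 :=
    (Real.Gamma_pos_of_pos (by linarith)).ne'
  push_cast at h1 h2
  rw [Nat.sub_sub, Nat.cast_sub (by omega)] at h1
  push_cast at h1
  rw [ehP, eval_mul, eval_pochP, eval_pochP, gE,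
    show c + (3 / 2 - M - ν) = c - M + 3 / 2 - ν by ring,
    show c + (M - 1 / 2 + ν - 2 * (j : ℝ)) = c + M - 1 / 2 + ν - 2 * j by ring,
    show c + (M : ℝ) - 1 - 2 * j + 1 / 2 - ν = c - M + 3 / 2 - ν + 2 * (M - (1 + j)) by ring,
    show c + (M : ℝ) - 1 - 2 * j + 1 / 2 + ν = c + M - 1 / 2 + ν - 2 * j by ring,
    h1, show c + (M : ℝ) - 1 / 2 + ν = c + M - 1 / 2 + ν - 2 * j + 2 * j by ring, h2,
    Nat.sub_sub]
  rw [show c + (M : ℝ) - 1 / 2 + ν - 2 * j + 2 * j - 2 * j = c + M - 1 / 2 + ν - 2 * j by ring]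
  generalize Real.Gamma (c - M + 3 / 2 - ν) = A at *
  generalize Real.Gamma (c + M - 1 / 2 + ν - 2 * j) = B at *
  generalize poch (c - M + 3 / 2 - ν) (2 * (M - (1 + j))) = P at *
  generalize poch (c + M - 1 / 2 + ν - 2 * j) (2 * j) = Q at *
  field_simp

lemma det_fhatP_mul_tau (ν : ℝ) (M : ℕ) (b : Fin M → Bool) (ψ : Fin M → ℝ[X]) {c : ℝ}
    (hc : 4 * M + |ν| + 4 < c) :
    (fhatP ν M b ψ).det.eval c * ∏ j : Fin M, tau j j (c + M - 1 - j) =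
      (entP ν M b ψ).det.eval c := by
  have hM : (0 : ℝ) ≤ M := M.cast_nonneg
  have hν := abs_le.1 (le_refl |ν|)
  let T : Matrix (Fin M) (Fin M) ℝ := Matrix.of fun k j => tau j k (c + M - 1 - j)
  have hT : T.det = ∏ j : Fin M, tau j j (c + M - 1 - j) := by
    refine Matrix.det_of_isUpperTriangular fun i j hij => ?_
    exact tau_eq_zero hij _
  rw [← hT, ← coe_evalRingHom, RingHom.map_det, RingHom.map_det, ← Matrix.det_mul]
  congr 1
  ext i j
  have hjM : (j : ℝ) + 1 ≤ M := by exact_mod_cast j.2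
  rw [Matrix.mul_apply]
  simp only [RingHom.mapMatrix_apply, Matrix.map_apply, fhatP, entP, Matrix.of_apply, T,
    coe_evalRingHom]
  by_cases hb : b i
  · simp only [hb, if_true, eval_mul, eval_comp, eval_pow, ptP, eval_add, eval_X, eval_C]
    set s := Real.Gamma (c + M - 1 / 2 + ν) / Real.Gamma (c - M + 3 / 2 - ν) with hs
    have key := tau_sum (F := fun j z => gE (ν + j) z * (itN ν j (ψ i)).eval (z ^ 2)) (J := M)
      (r := |ν| + M + 1) (fun j hj z hz => gE_itN_succ ν (ψ i) j (by
        have : (j : ℝ) + 1 ≤ M := by exact_mod_cast hj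
        linarith)) j.2.le (z := c + M - 1 - j) (by linarith) j.2
    simp only [CharP.cast_eq_zero, add_zero, itN] at key
    have hpre : (pochP (3 / 2 - M - ν) (2 * (M - 1 - j))).eval c =
        s * gE (ν + j) (c + M - 1 - j) := by
      have h1 := gamma_add_nat (z := c - M + 3 / 2 - ν) (by linarith) (2 * (M - 1 - j))
      have g1 : Real.Gamma (c - M + 3 / 2 - ν) ≠ 0 := (Real.Gamma_pos_of_pos (by linarith)).ne'
      have g2 : Real.Gamma (c + M - 1 / 2 + ν) ≠ 0 := (Real.Gamma_pos_of_pos (by linarith)).ne'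
      push_cast at h1
      rw [Nat.sub_sub, Nat.cast_sub (by omega)] at h1
      push_cast at h1
      rw [eval_pochP, gE, hs, show c + (3 / 2 - M - ν) = c - M + 3 / 2 - ν by ring,
        show c + (M : ℝ) - 1 - j + 1 / 2 - (ν + j) = c - M + 3 / 2 - ν + 2 * (M - (1 + j)) by
          ring, show c + (M : ℝ) - 1 - j + 1 / 2 + (ν + j) = c + M - 1 / 2 + ν by ring, h1,
        Nat.sub_sub]
      generalize Real.Gamma (c - M + 3 / 2 - ν) = A at *
      generalize Real.Gamma (c + M - 1 / 2 + ν) = B at *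
      field_simp
    rw [hpre, show c + ((M : ℝ) - 1 - j) = c + M - 1 - j by ring, mul_assoc, key,
      ← Fin.sum_univ_eq_sum_range (fun k => tau j k (c + M - 1 - j) *
        (gE ν (c + M - 1 - j + j - 2 * k) * (ψ i).eval ((c + M - 1 - j + j - 2 * k) ^ 2))) M,
      Finset.mul_sum]
    refine Finset.sum_congr rfl fun k _ => ?_
    rw [ehP_eval ν k.2 (by linarith), show c + ((M : ℝ) - 1 - 2 * k) = c + M - 1 - j + j - 2 * k by
      ring, show c + (M : ℝ) - 1 - 2 * k = c + M - 1 - j + j - 2 * k by ring]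
    ring
  · simp only [hb, eval_mul, eval_comp, eval_pow, ptP, eval_add, eval_X, eval_C]
    have key := tau_sum (F := fun j z => (dW^[j] (ψ i)).eval (z ^ 2)) (J := M)
      (r := 0) (fun j hj z hz => by
        rw [eq_div_iff (by positivity), ← eval_dW, Function.iterate_succ_apply']; ring)
      j.2.le (z := c + M - 1 - j) (by linarith) j.2
    simp only [Bool.false_eq_true, if_false, eval_one, one_mul, eval_comp, eval_pow, eval_add,
      eval_X, eval_C]
    simp only [Function.iterate_zero, id] at key
    rw [show c + ((M : ℝ) - 1 - j) = c + M - 1 - j by ring, key,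
      ← Fin.sum_univ_eq_sum_range (fun k => tau j k (c + M - 1 - j) *
        (ψ i).eval ((c + M - 1 - j + j - 2 * k) ^ 2)) M]
    refine Finset.sum_congr rfl fun k _ => ?_
    rw [show c + ((M : ℝ) - 1 - 2 * k) = c + M - 1 - j + j - 2 * k by ring]
    ring

lemma poly_eq_of_large {p q : ℝ[X]} (x₀ : ℝ) (h : ∀ x, x₀ < x → p.eval x = q.eval x) : p = q :=
  eq_of_infinite_eval_eq p q ((Set.Ioi_infinite x₀).mono fun x hx => h x hx)

lemma det_fhatP_eq (ν : ℝ) (M : ℕ) (b : Fin M → Bool) (ψ : Fin M → ℝ[X]) :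
    (fhatP ν M b ψ).det = C (kap M) * qqP M * (entP ν M b ψ).det := by
  refine poly_eq_of_large (4 * M + |ν| + 4) fun c hc => ?_
  have hν := abs_nonneg ν
  rw [eval_mul, ← det_fhatP_mul_tau ν M b ψ hc, mul_left_comm]
  suffices h : (C (kap M) * qqP M).eval c * ∏ j : Fin M, tau j j (c + M - 1 - j) = 1 by
    rw [h, mul_one]
  rw [Fin.prod_univ_eq_prod_range (fun j => tau j j (c + M - 1 - j)) M, eval_mul, eval_C, kap,
    qqP, eval_prod, ← Finset.prod_mul_distrib, ← Finset.prod_mul_distrib]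
  refine Finset.prod_eq_one fun j hj => ?_
  rw [tau_diag, eval_prod, ← Finset.prod_mul_distrib, ← Finset.prod_mul_distrib]
  refine Finset.prod_eq_one fun i hi => ?_
  have h1 : (j : ℝ) + 1 ≤ M := by exact_mod_cast Finset.mem_range.1 hj
  have h2 : (i : ℝ) + 1 ≤ j := by exact_mod_cast Finset.mem_range.1 hi
  have h3 : c + M - 1 - j - i ≠ 0 := by
    have : (0 : ℝ) ≤ j := j.cast_nonneg
    linarith
  simp only [eval_add, eval_X, eval_C]
  rw [show c + ((M : ℝ) - 1 - j - i) = c + M - 1 - j - i by ring]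
  field_simp

/-- A product over a set of `n` natural numbers is divisible by the product over `0, …, n - 1`,
for factors that form a divisibility chain. -/
lemma prod_range_card_dvd (f : ℕ → ℝ[X]) (hf : ∀ k j, k ≤ j → f k ∣ f j) (J : Finset ℕ) :
    ∏ i ∈ Finset.range J.card, f i ∣ ∏ j ∈ J, f j := by
  induction J using Finset.induction_on_max with
  | empty => simp
  | insert a s hs ih =>
    have ha : a ∉ s := fun h => (hs a h).false
    rw [Finset.card_insert_of_notMem ha, Finset.prod_range_succ, Finset.prod_insert ha, mul_comm]
    refine mul_dvd_mul (hf _ _ ?_) ih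
    have : s ⊆ Finset.range a := fun x hx => Finset.mem_range.2 (hs x hx)
    simpa using Finset.card_le_card this

lemma ppP_dvd_prod (ν : ℝ) (M : ℕ) (J : Finset (Fin M)) :
    ppP ν M J.card ∣ ∏ j ∈ J, ehP ν M j := by
  simp only [ehP, ppP, Finset.prod_mul_distrib]
  refine mul_dvd_mul ?_ ?_
  · have hinj : Set.InjOn (fun j : Fin M => M - 1 - (j : ℕ)) J := by
      intro i _ j _ h; ext; simp at h; omega
    have := prod_range_card_dvd (fun i => pochP (3 / 2 - M - ν) (2 * i))
      (fun k j h => pochP_dvd _ (by omega)) (J.image fun j : Fin M => M - 1 - (j : ℕ))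
    rwa [Finset.card_image_of_injOn hinj, Finset.prod_image hinj] at this
  · have hinj : Set.InjOn (fun j : Fin M => (j : ℕ)) J := fun i _ j _ h => Fin.ext h
    have := prod_range_card_dvd (fun i => pochP (M - 1 / 2 + ν - 2 * i) (2 * i))
      (fun k j h => pochP_sub_dvd _ h) (J.image fun j : Fin M => (j : ℕ))
    rwa [Finset.card_image_of_injOn hinj, Finset.prod_image hinj] at this

/-- Every term of the Leibniz expansion contains the factor `ppP`. -/
lemma ppP_dvd_det (ν : ℝ) (M : ℕ) (b : Fin M → Bool) (ψ : Fin M → ℝ[X]) :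
    ppP ν M (nU b) ∣ (fhatP ν M b ψ).det := by
  rw [Matrix.det_apply']
  refine Finset.dvd_sum fun σ _ => Dvd.dvd.mul_left ?_ _
  simp only [fhatP, Matrix.of_apply, Finset.prod_mul_distrib]
  refine Dvd.dvd.mul_right ?_ _
  rw [Finset.prod_ite, Finset.prod_const_one, mul_one]
  have : nU b = (Finset.univ.filter fun j => b (σ j) = true).card := by
    rw [nU]
    refine (Finset.card_bij (fun j _ => σ j) ?_ ?_ ?_).symm
    · intro j hj; simpa using hj
    · intro i _ j _ h; exact σ.injective h
    · intro i hi; exact ⟨σ.symm i, by simpa using hi, by simp⟩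
  rw [this]
  exact ppP_dvd_prod ν M _

lemma isCoprime_X_add_C {x y : ℝ} (h : x ≠ y) : IsCoprime (X + C x : ℝ[X]) (X + C y) := by
  have := isCoprime_X_sub_C_of_isUnit_sub (R := ℝ) (a := -x) (b := -y)
    (isUnit_iff_ne_zero.2 (by intro h'; apply h; linarith))
  simpa using this

lemma isCoprime_X_add_C_pochP {x α : ℝ} {n : ℕ} (h : ∀ i : ℕ, x ≠ α + i) :
    IsCoprime (X + C x : ℝ[X]) (pochP α n) := by
  rw [pochP, poch_eq_prod]
  refine IsCoprime.prod_right fun i _ => ?_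
  have := isCoprime_X_add_C (h i)
  simpa [add_assoc] using this

lemma isCoprime_qqP_ppP {ν : ℝ} (hν : ∀ k : ℤ, 2 * ν ≠ k) (M m : ℕ) :
    IsCoprime (ppP ν M m) (qqP M) := by
  refine IsCoprime.symm (IsCoprime.prod_left fun j _ => IsCoprime.prod_left fun i _ => ?_)
  refine IsCoprime.prod_right fun k _ => IsCoprime.mul_right ?_ ?_
  · refine isCoprime_X_add_C_pochP fun l h => hν (5 - 4 * M + 2 * j + 2 * i + 2 * l) ?_
    push_cast; linarith
  · refine isCoprime_X_add_C_pochP fun l h => hν (-1 - 2 * j - 2 * i + 4 * k - 2 * l) ?_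
    push_cast; linarith

/-! ### Limits of polynomials -/

/-- A pointwise limit of polynomials of bounded degree is a polynomial, and the coefficients
converge. -/
lemma exists_poly_of_tendsto {B : ℕ} {p : ℕ → ℝ[X]} (hB : ∀ n, (p n).natDegree ≤ B) {g : ℝ → ℝ}
    {x₀ : ℝ} (h : ∀ x, x₀ < x → Tendsto (fun n => (p n).eval x) atTop (𝓝 (g x))) :
    ∃ q : ℝ[X], q.natDegree ≤ B ∧ (∀ x, x₀ < x → g x = q.eval x) ∧
      ∀ k, Tendsto (fun n => (p n).coeff k) atTop (𝓝 (q.coeff k)) := by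
  classical
  let s := Finset.range (B + 1)
  let v : ℕ → ℝ := fun i => x₀ + 1 + i
  have hv : Set.InjOn v s := fun i _ j _ hij => by simpa [v] using hij
  have hv0 : ∀ i, x₀ < v i := fun i => by
    have : (0 : ℝ) ≤ i := i.cast_nonneg
    simp only [v]; linarith
  have hp : ∀ n, p n = Lagrange.interpolate s v fun i => (p n).eval (v i) := fun n =>
    Lagrange.eq_interpolate_of_eval_eq _ hv
      (lt_of_le_of_lt degree_le_natDegree (by
        rw [Finset.card_range]; exact_mod_cast Nat.lt_succ_of_le (hB n))) fun _ _ => rfl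
  set q := Lagrange.interpolate s v fun i => g (v i) with hq
  have hc : ∀ k, Tendsto (fun n => (p n).coeff k) atTop (𝓝 (q.coeff k)) := by
    intro k
    have e : ∀ n, (p n).coeff k = ∑ i ∈ s, (p n).eval (v i) * (Lagrange.basis s v i).coeff k := by
      intro n
      conv_lhs => rw [hp n]
      simp [Lagrange.interpolate_apply, finsetSum_coeff, coeff_C_mul]
    simp only [e]
    rw [hq, Lagrange.interpolate_apply, finsetSum_coeff]
    simp only [coeff_C_mul]
    exact tendsto_finsetSum _ fun i _ => (h _ (hv0 i)).mul_const _
  have hd : q.natDegree ≤ B := by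
    refine natDegree_le_iff_coeff_eq_zero.2 fun i hi => ?_
    refine tendsto_nhds_unique (hc i) ?_
    simp only [coeff_eq_zero_of_natDegree_lt (lt_of_le_of_lt (hB _) hi)]
    exact tendsto_const_nhds
  refine ⟨q, hd, fun x hx => ?_, hc⟩
  refine tendsto_nhds_unique (h x hx) ?_
  have e : ∀ r : ℝ[X], r.natDegree ≤ B → r.eval x = ∑ i ∈ Finset.range (B + 1), r.coeff i * x ^ i :=
    fun r hr => eval_eq_sum_range' (Nat.lt_succ_of_le hr) x
  rw [e q hd]
  simp only [e _ (hB _)]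
  exact tendsto_finsetSum _ fun i _ => (hc i).mul_const _

lemma LeadLe.tendsto {ψ : ℝ[X]} {k : ℤ} {L : ℝ} (h : LeadLe ψ k L) :
    Tendsto (fun w : ℝ => ψ.eval w * w ^ (-k)) atTop (𝓝 L) := by
  rcases lt_or_ge k 0 with hk | hk
  · have : ψ = 0 := by ext i; exact h.1 i (by omega)
    simp [this, h.2.2 hk]
  lift k to ℕ using hk
  have e : (fun w : ℝ => ψ.eval w * w ^ (-(k : ℤ))) = fun w => ψ.eval w / (X ^ k : ℝ[X]).eval w := by
    funext w; simp [div_eq_mul_inv]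
  rw [e]
  by_cases hL : L = 0
  · subst hL
    refine div_tendsto_atTop_zero_of_degree_lt _ _ ?_
    rw [degree_X_pow]
    refine (degree_lt_iff_coeff_zero _ _).2 fun i hi => ?_
    rcases eq_or_lt_of_le hi with rfl | hi
    · exact h.coeff_eq
    · exact h.1 i (by exact_mod_cast hi)
  · have hd : ψ.natDegree = k := natDegree_eq_of_le_of_coeff_ne_zero h.natDegree_le
      (by rw [h.coeff_eq]; exact hL)
    have h0 : ψ ≠ 0 := by rintro rfl; apply hL; rw [← h.coeff_eq]; simp
    have := div_tendsto_atTop_leadingCoeff_div_of_degree_eq ψ (X ^ k) (by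
      rw [degree_X_pow, degree_eq_natDegree h0, hd])
    rwa [leadingCoeff_X_pow, div_one, leadingCoeff, hd, h.coeff_eq] at this

lemma leadLe_of_tendsto {ψ : ℝ[X]} {k : ℕ} {L : ℝ}
    (h : Tendsto (fun w : ℝ => ψ.eval w * w ^ (-(k : ℤ))) atTop (𝓝 L)) : LeadLe ψ k L := by
  have hd : ψ.natDegree ≤ k := by
    by_contra! hlt
    have h0 : ψ ≠ 0 := by rintro rfl; simp at hlt
    have h1 := (leadLe_of_natDegree (le_refl ψ.natDegree)).tendsto
    have h2 : Tendsto (fun w : ℝ => (w ^ (ψ.natDegree - k))⁻¹) atTop (𝓝 0) :=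
      (tendsto_pow_atTop (by omega)).inv_tendsto_atTop
    have h3 := h.mul h2
    rw [mul_zero] at h3
    refine h0 (leadingCoeff_eq_zero.1 (tendsto_nhds_unique h1 (h3.congr' ?_)))
    filter_upwards [eventually_gt_atTop 0] with w hw
    rw [mul_assoc]
    congr 1
    rw [← zpow_natCast, ← zpow_neg, ← zpow_add₀ hw.ne', Nat.cast_sub hlt.le]
    congr 1; ring
  have h1 := leadLe_of_natDegree hd
  rwa [tendsto_nhds_unique h1.tendsto h] at h1

lemma tendsto_add_div (α : ℝ) : Tendsto (fun c : ℝ => (c + α) * c⁻¹) atTop (𝓝 1) := by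
  have h : Tendsto (fun c : ℝ => 1 + α * c⁻¹) atTop (𝓝 (1 + α * 0)) :=
    tendsto_const_nhds.add (tendsto_inv_atTop_zero.const_mul α)
  simp only [mul_zero, add_zero] at h
  refine h.congr' ?_
  filter_upwards [eventually_gt_atTop 0] with c hc
  field_simp

lemma tendsto_poch (α : ℝ) (n : ℕ) :
    Tendsto (fun c : ℝ => poch (c + α) n * (c ^ n)⁻¹) atTop (𝓝 1) := by
  induction n with
  | zero => simp [poch_zero]
  | succ n ih =>
    have := ih.mul (tendsto_add_div (α + n))
    rw [one_mul] at this
    refine this.congr fun c => ?_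
    rw [poch_succ, pow_succ, mul_inv]; ring

lemma LeadLe.tendsto_sq {ψ : ℝ[X]} {k : ℤ} {L : ℝ} (h : LeadLe ψ k L) (α : ℝ) :
    Tendsto (fun c : ℝ => ψ.eval ((c + α) ^ 2) * c ^ (-(2 * k))) atTop (𝓝 L) := by
  have h1 : Tendsto (fun c : ℝ => (c + α) ^ 2) atTop atTop :=
    (tendsto_pow_atTop (by norm_num)).comp (tendsto_atTop_add_const_right _ _ tendsto_id)
  have h2 := h.tendsto.comp h1
  have h3 := ((tendsto_add_div α).zpow₀ (2 * k) (Or.inl one_ne_zero))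
  have := h2.mul h3
  rw [one_zpow, mul_one] at this
  refine this.congr' ?_
  filter_upwards [eventually_gt_atTop 0, eventually_gt_atTop (-α)] with c hc hc'
  have hca : c + α ≠ 0 := by linarith
  simp only [Function.comp]
  rw [mul_zpow, inv_zpow, zpow_neg, zpow_neg, zpow_mul, zpow_mul]
  norm_cast
  field_simp

/-! ### The Casoratian determinant of a window, divided by its trivial factors -/

lemma LeadLe.iterate_dW {ψ : ℝ[X]} {k : ℤ} {L : ℝ} (h : LeadLe ψ k L) (j : ℕ) :
    LeadLe (KrallHahn.dW^[j] ψ) (k - j) ((∏ l ∈ Finset.range j, ((k : ℝ) - l)) * L) := by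
  induction j with
  | zero => simpa using h
  | succ j ih =>
    have := ih.dW
    rw [Function.iterate_succ_apply', Finset.prod_range_succ]
    convert this using 1
    · push_cast; ring
    · push_cast; ring

lemma LeadLe.itN {ψ : ℝ[X]} {k : ℤ} {L : ℝ} (ν : ℝ) (h : LeadLe ψ k L) (j : ℕ) :
    LeadLe (itN ν j ψ) k ((∏ l ∈ Finset.range j, ((k : ℝ) - ν - l)) * L) := by
  induction j with
  | zero => simpa [KrallHahn.itN] using h
  | succ j ih =>
    have := ih.dN (ν + j)
    rw [KrallHahn.itN, Finset.prod_range_succ]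
    convert this using 1; ring

/-- The exponents of the rows of a Casoratian matrix: the row `i` behaves like `z ^ (2 μ_i)`. -/
def muRow (ν : ℝ) {M : ℕ} (b : Fin M → Bool) (k : Fin M → ℕ) (i : Fin M) : ℝ :=
  k i - if b i then ν else 0

lemma nU_add {M : ℕ} (b : Fin M → Bool) :
    nU b + (Finset.univ.filter fun i => ¬ b i = true).card = M := by
  rw [nU, Finset.card_filter_add_card_filter_not, Finset.card_univ, Fintype.card_fin]

lemma tendsto_ppP (ν : ℝ) (M m : ℕ) :
    Tendsto (fun c : ℝ => (ppP ν M m).eval c * (c ^ (4 * m.choose 2))⁻¹) atTop (𝓝 1) := by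
  induction m with
  | zero => simp [ppP]
  | succ m ih =>
    have := (ih.mul (tendsto_poch (3 / 2 - M - ν) (2 * m))).mul
      (tendsto_poch (M - 1 / 2 + ν - 2 * m) (2 * m))
    rw [one_mul, one_mul] at this
    refine this.congr fun c => ?_
    have e : ppP ν M (m + 1) = ppP ν M m *
        (pochP (3 / 2 - M - ν) (2 * m) * pochP (M - 1 / 2 + ν - 2 * m) (2 * m)) :=
      Finset.prod_range_succ _ _
    rw [e, eval_mul, eval_mul, eval_pochP, eval_pochP,
      Nat.choose_succ_succ' m 1, Nat.choose_one_right, mul_add, pow_add,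
      show 4 * m = 2 * m + 2 * m by ring, pow_add, mul_inv, mul_inv]
    ring

lemma sumRange_cast (M : ℕ) : (∑ j ∈ Finset.range M, (j : ℤ)) = M.choose 2 := by
  induction M with
  | zero => simp
  | succ M ih => rw [Finset.sum_range_succ, Nat.choose_succ_succ' M 1, ih]; simp; ring

lemma tendsto_det_entP (ν : ℝ) {M : ℕ} {b : Fin M → Bool} {ψ : Fin M → ℝ[X]} {k : Fin M → ℕ}
    {L : Fin M → ℝ} (h : ∀ i, LeadLe (ψ i) (k i) (L i)) :
    Tendsto (fun c : ℝ => (entP ν M b ψ).det.eval c *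
        c ^ (2 * (M.choose 2 : ℤ) - 2 * ∑ i, (k i : ℤ) - 2 * (M - 1) * nU b)) atTop
      (𝓝 ((∏ i, L i) * (Matrix.vandermonde (muRow ν b k)).det)) := by
  classical
  let r : Fin M → ℤ := fun i => 2 * k i + if b i then 2 * ((M : ℤ) - 1) else 0
  let N : ℝ → Matrix (Fin M) (Fin M) ℝ := fun c => Matrix.of fun i j =>
    c ^ (-r i) * (c ^ (2 * (j : ℤ)) * (entP ν M b ψ i j).eval c)
  let N₀ : Matrix (Fin M) (Fin M) ℝ := Matrix.of fun i j =>
    L i * ((Matrix.of fun i (j : Fin M) => (descPochhammer ℝ j).eval (muRow ν b k i)) i j)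
  have hN₀ : N₀.det = (∏ i, L i) * (Matrix.vandermonde (muRow ν b k)).det := by
    rw [Matrix.det_mul_column, ← Matrix.det_eval_matrixOfPolynomials_eq_det_vandermonde]
    · intro i; exact descPochhammer_natDegree ℝ i
    · intro i; exact monic_descPochhammer ℝ i
  have hlim : Tendsto N atTop (𝓝 N₀) := by
    refine tendsto_pi_nhds.2 fun i => tendsto_pi_nhds.2 fun j => ?_
    have hj : (j : ℕ) + 1 ≤ M := j.2
    simp only [N, N₀, Matrix.of_apply, entP, muRow, r, descPochhammer_eval_eq_prod_range]
    by_cases hb : b i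
    · have h1 := ((h i).itN ν j).tendsto_sq ((M : ℝ) - 1 - j)
      have h2 := tendsto_poch (3 / 2 - M - ν) (2 * (M - 1 - j))
      have := h1.mul h2
      simp only [hb, if_true]
      push_cast at this
      rw [mul_one, mul_comm _ (L i)] at this
      refine this.congr' ?_
      filter_upwards [eventually_gt_atTop 0] with c hc
      simp only [eval_mul, eval_pochP, eval_comp, eval_pow, eval_add, eval_X, eval_C]
      have e : c ^ (-(2 * (k i : ℤ))) * (c ^ (2 * (M - 1 - (j : ℕ))))⁻¹ =
          c ^ (-(2 * (k i : ℤ) + 2 * (M - 1))) * c ^ (2 * (j : ℤ)) := by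
        rw [← zpow_natCast, ← zpow_neg, ← zpow_add₀ hc.ne', ← zpow_add₀ hc.ne']
        congr 1
        rw [Nat.sub_sub, Nat.cast_mul, Nat.cast_sub (by omega)]
        push_cast; ring
      linear_combination ((itN ν j (ψ i)).eval ((c + ((M : ℝ) - 1 - j)) ^ 2) *
        poch (c + (3 / 2 - M - ν)) (2 * (M - 1 - j))) * e
    · have := ((h i).iterate_dW j).tendsto_sq ((M : ℝ) - 1 - j)
      simp only [hb]
      rw [mul_comm _ (L i)] at this
      simp only [Bool.false_eq_true, if_false, sub_zero, add_zero]
      push_cast at this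
      refine this.congr' ?_
      filter_upwards [eventually_gt_atTop 0] with c hc
      simp only [eval_comp, eval_pow, eval_add, eval_X, eval_C]
      have e : c ^ (-(2 * ((k i : ℤ) - (j : ℕ)))) =
          c ^ (-(2 * (k i : ℤ))) * c ^ (2 * (j : ℤ)) := by
        rw [← zpow_add₀ hc.ne']; congr 1; ring
      rw [e]; ring
  have hdet := ((Continuous.matrix_det (continuous_id (X := Matrix (Fin M) (Fin M) ℝ))).tendsto
    N₀).comp hlim
  simp only [id, hN₀] at hdet
  refine hdet.congr' ?_
  filter_upwards [eventually_gt_atTop 0] with c hc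
  simp only [Function.comp, N]
  have e1 := Matrix.det_mul_column (fun i => c ^ (-r i))
    (Matrix.of fun i j : Fin M => c ^ (2 * (j : ℤ)) * (entP ν M b ψ i j).eval c)
  have e2 := Matrix.det_mul_row (fun j : Fin M => c ^ (2 * (j : ℤ)))
    (Matrix.of fun i j : Fin M => (entP ν M b ψ i j).eval c)
  simp only [Matrix.of_apply] at e1 e2
  rw [e1, e2, ← coe_evalRingHom, RingHom.map_det]
  have e3 : (evalRingHom c).mapMatrix (entP ν M b ψ) =
    Matrix.of fun i j : Fin M => (entP ν M b ψ i j).eval c := rfl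
  rw [e3, ← mul_assoc, mul_comm]
  congr 1
  have hprod : ∀ f : Fin M → ℤ, ∏ i, c ^ f i = c ^ ∑ i, f i := by
    intro f
    induction (Finset.univ : Finset (Fin M)) using Finset.induction_on with
    | empty => simp
    | insert a s ha ih => rw [Finset.prod_insert ha, Finset.sum_insert ha, ih, zpow_add₀ hc.ne']
  rw [hprod, hprod, ← zpow_add₀ hc.ne']
  congr 1
  simp only [r, Finset.sum_neg_distrib, Finset.sum_add_distrib, ← Finset.mul_sum]
  rw [Finset.sum_ite, Finset.sum_const_zero, Finset.sum_const, ← nU,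
    Fin.sum_univ_eq_sum_range (fun j => (j : ℤ)) M]
  rw [sumRange_cast]
  simp only [nsmul_eq_mul]
  ring

/-- A sequence tending to zero that avoids a given countable set. -/
lemma exists_seq_notMem {S : Set ℝ} (hS : S.Countable) :
    ∃ t : ℕ → ℝ, (∀ n, t n ∉ S) ∧ Tendsto t atTop (𝓝 0) := by
  obtain ⟨t, h1, h2⟩ := mem_closure_iff_seq_limit.1 (hS.dense_compl ℝ 0)
  exact ⟨t, h1, h2⟩

lemma qqP_ne_zero (M : ℕ) : qqP M ≠ 0 :=
  Finset.prod_ne_zero_iff.2 fun _ _ => Finset.prod_ne_zero_iff.2 fun _ _ => X_add_C_ne_zero _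

lemma pochP_ne_zero (α : ℝ) (n : ℕ) : pochP α n ≠ 0 := by
  rw [pochP, poch_eq_prod]
  refine Finset.prod_ne_zero_iff.2 fun i _ => ?_
  have := X_add_C_ne_zero (α + i)
  simpa [add_assoc] using this

lemma ppP_ne_zero (ν : ℝ) (M m : ℕ) : ppP ν M m ≠ 0 :=
  Finset.prod_ne_zero_iff.2 fun _ _ => mul_ne_zero (pochP_ne_zero _ _) (pochP_ne_zero _ _)

lemma eval_qqP_pos {M : ℕ} {c : ℝ} (hc : M < c) : 0 < (qqP M).eval c := by
  rw [qqP, eval_prod]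
  refine Finset.prod_pos fun j hj => ?_
  rw [eval_prod]
  refine Finset.prod_pos fun i hi => ?_
  have h1 : (j : ℝ) + 1 ≤ M := by exact_mod_cast Finset.mem_range.1 hj
  have h2 : (i : ℝ) + 1 ≤ j := by exact_mod_cast Finset.mem_range.1 hi
  simp only [eval_add, eval_X, eval_C]; linarith

lemma eval_ppP_pos {ν : ℝ} {M m : ℕ} (hm : m ≤ M) {c : ℝ} (hc : 2 * M + |ν| + 2 < c) :
    0 < (ppP ν M m).eval c := by
  have hν := abs_le.1 (le_refl |ν|)
  have hM : (0 : ℝ) ≤ M := M.cast_nonneg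
  rw [ppP, eval_prod]
  refine Finset.prod_pos fun j hj => ?_
  have h1 : (j : ℝ) + 1 ≤ M := by
    exact_mod_cast (Finset.mem_range.1 hj).trans_le hm
  rw [eval_mul, eval_pochP, eval_pochP]
  exact mul_pos (poch_pos (by linarith) _) (poch_pos (by linarith) _)

lemma nU_le {M : ℕ} (b : Fin M → Bool) : nU b ≤ M := by
  have := nU_add b; omega

/-- The degree of the Casoratian determinant without its trivial factors, as a polynomial in the
square of the centre. -/
def degG {M : ℕ} (b : Fin M → Bool) (k : Fin M → ℕ) : ℤ :=
  ∑ i, (k i : ℤ) - (nU b).choose 2 - (M - nU b).choose 2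

lemma degG_eq {M : ℕ} (b : Fin M → Bool) (k : Fin M → ℕ) :
    2 * (M.choose 2 : ℤ) - 2 * ∑ i, (k i : ℤ) - 2 * (M - 1) * nU b + 4 * (nU b).choose 2 =
      - (2 * degG b k) := by
  have hch : ∀ n : ℕ, 2 * (n.choose 2 : ℤ) = n * (n - 1) := by
    intro n
    induction n with
    | zero => simp
    | succ n ih => rw [Nat.choose_succ_succ' n 1]; push_cast; rw [mul_add, ih]; simp; ring
  obtain ⟨m, hm⟩ := Nat.exists_eq_add_of_le (nU_le b)
  rw [degG, show M - nU b = m by omega]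
  have h1 := hch M
  have h2 := hch (nU b)
  have h3 := hch m
  have h4 : (M : ℤ) = nU b + m := by exact_mod_cast hm
  generalize (M : ℤ) = x at *
  subst h4
  linear_combination h1 + h2 - h3

lemma tendsto_quotient (ν : ℝ) {M : ℕ} {b : Fin M → Bool} {ψ : Fin M → ℝ[X]} {k : Fin M → ℕ}
    {L : Fin M → ℝ} (h : ∀ i, LeadLe (ψ i) (k i) (L i)) {g : ℝ[X]}
    (hg : (fhatP ν M b ψ).det = qqP M * ppP ν M (nU b) * g) :
    Tendsto (fun c : ℝ => g.eval c * c ^ (-(2 * degG b k))) atTop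
      (𝓝 (kap M * ((∏ i, L i) * (Matrix.vandermonde (muRow ν b k)).det))) := by
  have hg' : C (kap M) * (entP ν M b ψ).det = ppP ν M (nU b) * g := by
    refine mul_left_cancel₀ (qqP_ne_zero M) ?_
    rw [← mul_assoc, ← mul_assoc, ← hg, det_fhatP_eq]; ring
  have h1 := ((tendsto_det_entP ν (b := b) h).const_mul (kap M)).div (tendsto_ppP ν M (nU b)) one_ne_zero
  rw [div_one] at h1
  refine h1.congr' ?_
  filter_upwards [eventually_gt_atTop 0, eventually_gt_atTop (2 * M + |ν| + 2)] with c hc hc'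
  have h2 := (eval_ppP_pos (nU_le b) hc').ne'
  have h3 := congrArg (eval c) hg'
  rw [eval_mul, eval_mul, eval_C] at h3
  rw [Pi.div_apply, ← mul_assoc, h3, ← degG_eq b k, zpow_add₀ hc.ne']
  have : c ^ (4 * (nU b).choose 2) ≠ 0 := by positivity
  have e : c ^ (4 * ((nU b).choose 2 : ℤ)) = c ^ (4 * (nU b).choose 2) := by norm_cast
  rw [e]
  field_simp

lemma degG_nonneg_of_le {M : ℕ} (b : Fin M → Bool) {k : Fin M → ℕ} (hk : ∀ i, M ≤ k i) :
    0 ≤ degG b k := by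
  have h1 : (M : ℤ) * M ≤ ∑ i, (k i : ℤ) := by
    have : ∑ _i : Fin M, (M : ℤ) ≤ ∑ i, (k i : ℤ) :=
      Finset.sum_le_sum fun i _ => by exact_mod_cast hk i
    simpa using this
  have hch : ∀ n : ℕ, 2 * (n.choose 2 : ℤ) ≤ n * n := by
    intro n
    induction n with
    | zero => simp
    | succ n ih => rw [Nat.choose_succ_succ' n 1]; push_cast; simp; linarith
  obtain ⟨m, hm⟩ := Nat.exists_eq_add_of_le (nU_le b)
  rw [degG, show M - nU b = m by omega]
  have h2 := hch (nU b)
  have h3 := hch m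
  have h4 : (M : ℤ) = nU b + m := by exact_mod_cast hm
  nlinarith [(Nat.cast_nonneg (nU b) : (0 : ℤ) ≤ nU b), (Nat.cast_nonneg m : (0 : ℤ) ≤ m)]

/-- The trivial factors divide the Casoratian determinant. For generic `ν` they are coprime; the
general case follows because the quotients have bounded degree. -/
lemma exists_det_fhatP_eq (ν : ℝ) {M : ℕ} (b : Fin M → Bool) (ψ : Fin M → ℝ[X]) :
    ∃ g : ℝ[X], (fhatP ν M b ψ).det = qqP M * ppP ν M (nU b) * g := by
  have hgen : ∀ ν : ℝ, (∀ k : ℤ, 2 * ν ≠ k) →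
      ∃ g : ℝ[X], (fhatP ν M b ψ).det = qqP M * ppP ν M (nU b) * g := by
    intro ν hν
    refine (isCoprime_qqP_ppP hν M (nU b)).symm.mul_dvd ?_ (ppP_dvd_det ν M b ψ)
    rw [det_fhatP_eq, mul_assoc]
    exact (dvd_mul_right _ _).mul_left _
  have hcount : (Set.range fun k : ℤ => ((k : ℝ) / 2 - ν)).Countable := Set.countable_range _
  obtain ⟨t, ht, ht0⟩ := exists_seq_notMem hcount
  have hgn : ∀ n, ∃ g : ℝ[X], (fhatP (ν + t n) M b ψ).det =
      qqP M * ppP (ν + t n) M (nU b) * g := fun n => hgen _ fun k hk => ht n ⟨k, by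
    simp only; linarith⟩
  choose g hg using hgn
  obtain ⟨D, hD⟩ := Int.eq_ofNat_of_zero_le
    (degG_nonneg_of_le b (k := fun i => (ψ i).natDegree + M) fun i => Nat.le_add_left _ _)
  have hdeg : ∀ n, (g n).natDegree ≤ 2 * D := by
    intro n
    have h1 := tendsto_quotient (ν + t n) (b := b) (k := fun i => (ψ i).natDegree + M)
      (fun i => leadLe_of_natDegree (Nat.le_add_right _ _)) (hg n)
    rw [hD] at h1
    rw [show (2 : ℤ) * (D : ℤ) = ((2 * D : ℕ) : ℤ) by push_cast; rfl] at h1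
    exact (leadLe_of_tendsto h1).natDegree_le
  have hν1 : Tendsto (fun n => ν + t n) atTop (𝓝 ν) := by simpa using ht0.const_add ν
  have hpoch : ∀ (A B : ℝ) (n : ℕ), Continuous fun ν : ℝ => poch (A + B * ν) n := by
    intro A B n
    simp only [poch_eq_prod]
    fun_prop
  have hfh : ∀ c : ℝ, Continuous fun ν : ℝ => (fhatP ν M b ψ).det.eval c := by
    intro c
    simp only [← coe_evalRingHom, RingHom.map_det]
    refine Continuous.matrix_det (continuous_matrix fun i j => ?_)
    simp only [RingHom.mapMatrix_apply, Matrix.map_apply, fhatP, Matrix.of_apply, coe_evalRingHom,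
      eval_mul]
    refine Continuous.mul ?_ continuous_const
    by_cases hb : b i
    · simp only [hb, if_true, ehP, eval_mul, eval_pochP]
      refine Continuous.mul ?_ ?_
      · convert hpoch (c + (3 / 2 - M)) (-1) (2 * (M - 1 - j)) using 3; ring
      · convert hpoch (c + (M - 1 / 2 - 2 * j)) 1 (2 * j) using 3; ring
    · simp only [hb, Bool.false_eq_true, if_false]; exact continuous_const
  have hpp : ∀ c : ℝ, Continuous fun ν : ℝ => (ppP ν M (nU b)).eval c := by
    intro c
    simp only [ppP, eval_prod, eval_mul, eval_pochP]
    refine continuous_finsetProd _ fun i _ => Continuous.mul ?_ ?_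
    · convert hpoch (c + (3 / 2 - M)) (-1) (2 * i) using 3; ring
    · convert hpoch (c + (M - 1 / 2 - 2 * i)) 1 (2 * i) using 3; ring
  obtain ⟨q, -, hq, -⟩ := exists_poly_of_tendsto hdeg (x₀ := 2 * M + |ν| + 3)
    (g := fun c => (fhatP ν M b ψ).det.eval c / ((qqP M).eval c * (ppP ν M (nU b)).eval c))
    (fun c hc => by
      have h1 : 0 < (qqP M).eval c := eval_qqP_pos (by
        have := abs_nonneg ν; have := (Nat.cast_nonneg M : (0 : ℝ) ≤ M); linarith)
      have h2 : 0 < (ppP ν M (nU b)).eval c := eval_ppP_pos (nU_le b) (by linarith)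
      refine ((((hfh c).tendsto ν).comp hν1).div
        ((((hpp c).tendsto ν).comp hν1).const_mul ((qqP M).eval c))
        (mul_pos h1 h2).ne').congr' ?_
      have hev : ∀ᶠ n in atTop, |ν + t n| < |ν| + 1 :=
        (hν1.abs).eventually (gt_mem_nhds (lt_add_one _))
      filter_upwards [hev] with n hn
      have h3 : 0 < (ppP (ν + t n) M (nU b)).eval c := eval_ppP_pos (nU_le b) (by linarith)
      simp only [Function.comp, Pi.div_apply]
      rw [hg n, eval_mul, eval_mul]
      field_simp)
  refine ⟨q, poly_eq_of_large (2 * M + |ν| + 3) fun c hc => ?_⟩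
  have h1 : 0 < (qqP M).eval c := eval_qqP_pos (by
    have := abs_nonneg ν; have := (Nat.cast_nonneg M : (0 : ℝ) ≤ M); linarith)
  have h2 : 0 < (ppP ν M (nU b)).eval c := eval_ppP_pos (nU_le b) (by linarith)
  have := hq c hc
  rw [div_eq_iff (mul_pos h1 h2).ne'] at this
  rw [this, eval_mul, eval_mul]; ring

/-- The Casoratian determinant without its trivial factors. -/
def gP (ν : ℝ) (M : ℕ) (b : Fin M → Bool) (ψ : Fin M → ℝ[X]) : ℝ[X] :=
  (exists_det_fhatP_eq ν b ψ).choose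

lemma det_fhatP_eq_gP (ν : ℝ) (M : ℕ) (b : Fin M → Bool) (ψ : Fin M → ℝ[X]) :
    (fhatP ν M b ψ).det = qqP M * ppP ν M (nU b) * gP ν M b ψ :=
  (exists_det_fhatP_eq ν b ψ).choose_spec

/-! ### Symmetry in the centre -/

lemma eval_ehP_neg (ν : ℝ) {M : ℕ} (j : Fin M) (c : ℝ) :
    (ehP ν M j).eval (-c) = (ehP ν M (Fin.rev j : Fin M)).eval c := by
  have hj := j.2
  have hjM : (j : ℝ) + 1 ≤ M := by exact_mod_cast hj
  have e1 : ∀ n : ℕ, (-1 : ℝ) ^ (2 * n) = 1 := fun n => by rw [pow_mul]; simp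
  rw [ehP, ehP, eval_mul, eval_mul, eval_pochP, eval_pochP, eval_pochP, eval_pochP,
    show -c + (3 / 2 - M - ν) = -(c + M + ν - 3 / 2) by ring, poch_neg, e1,
    show -c + (M - 1 / 2 + ν - 2 * (j : ℝ)) = -(c - M + 1 / 2 - ν + 2 * j) by ring, poch_neg, e1,
    Fin.val_rev, show M - 1 - (M - (j + 1)) = (j : ℕ) by omega,
    show M - ((j : ℕ) + 1) = M - 1 - j by omega, Nat.sub_sub, Nat.cast_mul, Nat.cast_sub (by omega),
    Nat.cast_mul, one_mul, one_mul, mul_comm]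
  push_cast
  congr 2 <;> ring

lemma eval_det_fhatP_neg (ν : ℝ) {M : ℕ} (b : Fin M → Bool) (ψ : Fin M → ℝ[X]) (c : ℝ) :
    (fhatP ν M b ψ).det.eval (-c) =
      ((Equiv.Perm.sign (Fin.revPerm : Equiv.Perm (Fin M)) : ℤ) : ℝ) *
        (fhatP ν M b ψ).det.eval c := by
  rw [← coe_evalRingHom, ← coe_evalRingHom, RingHom.map_det, RingHom.map_det, ← Matrix.det_permute']
  congr 1
  ext i j
  have hjM : (j : ℝ) + 1 ≤ M := by exact_mod_cast j.2
  simp only [RingHom.mapMatrix_apply, Matrix.map_apply, fhatP, Matrix.of_apply,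
    Matrix.submatrix_apply, id, coe_evalRingHom, eval_mul, Fin.revPerm_apply, eval_comp, ptP,
    eval_pow, eval_add, eval_X, eval_C]
  congr 1
  · split_ifs
    · exact eval_ehP_neg ν j c
    · simp
  · congr 1
    rw [Fin.val_rev, Nat.cast_sub j.2]
    push_cast; ring

lemma eval_ppP_neg (ν : ℝ) (M m : ℕ) (c : ℝ) :
    (ppP ν M m).eval (-c) = (ppP ν M m).eval c := by
  rw [ppP, eval_prod, eval_prod]
  refine Finset.prod_congr rfl fun i _ => ?_
  have e1 : ∀ n : ℕ, (-1 : ℝ) ^ (2 * n) = 1 := fun n => by rw [pow_mul]; simp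
  rw [eval_mul, eval_mul, eval_pochP, eval_pochP, eval_pochP, eval_pochP,
    show -c + (3 / 2 - M - ν) = -(c + M + ν - 3 / 2) by ring, poch_neg, e1,
    show -c + (M - 1 / 2 + ν - 2 * (i : ℝ)) = -(c - M + 1 / 2 - ν + 2 * i) by ring, poch_neg, e1,
    one_mul, one_mul, mul_comm]
  push_cast
  congr 2 <;> ring

lemma eval_qqP_neg (M : ℕ) (c : ℝ) :
    (qqP M).eval (-c) =
      ((Equiv.Perm.sign (Fin.revPerm : Equiv.Perm (Fin M)) : ℤ) : ℝ) * (qqP M).eval c := by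
  -- The window determinant of the monomials is a multiple of `qqP`.
  let ψ : Fin M → ℝ[X] := fun i => X ^ (i : ℕ)
  let b : Fin M → Bool := fun _ => false
  have hb : nU b = 0 := by simp [nU, b]
  have h1 := det_fhatP_eq_gP 0 M b ψ
  have h2 := tendsto_quotient 0 (k := fun i => (i : ℕ)) (L := fun _ => 1) (ψ := ψ) (fun i => by
    have := leadLe_of_natDegree (natDegree_X_pow_le (R := ℝ) (i : ℕ))
    simpa [ψ] using this) h1
  have h3 : degG b (fun i => (i : ℕ)) = 0 := by
    rw [degG, hb, Fin.sum_univ_eq_sum_range (fun j => (j : ℤ)) M, sumRange_cast]; simp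
  rw [h3] at h2
  have hne : kap M * ((∏ _i : Fin M, (1 : ℝ)) *
      (Matrix.vandermonde (muRow 0 b fun i => (i : ℕ))).det) ≠ 0 := by
    refine mul_ne_zero (kap_ne_zero M) (mul_ne_zero (by simp) ?_)
    rw [Matrix.det_vandermonde_ne_zero_iff]
    intro i j hij
    simpa [muRow, b, Fin.ext_iff] using hij
  rw [mul_zero, neg_zero] at h2
  have h4 := leadLe_of_tendsto (k := 0) (by simpa only [Nat.cast_zero, neg_zero] using h2)
  have h5 := eq_C_of_natDegree_le_zero h4.natDegree_le
  rw [h4.coeff_eq] at h5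
  rw [hb, ppP, Finset.range_zero, Finset.prod_empty, mul_one, h5] at h1
  have h6 := eval_det_fhatP_neg 0 b ψ c
  rw [h1, eval_mul, eval_mul, eval_C, eval_C, ← mul_assoc _ (eval c _)] at h6
  exact mul_right_cancel₀ hne h6

lemma eval_gP_neg (ν : ℝ) {M : ℕ} (b : Fin M → Bool) (ψ : Fin M → ℝ[X]) (c : ℝ) :
    (gP ν M b ψ).eval (-c) = (gP ν M b ψ).eval c := by
  have : (gP ν M b ψ).comp (-X) = gP ν M b ψ := by
    refine poly_eq_of_large (2 * M + |ν| + 2) fun c hc => ?_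
    have h1 := det_fhatP_eq_gP ν M b ψ
    have h2 := eval_det_fhatP_neg ν b ψ c
    rw [h1, eval_mul, eval_mul, eval_mul, eval_mul, eval_qqP_neg, eval_ppP_neg, mul_assoc,
      mul_assoc, mul_assoc] at h2
    have h3 : ((Equiv.Perm.sign (Fin.revPerm : Equiv.Perm (Fin M)) : ℤ) : ℝ) ≠ 0 := by
      exact_mod_cast (Units.ne_zero _)
    have h4 := mul_left_cancel₀ (eval_qqP_pos (by
      have := abs_nonneg ν; have := (Nat.cast_nonneg M : (0 : ℝ) ≤ M); linarith)).ne'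
      (mul_left_cancel₀ h3 h2)
    have h5 := mul_left_cancel₀ (eval_ppP_pos (nU_le b) hc).ne' h4
    simpa using h5
  have h := congrArg (eval c) this
  simpa using h

/-- The Casoratian determinant without its trivial factors, in terms of the square of the
centre. -/
def gW (ν : ℝ) (M : ℕ) (b : Fin M → Bool) (ψ : Fin M → ℝ[X]) : ℝ[X] := evenPart (gP ν M b ψ)

lemma eval_gW (ν : ℝ) {M : ℕ} (b : Fin M → Bool) (ψ : Fin M → ℝ[X]) (c : ℝ) :
    (gW ν M b ψ).eval (c ^ 2) = (gP ν M b ψ).eval c :=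
  (eval_evenPart (eval_gP_neg ν b ψ) c).symm

lemma leadLe_gW (ν : ℝ) {M : ℕ} {b : Fin M → Bool} {ψ : Fin M → ℝ[X]} {k : Fin M → ℕ}
    {L : Fin M → ℝ} (h : ∀ i, LeadLe (ψ i) (k i) (L i)) {D : ℕ} (hD : degG b k = D) :
    LeadLe (gW ν M b ψ) D (kap M * ((∏ i, L i) * (Matrix.vandermonde (muRow ν b k)).det)) := by
  have h1 := tendsto_quotient ν h (det_fhatP_eq_gP ν M b ψ)
  rw [hD] at h1
  have h2 := leadLe_of_tendsto (k := 2 * D) (by exact_mod_cast h1)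
  refine ⟨fun i hi => ?_, fun i hi => ?_, fun h => absurd h (by omega)⟩
  · rw [gW, coeff_evenPart]
    exact h2.1 _ (by push_cast; omega)
  · rw [gW, coeff_evenPart]
    exact h2.2.1 _ (by push_cast; omega)

/-! ### Operators on a window and their adjoints -/

lemma LeadLe.iterate_aW {ψ : ℝ[X]} {k : ℤ} {L : ℝ} (h : LeadLe ψ k L) (j : ℕ) :
    LeadLe (KrallHahn.aW^[j] ψ) k L := by
  induction j with
  | zero => simpa using h
  | succ j ih => rw [Function.iterate_succ_apply']; exact ih.aW

/-- The coefficients `T k` represent, on even functions, the operator `B` multiplied by the odd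
polynomial `z γ(z²)`, and the sum of the translated coefficients (the formal adjoint applied to `1`)
is the odd polynomial `z μ(z²)`. -/
structure Represents (T : ℕ → ℝ → ℝ) (j : ℕ) (B : ℝ[X] → ℝ[X]) (γ μ : ℝ[X]) : Prop where
  zero : ∀ k, j < k → T k = 0
  apply : ∀ ψ z, (j : ℝ) < z →
    ∑ k ∈ Finset.range (j + 1), T k z * ψ.eval ((z + j - 2 * k) ^ 2) =
      z * γ.eval (z ^ 2) * (B ψ).eval (z ^ 2)
  adjoint : ∀ z, (j : ℝ) < z →
    ∑ k ∈ Finset.range (j + 1), T k (z - j + 2 * k) = z * μ.eval (z ^ 2)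

lemma sum_range_add_shift {A B f : ℕ → ℝ} {j : ℕ} (hA : A (j + 1) = 0)
    (hf : ∀ k, f k = A k + if k = 0 then 0 else B (k - 1)) :
    ∑ k ∈ Finset.range (j + 1 + 1), f k =
      ∑ k ∈ Finset.range (j + 1), A k + ∑ k ∈ Finset.range (j + 1), B k := by
  simp only [hf, Finset.sum_add_distrib]
  rw [Finset.sum_range_succ, hA, add_zero, Finset.sum_range_succ' _ (j + 1)]
  simp

lemma Represents.mul (γ : ℝ[X]) :
    Represents (fun k z => if k = 0 then z * γ.eval (z ^ 2) else 0) 0 id γ γ := by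
  refine ⟨fun k hk => ?_, fun ψ z _ => ?_, fun z _ => ?_⟩
  · funext z; simp [hk.ne']
  · simp
  · simp

lemma Represents.comp_aW {T : ℕ → ℝ → ℝ} {j : ℕ} {B : ℝ[X] → ℝ[X]} {γ μ : ℝ[X]}
    (h : Represents T j B γ μ) :
    Represents (fun k z => (T k z + if k = 0 then 0 else T (k - 1) z) / 2) (j + 1)
      (fun ψ => B (aW ψ)) γ (aW μ + C 2 * dW μ) := by
  refine ⟨fun k hk => ?_, fun ψ z hz => ?_, fun z hz => ?_⟩
  · funext z
    simp [h.zero k (by omega), h.zero (k - 1) (by omega)]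
  · push_cast at hz
    have h0 : T (j + 1) z = 0 := by rw [h.zero (j + 1) (by omega)]; rfl
    rw [← h.apply (aW ψ) z (by linarith), sum_range_add_shift
      (A := fun k => T k z * ψ.eval ((z + (j + 1) - 2 * k) ^ 2) / 2)
      (B := fun k => T k z * ψ.eval ((z + (j + 1) - 2 * (k + 1)) ^ 2) / 2) (by simp [h0]) (by
        rintro (_ | k)
        · simp; ring
        · simp; ring), ← Finset.sum_add_distrib]
    refine Finset.sum_congr rfl fun k _ => ?_
    have := eval_aW ψ (z + j - 2 * k)
    rw [show z + (j + 1) - 2 * (k : ℝ) = z + j - 2 * k + 1 by ring,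
      show z + (j + 1) - 2 * ((k : ℝ) + 1) = z + j - 2 * k - 1 by ring]
    linear_combination -T k z / 2 * this
  · push_cast at hz
    have h1 := h.adjoint (z + 1) (by linarith)
    have h2 := h.adjoint (z - 1) (by linarith)
    have h3 := eval_aW μ z
    have h4 := eval_dW μ z
    have h0 : ∀ y, T (j + 1) y = 0 := fun y => by rw [h.zero (j + 1) (by omega)]; rfl
    have e1 : ∑ k ∈ Finset.range (j + 1 + 1),
        (T k (z - (j + 1 : ℕ) + 2 * k) + if k = 0 then 0 else T (k - 1) (z - (j + 1 : ℕ) + 2 * k)) / 2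
        = (∑ k ∈ Finset.range (j + 1), T k (z - 1 - j + 2 * k)) / 2 +
          (∑ k ∈ Finset.range (j + 1), T k (z + 1 - j + 2 * k)) / 2 := by
      simp only [add_div, Finset.sum_add_distrib]
      congr 1
      · rw [Finset.sum_range_succ, h0, zero_div, add_zero, Finset.sum_div]
        refine Finset.sum_congr rfl fun k _ => ?_
        push_cast; ring_nf
      · rw [Finset.sum_range_succ', Finset.sum_div]
        simp only [Nat.add_eq_zero_iff, one_ne_zero, and_false, if_false, Nat.add_sub_cancel,
          if_true, zero_div, add_zero]
        refine Finset.sum_congr rfl fun k _ => ?_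
        push_cast; ring_nf
    rw [e1, h1, h2]
    simp only [eval_add, eval_mul, eval_C]
    linear_combination (-z / 2) * h3 - h4 / 2

lemma Represents.comp_dW {T : ℕ → ℝ → ℝ} {j : ℕ} {B : ℝ[X] → ℝ[X]} {γ μ : ℝ[X]}
    (h : Represents T j B γ μ) :
    Represents (fun k z => T k z / (4 * (z + j - 2 * k)) -
        if k = 0 then 0 else T (k - 1) z / (4 * (z + j + 2 - 2 * k))) (j + 1)
      (fun ψ => B (dW ψ)) γ (C (-1) * dW μ) := by
  refine ⟨fun k hk => ?_, fun ψ z hz => ?_, fun z hz => ?_⟩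
  · funext z
    simp [h.zero k (by omega), h.zero (k - 1) (by omega)]
  · push_cast at hz
    have h0 : T (j + 1) z = 0 := by rw [h.zero (j + 1) (by omega)]; rfl
    rw [← h.apply (dW ψ) z (by linarith), sum_range_add_shift
      (A := fun k => T k z / (4 * (z + j - 2 * k)) * ψ.eval ((z + (j + 1) - 2 * k) ^ 2))
      (B := fun k => -(T k z / (4 * (z + j - 2 * k)) * ψ.eval ((z + (j + 1) - 2 * (k + 1)) ^ 2)))
      (by simp [h0]) (by
        rintro (_ | k)
        · simp
        · simp only [Nat.add_eq_zero_iff, one_ne_zero, and_false, if_false, Nat.add_sub_cancel]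
          push_cast; ring_nf), ← Finset.sum_add_distrib]
    refine Finset.sum_congr rfl fun k hk => ?_
    have hk' : (k : ℝ) ≤ j := by exact_mod_cast Nat.lt_succ_iff.1 (Finset.mem_range.1 hk)
    have hne : z + j - 2 * k ≠ 0 := by linarith
    have := eval_dW ψ (z + j - 2 * k)
    rw [show z + (j + 1) - 2 * (k : ℝ) = z + j - 2 * k + 1 by ring,
      show z + (j + 1) - 2 * ((k : ℝ) + 1) = z + j - 2 * k - 1 by ring, ← sub_eq_add_neg, ← mul_sub,
      ← this]
    field_simp
  · push_cast at hz
    have h1 := h.adjoint (z + 1) (by linarith)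
    have h2 := h.adjoint (z - 1) (by linarith)
    have h4 := eval_dW μ z
    have h0 : ∀ y, T (j + 1) y = 0 := fun y => by rw [h.zero (j + 1) (by omega)]; rfl
    have hz1 : z - 1 ≠ 0 := by have : (0 : ℝ) ≤ j := j.cast_nonneg
                               linarith
    have hz2 : z + 1 ≠ 0 := by have : (0 : ℝ) ≤ j := j.cast_nonneg
                               linarith
    have e1 : ∑ k ∈ Finset.range (j + 1 + 1),
        (T k (z - (j + 1 : ℕ) + 2 * k) / (4 * (z - (j + 1 : ℕ) + 2 * k + j - 2 * k)) -
          if k = 0 then 0 else T (k - 1) (z - (j + 1 : ℕ) + 2 * k) /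
            (4 * (z - (j + 1 : ℕ) + 2 * k + j + 2 - 2 * k)))
        = (∑ k ∈ Finset.range (j + 1), T k (z - 1 - j + 2 * k)) / (4 * (z - 1)) -
          (∑ k ∈ Finset.range (j + 1), T k (z + 1 - j + 2 * k)) / (4 * (z + 1)) := by
      simp only [Finset.sum_sub_distrib]
      congr 1
      · rw [Finset.sum_range_succ, h0, zero_div, add_zero, Finset.sum_div]
        refine Finset.sum_congr rfl fun k _ => ?_
        push_cast; ring_nf
      · rw [Finset.sum_range_succ', Finset.sum_div]
        simp only [Nat.add_eq_zero_iff, one_ne_zero, and_false, if_false, Nat.add_sub_cancel,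
          if_true, add_zero]
        refine Finset.sum_congr rfl fun k _ => ?_
        push_cast; ring_nf
    rw [e1, h1, h2]
    simp only [eval_mul, eval_C]
    field_simp
    linear_combination h4

/-- The operators `aW^n dW^i`, multiplied by `z γ(z²)`, have adjoints that preserve odd
polynomials. -/
lemma exists_represents (n i : ℕ) {γ : ℝ[X]} {e : ℕ} (hγ : γ.natDegree ≤ i + e) :
    ∃ T μ, Represents T (n + i) (fun ψ => aW^[n] (dW^[i] ψ)) γ μ ∧ μ.natDegree ≤ e := by
  have h1 : ∀ n, ∃ T μ L, Represents T n (fun ψ => aW^[n] ψ) γ μ ∧ LeadLe μ (i + e : ℕ) L := by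
    intro n
    induction n with
    | zero => exact ⟨_, γ, _, Represents.mul γ, leadLe_of_natDegree hγ⟩
    | succ n ih =>
      obtain ⟨T, μ, L, hT, hμ⟩ := ih
      refine ⟨_, _, _, hT.comp_aW, hμ.aW.add ((hμ.dW.mono ?_).C_mul 2)⟩
      omega
  have h2 : ∀ m, ∃ T μ L, Represents T (n + m) (fun ψ => aW^[n] (dW^[m] ψ)) γ μ ∧
      LeadLe μ ((i + e : ℕ) - m : ℤ) L := by
    intro m
    induction m with
    | zero =>
      obtain ⟨T, μ, L, hT, hμ⟩ := h1 n
      exact ⟨T, μ, L, hT, by simpa using hμ⟩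
    | succ m ih =>
      obtain ⟨T, μ, L, hT, hμ⟩ := ih
      refine ⟨_, _, -1 * ((((i + e : ℕ) - m : ℤ) : ℝ) * L), hT.comp_dW, ?_⟩
      convert hμ.dW.C_mul (-1) using 1
      push_cast; ring
  obtain ⟨T, μ, L, hT, hμ⟩ := h2 i
  refine ⟨T, μ, hT, LeadLe.natDegree_le (L := L) ?_⟩
  convert hμ using 1
  push_cast; ring

/-- A functional on windows that maps polynomials to odd polynomials, raising degrees by at most
`e`, is a combination of the operators `aW^(n-r) dW^r`; therefore the formal adjoint maps `1` to an
odd polynomial. -/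
lemma exists_adjoint_poly {n e : ℕ} {t : ℕ → ℝ → ℝ} {x₀ : ℝ} (g : ℕ → ℝ[X])
    (hg : ∀ m, (g m).natDegree ≤ m + e)
    (ht : ∀ m z, x₀ < z → ∑ k ∈ Finset.range (n + 1), t k z * ((z + n - 2 * k) ^ 2) ^ m =
      z * (g m).eval (z ^ 2)) :
    ∃ μ : ℝ[X], μ.natDegree ≤ e ∧ ∀ z, max x₀ n + n < z →
      ∑ k ∈ Finset.range (n + 1), t k (z - n + 2 * k) = z * μ.eval (z ^ 2) := by
  let B : ℕ → ℝ[X] → ℝ[X] := fun r ψ => aW^[n - r] (dW^[r] ψ)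
  have hB : ∀ r m : ℕ, LeadLe (B r (X ^ m)) ((m : ℤ) - r) (∏ l ∈ Finset.range r, ((m : ℝ) - l)) := by
    intro r m
    have h := leadLe_of_natDegree (natDegree_X_pow_le (R := ℝ) m)
    rw [coeff_X_pow_self] at h
    simpa using (h.iterate_dW r).iterate_aW (n - r)
  have hγ : ∀ i, ∃ γ : ℕ → ℝ[X], (∀ r, (γ r).natDegree ≤ r + e) ∧
      ∀ m < i, g m = ∑ r ∈ Finset.range i, γ r * B r (X ^ m) := by
    intro i
    induction i with
    | zero => exact ⟨0, by simp, by simp⟩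
    | succ i ih =>
      obtain ⟨γ, h1, h2⟩ := ih
      refine ⟨Function.update γ i (C ((i.factorial : ℝ)⁻¹) *
        (g i - ∑ r ∈ Finset.range i, γ r * B r (X ^ i))), fun r => ?_, fun m hm => ?_⟩
      · by_cases hr : r = i
        · subst hr
          rw [Function.update_self]
          refine (natDegree_C_mul_le _ _).trans ((natDegree_sub_le _ _).trans (max_le (hg r) ?_))
          refine natDegree_sum_le_of_forall_le _ _ fun l hl => ?_
          have hl' := (Finset.mem_range.1 hl).le
          have h3 := hB l r
          rw [← Nat.cast_sub hl'] at h3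
          exact (natDegree_mul_le).trans ((add_le_add (h1 l) h3.natDegree_le).trans (by omega))
        · rw [Function.update_of_ne hr]; exact h1 r
      · rw [Finset.sum_range_succ, Function.update_self, Finset.sum_congr rfl fun r hr => by
          rw [Function.update_of_ne (Finset.mem_range.1 hr).ne]]
        rcases Nat.lt_succ_iff_lt_or_eq.1 hm with hm | rfl
        · have h3 : B i (X ^ m) = 0 := by
            ext l; exact (hB i m).1 l (by omega)
          rw [h3, mul_zero, add_zero]
          exact h2 m hm
        · have h3 : B m (X ^ m) = C (m.factorial : ℝ) := by
            have h4 := hB m m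
            rw [sub_self] at h4
            have h5 := eq_C_of_natDegree_le_zero (LeadLe.natDegree_le (k := 0) h4)
            rw [h5, LeadLe.coeff_eq (k := 0) h4, ← Finset.prod_range_reflect,
              ← Finset.prod_range_add_one_eq_factorial]
            push_cast
            congr 1
            refine Finset.prod_congr rfl fun l hl => ?_
            have := Finset.mem_range.1 hl
            rw [Nat.sub_sub, Nat.cast_sub (by omega)]; push_cast; ring
          rw [h3, mul_right_comm, ← C_mul, inv_mul_cancel₀ (by positivity), C_1, one_mul]
          ring
  obtain ⟨γ, h1, h2⟩ := hγ (n + 1)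
  have hT : ∀ r, ∃ T μ, (r < n + 1 → Represents T n (B r) (γ r) μ) ∧ μ.natDegree ≤ e := by
    intro r
    obtain ⟨T, μ, h, h'⟩ := exists_represents (n - r) r (h1 r)
    refine ⟨T, μ, fun hr => ?_, h'⟩
    rwa [Nat.sub_add_cancel (by omega)] at h
  choose T μ hT hμ using hT
  have key : ∀ k < n + 1, ∀ z, max x₀ n < z → t k z = ∑ r ∈ Finset.range (n + 1), T r k z := by
    intro k hk z hz
    have hz1 := (le_max_left _ _).trans_lt hz
    have hz2 := (le_max_right _ _).trans_lt hz
    let v : Fin (n + 1) → ℝ := fun k => (z + n - 2 * (k : ℕ)) ^ 2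
    have hv : Function.Injective v := by
      intro i j hij
      have hi : ((i : ℕ) : ℝ) ≤ n := by exact_mod_cast Nat.lt_succ_iff.1 i.2
      have hj : ((j : ℕ) : ℝ) ≤ n := by exact_mod_cast Nat.lt_succ_iff.1 j.2
      have := (sq_eq_sq₀ (by linarith) (by linarith)).1 hij
      ext
      have h' : ((i : ℕ) : ℝ) = (j : ℕ) := by linarith
      exact_mod_cast h'
    have h0 := Matrix.eq_zero_of_forall_pow_sum_mul_pow_eq_zero (f := v)
      (v := fun k : Fin (n + 1) => t k z - ∑ r ∈ Finset.range (n + 1), T r k z) hv (fun m => by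
        have h3 : ∑ k ∈ Finset.range (n + 1), t k z * ((z + n - 2 * k) ^ 2) ^ (m : ℕ) =
            ∑ k ∈ Finset.range (n + 1), ∑ r ∈ Finset.range (n + 1),
              T r k z * ((z + n - 2 * k) ^ 2) ^ (m : ℕ) := by
          rw [ht m z hz1, h2 m m.2, eval_finsetSum, Finset.mul_sum, Finset.sum_comm]
          refine Finset.sum_congr rfl fun r hr => ?_
          have := (hT r (Finset.mem_range.1 hr)).apply (X ^ (m : ℕ)) z hz2
          simp only [eval_pow, eval_X] at this
          rw [this, eval_mul, mul_assoc]
        simp only [sub_mul, Finset.sum_mul, Finset.sum_sub_distrib, v]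
        rw [Fin.sum_univ_eq_sum_range (fun k => t k z * ((z + n - 2 * k) ^ 2) ^ (m : ℕ)) (n + 1),
          Fin.sum_univ_eq_sum_range (fun k => ∑ r ∈ Finset.range (n + 1),
            T r k z * ((z + n - 2 * k) ^ 2) ^ (m : ℕ)) (n + 1), h3, sub_self])
    exact sub_eq_zero.1 (congrFun h0 ⟨k, hk⟩)
  refine ⟨∑ r ∈ Finset.range (n + 1), μ r, natDegree_sum_le_of_forall_le _ _ fun r _ => hμ r,
    fun z hz => ?_⟩
  rw [Finset.sum_congr rfl fun k hk => key k (Finset.mem_range.1 hk) _ (by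
    have : (0 : ℝ) ≤ k := k.cast_nonneg
    linarith), Finset.sum_comm, eval_finsetSum, Finset.mul_sum]
  refine Finset.sum_congr rfl fun r hr => (hT r (Finset.mem_range.1 hr)).adjoint z ?_
  have := le_max_right x₀ n
  have : (0 : ℝ) ≤ n := n.cast_nonneg
  linarith

/-! ### Cofactors of the window matrices -/

/-- The cofactor of the entry `(i, k)` of the window matrix with centre `c`, normalized in such a
way that the sum over `k` against the values of a polynomial `φ` is the reduced determinant with
the row `i` replaced by `φ`. -/
def tF (ν : ℝ) {M : ℕ} (b : Fin M → Bool) (ψ : Fin M → ℝ[X]) (i : Fin M) (k : ℕ) (c : ℝ) : ℝ :=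
  if h : k < M then
    c * ((fhatP ν M b ψ).adjugate ⟨k, h⟩ i).eval c * (if b i then ehP ν M k else 1).eval c /
      ((qqP M).eval c * (ppP ν M (nU b)).eval c)
  else 0

lemma adjugate_congr_row {n R : Type*} [Fintype n] [DecidableEq n] [CommRing R]
    {A B : Matrix n n R} {i : n} (h : ∀ l, l ≠ i → A l = B l) (k : n) :
    A.adjugate k i = B.adjugate k i := by
  rw [Matrix.adjugate_apply, Matrix.adjugate_apply]
  congr 1
  ext l j
  by_cases hl : l = i
  · subst hl; simp
  · simp only [Matrix.updateRow_ne hl]; rw [h l hl]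

lemma sum_tF (ν : ℝ) {M : ℕ} (b : Fin M → Bool) (ψ : Fin M → ℝ[X]) (i : Fin M) (φ : ℝ[X]) {c : ℝ}
    (hc : 2 * M + |ν| + 2 < c) :
    ∑ k ∈ Finset.range M, tF ν b ψ i k c * φ.eval ((c + (M - 1) - 2 * k) ^ 2) =
      c * (gW ν M b (Function.update ψ i φ)).eval (c ^ 2) := by
  have h1 : 0 < (qqP M).eval c := eval_qqP_pos (by
    have := abs_nonneg ν; have := (Nat.cast_nonneg M : (0 : ℝ) ≤ M); linarith)
  have h2 : 0 < (ppP ν M (nU b)).eval c := eval_ppP_pos (nU_le b) hc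
  have h3 := det_fhatP_eq_gP ν M b (Function.update ψ i φ)
  rw [Matrix.det_eq_sum_mul_adjugate_row _ i] at h3
  have h4 := congrArg (eval c) h3
  rw [eval_finsetSum, eval_mul, eval_mul, ← eval_gW] at h4
  rw [← Fin.sum_univ_eq_sum_range (fun k => tF ν b ψ i k c * φ.eval ((c + (M - 1) - 2 * k) ^ 2)) M]
  have h5 : (gW ν M b (Function.update ψ i φ)).eval (c ^ 2) =
      (∑ k : Fin M, ((fhatP ν M b ψ).adjugate k i).eval c * (if b i then ehP ν M k else 1).eval c *
        φ.eval ((c + (M - 1) - 2 * k) ^ 2)) / ((qqP M).eval c * (ppP ν M (nU b)).eval c) := by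
    rw [eq_div_iff (mul_pos h1 h2).ne', mul_comm, ← h4]
    refine Finset.sum_congr rfl fun k _ => ?_
    rw [eval_mul, adjugate_congr_row (B := fhatP ν M b ψ) (fun l hl => by
      funext j; simp [fhatP, Function.update_of_ne hl])]
    simp only [fhatP, Matrix.of_apply, Function.update_self, eval_mul, eval_comp, ptP, eval_pow,
      eval_add, eval_X, eval_C]
    rw [show c + (M - 1) - 2 * ((k : ℕ) : ℝ) = c + (M - 1 - 2 * (k : ℕ)) by ring]
    ring
  rw [h5, Finset.sum_div, Finset.mul_sum]
  refine Finset.sum_congr rfl fun k _ => ?_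
  rw [tF, dif_pos k.2]
  ring

lemma degG_update {M : ℕ} (b : Fin M → Bool) (k : Fin M → ℕ) (i : Fin M) (m : ℕ) :
    degG b (Function.update k i m) = degG b k - k i + m := by
  have : ∑ l, ((Function.update k i m l : ℕ) : ℤ) = ∑ l, (k l : ℤ) - k i + m := by
    rw [← Finset.add_sum_erase _ _ (Finset.mem_univ i), Function.update_self,
      ← Finset.add_sum_erase _ (fun l => (k l : ℤ)) (Finset.mem_univ i), Finset.sum_congr rfl
      fun l hl => by rw [Function.update_of_ne (Finset.ne_of_mem_erase hl)]]
    ring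
  rw [degG, this, degG]; ring

/-- The sum over all windows that contain a given point is an odd polynomial. -/
lemma exists_sum_tF (ν : ℝ) {M : ℕ} (b : Fin M → Bool) {ψ : Fin M → ℝ[X]} {k : Fin M → ℕ}
    (hψ : ∀ i, (ψ i).natDegree ≤ k i) (i : Fin M) {e : ℕ} (he : degG b k - k i = e) :
    ∃ μ : ℝ[X], μ.natDegree ≤ e ∧ ∀ z, 4 * M + |ν| + 2 < z →
      ∑ j ∈ Finset.range M, tF ν b ψ i j (z - (M - 1) + 2 * j) = z * μ.eval (z ^ 2) := by
  obtain ⟨n, rfl⟩ : ∃ n, M = n + 1 := ⟨M - 1, by have := i.2; omega⟩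
  obtain ⟨μ, hμ, h⟩ := exists_adjoint_poly (n := n) (e := e) (t := tF ν b ψ i)
    (x₀ := 2 * (n + 1 : ℕ) + |ν| + 2)
    (fun m => gW ν (n + 1) b (Function.update ψ i (X ^ m))) (fun m => by
      refine (leadLe_gW ν (k := Function.update k i m) (L := fun l =>
        (Function.update ψ i (X ^ m) l).coeff (Function.update k i m l)) (fun l => ?_) ?_).natDegree_le
      · refine leadLe_of_natDegree ?_
        by_cases hl : l = i
        · subst hl; simp
        · simp [Function.update_of_ne hl, hψ l]
      · rw [degG_update, he]; push_cast; ring) (fun m z hz => by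
      rw [← sum_tF ν b ψ i (X ^ m) hz]
      refine Finset.sum_congr rfl fun k _ => ?_
      simp)
  refine ⟨μ, hμ, fun z hz => ?_⟩
  have hν := abs_nonneg ν
  have hn : (0 : ℝ) ≤ n := n.cast_nonneg
  push_cast at hz h ⊢
  rw [← h z (by
    rw [← lt_sub_iff_add_lt]
    refine max_lt ?_ ?_ <;> linarith)]
  refine Finset.sum_congr rfl fun k _ => ?_
  congr 1; ring

/-- The matrix of the values of the weighted rows at the points `t - 2k`. -/
def fMat (ν : ℝ) {M : ℕ} (b : Fin M → Bool) (ψ : Fin M → ℝ[X]) (t : ℝ) : Matrix (Fin M) (Fin M) ℝ :=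
  Matrix.of fun i k =>
    (if b i then gE ν (t - 2 * (k : ℕ)) else 1) * (ψ i).eval ((t - 2 * (k : ℕ)) ^ 2)

lemma gE_pos {ν z : ℝ} (h : |ν| < z) : 0 < gE ν z := by
  have hν := abs_le.1 (le_refl |ν|)
  exact div_pos (Real.Gamma_pos_of_pos (by linarith)) (Real.Gamma_pos_of_pos (by linarith))

/-- The factor that relates `fhatP` and `fMat`. -/
def sF (ν : ℝ) (M : ℕ) (c : ℝ) : ℝ :=
  Real.Gamma (c + M - 1 / 2 + ν) / Real.Gamma (c - M + 3 / 2 - ν)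

lemma sF_pos {ν : ℝ} {M : ℕ} {c : ℝ} (hc : 2 * M + |ν| + 2 < c) : 0 < sF ν M c := by
  have hν := abs_le.1 (le_refl |ν|)
  have hM := (Nat.cast_nonneg M : (0 : ℝ) ≤ M)
  exact div_pos (Real.Gamma_pos_of_pos (by linarith)) (Real.Gamma_pos_of_pos (by linarith))

lemma fhatP_eval (ν : ℝ) {M : ℕ} (b : Fin M → Bool) (ψ : Fin M → ℝ[X]) {c : ℝ}
    (hc : 2 * M + |ν| + 2 < c) :
    (evalRingHom c).mapMatrix (fhatP ν M b ψ) =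
      Matrix.diagonal (fun i => if b i then sF ν M c else 1) * fMat ν b ψ (c + M - 1) := by
  ext i k
  rw [Matrix.diagonal_mul]
  simp only [RingHom.mapMatrix_apply, Matrix.map_apply, fhatP, fMat, Matrix.of_apply,
    coe_evalRingHom, eval_mul, eval_comp, ptP, eval_pow, eval_add, eval_X, eval_C]
  rw [show c + ((M : ℝ) - 1 - 2 * (k : ℕ)) = c + M - 1 - 2 * (k : ℕ) by ring]
  split_ifs
  · rw [ehP_eval ν k.2 hc, sF]; ring
  · simp

/-- The cofactors in terms of the inverse of `fMat`. -/
lemma tF_eq (ν : ℝ) {M : ℕ} (b : Fin M → Bool) (ψ : Fin M → ℝ[X]) (i k : Fin M) {c : ℝ}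
    (hc : 2 * M + |ν| + 2 < c) (hd : (fhatP ν M b ψ).det.eval c ≠ 0) :
    IsUnit (fMat ν b ψ (c + M - 1)).det ∧
    tF ν b ψ i k c = c * (gW ν M b ψ).eval (c ^ 2) * ((fMat ν b ψ (c + M - 1))⁻¹ k i *
      if b i then gE ν (c + M - 1 - 2 * (k : ℕ)) else 1) := by
  have h1 : 0 < (qqP M).eval c := eval_qqP_pos (by
    have := abs_nonneg ν; have := (Nat.cast_nonneg M : (0 : ℝ) ≤ M); linarith)
  have h2 : 0 < (ppP ν M (nU b)).eval c := eval_ppP_pos (nU_le b) hc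
  have hs := (sF_pos hc).ne'
  have h3 := congrArg (eval c) (det_fhatP_eq_gP ν M b ψ)
  rw [eval_mul, eval_mul, ← eval_gW] at h3
  have hF := fhatP_eval ν b ψ hc
  set Fh := (evalRingHom c).mapMatrix (fhatP ν M b ψ) with hFh
  set f := fMat ν b ψ (c + M - 1) with hf
  have hdet : (fhatP ν M b ψ).det.eval c = Fh.det := by
    rw [← coe_evalRingHom, RingHom.map_det]
  have hadj : ((fhatP ν M b ψ).adjugate k i).eval c = Fh.adjugate k i := by
    rw [hFh, ← RingHom.map_adjugate]; rfl
  have hfd : f.det ≠ 0 := by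
    rw [hdet, hF, Matrix.det_mul] at hd
    exact right_ne_zero_of_mul hd
  refine ⟨isUnit_iff_ne_zero.2 hfd, ?_⟩
  -- `Fh * f⁻¹` is the diagonal matrix, hence the adjugate of `Fh` in terms of `f⁻¹`.
  have h4 : Fh.adjugate * Matrix.diagonal (fun i => if b i then sF ν M c else 1) =
      Fh.det • f⁻¹ := by
    have : Matrix.diagonal (fun i => if b i then sF ν M c else 1) = Fh * f⁻¹ := by
      rw [hF, Matrix.mul_assoc, Matrix.mul_nonsing_inv _ (isUnit_iff_ne_zero.2 hfd), Matrix.mul_one]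
    rw [this, ← Matrix.mul_assoc, Matrix.adjugate_mul, Matrix.smul_mul, Matrix.one_mul]
  have h5 := congrFun (congrFun h4 k) i
  rw [Matrix.mul_diagonal, Matrix.smul_apply, smul_eq_mul, ← hdet, h3] at h5
  rw [tF, dif_pos k.2, hadj, div_eq_iff (mul_pos h1 h2).ne']
  by_cases hb : b i
  · simp only [hb, if_true] at h5 ⊢
    rw [ehP_eval ν k.2 hc, ← sF]
    linear_combination c * gE ν (c + M - 1 - 2 * (k : ℕ)) * h5
  · simp only [hb, Bool.false_eq_true, if_false, mul_one, eval_one] at h5 ⊢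
    linear_combination c * h5

/-- For large centres the window matrices are invertible, unless the reduced determinant
vanishes identically. -/
lemma eventually_det_ne_zero {ν : ℝ} {M : ℕ} {b : Fin M → Bool} {ψ : Fin M → ℝ[X]}
    (h : gW ν M b ψ ≠ 0) : ∀ᶠ c : ℝ in atTop, (fhatP ν M b ψ).det.eval c ≠ 0 := by
  have h1 : gP ν M b ψ ≠ 0 := by
    rintro h0
    apply h
    ext j
    rw [gW, coeff_evenPart, h0]; simp
  have h2 : (fhatP ν M b ψ).det ≠ 0 := by
    rw [det_fhatP_eq_gP]
    exact mul_ne_zero (mul_ne_zero (qqP_ne_zero M) (ppP_ne_zero ν M _)) h1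
  have h3 := (fhatP ν M b ψ).det.roots.toFinset.finite_toSet.bddAbove
  obtain ⟨B, hB⟩ := h3
  filter_upwards [eventually_gt_atTop B] with c hc h0
  have : c ∈ ((fhatP ν M b ψ).det.roots.toFinset : Set ℝ) := by
    simp [h2, h0]
  exact absurd (hB this) (not_le.2 hc)

/-! ### Rational functions and their values at large arguments -/

/-- The rational function `r` has the value `f x` for all large `x`. -/
def Ev (r : RatFunc ℝ) (f : ℝ → ℝ) : Prop := ∀ᶠ x in atTop, r.eval (RingHom.id ℝ) x = f x

lemma eventually_eval_ne_zero {p : ℝ[X]} (hp : p ≠ 0) : ∀ᶠ x in atTop, p.eval x ≠ 0 := by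
  obtain ⟨B, hB⟩ := p.roots.toFinset.finite_toSet.bddAbove
  filter_upwards [eventually_gt_atTop B] with c hc h0
  have : c ∈ (p.roots.toFinset : Set ℝ) := by simp [hp, h0]
  exact absurd (hB this) (not_le.2 hc)

lemma eventually_denom_ne_zero (r : RatFunc ℝ) :
    ∀ᶠ x in atTop, (RatFunc.denom r).eval₂ (RingHom.id ℝ) x ≠ 0 := by
  filter_upwards [eventually_eval_ne_zero r.denom_ne_zero] with x hx
  simpa [eval₂_eq_eval_map] using hx

lemma Ev.congr {r : RatFunc ℝ} {f g : ℝ → ℝ} (h : Ev r f) (hfg : f =ᶠ[atTop] g) : Ev r g := by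
  filter_upwards [h, hfg] with x h1 h2
  rw [h1, h2]

lemma Ev.eq_of {r : RatFunc ℝ} {f g : ℝ → ℝ} (h : Ev r f) (h' : Ev r g) : f =ᶠ[atTop] g := by
  filter_upwards [h, h'] with x h1 h2
  rw [← h1, h2]

lemma Ev.add {r s : RatFunc ℝ} {f g : ℝ → ℝ} (hr : Ev r f) (hs : Ev s g) :
    Ev (r + s) (fun x => f x + g x) := by
  filter_upwards [hr, hs, eventually_denom_ne_zero r, eventually_denom_ne_zero s] with x h1 h2 h3 h4
  rw [RatFunc.eval_add _ _ h3 h4, h1, h2]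

lemma Ev.mul {r s : RatFunc ℝ} {f g : ℝ → ℝ} (hr : Ev r f) (hs : Ev s g) :
    Ev (r * s) (fun x => f x * g x) := by
  filter_upwards [hr, hs, eventually_denom_ne_zero r, eventually_denom_ne_zero s] with x h1 h2 h3 h4
  rw [RatFunc.eval_mul _ _ h3 h4, h1, h2]

lemma Ev.C (c : ℝ) : Ev (RatFunc.C c) (fun _ => c) := Eventually.of_forall fun x => by simp

lemma Ev.X : Ev RatFunc.X (fun x => x) := Eventually.of_forall fun x => by simp

lemma Ev.zero : Ev 0 (fun _ => 0) := by simpa using Ev.C 0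

lemma Ev.one : Ev 1 (fun _ => 1) := by simpa using Ev.C 1

lemma Ev.natCast (n : ℕ) : Ev (n : RatFunc ℝ) (fun _ => n) := by
  simpa using Ev.C n

lemma Ev.ofNat (n : ℕ) [n.AtLeastTwo] :
    Ev (OfNat.ofNat n : RatFunc ℝ) (fun _ => (OfNat.ofNat n : ℝ)) := by
  have := Ev.natCast (OfNat.ofNat n)
  simpa only [Nat.cast_ofNat] using this

lemma Ev.neg {r : RatFunc ℝ} {f : ℝ → ℝ} (hr : Ev r f) : Ev (-r) (fun x => -f x) := by
  simpa using (Ev.C (-1)).mul hr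

lemma Ev.sub {r s : RatFunc ℝ} {f g : ℝ → ℝ} (hr : Ev r f) (hs : Ev s g) :
    Ev (r - s) (fun x => f x - g x) := by
  simpa [sub_eq_add_neg] using hr.add hs.neg

lemma Ev.eventually_ne_zero {r : RatFunc ℝ} {f : ℝ → ℝ} (hr : Ev r f) (h : r ≠ 0) :
    ∀ᶠ x in atTop, f x ≠ 0 := by
  filter_upwards [hr, eventually_denom_ne_zero r,
    eventually_eval_ne_zero (RatFunc.num_ne_zero h)] with x h1 h2 h3
  rw [← h1, RatFunc.eval, eval₂_eq_eval_map, Polynomial.map_id]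
  exact div_ne_zero h3 h2

lemma Ev.inv {r : RatFunc ℝ} {f : ℝ → ℝ} (hr : Ev r f) : Ev r⁻¹ (fun x => (f x)⁻¹) := by
  by_cases h : r = 0
  · subst h
    filter_upwards [hr] with x h1
    rw [← h1]; simp
  · have h1 : Ev (r * r⁻¹) (fun x => f x * r⁻¹.eval (RingHom.id ℝ) x) :=
      hr.mul (Eventually.of_forall fun _ => rfl)
    rw [mul_inv_cancel₀ h] at h1
    filter_upwards [hr.eventually_ne_zero h, h1.eq_of Ev.one] with x h2 h3
    exact eq_inv_of_mul_eq_one_right h3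

lemma Ev.div {r s : RatFunc ℝ} {f g : ℝ → ℝ} (hr : Ev r f) (hs : Ev s g) :
    Ev (r / s) (fun x => f x / g x) := by
  simpa [div_eq_mul_inv] using hr.mul hs.inv

lemma Ev.pow {r : RatFunc ℝ} {f : ℝ → ℝ} (hr : Ev r f) (n : ℕ) :
    Ev (r ^ n) (fun x => f x ^ n) := by
  induction n with
  | zero => simpa using Ev.one
  | succ n ih => simpa [pow_succ] using ih.mul hr

lemma Ev.sum {ι : Type*} {s : Finset ι} {r : ι → RatFunc ℝ} {f : ι → ℝ → ℝ}
    (h : ∀ i ∈ s, Ev (r i) (f i)) : Ev (∑ i ∈ s, r i) (fun x => ∑ i ∈ s, f i x) := by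
  classical
  induction s using Finset.induction_on with
  | empty => simpa using Ev.zero
  | insert a s ha ih =>
    simp only [Finset.sum_insert ha]
    exact (h a (Finset.mem_insert_self a s)).add (ih fun i hi => h i (Finset.mem_insert_of_mem hi))

lemma Ev.prod {ι : Type*} {s : Finset ι} {r : ι → RatFunc ℝ} {f : ι → ℝ → ℝ}
    (h : ∀ i ∈ s, Ev (r i) (f i)) : Ev (∏ i ∈ s, r i) (fun x => ∏ i ∈ s, f i x) := by
  classical
  induction s using Finset.induction_on with
  | empty => simpa using Ev.one
  | insert a s ha ih =>
    simp only [Finset.prod_insert ha]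
    exact (h a (Finset.mem_insert_self a s)).mul (ih fun i hi => h i (Finset.mem_insert_of_mem hi))

lemma Ev.det {n : Type*} [Fintype n] [DecidableEq n] {A : Matrix n n (RatFunc ℝ)}
    {f : ℝ → Matrix n n ℝ} (h : ∀ i j, Ev (A i j) (fun x => f x i j)) :
    Ev A.det (fun x => (f x).det) := by
  simp only [Matrix.det_apply']
  refine Ev.sum fun σ _ => Ev.mul ?_ (Ev.prod fun i _ => h _ _)
  have := Ev.C ((Equiv.Perm.sign σ : ℤ) : ℝ)
  simpa using this

lemma Ev.adjugate {n : Type*} [Fintype n] [DecidableEq n] {A : Matrix n n (RatFunc ℝ)}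
    {f : ℝ → Matrix n n ℝ} (h : ∀ i j, Ev (A i j) (fun x => f x i j)) (k i : n) :
    Ev (A.adjugate k i) (fun x => (f x).adjugate k i) := by
  simp only [Matrix.adjugate_apply]
  refine Ev.det fun l j => ?_
  simp only [Matrix.updateRow_apply]
  split_ifs
  · by_cases hj : j = k
    · subst hj; simpa using Ev.one
    · simpa [hj] using Ev.zero
  · exact h _ _

lemma Ev.poch {r : RatFunc ℝ} {f : ℝ → ℝ} (hr : Ev r f) (n : ℕ) :
    Ev (poch r n) (fun x => KrallHahn.poch (f x) n) := by
  simp only [poch_eq_prod]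
  exact Ev.prod fun i _ => hr.add (Ev.natCast i)

lemma Ev.aeval {r : RatFunc ℝ} {f : ℝ → ℝ} (hr : Ev r f) (p : ℝ[X]) :
    Ev (aeval r p) (fun x => p.eval (f x)) := by
  simp only [aeval_eq_sum_range, eval_eq_sum_range, Algebra.smul_def]
  refine Ev.sum fun i _ => Ev.mul ?_ (hr.pow i)
  have := Ev.C (p.coeff i)
  rwa [RatFunc.algebraMap_eq_C]

lemma Ev.algebraMap (p : ℝ[X]) : Ev (algebraMap ℝ[X] (RatFunc ℝ) p) (fun x => p.eval x) :=
  Eventually.of_forall fun x => by simp [eval₂_eq_eval_map]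

/-- A rational function is determined by its values at large arguments. -/
lemma Ev.unique {r s : RatFunc ℝ} {f : ℝ → ℝ} (hr : Ev r f) (hs : Ev s f) : r = s := by
  by_contra hne
  have h := (hr.sub hs).eventually_ne_zero (sub_ne_zero.2 hne)
  simp only [sub_self, ne_eq, not_true_eq_false, eventually_false_iff_eq_bot] at h
  exact NeBot.ne inferInstance h

lemma Ev.ne_zero {r : RatFunc ℝ} {f : ℝ → ℝ} (hr : Ev r f) (h : ∀ᶠ x in atTop, f x ≠ 0) :
    r ≠ 0 := by
  rintro rfl
  obtain ⟨x, h1, h2⟩ := (h.and (hr.eq_of Ev.zero)).exists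
  exact h1 h2

/-! ### The rows of the determinants -/

/-- `true` on the rows that come from `F`. -/
def bRow (F G : Finset ℕ) : Fin (cnt F + cnt G) → Bool :=
  Fin.append (fun _ => true) (fun _ => false)

/-- The polynomials `Y_u`, `u ∈ I(F)`, followed by `Z_v`, `v ∈ I(G)`. -/
def polyR (a N : ℝ) (F G : Finset ℕ) : Fin (cnt F + cnt G) → ℝ[X] :=
  Fin.append (fun r => polyY a N (node F r)) (fun r => polyZ a N (node G r))

/-- The polynomials of the rows as functions of `w = (x + a + 1/2)²`. -/
def psiRow (a N : ℝ) (F G : Finset ℕ) (i : Fin (cnt F + cnt G)) : ℝ[X] :=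
  (polyR a N F G i).comp (X - C ((a + 1 / 2) ^ 2))

lemma eval_psiRow (a N : ℝ) (F G : Finset ℕ) (i : Fin (cnt F + cnt G)) (t : ℝ) :
    (psiRow a N F G i).eval ((t + a + 1 / 2) ^ 2) = (polyR a N F G i).eval (t * (t + 2 * a + 1)) := by
  rw [psiRow, eval_comp]
  congr 1
  simp only [eval_sub, eval_X, eval_C]
  ring

/-- The index in `Fin (cnt F + cnt G)` of a row of `Ω`. -/
def baseRow (F G : Finset ℕ) : Fin (size F G) → Fin (cnt F + cnt G) :=
  Fin.append (Fin.append (fun r => Fin.castAdd _ r) (fun r => Fin.castAdd _ r))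
    (Fin.append (fun r => Fin.natAdd _ r) (fun r => Fin.natAdd _ r))

/-- The sign that distinguishes the two copies of each row of `Ω`. -/
def sgnRow (F G : Finset ℕ) : Fin (size F G) → ℝ :=
  Fin.append (Fin.append (fun _ => -1) (fun _ => 1)) (Fin.append (fun _ => 1) (fun _ => -1))

lemma sgnRow_mul_self (F G : Finset ℕ) (h : Fin (size F G)) : sgnRow F G h * sgnRow F G h = 1 := by
  refine Fin.addCases (fun h => ?_) (fun h => ?_) h <;>
  refine Fin.addCases (fun h => ?_) (fun h => ?_) h <;> simp [sgnRow, -Fin.natAdd_eq_addNat]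

lemma row_ext (F G : Finset ℕ) {h h' : Fin (size F G)} (h1 : baseRow F G h = baseRow F G h')
    (h2 : sgnRow F G h = sgnRow F G h') : h = h' := by
  revert h1 h2
  refine Fin.addCases (fun h => ?_) (fun h => ?_) h <;>
  refine Fin.addCases (fun h => ?_) (fun h => ?_) h <;>
  refine Fin.addCases (fun h => ?_) (fun h => ?_) h' <;>
  refine Fin.addCases (fun h => ?_) (fun h => ?_) h <;>
  intro h1 h2 <;> simp [baseRow, sgnRow, Fin.ext_iff, -Fin.natAdd_eq_addNat] at h1 h2 ⊢ <;> first | omega | (norm_num at h2)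

lemma polyRow_eq (a N : ℝ) (F G : Finset ℕ) (h : Fin (size F G)) :
    polyRow a N F G h = polyR a N F G (baseRow F G h) := by
  refine Fin.addCases (fun h => ?_) (fun h => ?_) h <;>
  refine Fin.addCases (fun h => ?_) (fun h => ?_) h <;> simp [polyRow, polyR, baseRow, -Fin.natAdd_eq_addNat]

/-- The weight of the rows that come from `F`, as a function of `x`. -/
def wE (a N t : ℝ) : ℝ := gE (N + a + 1) (t + a + 1 / 2)

lemma wE_eq (a N t : ℝ) : wE a N t = Real.Gamma (t - N) / Real.Gamma (t + 2 * a + N + 2) := by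
  rw [wE, gE]; congr 2 <;> ring

lemma wE_pos {a N t : ℝ} (h : |N + a + 1| < t + a + 1 / 2) : 0 < wE a N t := gE_pos h

/-- The function `ξ¹` is a quotient of values of the weight. -/
lemma poch_div_poch {a N t : ℝ} {l : ℕ} (h : |N + a + 1| < t - l + a + 1 / 2) :
    poch (t - l - N) l / ((-1) ^ l * poch (t - l + (2 * a + N + 2)) l) =
      (-1) ^ l * (wE a N t / wE a N (t - l)) := by
  have hν := abs_le.1 (le_refl |N + a + 1|)
  have h1 := gamma_add_nat (z := t - l - N) (by linarith) l
  have h2 := gamma_add_nat (z := t - l + (2 * a + N + 2)) (by linarith) l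
  have p1 := Real.Gamma_pos_of_pos (s := t - l - N) (by linarith)
  have p2 := Real.Gamma_pos_of_pos (s := t - l + (2 * a + N + 2)) (by linarith)
  have p3 : 0 < poch (t - l + (2 * a + N + 2)) l := poch_pos (by linarith) _
  rw [wE_eq, wE_eq, show t - N = t - l - N + l by ring, h1,
    show t + 2 * a + N + 2 = t - l + (2 * a + N + 2) + l by ring, h2,
    show t - (l : ℝ) + 2 * a + N + 2 = t - l + (2 * a + N + 2) by ring]
  have hs : ((-1 : ℝ) ^ l) * (-1) ^ l = 1 := by rw [← mul_pow]; norm_num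
  have hs0 : ((-1 : ℝ) ^ l) ≠ 0 := by intro h0; rw [h0] at hs; norm_num at hs
  field_simp
  rw [pow_two, hs, mul_one]

lemma Ev.xi1 {a N : ℝ} {y : RatFunc ℝ} {s : ℝ} (hy : Ev y (fun x => x + s)) (l : ℕ) :
    Ev (xi1 a N y l) (fun x => (-1) ^ l * (wE a N (x + s) / wE a N (x + s - l))) := by
  have h1 : Ev (KrallHahn.xi1 a N y l) (fun x => KrallHahn.poch (x + s - l - N) l /
      ((-1) ^ l * KrallHahn.poch (x + s - l + (2 * a + N + 2)) l)) := by
    refine Ev.div (((hy.sub (Ev.natCast l)).sub (Ev.C N)).poch l) ?_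
    refine (Ev.pow ?_ l).mul (((hy.sub (Ev.natCast l)).add (Ev.C _)).poch l)
    exact Ev.one.neg
  refine h1.congr ?_
  filter_upwards [eventually_gt_atTop (|N + a + 1| - s + l - a - 1 / 2)] with x hx
  exact poch_div_poch (by linarith)

lemma Ev.xiRow {a N : ℝ} {F G : Finset ℕ} {y : RatFunc ℝ} {s : ℝ} (hy : Ev y (fun x => x + s))
    (l : ℕ) (h : Fin (size F G)) :
    Ev (xiRow a N F G h y l) (fun x => sgnRow F G h ^ l *
      if bRow F G (baseRow F G h) then wE a N (x + s) / wE a N (x + s - l) else 1) := by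
  have hs : ((-1 : ℝ) ^ l) * (-1) ^ l = 1 := by rw [← mul_pow]; norm_num
  have hev : Ev ((-1) ^ l) (fun _ => (-1) ^ l) := (Ev.one.neg).pow l
  refine Fin.addCases (fun h => ?_) (fun h => ?_) h <;>
  refine Fin.addCases (fun h => ?_) (fun h => ?_) h
  · simpa [-Fin.natAdd_eq_addNat, KrallHahn.xiRow, sgnRow, baseRow, bRow] using hy.xi1 l
  · simp [-Fin.natAdd_eq_addNat, KrallHahn.xiRow, sgnRow, baseRow, bRow]
    refine (hev.mul (hy.xi1 l)).congr (Eventually.of_forall fun x => ?_)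
    simp only [← mul_assoc, hs, one_mul]
  · simpa [-Fin.natAdd_eq_addNat, KrallHahn.xiRow, sgnRow, baseRow, bRow, xi3] using Ev.one
  · simpa [-Fin.natAdd_eq_addNat, KrallHahn.xiRow, sgnRow, baseRow, bRow, xi4] using hev

lemma Ev.theta {a : ℝ} {y : RatFunc ℝ} {f : ℝ → ℝ} (hy : Ev y f) :
    Ev (theta a y) (fun x => f x * (f x + (2 * a + 1))) :=
  hy.mul (hy.add (Ev.C _))

lemma Ev.sigma {a : ℝ} {y : RatFunc ℝ} {f : ℝ → ℝ} (hy : Ev y f) :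
    Ev (sigma a y) (fun x => -(2 * f x + (2 * a - 1))) :=
  (((Ev.ofNat 2).mul hy).add (Ev.C _)).neg

/-- The values of the matrix of `Ω`. -/
def omegaR (a N : ℝ) (F G : Finset ℕ) (t : ℝ) : Matrix (Fin (size F G)) (Fin (size F G)) ℝ :=
  Matrix.of fun h j => sgnRow F G h ^ ((j : ℕ) + 1) *
    (if bRow F G (baseRow F G h) then wE a N (t - (j + 1)) / wE a N (t - size F G) else 1) *
    (psiRow a N F G (baseRow F G h)).eval ((t - (j + 1) + a + 1 / 2) ^ 2)

lemma size_eq (F G : Finset ℕ) : size F G = (cnt F + cnt G) * 2 := by simp only [size]; ring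

lemma sgnRow_pow (F G : Finset ℕ) (h : Fin (size F G)) {j : ℕ} (hj : j ≤ size F G) :
    sgnRow F G h ^ (size F G - j) = sgnRow F G h ^ j := by
  have h1 : sgnRow F G h ^ (size F G - j) * sgnRow F G h ^ j = 1 := by
    rw [← pow_add, Nat.sub_add_cancel hj, size_eq, mul_comm, pow_mul, pow_two, sgnRow_mul_self,
      one_pow]
  have h2 : sgnRow F G h ^ j * sgnRow F G h ^ j = 1 := by
    rw [← mul_pow, sgnRow_mul_self, one_pow]
  have h3 : sgnRow F G h ^ j ≠ 0 := left_ne_zero_of_mul_eq_one h2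
  exact mul_right_cancel₀ h3 (h1.trans h2.symm)

lemma Ev.omegaMat {a N : ℝ} {F G : Finset ℕ} {y : RatFunc ℝ} {s : ℝ} (hy : Ev y (fun x => x + s))
    (h j : Fin (size F G)) :
    Ev (omegaMat a N F G y h j) (fun x => omegaR a N F G (x + s) h j) := by
  have hy' : Ev (y - ((j : ℕ) + 1 : ℕ)) (fun x => x + (s - ((j : ℕ) + 1 : ℕ))) :=
    (hy.sub (Ev.natCast _)).congr (Eventually.of_forall fun x => by ring)
  have h1 := (hy'.xiRow (a := a) (N := N) (F := F) (G := G) (size F G - ((j : ℕ) + 1)) h).mul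
    ((hy'.theta (a := a)).aeval (polyRow a N F G h))
  refine h1.congr (Eventually.of_forall fun x => ?_)
  have hj : (j : ℕ) + 1 ≤ size F G := j.2
  simp only [omegaR, Matrix.of_apply]
  rw [sgnRow_pow F G h hj, polyRow_eq, eval_psiRow, Nat.cast_sub hj]
  push_cast
  rw [show x + (s - (((j : ℕ) : ℝ) + 1)) = x + s - (((j : ℕ) : ℝ) + 1) by ring,
    show x + s - (((j : ℕ) : ℝ) + 1) - ((cnt F : ℝ) + cnt F + (cnt G + cnt G) - (((j : ℕ) : ℝ) + 1)) =
      x + s - ((cnt F : ℝ) + cnt F + (cnt G + cnt G)) by ring]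
  congr 2; ring

lemma sum_pairs {R : Type*} [AddCommMonoid R] {M n : ℕ} (hn : n = M * 2) (f : Fin n → R) :
    ∑ j, f j = ∑ k : Fin M, (f ⟨2 * k, by omega⟩ + f ⟨2 * k + 1, by omega⟩) := by
  subst hn
  rw [← Equiv.sum_comp finProdFinEquiv, Fintype.sum_prod_type]
  refine Finset.sum_congr rfl fun k _ => ?_
  rw [Fin.sum_univ_two]
  congr 2 <;> ext <;> simp [finProdFinEquiv] <;> ring

/-- The inverse of the matrix `omegaR`: the columns with odd and with even number are windows of
points with step `2`. -/
def omegaInv (a N : ℝ) (F G : Finset ℕ) (t : ℝ) : Matrix (Fin (size F G)) (Fin (size F G)) ℝ :=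
  Matrix.of fun j h => 1 / 2 * sgnRow F G h ^ ((j : ℕ) + 1) *
    (if bRow F G (baseRow F G h) then wE a N (t - size F G) else 1) *
    (fMat (N + a + 1) (bRow F G) (psiRow a N F G) (t + a - 1 / 2 - ((j : ℕ) % 2 : ℕ)))⁻¹
      ⟨(j : ℕ) / 2, by have := j.2; have := size_eq F G; omega⟩ (baseRow F G h)

lemma omegaR_mul_omegaInv {a N : ℝ} {F G : Finset ℕ} {t : ℝ}
    (h0 : |N + a + 1| < t - size F G + a + 1 / 2)
    (h1 : IsUnit (fMat (N + a + 1) (bRow F G) (psiRow a N F G) (t + a - 1 / 2)).det)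
    (h2 : IsUnit (fMat (N + a + 1) (bRow F G) (psiRow a N F G) (t + a - 1 / 2 - 1)).det) :
    omegaR a N F G t * omegaInv a N F G t = 1 := by
  have hw : wE a N (t - size F G) ≠ 0 := (wE_pos h0).ne'
  ext h h'
  rw [Matrix.mul_apply, sum_pairs (size_eq F G), Finset.sum_add_distrib]
  have e1 := congrFun (congrFun (Matrix.mul_nonsing_inv _ h1) (baseRow F G h)) (baseRow F G h')
  have e2 := congrFun (congrFun (Matrix.mul_nonsing_inv _ h2) (baseRow F G h)) (baseRow F G h')
  rw [Matrix.mul_apply] at e1 e2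
  set c : ℝ := (if bRow F G (baseRow F G h) then (wE a N (t - size F G))⁻¹ else 1) *
    (if bRow F G (baseRow F G h') then wE a N (t - size F G) else 1) with hc
  have hpow : ∀ (h : Fin (size F G)) (k : ℕ), sgnRow F G h ^ (2 * k) = 1 := fun h k => by
    rw [pow_mul, pow_two, sgnRow_mul_self, one_pow]
  have s1 : ∑ k : Fin (cnt F + cnt G), omegaR a N F G t h ⟨2 * k, by
        have := k.2; have := size_eq F G; omega⟩ *
      omegaInv a N F G t ⟨2 * k, by have := k.2; have := size_eq F G; omega⟩ h' =
      1 / 2 * (sgnRow F G h * sgnRow F G h') * c *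
        (1 : Matrix _ _ ℝ) (baseRow F G h) (baseRow F G h') := by
    rw [← e1, Finset.mul_sum]
    refine Finset.sum_congr rfl fun k _ => ?_
    simp only [omegaR, omegaInv, Matrix.of_apply, fMat, Nat.mul_mod_right, Nat.cast_zero, sub_zero,
      pow_succ, hpow, one_mul, wE, hc]
    have ek : (⟨2 * (k : ℕ) / 2, by omega⟩ : Fin (cnt F + cnt G)) = k := by ext; simp
    rw [ek]
    push_cast
    rw [show t - (2 * (k : ℝ) + 1) + a + 1 / 2 = t + a - 1 / 2 - 2 * k by ring]
    split_ifs <;> ring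
  have s2 : ∑ k : Fin (cnt F + cnt G), omegaR a N F G t h ⟨2 * k + 1, by
        have := k.2; have := size_eq F G; omega⟩ *
      omegaInv a N F G t ⟨2 * k + 1, by have := k.2; have := size_eq F G; omega⟩ h' =
      1 / 2 * c * (1 : Matrix _ _ ℝ) (baseRow F G h) (baseRow F G h') := by
    rw [← e2, Finset.mul_sum]
    refine Finset.sum_congr rfl fun k _ => ?_
    have ek : (⟨(2 * (k : ℕ) + 1) / 2, by omega⟩ : Fin (cnt F + cnt G)) = k := by ext; simp; omega
    have ep : ∀ h : Fin (size F G), sgnRow F G h ^ (2 * (k : ℕ) + 1 + 1) = 1 := fun h => by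
      rw [show 2 * (k : ℕ) + 1 + 1 = 2 * (k + 1) by ring, hpow]
    have em : (2 * (k : ℕ) + 1) % 2 = 1 := by omega
    simp only [omegaR, omegaInv, Matrix.of_apply, fMat, ep, em, wE, hc, ek]
    push_cast
    rw [show t - (2 * (k : ℝ) + 1 + 1) + a + 1 / 2 = t + a - 1 / 2 - 1 - 2 * k by ring]
    split_ifs <;> ring
  rw [s1, s2]
  by_cases hb : baseRow F G h = baseRow F G h'
  · have hc1 : c = 1 := by
      rw [hc, hb]; split_ifs
      · rw [inv_mul_cancel₀ hw]
      · norm_num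
    rw [hb, Matrix.one_apply_eq, hc1]
    by_cases hs : sgnRow F G h = sgnRow F G h'
    · rw [row_ext F G hb hs, Matrix.one_apply_eq, sgnRow_mul_self]; norm_num
    · rw [Matrix.one_apply_ne (fun e => hs (by rw [e]))]
      have q1 := sgnRow_mul_self F G h
      have q2 := sgnRow_mul_self F G h'
      have : (sgnRow F G h - sgnRow F G h') * (sgnRow F G h * sgnRow F G h' + 1) = 0 := by
        linear_combination sgnRow F G h' * q1 - sgnRow F G h * q2
      rcases mul_eq_zero.1 this with h3 | h3
      · exact absurd (sub_eq_zero.1 h3) hs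
      · linear_combination h3 / 2
  · rw [Matrix.one_apply_ne hb, Matrix.one_apply_ne (fun e => hb (by rw [e]))]; ring

/-! ### Degrees of the rows -/

lemma LeadLe.comp_X_add_C {p : ℝ[X]} {k : ℤ} {L : ℝ} (h : LeadLe p k L) (c : ℝ) :
    LeadLe (p.comp (X + C c)) k L := by
  have := leadLe_of_monomials (fun p => p.comp (X + C c)) (fun p q => by simp)
    (fun r p => by simp) 0 (fun _ => 1) (fun k => by
      have h := leadLe_of_natDegree (natDegree_X_add_C_pow_le c k)
      rw [coeff_X_add_C_pow] at h
      simpa using h) h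
  simpa using this

/-- The leading coefficient of the dual Hahn polynomial. -/
lemma leadLe_dualHahn (α β M : ℝ) (n : ℕ) :
    LeadLe (dualHahn α β M n) n (1 / (poch (α + 1) n * poch (-M) n)) := by
  have hprod : ∀ j : ℕ, LeadLe (∏ i ∈ Finset.range j, (X - C ((i : ℝ) * (α + β + 1 + i)))) j 1 := by
    intro j
    have h1 : (∏ i ∈ Finset.range j, (X - C ((i : ℝ) * (α + β + 1 + i)))).Monic :=
      monic_prod_of_monic _ _ fun i _ => monic_X_sub_C _
    have h2 : (∏ i ∈ Finset.range j, (X - C ((i : ℝ) * (α + β + 1 + i)))).natDegree = j := by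
      rw [natDegree_prod_of_monic _ _ fun i _ => monic_X_sub_C _]
      simp only [natDegree_X_sub_C, Finset.sum_const, Finset.card_range, smul_eq_mul, mul_one]
    have h3 := leadLe_of_natDegree h2.le
    have h4 := h1.coeff_natDegree
    rw [h2] at h4
    rwa [h4] at h3
  have hsum : ∀ m ≤ n, LeadLe (∑ j ∈ Finset.range m,
      C ((-1) ^ j * poch (-(n : ℝ)) j / (poch (α + 1) j * poch (-M) j * j.factorial)) *
      ∏ i ∈ Finset.range j, (X - C ((i : ℝ) * (α + β + 1 + i)))) n 0 := by
    intro m hm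
    induction m with
    | zero => simpa using LeadLe.zero n
    | succ m ih =>
      rw [Finset.sum_range_succ]
      have := (ih (by omega)).add ((((hprod m).C_mul
        ((-1) ^ m * poch (-(n : ℝ)) m / (poch (α + 1) m * poch (-M) m * m.factorial))).mono
          (show (m : ℤ) < n by omega)))
      simpa using this
  rw [dualHahn, Finset.sum_range_succ]
  convert (hsum n le_rfl).add ((hprod n).C_mul _) using 1
  have h1 : (-1 : ℝ) ^ n * poch (-(n : ℝ)) n = n.factorial := by
    rw [poch_neg, ← mul_assoc, ← mul_pow, neg_one_mul, neg_neg, one_pow, one_mul, sub_self,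
      zero_add, poch_eq_prod, ← Finset.prod_range_add_one_eq_factorial]
    push_cast
    exact Finset.prod_congr rfl fun i _ => add_comm _ _
  have h2 : (n.factorial : ℝ) ≠ 0 := by positivity
  rw [h1]
  field_simp
  rw [zero_add]

/-- The degrees of the rows. -/
def kRow (F G : Finset ℕ) : Fin (cnt F + cnt G) → ℕ := Fin.append (node F) (node G)

/-- The leading coefficients of the rows. -/
def LRow (a N : ℝ) (F G : Finset ℕ) : Fin (cnt F + cnt G) → ℝ :=
  Fin.append
    (fun r => 1 / (poch (-a + 1) (node F r) * poch (-(2 * a + N)) (node F r)))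
    (fun r => 1 / (poch (-a + 1) (node G r) * poch (-(-2 - N)) (node G r)))

lemma leadLe_psiRow (a N : ℝ) (F G : Finset ℕ) (i : Fin (cnt F + cnt G)) :
    LeadLe (psiRow a N F G i) (kRow F G i) (LRow a N F G i) := by
  rw [psiRow, sub_eq_add_neg, ← C_neg]
  refine LeadLe.comp_X_add_C ?_ _
  refine Fin.addCases (fun r => ?_) (fun r => ?_) i
  · simp only [polyR, kRow, LRow, Fin.append_left]
    exact (leadLe_dualHahn _ _ _ _).comp_X_add_C _
  · simp only [polyR, kRow, LRow, Fin.append_right]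
    exact (leadLe_dualHahn _ _ _ _).comp_X_add_C _

lemma node_mem (F : Finset ℕ) (r : Fin (cnt F)) : node F r ∈ invol F :=
  Finset.orderEmbOfFin_mem _ _ _

lemma node_injective (F : Finset ℕ) : Function.Injective (node F) :=
  ((invol F).orderEmbOfFin rfl).injective

lemma sum_node {R : Type*} [AddCommMonoid R] (F : Finset ℕ) (f : ℕ → R) :
    ∑ r, f (node F r) = ∑ u ∈ invol F, f u := by
  have h : (invol F).image id = Finset.univ.image (node F) := by
    rw [Finset.image_id]
    exact (Finset.image_orderEmbOfFin_univ (invol F) rfl).symm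
  rw [Finset.image_id] at h
  conv_rhs => rw [h]
  rw [Finset.sum_image fun i _ j _ hij => node_injective F hij]

lemma nU_bRow (F G : Finset ℕ) : nU (bRow F G) = cnt F := by
  rw [nU, Finset.card_filter, Fin.sum_univ_add]
  simp [bRow]

lemma LRow_ne_zero {a N : ℝ} {F G : Finset ℕ}
    (hY : ∀ u ∈ invol F, DualHahnDefined (-a) (2 * a + N) u)
    (hZ : ∀ v ∈ invol G, DualHahnDefined (-a) (-2 - N) v) (i : Fin (cnt F + cnt G)) :
    LRow a N F G i ≠ 0 := by
  refine Fin.addCases (fun r => ?_) (fun r => ?_) i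
  · simp only [LRow, Fin.append_left]
    have h := hY _ (node_mem F r)
    exact one_div_ne_zero (mul_ne_zero h.1 h.2)
  · simp only [LRow, Fin.append_right]
    have h := hZ _ (node_mem G r)
    exact one_div_ne_zero (mul_ne_zero h.1 h.2)

lemma muRow_injective {a N : ℝ} {F G : Finset ℕ}
    (hUV : ∀ u ∈ invol F, ∀ v ∈ invol G, (v : ℝ) - u + a + N + 1 ≠ 0) :
    Function.Injective (muRow (N + a + 1) (bRow F G) (kRow F G)) := by
  intro i j
  refine Fin.addCases (fun r => ?_) (fun r => ?_) i <;>
  refine Fin.addCases (fun r' => ?_) (fun r' => ?_) j <;> intro h <;>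
  simp only [muRow, bRow, kRow, Fin.append_left, Fin.append_right, if_true, Bool.false_eq_true,
    if_false, sub_zero] at h
  · have h' : node F r = node F r' := by exact_mod_cast sub_left_injective h
    rw [node_injective F h']
  · exact absurd (by linarith) (hUV _ (node_mem F r) _ (node_mem G r'))
  · exact absurd (by linarith) (hUV _ (node_mem F r') _ (node_mem G r))
  · have h' : node G r = node G r' := by exact_mod_cast h
    rw [node_injective G h']

lemma degG_rows (F G : Finset ℕ) : degG (bRow F G) (kRow F G) =
    (∑ u ∈ invol F, (u : ℤ) - (cnt F).choose 2) + (∑ u ∈ invol G, (u : ℤ) - (cnt G).choose 2) := by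
  rw [degG, nU_bRow, Nat.add_sub_cancel_left, Fin.sum_univ_add]
  simp only [kRow, Fin.append_left, Fin.append_right, sum_node _ (fun u => (u : ℤ))]
  ring

lemma choose_two_int (n : ℕ) : 2 * (n.choose 2 : ℤ) = n * (n - 1) := by
  induction n with
  | zero => simp
  | succ n ih => rw [Nat.choose_succ_succ' n 1]; push_cast; rw [mul_add, ih]; simp; ring

/-- The involution preserves the sum of the elements minus the binomial coefficient. -/
lemma sum_invol {F : Finset ℕ} (hF : ∀ f ∈ F, 0 < f) :
    ∑ u ∈ invol F, (u : ℤ) - (cnt F).choose 2 = ∑ f ∈ F, (f : ℤ) - F.card.choose 2 := by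
  rcases F.eq_empty_or_nonempty with rfl | hne
  · simp [invol, cnt]
  set p := F.sup id with hp
  have hpm : p ∈ F := by
    obtain ⟨f, hf, h⟩ := Finset.exists_mem_eq_sup F hne id
    rw [hp, h]; exact hf
  have hle : ∀ f ∈ F, f ≤ p := fun f hf => Finset.le_sup (f := id) hf
  have hinj : Set.InjOn (fun f => p - f) F := fun f hf f' hf' h => by
    have h1 := hle f hf
    have h2 := hle f' hf'
    simp only at h; omega
  have hun : invol F ∪ F.image (fun f => p - f) = Finset.range (p + 1) := by
    ext x
    simp only [invol, ← hp, Finset.mem_union, Finset.mem_sdiff, Finset.mem_Icc, Finset.mem_image,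
      Finset.mem_range]
    constructor
    · rintro (⟨h, -⟩ | ⟨f, hf, rfl⟩) <;> omega
    · intro hx
      by_cases h : ∃ f ∈ F, p - f = x
      · exact Or.inr h
      · refine Or.inl ⟨⟨?_, by omega⟩, h⟩
        by_contra h0
        exact h ⟨p, hpm, by omega⟩
  have hdis : Disjoint (invol F) (F.image (fun f => p - f)) := Finset.sdiff_disjoint
  have h1 : ∑ u ∈ invol F, (u : ℤ) + ∑ f ∈ F, ((p : ℤ) - f) = (p + 1).choose 2 := by
    rw [← sumRange_cast, ← hun, Finset.sum_union hdis, Finset.sum_image hinj]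
    congr 1
    refine Finset.sum_congr rfl fun f hf => ?_
    rw [Nat.cast_sub (hle f hf)]
  have h2 : (cnt F : ℤ) + F.card = p + 1 := by
    have := congrArg Finset.card hun
    rw [Finset.card_union_of_disjoint hdis, Finset.card_image_of_injOn hinj,
      Finset.card_range] at this
    exact_mod_cast this
  rw [Finset.sum_sub_distrib, Finset.sum_const, nsmul_eq_mul] at h1
  have h3 := choose_two_int (p + 1)
  have h4 := choose_two_int (cnt F)
  have h5 := choose_two_int F.card
  rw [show (cnt F : ℤ) = p + 1 - F.card by linarith] at h4
  push_cast at h3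
  nlinarith

/-- The order of the operator is `2 (degD + 1)`. -/
lemma exists_degD {F G : Finset ℕ} (hF : ∀ f ∈ F, 0 < f) (hG : ∀ f ∈ G, 0 < f) :
    ∃ D : ℕ, degG (bRow F G) (kRow F G) = D ∧
      (D : ℤ) = ∑ f ∈ F, (f : ℤ) + ∑ f ∈ G, (f : ℤ) - F.card.choose 2 - G.card.choose 2 ∧
      ∀ i, kRow F G i ≤ D := by
  have hbound : ∀ (s : Finset ℕ), (∀ u ∈ s, 0 < u) → ∀ u ∈ s, u + s.card.choose 2 ≤ ∑ u ∈ s, u := by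
    intro s
    induction s using Finset.induction_on_max with
    | empty => simp
    | insert b s hb ih =>
      intro hs u hu
      have hbs : b ∉ s := fun h => (hb b h).false
      have hcard : s.card + 1 ≤ b := by
        have : s ⊆ Finset.Ico 1 b := fun x hx =>
          Finset.mem_Ico.2 ⟨hs x (Finset.mem_insert_of_mem hx), hb x hx⟩
        have h := Finset.card_le_card this
        rw [Nat.card_Ico] at h
        have := hs b (Finset.mem_insert_self b s)
        omega
      have ih' := ih fun u hu => hs u (Finset.mem_insert_of_mem hu)
      have hch : (s.card + 1).choose 2 = s.card + s.card.choose 2 := by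
        rw [Nat.choose_succ_succ' _ 1, Nat.choose_one_right]
      rw [Finset.sum_insert hbs, Finset.card_insert_of_notMem hbs, hch]
      have hmin : s.card.choose 2 + s.card ≤ ∑ u ∈ s, u := by
        rcases s.eq_empty_or_nonempty with rfl | hne
        · simp
        · obtain ⟨x, hx, hxc⟩ : ∃ x ∈ s, s.card ≤ x := by
            by_contra! h
            have : s ⊆ Finset.Ico 1 s.card := fun x hx =>
              Finset.mem_Ico.2 ⟨hs x (Finset.mem_insert_of_mem hx), h x hx⟩
            have h' := Finset.card_le_card this
            rw [Nat.card_Ico] at h'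
            have := hne.card_pos
            omega
          have := ih' x hx
          omega
      rcases Finset.mem_insert.1 hu with rfl | hu
      · omega
      · have := ih' u hu
        omega
  have hpos : ∀ (F : Finset ℕ), ∀ u ∈ invol F, 0 < u := fun F u hu =>
    (Finset.mem_Icc.1 (Finset.mem_sdiff.1 hu).1).1
  have hge : ∀ F : Finset ℕ, (cnt F).choose 2 ≤ ∑ u ∈ invol F, u := fun F => by
    rcases (invol F).eq_empty_or_nonempty with h | ⟨x, hx⟩
    · simp [cnt, h]
    · have : x + (cnt F).choose 2 ≤ _ := hbound _ (hpos F) x hx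
      omega
  have h1 := degG_rows F G
  refine ⟨(∑ u ∈ invol F, u - (cnt F).choose 2) + (∑ u ∈ invol G, u - (cnt G).choose 2), ?_, ?_, ?_⟩
  · rw [h1]
    push_cast [Nat.cast_sub (hge F), Nat.cast_sub (hge G)]
    ring
  · push_cast [Nat.cast_sub (hge F), Nat.cast_sub (hge G)]
    rw [sum_invol hF, sum_invol hG]; ring
  · intro i
    have h2 := hge F
    have h3 := hge G
    refine Fin.addCases (fun r => ?_) (fun r => ?_) i
    · simp only [kRow, Fin.append_left]
      have : node F r + (cnt F).choose 2 ≤ _ := hbound _ (hpos F) _ (node_mem F r)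
      omega
    · simp only [kRow, Fin.append_right]
      have : node G r + (cnt G).choose 2 ≤ _ := hbound _ (hpos G) _ (node_mem G r)
      omega

/-! ### The right-hand side of the difference equation -/

/-- The index set of the product `q`, with `n` for `m₁ + m₃`. -/
def qIdx (n : ℕ) : Finset (Σ _ : ℕ, ℕ) :=
  (Finset.Icc 1 (n / 2)).sigma fun i => Finset.Icc 1 (2 * n - 4 * i + 1)

/-- The two products are over the same linear factors: the pair `(i, j)` with `i < j` is matched
with the layer `⌈(j - i) / 2⌉` and the sum `i + j`. -/
lemma eval_qqP_eq (n : ℕ) (c : ℝ) :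
    (qqP n).eval c = ∏ p ∈ qIdx n, (c - n + 2 * p.1 + p.2 - 1) := by
  rw [qqP, eval_prod]
  simp only [eval_prod, eval_add, eval_X, eval_C]
  rw [Finset.prod_sigma']
  refine Finset.prod_bij'
    (fun p _ => ⟨(p.1 - p.2 + 1) / 2, 2 * n - 2 * ((p.1 - p.2 + 1) / 2) - p.2 - p.1⟩)
    (fun p _ => ⟨(2 * n - 2 * p.1 - p.2 + (2 * p.1 - p.2 % 2)) / 2,
      (2 * n - 2 * p.1 - p.2 - (2 * p.1 - p.2 % 2)) / 2⟩) ?_ ?_ ?_ ?_ ?_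
  · rintro ⟨j, i⟩ h
    simp only [qIdx, Finset.mem_sigma, Finset.mem_range, Finset.mem_Icc] at h ⊢
    omega
  · rintro ⟨i, j⟩ h
    simp only [qIdx, Finset.mem_sigma, Finset.mem_range, Finset.mem_Icc] at h ⊢
    omega
  · rintro ⟨j, i⟩ h
    simp only [Finset.mem_sigma, Finset.mem_range] at h
    simp only [Sigma.mk.injEq, heq_eq_eq]
    omega
  · rintro ⟨i, j⟩ h
    simp only [qIdx, Finset.mem_sigma, Finset.mem_Icc] at h
    simp only [Sigma.mk.injEq, heq_eq_eq]
    omega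
  · rintro ⟨j, i⟩ h
    simp only [Finset.mem_sigma, Finset.mem_range] at h
    have h1 : 2 * ((j - i + 1) / 2) + (2 * n - 2 * ((j - i + 1) / 2) - i - j) + i + j = 2 * n := by
      omega
    have h2 : (2 : ℝ) * ((j - i + 1) / 2 : ℕ) + ((2 * n - 2 * ((j - i + 1) / 2) - i - j : ℕ) : ℝ) +
        i + j = 2 * n := by exact_mod_cast h1
    linear_combination -h2

/-- The constant factor of the right-hand side. -/
def kapG (n : ℕ) : ℝ := -2 * ((-2) ^ (qIdx n).card)⁻¹

lemma kapG_ne_zero (n : ℕ) : kapG n ≠ 0 :=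
  mul_ne_zero (by norm_num) (inv_ne_zero (pow_ne_zero _ (by norm_num)))

/-- The reduced Casoratian determinant, as a polynomial in the square of the centre. -/
def gCore (a N : ℝ) (F G : Finset ℕ) : ℝ[X] :=
  gW (N + a + 1) (cnt F + cnt G) (bRow F G) (psiRow a N F G)

/-- The polynomial `H Ω₁`. It is an odd function of the centre of the window of points
`x - 1, x - 3, …`. -/
def rhsP (a N : ℝ) (F G : Finset ℕ) : ℝ[X] :=
  C (kapG (cnt F + cnt G)) * (X + C (a + 1 / 2 - (cnt F + cnt G : ℕ))) *
    (gCore a N F G).comp ((X + C (a + 1 / 2 - (cnt F + cnt G : ℕ))) ^ 2)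

lemma eval_rhsP (a N : ℝ) (F G : Finset ℕ) (x : ℝ) :
    (rhsP a N F G).eval x = kapG (cnt F + cnt G) * ((x + a + 1 / 2 - (cnt F + cnt G : ℕ)) *
      (gCore a N F G).eval ((x + a + 1 / 2 - (cnt F + cnt G : ℕ)) ^ 2)) := by
  rw [rhsP, eval_mul, eval_mul, eval_comp, eval_pow, eval_add, eval_C, eval_X, eval_C,
    show x + (a + 1 / 2 - ((cnt F + cnt G : ℕ) : ℝ)) = x + a + 1 / 2 - (cnt F + cnt G : ℕ) by ring]
  ring

lemma Ev.denD {a N : ℝ} {y : RatFunc ℝ} {f : ℝ → ℝ} (hy : Ev y f) (j : ℕ) :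
    Ev (denD a N y j) (fun x => (-1) ^ j * KrallHahn.poch (f x - j + (2 * a + N + 2)) j) :=
  (Ev.one.neg.pow j).mul (((hy.sub (Ev.natCast j)).add (Ev.C _)).poch j)

lemma Ev.numN {N : ℝ} {y : RatFunc ℝ} {f : ℝ → ℝ} (hy : Ev y f) (j : ℕ) :
    Ev (numN N y j) (fun x => KrallHahn.poch (f x - j - N) j) :=
  ((hy.sub (Ev.natCast j)).sub (Ev.C N)).poch j

lemma ev_pFun (a N : ℝ) (F G : Finset ℕ) :
    Ev (pFun a N F G RatFunc.X) (fun x =>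
      (ppP (N + a + 1) (cnt F + cnt G) (cnt F)).eval (x + a + 1 / 2 - (cnt F + cnt G : ℕ))) := by
  have h1 : Ev (pFun a N F G RatFunc.X) _ := Ev.prod fun j _ =>
    ((Ev.X.sub Ev.one).denD (a := a) (N := N) (2 * j)).mul
      ((((Ev.X.sub (Ev.natCast (size F G))).add ((Ev.ofNat 2).mul (Ev.natCast j))).add
        Ev.one).numN (N := N) (2 * j))
  refine h1.congr (Eventually.of_forall fun x => ?_)
  simp only
  rw [ppP, eval_prod]
  rcases Nat.eq_zero_or_pos (cnt F) with h0 | h0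
  · simp [h0]
  obtain ⟨n, hn⟩ : ∃ n, cnt F = n + 1 := ⟨cnt F - 1, by omega⟩
  have hI : Finset.Icc 1 (cnt F - 1) = (Finset.range n).image (· + 1) := by
    ext j; simp only [Finset.mem_Icc, Finset.mem_image, Finset.mem_range]
    constructor
    · intro h; exact ⟨j - 1, by omega, by omega⟩
    · rintro ⟨i, hi, rfl⟩; omega
  rw [hI, Finset.prod_image (by intro i _ j _ h; simpa using h), hn, Finset.prod_range_succ']
  have e1 : ∀ α, pochP α (2 * 0) = 1 := fun α => by simp [pochP, poch_zero]
  rw [e1, e1, one_mul, eval_one, mul_one]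
  refine Finset.prod_congr rfl fun j _ => ?_
  have e2 : (-1 : ℝ) ^ (2 * (j + 1)) = 1 := by rw [pow_mul]; simp
  rw [e2, one_mul, eval_mul, eval_pochP, eval_pochP, mul_comm]
  have hn' : (cnt F : ℝ) = n + 1 := by exact_mod_cast hn
  congr 2
  · push_cast [hn']; ring
  · push_cast [hn']; ring

lemma ev_qFun (a : ℝ) (F G : Finset ℕ) :
    Ev (qFun a F G RatFunc.X) (fun x => (-2) ^ (qIdx (cnt F + cnt G)).card *
      (qqP (cnt F + cnt G)).eval (x + a + 1 / 2 - (cnt F + cnt G : ℕ))) := by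
  have h1 : Ev (qFun a F G RatFunc.X) _ := Ev.prod fun i _ => Ev.prod fun j _ =>
    (((Ev.X.sub (Ev.natCast (size F G))).add ((Ev.ofNat 2).mul (Ev.natCast i))).add
      (Ev.natCast j)).sigma (a := a)
  refine h1.congr (Eventually.of_forall fun x => ?_)
  simp only
  rw [eval_qqP_eq, ← Finset.prod_const, ← Finset.prod_mul_distrib, Finset.prod_sigma', qIdx,
    size_eq, mul_comm _ 2]
  refine Finset.prod_congr rfl fun p _ => ?_
  push_cast; ring

/-- The values of the matrix of `Ω₁`. -/
lemma ev_omega1 (a N : ℝ) (F G : Finset ℕ) :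
    Ev (omega1 a N F G RatFunc.X) (fun x => (-(wE a N (x - size F G))⁻¹) ^ cnt F *
      (fMat (N + a + 1) (bRow F G) (psiRow a N F G) (x + a - 1 / 2)).det) := by
  have hentry : ∀ i j : Fin (cnt F + cnt G), Ev
      (let j : ℕ := (j : ℕ) + 1
       let z : RatFunc ℝ := (RatFunc.X : RatFunc ℝ) - 2 * (j : RatFunc ℝ) + 1
       let l : ℕ := size F G + 1 - 2 * j
       Fin.append
        (fun r : Fin (cnt F) => xi1 a N z l * aeval (theta a z) (polyY a N (node F r)))
        (fun r : Fin (cnt G) => xi3 z l * aeval (theta a z) (polyZ a N (node G r))) i)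
      (fun x => (if bRow F G i then -(wE a N (x - size F G))⁻¹ else 1) *
        fMat (N + a + 1) (bRow F G) (psiRow a N F G) (x + a - 1 / 2) i j) := by
    intro i j
    have hj : (j : ℕ) + 1 ≤ cnt F + cnt G := j.2
    have hz : Ev (RatFunc.X - 2 * (((j : ℕ) + 1 : ℕ) : RatFunc ℝ) + 1)
        (fun x => x + (-2 * (j : ℕ) - 1)) :=
      ((Ev.X.sub ((Ev.ofNat 2).mul (Ev.natCast _))).add Ev.one).congr
        (Eventually.of_forall fun x => by push_cast; ring)
    have hl : size F G + 1 - 2 * ((j : ℕ) + 1) = 2 * (cnt F + cnt G - (j + 1)) + 1 := by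
      rw [size_eq]; omega
    have hl' : ((size F G + 1 - 2 * ((j : ℕ) + 1) : ℕ) : ℝ) = size F G - 2 * j - 1 := by
      rw [Nat.cast_sub (by rw [size_eq]; omega)]; push_cast; ring
    have ept : ∀ x : ℝ, x + a - 1 / 2 - 2 * ((j : ℕ) : ℝ) = x + (-2 * (j : ℕ) - 1) + a + 1 / 2 :=
      fun x => by ring
    refine Fin.addCases (fun r => ?_) (fun r => ?_) i
    · simp only [Fin.append_left]
      refine ((hz.xi1 _).mul (hz.theta.aeval _)).congr (Eventually.of_forall fun x => ?_)
      simp only [fMat, Matrix.of_apply, bRow, Fin.append_left, if_true, ept, eval_psiRow, polyR, hl']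
      rw [hl, pow_succ, pow_mul]
      have ew : x + (-2 * ((j : ℕ) : ℝ) - 1) - ((size F G : ℝ) - 2 * (j : ℕ) - 1) = x - size F G := by
        ring
      rw [ew, wE, add_assoc (x + (-2 * ((j : ℕ) : ℝ) - 1)) (2 * a) 1]
      norm_num
      ring
    · simp only [Fin.append_right]
      refine (Ev.one.mul (hz.theta.aeval _)).congr (Eventually.of_forall fun x => ?_)
      simp only [fMat, Matrix.of_apply, bRow, Fin.append_right, ept, eval_psiRow, polyR,
        Bool.false_eq_true, if_false]
      rw [add_assoc (x + (-2 * ((j : ℕ) : ℝ) - 1)) (2 * a) 1]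
      ring
  have h1 := Ev.det (f := fun x => Matrix.of fun i j : Fin (cnt F + cnt G) =>
    (if bRow F G i then -(wE a N (x - size F G))⁻¹ else 1) *
        fMat (N + a + 1) (bRow F G) (psiRow a N F G) (x + a - 1 / 2) i j) hentry
  refine Ev.congr (r := omega1 a N F G RatFunc.X) h1 (Eventually.of_forall fun x => ?_)
  simp only
  rw [Matrix.det_mul_column, Finset.prod_ite, Finset.prod_const_one, mul_one, Finset.prod_const,
    ← nU, nU_bRow]

lemma rhs_eq (a N : ℝ) (F G : Finset ℕ) :
    hFun a N F G RatFunc.X * omega1 a N F G RatFunc.X =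
      algebraMap ℝ[X] (RatFunc ℝ) (rhsP a N F G) := by
  refine Ev.unique (f := fun x => (rhsP a N F G).eval x) ?_ (Ev.algebraMap _)
  have hσ : Ev (sigma a ((RatFunc.X : RatFunc ℝ) - (cnt F : RatFunc ℝ) - (cnt G : RatFunc ℝ) + 1)) _ :=
    (((Ev.X.sub (Ev.natCast (cnt F))).sub (Ev.natCast (cnt G))).add Ev.one).sigma
  have h1 : Ev (hFun a N F G RatFunc.X * omega1 a N F G RatFunc.X) _ :=
    ((hσ.mul (((Ev.X.sub Ev.one).denD (a := a) (N := N) (size F G - 1)).pow (cnt F))).div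
      (((ev_pFun a N F G).mul (ev_qFun a F G)).mul
        (((((Ev.X.sub (Ev.natCast (size F G))).add Ev.one).numN (N := N) 1)).pow (cnt F)))).mul
      (ev_omega1 a N F G)
  refine h1.congr ?_
  set M := cnt F + cnt G with hM
  have hsz : (size F G : ℝ) = 2 * M := by rw [size_eq]; push_cast [hM]; ring
  filter_upwards [eventually_gt_atTop (2 * M + |N + a + 1| + 2 + M - a - 1 / 2)] with x hx
  have hν := abs_le.1 (le_refl |N + a + 1|)
  have hM0 : (0 : ℝ) ≤ M := M.cast_nonneg
  rw [eval_rhsP]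
  set c := x + a + 1 / 2 - (M : ℝ) with hc
  have hc' : 2 * M + |N + a + 1| + 2 < c := by linarith
  have h2 : (fhatP (N + a + 1) M (bRow F G) (psiRow a N F G)).det.eval c =
      sF (N + a + 1) M c ^ cnt F * (fMat (N + a + 1) (bRow F G) (psiRow a N F G)
        (x + a - 1 / 2)).det := by
    rw [← coe_evalRingHom, RingHom.map_det, fhatP_eval _ _ _ hc', Matrix.det_mul,
      Matrix.det_diagonal, Finset.prod_ite, Finset.prod_const_one, mul_one, Finset.prod_const,
      ← nU, nU_bRow, hc]
    congr 3; ring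
  have h3 : ((-1) ^ (size F G - 1) * poch (x - 1 - (size F G - 1 : ℕ) + (2 * a + N + 2))
      (size F G - 1)) ^ cnt F * (-(wE a N (x - size F G))⁻¹) ^ cnt F =
      sF (N + a + 1) M c ^ cnt F * poch (x - size F G + 1 - (1 : ℕ) - N) 1 ^ cnt F := by
    rcases Nat.eq_zero_or_pos (cnt F) with h0 | h0
    · simp [h0]
    rw [← mul_pow, ← mul_pow]
    congr 1
    have hM1 : 1 ≤ M := by omega
    have hl : size F G - 1 = 2 * (M - 1) + 1 := by rw [size_eq]; omega
    have hl' : ((size F G - 1 : ℕ) : ℝ) = 2 * M - 1 := by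
      rw [Nat.cast_sub (by rw [size_eq]; omega), hsz]; norm_num
    have g1 := gamma_add_nat (z := x - 2 * M + (2 * a + N + 2)) (by linarith) (size F G - 1)
    rw [hl'] at g1
    have g2 := Real.Gamma_add_one (s := x - 2 * M - N) (by linarith)
    have p1 := Real.Gamma_pos_of_pos (s := x - 2 * M - N) (by linarith)
    have p2 := Real.Gamma_pos_of_pos (s := x - 2 * M + (2 * a + N + 2)) (by linarith)
    have p3 : (0 : ℝ) < x - 2 * M - N := by linarith
    rw [wE_eq, sF, hl', hsz, show x - 1 - (2 * (M : ℝ) - 1) + (2 * a + N + 2) =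
      x - 2 * M + (2 * a + N + 2) by ring,
      show c + M - 1 / 2 + (N + a + 1) = x - 2 * M + (2 * a + N + 2) + (2 * M - 1) by rw [hc]; ring,
      show c - M + 3 / 2 - (N + a + 1) = x - 2 * M - N + 1 by rw [hc]; ring, g1, g2,
      show x - 2 * (M : ℝ) + 2 * a + N + 2 = x - 2 * M + (2 * a + N + 2) by ring,
      show (-1 : ℝ) ^ (size F G - 1) = -1 by rw [hl, pow_succ, pow_mul]; norm_num,
      show poch (x - 2 * (M : ℝ) + 1 - (1 : ℕ) - N) 1 = x - 2 * M - N by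
        rw [poch_succ, poch_zero]; push_cast; ring]
    field_simp
  have h4 := congrArg (eval c) (det_fhatP_eq_gP (N + a + 1) M (bRow F G) (psiRow a N F G))
  rw [eval_mul, eval_mul, ← eval_gW, nU_bRow, h2] at h4
  have q1 : 0 < (qqP M).eval c := eval_qqP_pos (by linarith)
  have q2 : 0 < (ppP (N + a + 1) M (cnt F)).eval c := eval_ppP_pos (by omega) hc'
  have q3 : poch (x - size F G + 1 - (1 : ℕ) - N) 1 ≠ 0 := by
    rw [hsz, poch_succ, poch_zero]; push_cast
    have : (0 : ℝ) < x - 2 * M - N := by linarith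
    intro h; linarith
  have q4 : ((-2 : ℝ) ^ (qIdx M).card) ≠ 0 := pow_ne_zero _ (by norm_num)
  have q5 := pow_ne_zero (cnt F) q3
  have hsig : -(2 * (x - cnt F - cnt G + 1) + (2 * a - 1)) = -2 * c := by
    rw [hc, hM]; push_cast; ring
  rw [hsig, kapG, gCore, div_mul_eq_mul_div, div_eq_iff (by positivity)]
  set Dp := ((-1) ^ (size F G - 1) * poch (x - 1 - (size F G - 1 : ℕ) + (2 * a + N + 2))
      (size F G - 1)) ^ cnt F
  set Np := poch (x - size F G + 1 - (1 : ℕ) - N) 1 ^ cnt F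
  set Wp := (-(wE a N (x - size F G))⁻¹) ^ cnt F
  set dd := (fMat (N + a + 1) (bRow F G) (psiRow a N F G) (x + a - 1 / 2)).det
  set sp := sF (N + a + 1) M c ^ cnt F
  set gg := eval (c ^ 2) (gW (N + a + 1) M (bRow F G) (psiRow a N F G))
  field_simp
  linear_combination -c * dd * h3 - c * Np * h4

/-! ### The difference equations for `R` and `P_S` -/

lemma poly_eq_of_eventually {p q : ℝ[X]} (h : ∀ᶠ x in atTop, p.eval x = q.eval x) : p = q := by
  obtain ⟨x₀, hx⟩ := eventually_atTop.1 h
  exact poly_eq_of_large x₀ fun x hx' => hx x hx'.le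

lemma LeadLe.eq_zero_or_lt {p : ℝ[X]} {n : ℕ} (h : LeadLe p n 0) : p = 0 ∨ p.natDegree < n := by
  by_contra! h'
  have h1 := le_antisymm h.natDegree_le h'.2
  have h2 := h.coeff_eq
  rw [← h1, coeff_natDegree, leadingCoeff_eq_zero] at h2
  exact h'.1 h2

lemma eq_zero_of_add_shift {p : ℝ[X]} (h : p + p.comp (X + C 1) = 0) : p = 0 := by
  have h1 := leadLe_of_natDegree (le_refl p.natDegree)
  have h2 := h1.add (h1.comp_X_add_C 1)
  rw [h] at h2
  have := h2.coeff_eq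
  rw [coeff_zero, coeff_natDegree] at this
  exact leadingCoeff_eq_zero.1 (by linarith)

lemma exists_add_shift (g : ℝ[X]) : ∃ p : ℝ[X], p + p.comp (X + C 1) = g := by
  suffices h : ∀ n : ℕ, ∀ g : ℝ[X], g.natDegree < n → ∃ p : ℝ[X], p + p.comp (X + C 1) = g from
    h _ g (Nat.lt_succ_self _)
  intro n
  induction n with
  | zero => intro g hg; omega
  | succ n ih =>
    intro g hg
    have h1 := leadLe_of_natDegree (Nat.lt_succ_iff.1 hg)
    have h2 := (h1.C_mul (1 / 2)).add ((h1.comp_X_add_C 1).C_mul (-1 / 2))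
    rw [show 1 / 2 * g.coeff n + -1 / 2 * g.coeff n = 0 by ring] at h2
    set r := C (1 / 2 : ℝ) * g + C (-1 / 2) * g.comp (X + C 1) with hr
    have hsum : ∀ p : ℝ[X], p + p.comp (X + C 1) = r →
        (C (1 / 2) * g + p) + (C (1 / 2) * g + p).comp (X + C 1) = g := by
      intro p hp
      have e1 : C (-1 / 2 : ℝ) = -C (1 / 2) := by rw [← C_neg]; congr 1; norm_num
      have e2 : C (1 / 2 : ℝ) + C (1 / 2) = 1 := by rw [← C_add, ← C_1]; congr 1; norm_num
      rw [hr, e1] at hp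
      rw [add_comp, mul_comp, C_comp]
      linear_combination hp + g * e2
    rcases h2.eq_zero_or_lt with h | h
    · exact ⟨_, hsum 0 (by rw [h]; simp)⟩
    · obtain ⟨p, hp⟩ := ih r h
      exact ⟨_, hsum p hp⟩

/-- The operator `dW` as a linear map. -/
def dWL : ℝ[X] →ₗ[ℝ] ℝ[X] where
  toFun := dW
  map_add' := dW_add
  map_smul' c p := by rw [smul_eq_C_mul, dW_C_mul, RingHom.id_apply, smul_eq_C_mul]

lemma dW_surjective : Function.Surjective dWL := by
  intro g
  suffices h : ∀ n : ℕ, ∀ g : ℝ[X], g.natDegree < n → ∃ p : ℝ[X], dWL p = g from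
    h _ g (Nat.lt_succ_self _)
  intro n
  induction n with
  | zero => intro g hg; omega
  | succ n ih =>
    intro g hg
    have h1 := leadLe_of_natDegree (Nat.lt_succ_iff.1 hg)
    have h0 := leadLe_of_natDegree (natDegree_X_pow_le (R := ℝ) (n + 1))
    rw [coeff_X_pow_self] at h0
    have h3 := h0.dW
    rw [Nat.cast_succ, add_sub_cancel_right] at h3
    have h2 := h1.add (h3.C_mul (-(g.coeff n / (n + 1))))
    push_cast at h2
    rw [show g.coeff n + -(g.coeff n / (n + 1)) * (((n : ℝ) + 1) * 1) = 0 by field_simp; ring] at h2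
    set r := g + C (-(g.coeff n / (n + 1))) * dW (X ^ (n + 1)) with hr
    have hsum : ∀ p, dWL p = r → dWL (p + C (g.coeff n / (n + 1)) * X ^ (n + 1)) = g := by
      intro p hp
      change dW _ = _ at hp ⊢
      rw [dW_add, hp, dW_C_mul, hr, C_neg]; ring
    rcases h2.eq_zero_or_lt with h | h
    · exact ⟨_, hsum 0 (by rw [h, map_zero])⟩
    · obtain ⟨p, hp⟩ := ih r h
      exact ⟨_, hsum p hp⟩

/-- A linear right inverse of `dW`. -/
def dWInv : ℝ[X] →ₗ[ℝ] ℝ[X] :=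
  (LinearMap.exists_rightInverse_of_surjective dWL (LinearMap.range_eq_top.2 dW_surjective)).choose

lemma dW_dWInv (f : ℝ[X]) : dW (dWInv f) = f :=
  LinearMap.congr_fun (LinearMap.exists_rightInverse_of_surjective dWL
    (LinearMap.range_eq_top.2 dW_surjective)).choose_spec f

/-- The polynomial `σ_{x-(m-1)/2} R(x)`. -/
def sigR (a : ℝ) (F G : Finset ℕ) (R : ℝ[X]) : ℝ[X] :=
  C (-2) * (X + C (a - (cnt F + cnt G : ℕ))) * R

lemma Ev.sigmaR {a : ℝ} {F G : Finset ℕ} {R : ℝ[X]} {y : RatFunc ℝ} {f : ℝ → ℝ} (hy : Ev y f) :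
    Ev (sigmaR a F G R y) (fun x => (sigR a F G R).eval (f x)) := by
  refine (((hy.sub (Ev.C _)).sigma).mul (hy.aeval R)).congr (Eventually.of_forall fun x => ?_)
  simp only [sigR, eval_mul, eval_C, eval_add, eval_X]
  rw [size_eq]; push_cast; ring

lemma solvesR_iff (a N : ℝ) (F G : Finset ℕ) (R : ℝ[X]) :
    SolvesR a N F G R ↔ sigR a F G R + (sigR a F G R).comp (X + C 1) = rhsP a N F G := by
  have h1 : Ev (sigmaR a F G R RatFunc.X + sigmaR a F G R (RatFunc.X + 1))
      (fun x => (sigR a F G R + (sigR a F G R).comp (X + C 1)).eval x) :=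
    (Ev.X.sigmaR.add (Ev.X.add Ev.one).sigmaR).congr (Eventually.of_forall fun x => by simp)
  rw [SolvesR, rhs_eq]
  constructor
  · intro h
    rw [h] at h1
    exact poly_eq_of_eventually ((Ev.algebraMap _).eq_of h1).symm
  · intro h
    rw [h] at h1
    exact h1.unique (Ev.algebraMap _)

lemma rhsP_odd (a N : ℝ) (F G : Finset ℕ) (x : ℝ) :
    (rhsP a N F G).eval (2 * (cnt F + cnt G : ℕ) - 2 * a - 1 - x) = -(rhsP a N F G).eval x := by
  rw [eval_rhsP, eval_rhsP, show (2 * ((cnt F + cnt G : ℕ) : ℝ) - 2 * a - 1 - x) + a + 1 / 2 -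
    ((cnt F + cnt G : ℕ) : ℝ) = -(x + a + 1 / 2 - ((cnt F + cnt G : ℕ) : ℝ)) by ring, neg_sq]
  ring

/-- A solution of `p(x) + p(x+1) = H(x) Ω₁(x)` is odd with respect to the point `m/2 - a`. -/
lemma solution_odd {a N : ℝ} {F G : Finset ℕ} {p : ℝ[X]}
    (hp : p + p.comp (X + C 1) = rhsP a N F G) (x : ℝ) :
    p.eval (2 * (cnt F + cnt G : ℕ) - 2 * a - x) = -p.eval x := by
  set r : ℝ := 2 * (cnt F + cnt G : ℕ) - 2 * a with hr
  have h1 : ∀ x, p.eval x + p.eval (x + 1) = (rhsP a N F G).eval x := fun x => by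
    rw [← hp]; simp
  have h2 : p + p.comp (C r - X) = 0 := by
    refine eq_zero_of_add_shift (Polynomial.funext fun x => ?_)
    have e1 := h1 x
    have e2 := h1 (r - 1 - x)
    rw [hr, show (2 * ((cnt F + cnt G : ℕ) : ℝ) - 2 * a) - 1 - x =
      2 * ((cnt F + cnt G : ℕ) : ℝ) - 2 * a - 1 - x by ring, rhsP_odd] at e2
    simp only [eval_add, eval_comp, eval_sub, eval_C, eval_X, eval_zero]
    rw [show r - (x + 1) = 2 * ((cnt F + cnt G : ℕ) : ℝ) - 2 * a - 1 - x by rw [hr]; ring,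
      show r - x = 2 * ((cnt F + cnt G : ℕ) : ℝ) - 2 * a - 1 - x + 1 by rw [hr]; ring]
    linear_combination e1 + e2
  have h3 := congrArg (eval x) h2
  simp only [eval_add, eval_comp, eval_sub, eval_C, eval_X, eval_zero] at h3
  linarith

lemma existsUnique_solvesR (a N : ℝ) (F G : Finset ℕ) : ∃! R : ℝ[X], SolvesR a N F G R := by
  obtain ⟨p, hp⟩ := exists_add_shift (rhsP a N F G)
  have h0 : p.eval (-(a - (cnt F + cnt G : ℕ))) = 0 := by
    have := solution_odd hp (-(a - (cnt F + cnt G : ℕ)))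
    rw [show 2 * ((cnt F + cnt G : ℕ) : ℝ) - 2 * a - -(a - ((cnt F + cnt G : ℕ) : ℝ)) =
      -(a - ((cnt F + cnt G : ℕ) : ℝ)) by ring] at this
    linarith
  obtain ⟨R, hR⟩ := dvd_iff_isRoot.2 h0
  rw [C_neg, sub_neg_eq_add] at hR
  have e : C (-2 : ℝ) * C (-1 / 2) = 1 := by rw [← C_mul, ← C_1]; congr 1; norm_num
  refine ⟨C (-1 / 2) * R, ?_, fun R' hR' => ?_⟩
  · simp only
    rw [solvesR_iff]
    have : sigR a F G (C (-1 / 2) * R) = p := by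
      rw [sigR, hR]; linear_combination (X + C (a - ((cnt F + cnt G : ℕ) : ℝ))) * R * e
    rw [this, hp]
  · simp only at hR'
    rw [solvesR_iff] at hR'
    have h1 : sigR a F G R' - p = 0 := eq_zero_of_add_shift (by
      rw [sub_comp]; linear_combination hR' - hp)
    have h2 : (X + C (a - ((cnt F + cnt G : ℕ) : ℝ))) * (R' - C (-1 / 2) * R) = 0 := by
      rw [sigR, hR] at h1
      linear_combination C (-1 / 2) * h1 - (X + C (a - ((cnt F + cnt G : ℕ) : ℝ))) * R' * e
    rcases mul_eq_zero.1 h2 with h3 | h3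
    · exact absurd h3 (X_add_C_ne_zero _)
    · exact sub_eq_zero.1 h3

/-! ### Inversion of the matrix of `Ω` -/

lemma isUnit_fMat {ν : ℝ} {M : ℕ} {b : Fin M → Bool} {ψ : Fin M → ℝ[X]} {c : ℝ}
    (hc : 2 * M + |ν| + 2 < c) (hd : (fhatP ν M b ψ).det.eval c ≠ 0) :
    IsUnit (fMat ν b ψ (c + M - 1)).det := by
  rw [← coe_evalRingHom, RingHom.map_det, fhatP_eval ν b ψ hc, Matrix.det_mul] at hd
  exact isUnit_iff_ne_zero.2 (right_ne_zero_of_mul hd)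

lemma eventually_isUnit_fMat {a N : ℝ} {F G : Finset ℕ} (hg : gCore a N F G ≠ 0) (s : ℝ) :
    ∀ᶠ x in atTop, IsUnit (fMat (N + a + 1) (bRow F G) (psiRow a N F G) (x + s)).det := by
  have h1 := (eventually_det_ne_zero hg).and
    (eventually_gt_atTop (2 * (cnt F + cnt G : ℕ) + |N + a + 1| + 2))
  have h2 := (tendsto_atTop_add_const_right _ (s - (cnt F + cnt G : ℕ) + 1)
    (tendsto_id (α := ℝ))).eventually h1
  filter_upwards [h2] with x hx
  have := isUnit_fMat hx.2 hx.1
  convert this using 3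
  simp only [id]; ring

lemma eventually_omegaInv {a N : ℝ} {F G : Finset ℕ} (hg : gCore a N F G ≠ 0) (s : ℝ) :
    ∀ᶠ x in atTop, omegaR a N F G (x + s) * omegaInv a N F G (x + s) = 1 := by
  filter_upwards [eventually_isUnit_fMat hg (s + a - 1 / 2),
    eventually_isUnit_fMat hg (s + a - 1 / 2 - 1),
    eventually_gt_atTop (|N + a + 1| + size F G - a - 1 / 2 - s)] with x h1 h2 h3
  refine omegaR_mul_omegaInv (by linarith) ?_ ?_
  · convert h1 using 3; ring
  · convert h2 using 3; ring

lemma Ev.omega {a N : ℝ} {F G : Finset ℕ} {y : RatFunc ℝ} {s : ℝ} (hy : Ev y (fun x => x + s)) :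
    Ev (omega a N F G y) (fun x => (omegaR a N F G (x + s)).det) :=
  Ev.det fun h j => hy.omegaMat h j

lemma omega_ne_zero {a N : ℝ} {F G : Finset ℕ} (hg : gCore a N F G ≠ 0) {y : RatFunc ℝ} {s : ℝ}
    (hy : Ev y (fun x => x + s)) : omega a N F G y ≠ 0 := by
  refine hy.omega.ne_zero ?_
  filter_upwards [eventually_omegaInv hg s] with x hx
  intro h0
  have := congrArg Matrix.det hx
  rw [Matrix.det_mul, h0, zero_mul, Matrix.det_one] at this
  exact zero_ne_one this

lemma sFun_mul_omega {a N : ℝ} {F G : Finset ℕ} (hg : gCore a N F G ≠ 0) (R : ℝ[X])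
    {y : RatFunc ℝ} {s : ℝ} (hy : Ev y (fun x => x + s)) :
    sFun a N F G R y * omega a N F G y = sigmaR a F G R y :=
  div_mul_cancel₀ _ (omega_ne_zero hg hy)

lemma hypPoly {a N : ℝ} {F G : Finset ℕ} (hg : gCore a N F G ≠ 0) (R : ℝ[X]) :
    HypPoly a N F G (sFun a N F G R) := by
  refine ⟨sigR a F G R, ?_⟩
  rw [sFun_mul_omega hg R (s := 0) (by simpa using Ev.X)]
  exact Ev.X.sigmaR.unique (Ev.algebraMap _)

/-! ### The functions `M_h` -/

/-- The value at `x` of `M_h`, for the rows `h` with index `i`. -/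
def mVal (a N : ℝ) (F G : Finset ℕ) (i : Fin (cnt F + cnt G)) (x : ℝ) : ℝ :=
  1 / 2 * kapG (cnt F + cnt G) * ∑ k ∈ Finset.range (cnt F + cnt G),
    tF (N + a + 1) (bRow F G) (psiRow a N F G) i k
      (x + a + 1 / 2 - ((cnt F + cnt G : ℕ) - 1) + 2 * k)

lemma ev_mFun {a N : ℝ} {F G : Finset ℕ} (hg : gCore a N F G ≠ 0) {R : ℝ[X]}
    (hR : SolvesR a N F G R) (h : Fin (size F G)) :
    Ev (mFun a N F G (sFun a N F G R) h RatFunc.X)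
      (mVal a N F G (baseRow F G h)) := by
  have hX0 : Ev RatFunc.X (fun x => x + 0) := by simpa using Ev.X
  have hXj : ∀ j : ℕ, Ev (RatFunc.X + (j : RatFunc ℝ)) (fun x => x + (j : ℝ)) := fun j =>
    Ev.X.add (Ev.natCast j)
  have h1 : Ev (mFun a N F G (sFun a N F G R) h RatFunc.X) _ := Ev.sum fun j _ =>
    ((hX0.xiRow (a := a) (N := N) (size F G - ((j : ℕ) + 1)) h).mul
      ((hXj ((j : ℕ) + 1)).sigmaR.div (hXj ((j : ℕ) + 1)).omega)).mul
      (Ev.adjugate (f := fun x => omegaR a N F G (x + ((j : ℕ) + 1 : ℕ)))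
        (fun l l' => (hXj ((j : ℕ) + 1)).omegaMat l l') j h)
  refine h1.congr ?_
  have hinv : ∀ᶠ x in atTop, ∀ j : Fin (size F G),
      omegaR a N F G (x + ((j : ℕ) + 1 : ℕ)) * omegaInv a N F G (x + ((j : ℕ) + 1 : ℕ)) = 1 :=
    eventually_all.2 fun j => eventually_omegaInv hg _
  have hdet : ∀ᶠ x in atTop, ∀ k : Fin (cnt F + cnt G),
      (fhatP (N + a + 1) _ (bRow F G) (psiRow a N F G)).det.eval
        (x + (a + 1 / 2 - ((cnt F + cnt G : ℕ) - 1) + 2 * (k : ℕ))) ≠ 0 :=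
    eventually_all.2 fun k => (tendsto_atTop_add_const_right _ _ (tendsto_id (α := ℝ))).eventually
      (eventually_det_ne_zero hg)
  filter_upwards [hinv, hdet, eventually_gt_atTop (|N + a + 1| + 2 + 3 * size F G - a - 1 / 2)]
    with x hx hd hx'
  set i := baseRow F G h with hi
  have hsz : (size F G : ℝ) = 2 * (cnt F + cnt G : ℕ) := by rw [size_eq]; push_cast; ring
  have hM0 : (0 : ℝ) ≤ (cnt F + cnt G : ℕ) := Nat.cast_nonneg _
  set z := x + a + 1 / 2 with hz
  set Q := sigR a F G R with hQ
  have hQG : ∀ y, Q.eval y + Q.eval (y + 1) = (rhsP a N F G).eval y := fun y => by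
    rw [← (solvesR_iff a N F G R).1 hR]; simp [hQ]
  -- The factor `S Ω / det` times the adjugate is `S Ω` times the inverse.
  have hterm : ∀ j : Fin (size F G), (sgnRow F G h ^ (size F G - ((j : ℕ) + 1)) *
      if bRow F G i then wE a N (x + 0) / wE a N (x + 0 - (size F G - ((j : ℕ) + 1) : ℕ)) else 1) *
      (Q.eval (x + ((j : ℕ) + 1 : ℕ)) / (omegaR a N F G (x + ((j : ℕ) + 1 : ℕ))).det) *
      (omegaR a N F G (x + ((j : ℕ) + 1 : ℕ))).adjugate j h =
      1 / 2 * Q.eval (x + ((j : ℕ) + 1 : ℕ)) * ((if bRow F G i then wE a N x else 1) *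
        (fMat (N + a + 1) (bRow F G) (psiRow a N F G)
          (x + ((j : ℕ) + 1 : ℕ) + a - 1 / 2 - ((j : ℕ) % 2 : ℕ)))⁻¹
          ⟨(j : ℕ) / 2, by have := j.2; have := size_eq F G; omega⟩ i) := by
    intro j
    have e1 := hx j
    set A := omegaR a N F G (x + ((j : ℕ) + 1 : ℕ))
    have hA : A.det ≠ 0 := by
      intro h0
      have := congrArg Matrix.det e1
      rw [Matrix.det_mul, h0, zero_mul, Matrix.det_one] at this
      exact zero_ne_one this
    have e2 : A.adjugate = A.det • omegaInv a N F G (x + ((j : ℕ) + 1 : ℕ)) := by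
      rw [← Matrix.mul_one A.adjugate, ← e1, ← Matrix.mul_assoc, Matrix.adjugate_mul,
        Matrix.smul_mul, Matrix.one_mul]
    have hj : (j : ℕ) + 1 ≤ size F G := j.2
    have hj0 : (0 : ℝ) ≤ (j : ℕ) := Nat.cast_nonneg _
    have hsg : sgnRow F G h ^ ((j : ℕ) + 1) * sgnRow F G h ^ ((j : ℕ) + 1) = 1 := by
      rw [← mul_pow, sgnRow_mul_self, one_pow]
    have hw : wE a N (x + ((j : ℕ) + 1 : ℕ) - size F G) ≠ 0 := (wE_pos (by
      rw [hsz] at hx' ⊢; rw [Nat.cast_succ]; linarith [abs_nonneg (N + a + 1)])).ne'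
    have e3 : x + 0 - ((size F G - ((j : ℕ) + 1) : ℕ) : ℝ) = x + ((j : ℕ) + 1 : ℕ) - size F G := by
      rw [Nat.cast_sub hj]; ring
    rw [e2, Matrix.smul_apply, smul_eq_mul, sgnRow_pow F G h hj, e3, add_zero]
    simp only [omegaInv, Matrix.of_apply, ← hi]
    generalize (fMat _ _ _ _)⁻¹ _ _ = V
    generalize eval (x + ((j : ℕ) + 1 : ℕ)) Q = q
    generalize A.det = d at hA
    generalize sgnRow F G h ^ ((j : ℕ) + 1) = s at hsg
    generalize wE a N (x + ((j : ℕ) + 1 : ℕ) - size F G) = w at hw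
    have h2 : q / d * d = q := div_mul_cancel₀ _ hA
    split_ifs
    · have h3 : wE a N x / w * w = wE a N x := div_mul_cancel₀ _ hw
      linear_combination 1 / 2 * (s * s * (q / d * d) * V) * h3 +
        1 / 2 * s * s * wE a N x * V * h2 + 1 / 2 * wE a N x * q * V * hsg
    · linear_combination 1 / 2 * s * s * V * h2 + 1 / 2 * q * V * hsg
  rw [Finset.sum_congr rfl fun j _ => hterm j, sum_pairs (size_eq F G), mVal, Finset.mul_sum,
    ← Fin.sum_univ_eq_sum_range (fun k => 1 / 2 * kapG (cnt F + cnt G) *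
      tF (N + a + 1) (bRow F G) (psiRow a N F G) i k (z - ((cnt F + cnt G : ℕ) - 1) + 2 * k)) (cnt F + cnt G)]
  refine Finset.sum_congr rfl fun k _ => ?_
  have hk : ((k : ℕ) : ℝ) + 1 ≤ (cnt F + cnt G : ℕ) := by exact_mod_cast k.2
  have hk0 : (0 : ℝ) ≤ (k : ℕ) := Nat.cast_nonneg _
  have e1 : (2 * (k : ℕ)) % 2 = 0 := by omega
  have e2 : (2 * (k : ℕ) + 1) % 2 = 1 := by omega
  have e3 : (⟨2 * (k : ℕ) / 2, by omega⟩ : Fin (cnt F + cnt G)) = k := by ext; simp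
  have e4 : (⟨(2 * (k : ℕ) + 1) / 2, by omega⟩ : Fin (cnt F + cnt G)) = k := by ext; simp; omega
  set c := z - ((cnt F + cnt G : ℕ) - 1) + 2 * ((k : ℕ) : ℝ) with hc
  have e5 := (tF_eq (N + a + 1) (bRow F G) (psiRow a N F G) i k (c := c) (by
    rw [hc]; linarith) (by convert hd k using 2; rw [hc, hz]; ring)).2
  have e6 := hQG (x + (2 * (k : ℕ) + 1 : ℕ))
  rw [eval_rhsP] at e6
  simp only [e1, e2, e3, e4]
  rw [show x + ((2 * (k : ℕ) + 1 + 1 : ℕ) : ℝ) = x + (2 * (k : ℕ) + 1 : ℕ) + 1 by push_cast; ring,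
    show x + ((2 * (k : ℕ) + 1 : ℕ) : ℝ) + 1 + a - 1 / 2 - (1 : ℕ) = c + (cnt F + cnt G : ℕ) - 1 by
      rw [hc, hz]; push_cast; ring,
    show x + ((2 * (k : ℕ) + 1 : ℕ) : ℝ) + a - 1 / 2 - (0 : ℕ) = c + (cnt F + cnt G : ℕ) - 1 by
      rw [hc, hz]; push_cast; ring, e5]
  rw [show x + ((2 * (k : ℕ) + 1 : ℕ) : ℝ) + a + 1 / 2 - ((cnt F + cnt G : ℕ) : ℝ) = c by
    rw [hc, hz]; push_cast; ring] at e6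
  rw [show c + ((cnt F + cnt G : ℕ) : ℝ) - 1 - 2 * ((k : ℕ) : ℝ) = x + a + 1 / 2 by rw [hc, hz]; ring, gCore] at *
  simp only [wE]
  linear_combination 1 / 2 * ((if bRow F G i = true then gE (N + a + 1) (x + a + 1 / 2) else 1) *
    (fMat (N + a + 1) (bRow F G) (psiRow a N F G) (c + (cnt F + cnt G : ℕ) - 1))⁻¹ k i) * e6

/-- The polynomial `p` represents the functions `M_h` of the rows with index `i`. -/
def IsMt (a N : ℝ) (F G : Finset ℕ) (i : Fin (cnt F + cnt G)) (p : ℝ[X]) : Prop :=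
  ∀ᶠ x in atTop, mVal a N F G i x = -2 * (x + a + 1 / 2) * p.eval (x * (x + (2 * a + 1)))

lemma hypM_iff {a N : ℝ} {F G : Finset ℕ} (hg : gCore a N F G ≠ 0) {R : ℝ[X]}
    (hR : SolvesR a N F G R) (Mt : Fin (size F G) → ℝ[X]) :
    HypM a N F G (sFun a N F G R) Mt ↔ ∀ h, IsMt a N F G (baseRow F G h) (Mt h) := by
  refine forall_congr' fun h => ?_
  have h1 := ev_mFun hg hR h
  have h2 : Ev (sigma a (RatFunc.X + 1) * aeval (theta a RatFunc.X) (Mt h))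
      (fun x => -2 * (x + a + 1 / 2) * (Mt h).eval (x * (x + (2 * a + 1)))) :=
    ((Ev.X.add Ev.one).sigma.mul (Ev.X.theta.aeval (Mt h))).congr
      (Eventually.of_forall fun x => by ring)
  constructor
  · intro h3
    rw [h3] at h1
    exact h1.eq_of h2
  · intro h3
    exact (h1.congr h3).unique h2

lemma IsMt.unique {a N : ℝ} {F G : Finset ℕ} {i : Fin (cnt F + cnt G)} {p q : ℝ[X]}
    (hp : IsMt a N F G i p) (hq : IsMt a N F G i q) : p = q := by
  have h1 : ∀ᶠ x in atTop, (p - q).eval (x * (x + (2 * a + 1))) = 0 := by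
    filter_upwards [hp, hq, eventually_gt_atTop (-(a + 1 / 2))] with x h1 h2 h3
    have h4 : -2 * (x + a + 1 / 2) ≠ 0 := by
      have : 0 < x + a + 1 / 2 := by linarith
      intro h; linarith
    rw [h1] at h2
    rw [eval_sub, mul_left_cancel₀ h4 h2, sub_self]
  have h2 : Tendsto (fun x : ℝ => x * (x + (2 * a + 1))) atTop atTop :=
    tendsto_id.atTop_mul_atTop₀ (tendsto_atTop_add_const_right _ _ tendsto_id)
  by_contra hne
  obtain ⟨x, h3, h4⟩ := (h1.and (h2.eventually (eventually_eval_ne_zero (sub_ne_zero.2 hne)))).exists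
  exact h4 h3

lemma exists_isMt (a N : ℝ) {F G : Finset ℕ} {D : ℕ} (hD : degG (bRow F G) (kRow F G) = D)
    (hk : ∀ i, kRow F G i ≤ D) (i : Fin (cnt F + cnt G)) :
    ∃ p : ℝ[X], p.natDegree ≤ D - kRow F G i ∧ IsMt a N F G i p := by
  obtain ⟨μ, h1, h2⟩ := exists_sum_tF (N + a + 1) (bRow F G) (ψ := psiRow a N F G)
    (fun i => (leadLe_psiRow a N F G i).natDegree_le) i (e := D - kRow F G i) (by
      rw [hD, Nat.cast_sub (hk i)])
  refine ⟨C (-(1 / 4) * kapG (cnt F + cnt G)) * μ.comp (X + C ((a + 1 / 2) ^ 2)), ?_, ?_⟩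
  · refine (natDegree_C_mul_le _ _).trans ?_
    rw [natDegree_comp, natDegree_X_add_C, mul_one]; exact h1
  · filter_upwards [eventually_gt_atTop
      (4 * (cnt F + cnt G : ℕ) + |N + a + 1| + 2 - a - 1 / 2)] with x hx
    rw [mVal, h2 (x + a + 1 / 2) (by linarith)]
    simp only [eval_mul, eval_comp, eval_add, eval_X, eval_C]
    rw [show x * (x + (2 * a + 1)) + (a + 1 / 2) ^ 2 = (x + a + 1 / 2) ^ 2 by ring]
    ring

/-! ### The polynomial `P_S` -/

lemma hypP_iff {a N : ℝ} {F G : Finset ℕ} (hg : gCore a N F G ≠ 0) (R P : ℝ[X]) :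
    HypP a N F G (sFun a N F G R) P ↔
      ∀ x : ℝ, P.eval (x * (x + (2 * a + 1))) - P.eval ((x - 1) * (x - 1 + (2 * a + 1))) =
        (sigR a F G R).eval x + (sigR a F G R).eval (x + 2 * (cnt F + cnt G : ℕ)) := by
  have hX0 : Ev RatFunc.X (fun x => x + 0) := by simpa using Ev.X
  have hXm : Ev (RatFunc.X + (size F G : RatFunc ℝ)) (fun x => x + (size F G : ℝ)) :=
    Ev.X.add (Ev.natCast _)
  have h1 : Ev (aeval (theta a RatFunc.X) P - aeval (theta a (RatFunc.X - 1)) P) _ :=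
    (Ev.X.theta.aeval P).sub ((Ev.X.sub Ev.one).theta.aeval P)
  have h2 := (Ev.X.sigmaR (a := a) (F := F) (G := G) (R := R)).add
    (hXm.sigmaR (a := a) (F := F) (G := G) (R := R))
  rw [HypP, sFun_mul_omega hg R hX0, sFun_mul_omega hg R hXm]
  have hsz : (size F G : ℝ) = 2 * (cnt F + cnt G : ℕ) := by rw [size_eq]; push_cast; ring
  rw [hsz] at h2
  constructor
  · intro h3
    rw [h3] at h1
    have h4 : P.comp (X * (X + C (2 * a + 1))) - P.comp ((X - 1) * (X - 1 + C (2 * a + 1))) =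
        sigR a F G R + (sigR a F G R).comp (X + C (2 * ((cnt F + cnt G : ℕ) : ℝ))) := by
      refine poly_eq_of_eventually ?_
      filter_upwards [h1.eq_of h2] with x hx
      simpa using hx
    intro x
    have h5 := congrArg (eval x) h4
    simpa using h5
  · intro h3
    exact (h1.congr (Eventually.of_forall h3)).unique h2

lemma exists_hypP {a N : ℝ} {F G : Finset ℕ} (hg : gCore a N F G ≠ 0) {R : ℝ[X]}
    (hR : SolvesR a N F G R) : ∃ P, HypP a N F G (sFun a N F G R) P := by
  set M : ℝ := ((cnt F + cnt G : ℕ) : ℝ) with hM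
  set Q := sigR a F G R with hQ
  have hodd := solution_odd ((solvesR_iff a N F G R).1 hR)
  rw [← hQ, ← hM] at hodd
  -- The right-hand side as a function of `y = x + a`.
  let T : ℝ[X] := Q.comp (X + C (-a)) + Q.comp (X + C (2 * M - a))
  have hT : ∀ y, T.eval (-y) = -T.eval y := by
    intro y
    have e1 := hodd (y - a)
    have e2 := hodd (y + (2 * M - a))
    simp only [T, eval_add, eval_comp, eval_X, eval_C]
    rw [show -y + -a = 2 * M - 2 * a - (y + (2 * M - a)) by ring,
      show -y + (2 * M - a) = 2 * M - 2 * a - (y - a) by ring, e1, e2]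
    ring_nf
  refine ⟨(dWInv (C (1 / 8) * (oddPart T).comp (C (1 / 4) * X))).comp
    (C 4 * (X + C ((a + 1 / 2) ^ 2))), (hypP_iff hg R _).2 fun x => ?_⟩
  have h1 := eval_dW (dWInv (C (1 / 8) * (oddPart T).comp (C (1 / 4) * X))) (2 * (x + a))
  have h2 := eval_oddPart hT (x + a)
  rw [dW_dWInv] at h1
  simp only [eval_comp, eval_mul, eval_C, eval_add, eval_X] at h1 ⊢
  rw [show 1 / 4 * (2 * (x + a)) ^ 2 = (x + a) ^ 2 by ring] at h1
  rw [show 4 * (x * (x + (2 * a + 1)) + (a + 1 / 2) ^ 2) = (2 * (x + a) + 1) ^ 2 by ring,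
    show 4 * ((x - 1) * (x - 1 + (2 * a + 1)) + (a + 1 / 2) ^ 2) = (2 * (x + a) - 1) ^ 2 by ring,
    ← h1]
  simp only [T, eval_add, eval_comp, eval_X, eval_C] at h2
  rw [show x + a + -a = x by ring, show x + a + (2 * M - a) = x + 2 * M by ring] at h2
  rw [h2]; ring

/-- The property of `P_S` that is used for the eigenvalue equation. -/
def IsPS (a N : ℝ) (F G : Finset ℕ) (P : ℝ[X]) : Prop :=
  ∀ x : ℝ, P.eval (x * (x + (2 * a + 1))) - P.eval ((x - 2) * (x - 2 + (2 * a + 1))) =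
    (rhsP a N F G).eval (x - 1) + (rhsP a N F G).eval (x + 2 * (cnt F + cnt G : ℕ) - 1)

lemma HypP.isPS {a N : ℝ} {F G : Finset ℕ} (hg : gCore a N F G ≠ 0) {R P : ℝ[X]}
    (hR : SolvesR a N F G R) (hP : HypP a N F G (sFun a N F G R) P) : IsPS a N F G P := by
  intro x
  have h1 := (hypP_iff hg R P).1 hP x
  have h2 := (hypP_iff hg R P).1 hP (x - 1)
  have h3 : ∀ y, (sigR a F G R).eval y + (sigR a F G R).eval (y + 1) = (rhsP a N F G).eval y :=
    fun y => by rw [← (solvesR_iff a N F G R).1 hR]; simp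
  have h4 := h3 (x - 1)
  have h5 := h3 (x + 2 * (cnt F + cnt G : ℕ) - 1)
  rw [sub_add_cancel] at h4 h5
  rw [show x - 1 + 2 * ((cnt F + cnt G : ℕ) : ℝ) = x + 2 * ((cnt F + cnt G : ℕ) : ℝ) - 1 by ring,
    show x - 1 - 1 = x - 2 by ring] at h2
  linear_combination h1 + h2 + h4 + h5

/-! ### Degrees of `gCore` and `P_S`, and the shape of `D_S` -/

lemma exists_leadLe_gCore {a N : ℝ} {F G : Finset ℕ}
    (hY : ∀ u ∈ invol F, DualHahnDefined (-a) (2 * a + N) u)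
    (hZ : ∀ v ∈ invol G, DualHahnDefined (-a) (-2 - N) v)
    (hUV : ∀ u ∈ invol F, ∀ v ∈ invol G, (v : ℝ) - u + a + N + 1 ≠ 0) {D : ℕ}
    (hD : degG (bRow F G) (kRow F G) = D) : ∃ L, L ≠ 0 ∧ LeadLe (gCore a N F G) D L :=
  ⟨_, mul_ne_zero (kap_ne_zero _) (mul_ne_zero
    (Finset.prod_ne_zero_iff.2 fun i _ => LRow_ne_zero hY hZ i)
    (Matrix.det_vandermonde_ne_zero_iff.2 (muRow_injective hUV))),
    leadLe_gW _ (leadLe_psiRow a N F G) hD⟩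

lemma LeadLe.ne_zero {p : ℝ[X]} {D : ℕ} {L : ℝ} (h : LeadLe p D L) (hL : L ≠ 0) : p ≠ 0 := by
  rintro rfl
  exact hL (h.coeff_eq.symm.trans (coeff_zero _))

/-- If `dW ψ` has degree `D`, then `ψ` has degree `D + 1`. -/
lemma natDegree_of_leadLe_dW {ψ : ℝ[X]} {D : ℕ} {L : ℝ} (h : LeadLe (dW ψ) D L) (hL : L ≠ 0) :
    ψ.natDegree = D + 1 := by
  have h1 : LeadLe (dW ψ) (ψ.natDegree - 1) (ψ.natDegree * ψ.leadingCoeff) :=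
    (leadLe_of_natDegree (le_refl ψ.natDegree)).dW
  rcases lt_trichotomy ψ.natDegree (D + 1) with h2 | h2 | h2
  · exact absurd (h.coeff_eq.symm.trans (h1.mono (k' := D) (by omega)).coeff_eq) hL
  · exact h2
  · obtain ⟨k, hk⟩ : ∃ k : ℕ, ψ.natDegree = k + 1 := ⟨ψ.natDegree - 1, by omega⟩
    have h3 := (h.mono (k' := k) (by omega)).coeff_eq
    rw [hk] at h1
    have h4 := h1.2.1 k (by push_cast; ring)
    rw [h3] at h4
    have h5 : ψ ≠ 0 := by rintro rfl; simp at hk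
    exact absurd h4.symm (mul_ne_zero (by positivity) (leadingCoeff_ne_zero.2 h5))

lemma tendsto_odd_sum {g : ℝ[X]} {D : ℕ} {L : ℝ} (h : LeadLe g D L) (m : ℝ) :
    Tendsto (fun c : ℝ => ((c - m) * g.eval ((c - m) ^ 2) + (c + m) * g.eval ((c + m) ^ 2)) *
      c⁻¹ * c ^ (-(2 * (D : ℤ)))) atTop (𝓝 (2 * L)) := by
  have h1 := (tendsto_add_div (-m)).mul (h.tendsto_sq (-m))
  have h2 := (tendsto_add_div m).mul (h.tendsto_sq m)
  have h3 := h1.add h2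
  rw [one_mul, ← two_mul] at h3
  refine h3.congr fun c => ?_
  rw [← sub_eq_add_neg]; ring

lemma IsPS.natDegree_eq {a N : ℝ} {F G : Finset ℕ} {D : ℕ} {L : ℝ}
    (hg : LeadLe (gCore a N F G) D L) (hL : L ≠ 0) {P : ℝ[X]} (hP : IsPS a N F G P) :
    P.natDegree = D + 1 := by
  set M : ℝ := ((cnt F + cnt G : ℕ) : ℝ) with hM
  set ψ := P.comp (X + C (-(a + 1 / 2) ^ 2)) with hψ
  have h1 : ∀ y : ℝ, 4 * y * (dW ψ).eval (y ^ 2) = kapG (cnt F + cnt G) *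
      ((y - M) * (gCore a N F G).eval ((y - M) ^ 2) +
        (y + M) * (gCore a N F G).eval ((y + M) ^ 2)) := by
    intro y
    have h2 := hP (y + 1 - a - 1 / 2)
    rw [eval_rhsP, eval_rhsP, ← hM] at h2
    rw [eval_dW, hψ, eval_comp, eval_comp]
    simp only [eval_add, eval_X, eval_C]
    rw [show (y + 1) ^ 2 + -(a + 1 / 2) ^ 2 =
        (y + 1 - a - 1 / 2) * (y + 1 - a - 1 / 2 + (2 * a + 1)) by ring,
      show (y - 1) ^ 2 + -(a + 1 / 2) ^ 2 =
        (y + 1 - a - 1 / 2 - 2) * (y + 1 - a - 1 / 2 - 2 + (2 * a + 1)) by ring, h2,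
      show y + 1 - a - 1 / 2 - 1 + a + 1 / 2 - M = y - M by ring,
      show y + 1 - a - 1 / 2 + 2 * M - 1 + a + 1 / 2 - M = y + M by ring]
    ring
  have h2 : LeadLe (dW ψ) D (kapG (cnt F + cnt G) / 4 * (2 * L)) := by
    refine leadLe_of_tendsto ?_
    have h3 := ((tendsto_odd_sum hg M).const_mul (kapG (cnt F + cnt G) / 4)).comp
      Real.tendsto_sqrt_atTop
    refine h3.congr' ?_
    filter_upwards [eventually_gt_atTop 0] with w hw
    have h4 := h1 (√w)
    have h5 : 0 < √w := Real.sqrt_pos.2 hw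
    simp only [Function.comp]
    rw [Real.sq_sqrt hw.le] at h4
    have h6 : (√w) ^ (-(2 * (D : ℤ))) = w ^ (-(D : ℤ)) := by
      rw [← mul_neg, zpow_mul]; congr 1; exact_mod_cast Real.sq_sqrt hw.le
    rw [h6, ← mul_assoc, ← mul_assoc, div_mul_eq_mul_div, ← h4]
    field_simp
  have h3 := natDegree_of_leadLe_dW h2
    (mul_ne_zero (div_ne_zero (kapG_ne_zero _) (by norm_num)) (mul_ne_zero two_ne_zero hL))
  rw [hψ, natDegree_comp, natDegree_X_add_C, mul_one] at h3
  exact h3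

/-- The first-order operator `𝒟₁ + 𝒟₂` or `𝒟₃ + 𝒟₄` that belongs to a row. -/
def opK (a N : ℝ) (b : Bool) : Module.End ℝ ℝ[X] :=
  if b then opD1 a + opD2 a N else opD3 a + opD4 a N

/-- The operator `D_S`, with one polynomial `μ i` for each of the rows with index `i`. -/
def opSR (a N : ℝ) (F G : Finset ℕ) (μ : Fin (cnt F + cnt G) → ℝ[X]) (P : ℝ[X]) :
    Module.End ℝ ℝ[X] :=
  (1 / 2 : ℝ) • aeval (opH a N) P + ∑ i, aeval (opH a N) (μ i) * opK a N (bRow F G i) *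
    aeval (opH a N) (polyR a N F G i)

lemma exists_opS_eq {a N : ℝ} {F G : Finset ℕ} {Mt : Fin (size F G) → ℝ[X]}
    (hMt : ∀ h, IsMt a N F G (baseRow F G h) (Mt h)) (P : ℝ[X]) :
    ∃ μ, (∀ i, IsMt a N F G i (μ i)) ∧ opS a N F G Mt P = opSR a N F G μ P := by
  refine ⟨Fin.append (fun h => Mt (Fin.castAdd _ (Fin.castAdd _ h)))
    (fun h => Mt (Fin.natAdd _ (Fin.castAdd _ h))), fun i => ?_, ?_⟩
  · refine Fin.addCases (fun h => ?_) (fun h => ?_) i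
    · have := hMt (Fin.castAdd _ (Fin.castAdd _ h))
      simpa [baseRow] using this
    · have := hMt (Fin.natAdd _ (Fin.castAdd _ h))
      simpa [baseRow] using this
  · rw [opS, opSR, Fin.sum_univ_add, ← add_assoc]
    simp [opK, bRow, polyR]

/-! ### Orders of difference operators -/

lemma shift_mul_shift (c d : ℝ) : shift c * shift d = shift (c + d) :=
  LinearMap.ext fun p => taylor_taylor p c d

lemma shift_mul_mulBy (c : ℝ) (f : ℝ[X]) : shift c * mulBy f = mulBy (shift c f) * shift c :=
  LinearMap.ext fun p => taylor_mul c f p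

lemma mulBy_mul_mulBy (f g : ℝ[X]) : mulBy f * mulBy g = mulBy (f * g) :=
  LinearMap.ext fun p => (mul_assoc f g p).symm

lemma shift_zero : shift 0 = 1 := LinearMap.ext fun p => taylor_zero p

lemma mulBy_add (f g : ℝ[X]) : mulBy (f + g) = mulBy f + mulBy g :=
  LinearMap.ext fun p => add_mul f g p

lemma mulBy_sub (f g : ℝ[X]) : mulBy (f - g) = mulBy f - mulBy g :=
  LinearMap.ext fun p => sub_mul f g p

lemma mulBy_one : mulBy 1 = 1 := LinearMap.ext fun p => one_mul p

lemma mulBy_C (c : ℝ) : mulBy (C c) = c • (1 : Module.End ℝ ℝ[X]) :=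
  LinearMap.ext fun p => (smul_eq_C_mul c).symm

lemma smul_mulBy (c : ℝ) (f : ℝ[X]) : c • mulBy f = mulBy (C c * f) := by
  rw [← mulBy_mul_mulBy, mulBy_C, smul_mul_assoc, one_mul]

/-- The difference operators with shifts of size at most `r` and coefficients of degree less
than `e`. -/
def diffFil (r e : ℕ) : Submodule ℝ (Module.End ℝ ℝ[X]) :=
  Submodule.span ℝ {T | ∃ (f : ℝ[X]) (l : ℤ), |l| ≤ r ∧ f.degree < e ∧ T = mulBy f * shift l}

lemma mem_diffFil {r e : ℕ} {f : ℝ[X]} {l : ℤ} (hl : |l| ≤ r) (hf : f.degree < e) :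
    mulBy f * shift l ∈ diffFil r e :=
  Submodule.subset_span ⟨f, l, hl, hf, rfl⟩

lemma diffFil_mono {r r' e e' : ℕ} (hr : r ≤ r') (he : e ≤ e') : diffFil r e ≤ diffFil r' e' := by
  refine Submodule.span_mono ?_
  rintro _ ⟨f, l, hl, hf, rfl⟩
  exact ⟨f, l, hl.trans (by exact_mod_cast hr), hf.trans_le (by exact_mod_cast he), rfl⟩

lemma diffFil_mul_le {r r' r'' e e' e'' : ℕ} {S T : Module.End ℝ ℝ[X]} (hS : S ∈ diffFil r e)
    (hT : T ∈ diffFil r' e') (hr : r + r' ≤ r'') (he : e + e' ≤ e'' + 1) :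
    S * T ∈ diffFil r'' e'' := by
  refine Submodule.span_induction (p := fun S _ => S * T ∈ diffFil r'' e'') ?_
    (by simp) (fun x y _ _ hx hy => by rw [add_mul]; exact add_mem hx hy)
    (fun c x _ hx => by rw [smul_mul_assoc]; exact Submodule.smul_mem _ _ hx) hS
  rintro _ ⟨f, l, hl, hf, rfl⟩
  refine Submodule.span_induction
    (p := fun T _ => mulBy f * shift l * T ∈ diffFil r'' e'') ?_
    (by simp) (fun x y _ _ hx hy => by rw [mul_add]; exact add_mem hx hy)
    (fun c x _ hx => by rw [mul_smul_comm]; exact Submodule.smul_mem _ _ hx) hT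
  rintro _ ⟨g, l', hl', hg, rfl⟩
  have h1 : mulBy f * shift l * (mulBy g * shift l') =
      mulBy (f * shift l g) * shift ((l + l' : ℤ) : ℝ) := by
    rw [mul_assoc, ← mul_assoc (shift l), shift_mul_mulBy, mul_assoc, shift_mul_shift, ← mul_assoc,
      mulBy_mul_mulBy, Int.cast_add]
  rw [h1]
  refine mem_diffFil ((abs_add_le l l').trans ((add_le_add hl hl').trans (by exact_mod_cast hr))) ?_
  have h2 : (shift l g).degree < e' := by rw [shift, degree_taylor]; exact hg
  rcases eq_or_ne f 0 with rfl | h0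
  · rw [zero_mul, degree_zero]; exact WithBot.bot_lt_coe _
  rcases eq_or_ne (shift l g) 0 with h3 | h3
  · rw [h3, mul_zero, degree_zero]; exact WithBot.bot_lt_coe _
  rw [degree_mul, degree_eq_natDegree h0, degree_eq_natDegree h3] at *
  norm_cast at *
  omega

lemma diffFil_mul {r r' e e' : ℕ} {S T : Module.End ℝ ℝ[X]} (hS : S ∈ diffFil r (e + 1))
    (hT : T ∈ diffFil r' e') : S * T ∈ diffFil (r + r') (e + e') :=
  diffFil_mul_le hS hT le_rfl (by omega)

lemma one_mem_diffFil : (1 : Module.End ℝ ℝ[X]) ∈ diffFil 0 1 := by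
  have := mem_diffFil (r := 0) (e := 1) (f := 1) (l := 0) (by simp)
    (by rw [degree_one]; exact_mod_cast one_pos)
  rwa [mulBy_one, one_mul, Int.cast_zero, shift_zero] at this

lemma diffFil_pow {r e : ℕ} {S : Module.End ℝ ℝ[X]} (hS : S ∈ diffFil r (e + 1)) (n : ℕ) :
    S ^ n ∈ diffFil (n * r) (n * e + 1) := by
  induction n with
  | zero => simpa using one_mem_diffFil
  | succ n ih =>
    rw [pow_succ']
    have := diffFil_mul hS ih
    rwa [show r + n * r = (n + 1) * r by ring, show e + (n * e + 1) = (n + 1) * e + 1 by ring]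
      at this

lemma aeval_mem_diffFil {r e : ℕ} {S : Module.End ℝ ℝ[X]} (hS : S ∈ diffFil r (e + 1)) {n : ℕ}
    {p : ℝ[X]} (hp : p.natDegree ≤ n) : aeval S p ∈ diffFil (n * r) (n * e + 1) := by
  rw [aeval_eq_sum_range]
  refine Submodule.sum_mem _ fun i hi => Submodule.smul_mem _ _ ?_
  have hi' : i ≤ n := by rw [Finset.mem_range] at hi; omega
  exact diffFil_mono (Nat.mul_le_mul_right _ hi') (by gcongr) (diffFil_pow hS i)

/-- An element of `diffFil r e` as a sum over the shifts. -/
lemma exists_sum_of_mem_diffFil {r e : ℕ} {T : Module.End ℝ ℝ[X]} (hT : T ∈ diffFil r e) :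
    ∃ h : ℤ → ℝ[X], (∀ l, (h l).degree < e) ∧
      T = ∑ l ∈ Finset.Icc (-(r : ℤ)) r, mulBy (h l) * shift (l : ℝ) := by
  refine Submodule.span_induction (p := fun T _ => ∃ h : ℤ → ℝ[X], (∀ l, (h l).degree < e) ∧
      T = ∑ l ∈ Finset.Icc (-(r : ℤ)) r, mulBy (h l) * shift (l : ℝ)) ?_ ?_ ?_ ?_ hT
  · rintro _ ⟨f, l, hl, hf, rfl⟩
    refine ⟨fun l' => if l' = l then f else 0, fun l' => ?_, ?_⟩
    · dsimp only
      split_ifs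
      · exact hf
      · rw [degree_zero]; exact WithBot.bot_lt_coe _
    · rw [Finset.sum_eq_single_of_mem l (Finset.mem_Icc.2 (abs_le.1 hl))]
      · simp
      · intro l' _ h
        simp [h, mulBy]
  · exact ⟨0, fun l => by simp [degree_zero], by simp [mulBy]⟩
  · rintro _ _ _ _ ⟨h, h1, rfl⟩ ⟨h', h1', rfl⟩
    refine ⟨h + h', fun l => (degree_add_le _ _).trans_lt (max_lt (h1 l) (h1' l)), ?_⟩
    simp only [Pi.add_apply, mulBy_add, add_mul, Finset.sum_add_distrib]
  · rintro c _ _ ⟨h, h1, rfl⟩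
    refine ⟨fun l => C c * h l, fun l => ?_, ?_⟩
    · change (C c * h l).degree < _
      rw [← smul_eq_C_mul]; exact (degree_smul_le c _).trans_lt (h1 l)
    · rw [Finset.smul_sum]
      exact Finset.sum_congr rfl fun l _ => by rw [← smul_mul_assoc, smul_mulBy]

lemma fwd_mem : fwd ∈ diffFil 1 1 := by
  have h1 : (1 : ℝ[X]).degree < (1 : ℕ) := by rw [degree_one]; exact_mod_cast one_pos
  have h2 := mem_diffFil (r := 1) (l := 1) (by simp) h1
  have h3 := diffFil_mono (Nat.zero_le 1) le_rfl one_mem_diffFil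
  rw [mulBy_one, one_mul, Int.cast_one] at h2
  exact sub_mem h2 h3

lemma bwd_mem : bwd ∈ diffFil 1 1 := by
  have h1 : (1 : ℝ[X]).degree < (1 : ℕ) := by rw [degree_one]; exact_mod_cast one_pos
  have h2 := mem_diffFil (r := 1) (l := -1) (by simp) h1
  have h3 := diffFil_mono (Nat.zero_le 1) le_rfl one_mem_diffFil
  rw [mulBy_one, one_mul, Int.cast_neg, Int.cast_one] at h2
  exact sub_mem h3 h2

lemma sub_pow_of_mul_eq_one {A : Type*} [Ring A] {s t : A} (hts : t * s = 1) (hst : s * t = 1)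
    (d : ℕ) : (s - 1 - (1 - t)) ^ d = ∑ m ∈ Finset.range (2 * d + 1),
      ((-1) ^ m * (2 * d).choose m : ℤ) • (t ^ d * s ^ m) := by
  have h1 : s - 1 - (1 - t) = t * (-s + 1) ^ 2 := by
    have h2 : t * (s * s) = s := by rw [← mul_assoc, hts, one_mul]
    have h3 : t * (-s + 1) ^ 2 = t * (s * s) - t * s - t * s + t := by noncomm_ring
    rw [h3, h2, hts]
    abel
  have hc : Commute t ((-s + 1) ^ 2) :=
    ((Commute.neg_right (hts.trans hst.symm)).add_right (Commute.one_right _)).pow_right 2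
  rw [h1, hc.mul_pow, ← pow_mul, (Commute.one_right (-s)).add_pow, Finset.mul_sum]
  refine Finset.sum_congr rfl fun m _ => ?_
  rw [one_pow, mul_one, neg_pow s, zsmul_eq_mul]
  push_cast
  rw [← mul_assoc, ← mul_assoc, mul_assoc (t ^ d), ← (Nat.cast_commute _ _).eq]
  rcases neg_one_pow_eq_or A m with h | h <;> rw [h] <;>
    simp [mul_assoc, (Nat.cast_commute ((2 * d).choose m) (t ^ d * s ^ m)).eq]

lemma shift_pow (c : ℝ) (n : ℕ) : shift c ^ n = shift (n * c) := by
  induction n with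
  | zero => simp [shift_zero]
  | succ n ih => rw [pow_succ, ih, shift_mul_shift]; congr 1; push_cast; ring

lemma exists_secDiff_pow (d : ℕ) : ∃ c : ℤ → ℝ, c d ≠ 0 ∧ c (-d) ≠ 0 ∧
    (fwd - bwd) ^ d = ∑ l ∈ Finset.Icc (-(d : ℤ)) d, mulBy (C (c l)) * shift (l : ℝ) := by
  refine ⟨fun l => (-1) ^ (l + d).toNat * ((2 * d).choose (l + d).toNat : ℝ), ?_, ?_, ?_⟩
  · simp [show ((d : ℤ) + d).toNat = 2 * d by omega]
  · simp
  · have h1 : shift (-1) * shift 1 = 1 := by rw [shift_mul_shift]; simp [shift_zero]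
    have h2 : shift 1 * shift (-1) = 1 := by rw [shift_mul_shift]; simp [shift_zero]
    refine (sub_pow_of_mul_eq_one h1 h2 d).trans ?_
    refine Finset.sum_bij' (fun m _ => (m : ℤ) - d) (fun l _ => (l + d).toNat) ?_ ?_ ?_ ?_ ?_
    · intro m hm; simp at hm ⊢; omega
    · intro l hl; simp at hl ⊢; omega
    · intro m hm; simp
    · intro l hl; simp at hl ⊢; omega
    · intro m hm
      dsimp only
      rw [shift_pow, shift_pow, shift_mul_shift, mulBy_C, smul_mul_assoc, one_mul,
        show ((m : ℤ) - d + d).toNat = m by omega, ← Int.cast_smul_eq_zsmul ℝ]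
      congr 1
      · push_cast; ring
      · congr 1; push_cast; ring

lemma degree_shift_sub_lt (c : ℝ) (d : ℕ) :
    (shift c (X ^ d) - X ^ d).degree < (d : WithBot ℕ) := by
  have h1 : (shift c (X ^ d) : ℝ[X]).degree = (X ^ d : ℝ[X]).degree := degree_taylor _ _
  have h2 := degree_sub_lt_left h1 (fun h => by
    have := (taylor_eq_zero c (X ^ d : ℝ[X])).1 h
    exact pow_ne_zero d X_ne_zero this) (leadingCoeff_taylor _ _)
  rwa [h1, degree_X_pow] at h2

lemma secDiff_mul_mulBy (d : ℕ) :
    (fwd - bwd) * mulBy (X ^ d) - mulBy (X ^ d) * (fwd - bwd) ∈ diffFil 1 d := by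
  have h1 : (fwd - bwd) * mulBy (X ^ d) - mulBy (X ^ d) * (fwd - bwd) =
      mulBy (shift 1 (X ^ d) - X ^ d) * shift ((1 : ℤ) : ℝ) +
        mulBy (shift (-1) (X ^ d) - X ^ d) * shift ((-1 : ℤ) : ℝ) := by
    simp only [fwd, bwd, mulBy_sub, sub_mul, mul_sub, shift_mul_mulBy, mul_one, one_mul,
      Int.cast_one, Int.cast_neg]
    abel
  rw [h1]
  exact add_mem (mem_diffFil (by simp) (degree_shift_sub_lt _ _))
    (mem_diffFil (by simp) (degree_shift_sub_lt _ _))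

lemma mem_diffFil_mulBy {f : ℝ[X]} {e : ℕ} (hf : f.degree < e) : mulBy f ∈ diffFil 0 e := by
  have := mem_diffFil (r := 0) (l := 0) (by simp) hf
  rwa [Int.cast_zero, shift_zero, mul_one] at this

lemma degree_linear_lt (c d : ℝ) : (C c * X + C d : ℝ[X]).degree < (2 : ℕ) :=
  degree_linear_le.trans_lt (by norm_num)

lemma mulBy_linear_mem (c d : ℝ) {T : Module.End ℝ ℝ[X]} (hT : T ∈ diffFil 1 1) :
    mulBy (C c * X + C d) * T ∈ diffFil 1 2 :=
  diffFil_mono (show 0 + 1 ≤ 1 by norm_num) (show 1 + 1 ≤ 2 by norm_num)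
    (diffFil_mul (mem_diffFil_mulBy (degree_linear_lt c d)) hT)

lemma opH_sub_mem (a N : ℝ) : opH a N - mulBy (X ^ 2) * (fwd - bwd) ∈ diffFil 1 2 := by
  have h1 : opH a N - mulBy (X ^ 2) * (fwd - bwd) =
      mulBy (C (a + 1 - N) * X + C (-(a + 1) * N)) * fwd +
        mulBy (C (a + N + 1) * X + C 0) * bwd := by
    rw [opH, show (X + C (a + 1)) * (X - C N) =
      X ^ 2 + (C (a + 1 - N) * X + C (-(a + 1) * N)) by simp; ring,
      show X * (X - C (a + N + 1)) = X ^ 2 - (C (a + N + 1) * X + C 0) by simp; ring, mulBy_add _ _,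
      mulBy_sub]
    simp only [add_mul, sub_mul, mul_sub]
    abel
  rw [h1]
  exact add_mem (mulBy_linear_mem _ _ fwd_mem) (mulBy_linear_mem _ _ bwd_mem)

lemma opH_mem (a N : ℝ) : opH a N ∈ diffFil 1 3 := by
  rw [← sub_add_cancel (opH a N) (mulBy (X ^ 2) * (fwd - bwd))]
  refine add_mem (diffFil_mono le_rfl (by norm_num) (opH_sub_mem a N)) ?_
  refine diffFil_mono (show 0 + 1 ≤ 1 by norm_num) (show 2 + 1 ≤ 3 by norm_num)
    (diffFil_mul (mem_diffFil_mulBy ?_) (sub_mem fwd_mem bwd_mem))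
  rw [degree_X_pow]; norm_num

lemma mul_sub_mul_mul_mul {A : Type*} [Ring A] (H H' S B δ δ' : A) :
    H * H' - S * B * (δ * δ') = H * (H' - B * δ') + (H - S * δ) * (B * δ') +
      S * ((δ * B - B * δ) * δ') := by
  noncomm_ring

lemma opH_pow_sub_mem (a N : ℝ) (d : ℕ) :
    opH a N ^ d - mulBy (X ^ (2 * d)) * (fwd - bwd) ^ d ∈ diffFil d (2 * d) := by
  induction d with
  | zero => simp [mulBy_one]
  | succ d ih =>
    have hX : ∀ k : ℕ, mulBy (X ^ k) ∈ diffFil 0 (k + 1) := fun k => mem_diffFil_mulBy (by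
      rw [degree_X_pow]; exact_mod_cast Nat.lt_succ_self k)
    have hδ : (fwd - bwd) ^ d ∈ diffFil d 1 := by
      have := diffFil_pow (e := 0) (sub_mem fwd_mem bwd_mem) d
      simpa using this
    have h1 := diffFil_mul (opH_mem a N) ih
    have h2 := diffFil_mul (e := 1) (opH_sub_mem a N) (diffFil_mul (hX (2 * d)) hδ)
    have h3 := diffFil_mul (hX 2) (diffFil_mul_le (r'' := 1 + d) (e'' := 2 * d)
      (secDiff_mul_mulBy (2 * d)) hδ le_rfl le_rfl)
    rw [show (X ^ (2 * (d + 1)) : ℝ[X]) = X ^ 2 * X ^ (2 * d) by ring, ← mulBy_mul_mulBy,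
        pow_succ' (opH a N), pow_succ' (fwd - bwd), mul_sub_mul_mul_mul]
    refine add_mem (add_mem ?_ ?_) ?_
    · exact diffFil_mono (by omega) (by omega) h1
    · exact diffFil_mono (by omega) (by omega) h2
    · exact diffFil_mono (by omega) (by omega) h3

lemma opK_mem (a N : ℝ) (b : Bool) : opK a N b ∈ diffFil 1 2 := by
  have hc : ∀ c : ℝ, mulBy (C c) ∈ diffFil 1 2 := fun c =>
    diffFil_mono (by norm_num) (by norm_num) (mem_diffFil_mulBy (e := 1)
      (degree_C_le.trans_lt (by norm_num)))
  have h1 : ∀ (c : ℝ) {T : Module.End ℝ ℝ[X]}, T ∈ diffFil 1 1 →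
      mulBy (X + C c) * T ∈ diffFil 1 2 := fun c T hT => by
    have := mulBy_linear_mem 1 c hT
    rwa [C_1, one_mul] at this
  have h2 : ∀ (c : ℝ) {T : Module.End ℝ ℝ[X]}, T ∈ diffFil 1 1 →
      mulBy (X - C c) * T ∈ diffFil 1 2 := fun c T hT => by
    have := h1 (-c) hT
    rwa [C_neg, ← sub_eq_add_neg] at this
  rw [opK]
  split_ifs
  · refine add_mem (add_mem (hc _) ?_) (add_mem (hc _) (h2 _ fwd_mem))
    have := h1 0 bwd_mem
    rwa [C_0, add_zero] at this
  · exact add_mem (add_mem (hc _) (h1 _ fwd_mem)) (add_mem (hc _) (h2 _ bwd_mem))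

lemma row_mem {a N : ℝ} {F G : Finset ℕ} {D : ℕ} {μ : Fin (cnt F + cnt G) → ℝ[X]}
    (hμ : ∀ i, (μ i).natDegree + kRow F G i ≤ D) (i : Fin (cnt F + cnt G)) :
    aeval (opH a N) (μ i) * opK a N (bRow F G i) * aeval (opH a N) (polyR a N F G i) ∈
      diffFil (D + 1) (2 * (D + 1)) := by
  have hY : (polyR a N F G i).natDegree ≤ kRow F G i := by
    have := (leadLe_psiRow a N F G i).natDegree_le
    rwa [psiRow, natDegree_comp, natDegree_X_sub_C, mul_one] at this
  have h1 := aeval_mem_diffFil (opH_mem a N) (le_refl (μ i).natDegree)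
  have h2 := aeval_mem_diffFil (opH_mem a N) hY
  have := hμ i
  exact diffFil_mul_le (diffFil_mul_le h1 (opK_mem a N (bRow F G i)) le_rfl
    (e'' := (μ i).natDegree * 2 + 2) (by omega)) h2 (by omega) (by omega)

lemma aeval_opH_sub_mem (a N : ℝ) {D : ℕ} {P : ℝ[X]} (hP : P.natDegree = D + 1) :
    (1 / 2 : ℝ) • aeval (opH a N) P -
      (1 / 2 * P.leadingCoeff) • (mulBy (X ^ (2 * (D + 1))) * (fwd - bwd) ^ (D + 1)) ∈
      diffFil (D + 1) (2 * (D + 1)) := by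
  have h1 : aeval (opH a N) P = aeval (opH a N) P.eraseLead +
      P.leadingCoeff • opH a N ^ (D + 1) := by
    conv_lhs => rw [← eraseLead_add_C_mul_X_pow P]
    rw [map_add, map_mul, aeval_C, map_pow, aeval_X, hP, Algebra.smul_def]
  have h2 := aeval_mem_diffFil (opH_mem a N) (n := D)
    ((eraseLead_natDegree_le P).trans (by omega))
  rw [h1, smul_add, smul_smul, add_sub_assoc,
    ← smul_sub (1 / 2 * P.leadingCoeff) (opH a N ^ (D + 1))]
  exact add_mem (Submodule.smul_mem _ _ (diffFil_mono (by omega) (by omega) h2))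
    (Submodule.smul_mem _ _ (opH_pow_sub_mem a N (D + 1)))

/-- The operator `D_S` has order `2 deg P_S`, as all its other terms have lower degree. -/
lemma hasOrder_opSR {a N : ℝ} {F G : Finset ℕ} {D : ℕ} {μ : Fin (cnt F + cnt G) → ℝ[X]}
    (hμ : ∀ i, (μ i).natDegree + kRow F G i ≤ D) {P : ℝ[X]} (hP : P.natDegree = D + 1) :
    HasOrder (opSR a N F G μ P) (2 * (D + 1)) := by
  obtain ⟨h, h1, h2⟩ := exists_sum_of_mem_diffFil (add_mem (aeval_opH_sub_mem a N hP)
    (sum_mem fun i _ => row_mem hμ i))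
  obtain ⟨c, c1, c2, c3⟩ := exists_secDiff_pow (D + 1)
  have hP0 : P.leadingCoeff ≠ 0 := by
    rw [Ne, leadingCoeff_eq_zero]; rintro rfl; simp at hP
  have hne : ∀ l, c l ≠ 0 →
      C (1 / 2 * P.leadingCoeff * c l) * X ^ (2 * (D + 1)) + h l ≠ 0 := by
    intro l hl h0
    have h3 := congrArg (fun p => coeff p (2 * (D + 1))) h0
    simp only [coeff_add, coeff_C_mul, coeff_X_pow, if_true, coeff_zero,
      coeff_eq_zero_of_degree_lt (h1 l), mul_one, add_zero] at h3
    exact mul_ne_zero (mul_ne_zero (by norm_num) hP0) hl h3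
  refine ⟨-(D + 1 : ℕ), (D + 1 : ℕ), fun l => C (1 / 2 * P.leadingCoeff * c l) *
    X ^ (2 * (D + 1)) + h l, by omega, hne _ c2, hne _ c1, ?_, by push_cast; ring⟩
  have h3 : opSR a N F G μ P = (1 / 2 * P.leadingCoeff) • (mulBy (X ^ (2 * (D + 1))) *
      (fwd - bwd) ^ (D + 1)) + ((1 / 2 : ℝ) • aeval (opH a N) P -
      (1 / 2 * P.leadingCoeff) • (mulBy (X ^ (2 * (D + 1))) * (fwd - bwd) ^ (D + 1)) +
      ∑ i, aeval (opH a N) (μ i) * opK a N (bRow F G i) * aeval (opH a N) (polyR a N F G i)) := by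
    rw [opSR]; abel
  rw [h3, h2, c3, Finset.mul_sum, Finset.smul_sum, ← Finset.sum_add_distrib]
  refine Finset.sum_congr rfl fun l _ => ?_
  rw [mulBy_add, add_mul, ← mul_assoc, mulBy_mul_mulBy, ← smul_mul_assoc, smul_mulBy]
  congr 3
  rw [C_mul (a := 1 / 2 * P.leadingCoeff)]; ring

/-! ### Hahn polynomials and first-order operators -/

/-- A polynomial of degree less than `m` is a combination of polynomials of degrees
`0, …, m - 1`. -/
lemma exists_sum_of_degree {q : ℕ → ℝ[X]} {m : ℕ} (hq : ∀ j < m, (q j).degree = j) {f : ℝ[X]}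
    (hf : f.degree < m) : ∃ e : ℕ → ℝ, f = ∑ j ∈ Finset.range m, C (e j) * q j := by
  induction m generalizing f with
  | zero =>
    refine ⟨0, ?_⟩
    rw [Finset.sum_range_zero]
    exact degree_eq_bot.1 (by simpa [Nat.WithBot.lt_zero_iff] using hf)
  | succ m ih =>
    have hm := hq m m.lt_succ_self
    have hm0 : (q m).coeff m ≠ 0 := coeff_ne_zero_of_eq_degree hm
    have h1 : (f - C (f.coeff m / (q m).coeff m) * q m).degree < m := by
      rw [degree_lt_iff_coeff_zero]
      intro i hi
      rw [coeff_sub, coeff_C_mul]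
      rcases hi.eq_or_lt with rfl | hi
      · rw [div_mul_cancel₀ _ hm0, sub_self]
      · have h1 : (q m).degree < i := by rw [hm]; exact_mod_cast hi
        have h2 : f.degree < i := hf.trans_le (by exact_mod_cast hi)
        rw [coeff_eq_zero_of_degree_lt h1, coeff_eq_zero_of_degree_lt h2, mul_zero, sub_zero]
    obtain ⟨e, he⟩ := ih (fun j hj => hq j (hj.trans m.lt_succ_self)) h1
    refine ⟨Function.update e m (f.coeff m / (q m).coeff m), ?_⟩
    rw [Finset.sum_range_succ, Function.update_self, ← sub_eq_iff_eq_add, he]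
    refine Finset.sum_congr rfl fun j hj => ?_
    rw [Function.update_of_ne (Finset.mem_range.1 hj).ne]

/-- The basis `(-x)_j` in which the Hahn polynomials are defined. -/
def bp (j : ℕ) : ℝ[X] := poch (-X : ℝ[X]) j

lemma bp_succ (j : ℕ) : bp (j + 1) = bp j * (-X + (j : ℝ[X])) := poch_succ _ _

lemma bp_zero : bp 0 = 1 := poch_zero _

lemma degree_bp (j : ℕ) : (bp j).degree = j := by
  induction j with
  | zero => rw [bp_zero, degree_one]; rfl
  | succ j ih =>
    rw [bp_succ, degree_mul, ih, ← C_eq_natCast, ← degree_neg, neg_add, neg_neg, ← C_neg,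
      degree_X_add_C]
    rfl

lemma shift_apply (c : ℝ) (p : ℝ[X]) : shift c p = p.comp (X + C c) := rfl

lemma mulBy_apply (f p : ℝ[X]) : mulBy f p = f * p := rfl

lemma eval_shift (c : ℝ) (p : ℝ[X]) (x : ℝ) : (shift c p).eval x = p.eval (x + c) := by
  simp [shift_apply]

lemma shift_mul (c : ℝ) (p q : ℝ[X]) : shift c (p * q) = shift c p * shift c q :=
  taylor_mul c p q

lemma fwd_apply (p : ℝ[X]) : fwd p = shift 1 p - p := rfl

lemma bwd_apply (p : ℝ[X]) : bwd p = p - shift (-1) p := rfl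

lemma shift_bp (c : ℝ) (j : ℕ) : shift c (bp j) = poch (-X - C c) j := by
  rw [shift_apply, bp, ← coe_compRingHom_apply, map_poch]
  congr 1
  simp; ring

lemma fwd_bp (j : ℕ) : fwd (bp (j + 1)) = C (-(j + 1 : ℝ)) * bp j := by
  rw [fwd_apply, shift_bp, poch_succ_left, C_1, sub_add_cancel, bp_succ, bp, C_neg, C_add,
    C_eq_natCast, C_1]
  ring

lemma mul_fwd_bp (r : ℝ) (j : ℕ) :
    (X - C r) * fwd (bp j) = C (j : ℝ) * bp j + C (-(j * (j - 1 - r))) * bp (j - 1) := by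
  cases j with
  | zero => rw [bp_zero, fwd_apply, shift_apply]; simp
  | succ j =>
    rw [fwd_bp, bp_succ, Nat.add_sub_cancel]
    simp only [C_neg, C_add, C_mul, C_sub, C_1, Nat.cast_add, Nat.cast_one, C_eq_natCast]
    ring

lemma X_mul_bwd_bp (j : ℕ) : X * bwd (bp j) = C (j : ℝ) * bp j := by
  have h1 := poch_succ_left (-X : ℝ[X]) j
  rw [poch_succ] at h1
  rw [bwd_apply, shift_bp, C_neg, C_1, sub_neg_eq_add, C_eq_natCast, bp]
  linear_combination -h1

lemma opH_apply (a N : ℝ) (p : ℝ[X]) :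
    opH a N p = (X + C (a + 1)) * (X - C N) * fwd p - X * (X - C (a + N + 1)) * bwd p := rfl

lemma opH_bp (a N : ℝ) (j : ℕ) : opH a N (bp j) =
    C ((j : ℝ) * (j + 2 * a + 1)) * bp j + C (-(j * (j - 1 - N) * (j + a))) * bp (j - 1) := by
  have h1 := mul_fwd_bp N j
  have h2 := X_mul_bwd_bp j
  rw [opH_apply]
  cases j with
  | zero =>
    rw [mul_assoc, h1, mul_assoc, mul_comm (X - C (a + N + 1)), ← mul_assoc, h2]; simp
  | succ j =>
    rw [Nat.add_sub_cancel, bp_succ] at *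
    simp only [C_neg, C_add, C_mul, C_sub, C_1, Nat.cast_add, Nat.cast_one, C_eq_natCast, C_ofNat]
      at *
    linear_combination (X + C a + 1) * h1 - (X - (C a + C N + 1)) * h2

lemma map_C_mul (T : ℝ[X] →ₗ[ℝ] ℝ[X]) (c : ℝ) (p : ℝ[X]) : T (C c * p) = C c * T p := by
  rw [← smul_eq_C_mul, map_smul, smul_eq_C_mul]

/-- A linear operator that is lower triangular with two diagonals in the basis `bp`. -/
lemma apply_sum_bp {T : ℝ[X] →ₗ[ℝ] ℝ[X]} {α β : ℕ → ℝ} (hβ : β 0 = 0)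
    (hT : ∀ j, T (bp j) = C (α j) * bp j + C (β j) * bp (j - 1)) {c : ℕ → ℝ} {m : ℕ}
    (hc : c m = 0) : T (∑ j ∈ Finset.range m, C (c j) * bp j) =
      ∑ j ∈ Finset.range m, C (α j * c j + β (j + 1) * c (j + 1)) * bp j := by
  have h1 : ∀ m, T (∑ j ∈ Finset.range m, C (c j) * bp j) =
      ∑ j ∈ Finset.range m, C (α j * c j + β (j + 1) * c (j + 1)) * bp j -
        C (β m * c m) * bp (m - 1) := by
    intro m
    induction m with
    | zero => simp [hβ]
    | succ m ih =>
      rw [Finset.sum_range_succ, map_add, ih, Finset.sum_range_succ, map_C_mul, hT,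
        Nat.add_sub_cancel]
      simp only [C_add, C_mul]
      ring
  rw [h1, hc]; simp

lemma degree_opH_sub_lt (a N : ℝ) {f : ℝ[X]} {m : ℕ} (hf : f.degree ≤ m) :
    (opH a N f - C ((m : ℝ) * (m + 2 * a + 1)) * f).degree < m := by
  obtain ⟨e, rfl⟩ := exists_sum_of_degree (m := m + 1) (fun j _ => degree_bp j)
    (hf.trans_lt (by exact_mod_cast m.lt_succ_self))
  rw [map_sum, Finset.mul_sum, ← Finset.sum_sub_distrib]
  refine (degree_sum_le _ _).trans_lt ((Finset.sup_lt_iff (WithBot.bot_lt_coe m)).2 fun j hj => ?_)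
  have hj' : j ≤ m := Nat.lt_succ_iff.1 (Finset.mem_range.1 hj)
  have h1 : opH a N (C (e j) * bp j) - C ((m : ℝ) * (m + 2 * a + 1)) * (C (e j) * bp j) =
      C (e j * (j * (j + 2 * a + 1) - m * (m + 2 * a + 1))) * bp j +
      C (e j * -(j * (j - 1 - N) * (j + a))) * bp (j - 1) := by
    rw [map_C_mul, opH_bp]
    simp only [C_add, C_mul, C_sub]; ring
  rw [h1]
  have hlow : ∀ (c : ℝ) (i : ℕ), i < m → (C c * bp i).degree < m := fun c i hi => by
    rw [← smul_eq_C_mul]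
    exact (degree_smul_le _ _).trans_lt (by rw [degree_bp]; exact_mod_cast hi)
  refine (degree_add_le _ _).trans_lt (max_lt ?_ ?_)
  · rcases hj'.eq_or_lt with rfl | hj'
    · rw [sub_self, mul_zero, C_0, zero_mul, degree_zero]; exact WithBot.bot_lt_coe _
    · exact hlow _ _ hj'
  · rcases Nat.eq_zero_or_pos j with rfl | h
    · simp [WithBot.bot_lt_coe]
    · exact hlow _ _ (by omega)

/-- The parameters for which all denominators that depend on an integer are nonzero. -/
structure Generic (a N : ℝ) : Prop where
  a_ne : ∀ k : ℤ, a ≠ k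
  N_ne : ∀ k : ℤ, N ≠ k
  aN_ne : ∀ k : ℤ, a + N ≠ k
  two_a_ne : ∀ k : ℤ, 2 * a ≠ k
  two_aN_ne : ∀ k : ℤ, 2 * a + N ≠ k

lemma poch_ne_zero {z : ℝ} (hz : ∀ k : ℤ, z ≠ k) (n : ℕ) : poch z n ≠ 0 := by
  rw [poch_eq_prod, Finset.prod_ne_zero_iff]
  intro i _ h
  exact hz (-i) (by push_cast; linarith)

lemma eq_zero_of_opH_eq {a N : ℝ} (h : ∀ k : ℤ, 2 * a ≠ k) {n : ℕ} {f : ℝ[X]}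
    (hf : f.degree < n) (hf' : opH a N f = C ((n : ℝ) * (n + 2 * a + 1)) * f) : f = 0 := by
  by_contra h0
  have h1 := degree_opH_sub_lt a N (degree_le_natDegree (p := f))
  set m := f.natDegree
  rw [hf', ← sub_mul, ← C_sub, ← smul_eq_C_mul, degree_smul_of_smul_regular, degree_eq_natDegree h0]
    at h1
  · exact lt_irrefl _ h1
  · refine IsSMulRegular.of_ne_zero ?_
    have hm : m < n := by rwa [degree_eq_natDegree h0, Nat.cast_lt] at hf
    have h2 : (n : ℝ) - m ≠ 0 := sub_ne_zero.2 (by exact_mod_cast hm.ne')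
    have h3 : (n : ℝ) + m + 2 * a + 1 ≠ 0 := fun h3 => h (-(n + m + 1)) (by push_cast; linarith)
    have h4 : (n : ℝ) * (n + 2 * a + 1) - m * (m + 2 * a + 1) =
      (n - m) * (n + m + 2 * a + 1) := by ring
    rw [h4]; exact mul_ne_zero h2 h3

/-- The coefficient of `h_n^{a,a,N}` at `bp j`. -/
def cH (a N : ℝ) (n j : ℕ) : ℝ :=
  if j ≤ n then poch (N - n + 1) (n - j) * poch (a + a + 1) (j + n) /
      (poch (2 + a + a + N) n * poch (a + 1) j * (n - j).factorial * j.factorial) else 0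

lemma hahn_eq_sum (a N : ℝ) {n m : ℕ} (h : n < m) :
    hahn a a N n = ∑ j ∈ Finset.range m, C (cH a N n j) * bp j := by
  rw [hahn, ← Finset.sum_subset (Finset.range_subset_range.2 h)]
  · exact Finset.sum_congr rfl fun j hj => by
      rw [cH, if_pos (Nat.lt_succ_iff.1 (Finset.mem_range.1 hj))]; rfl
  · intro j _ hj
    rw [cH, if_neg (by simpa using hj), C_0, zero_mul]

lemma cH_succ_left {a N : ℝ} (hg : Generic a N) (n j : ℕ) :
    (n + 1 - j) * (2 * a + N + n + 2) * cH a N (n + 1) j =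
      (N - n) * (2 * a + n + 1 + j) * cH a N n j := by
  rcases lt_trichotomy j (n + 1) with h | rfl | h
  · obtain ⟨m, rfl⟩ := Nat.exists_eq_add_of_le (Nat.lt_succ_iff.1 h)
    have h1 : poch (2 + a + a + N) (j + m + 1) ≠ 0 := poch_ne_zero (fun k hk =>
      hg.two_aN_ne (k - 2) (by push_cast; linarith)) _
    have h2 : poch (a + 1) j ≠ 0 := poch_ne_zero (fun k hk =>
      hg.a_ne (k - 1) (by push_cast; linarith)) _
    rw [cH, cH, if_pos (by omega), if_pos (by omega), show j + m + 1 - j = m + 1 by omega,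
      show j + m - j = m by omega, show j + (j + m + 1) = (j + (j + m)) + 1 by ring,
      poch_succ (a + a + 1), poch_succ_left (N - _ + 1), Nat.factorial_succ]
    rw [poch_succ (2 + a + a + N)] at h1 ⊢
    have h3 := left_ne_zero_of_mul h1
    have h4 := right_ne_zero_of_mul h1
    push_cast at *
    rw [show N - ((j : ℝ) + m + 1) + 1 + 1 = N - (j + m) + 1 by ring]
    field_simp
    ring
  · rw [cH, cH, if_pos le_rfl, if_neg (by omega)]; push_cast; ring
  · rw [cH, cH, if_neg (by omega), if_neg (by omega)]; ring

lemma cH_succ_right {a N : ℝ} (hN : ∀ n, poch (2 + a + a + N) n ≠ 0)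
    (ha : ∀ n, poch (a + 1) n ≠ 0) (n j : ℕ) :
    (N - j) * (a + 1 + j) * (j + 1) * cH a N n (j + 1) =
      (2 * a + 1 + j + n) * (n - j) * cH a N n j := by
  rcases lt_trichotomy j n with h | rfl | h
  · obtain ⟨m, rfl⟩ := Nat.exists_eq_add_of_lt h
    have h1 : poch (2 + a + a + N) (j + m + 1) ≠ 0 := hN _
    have h2 : poch (a + 1) (j + 1) ≠ 0 := ha _
    rw [cH, cH, if_pos (by omega), if_pos (by omega), show j + m + 1 - j = m + 1 by omega,
      show j + m + 1 - (j + 1) = m by omega,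
      show j + 1 + (j + m + 1) = (j + (j + m + 1)) + 1 by ring,
      poch_succ (a + a + 1), poch_succ (N - _ + 1) m, Nat.factorial_succ, Nat.factorial_succ]
    rw [poch_succ (a + 1)] at h2 ⊢
    have h3 := left_ne_zero_of_mul h2
    have h4 := right_ne_zero_of_mul h2
    push_cast at *
    field_simp
    ring
  · rw [cH, if_neg (by omega)]; ring
  · rw [cH, cH, if_neg (by omega), if_neg (by omega)]; ring

lemma opH_hahn_of_poch_ne_zero {a N : ℝ} (hN : ∀ n, poch (2 + a + a + N) n ≠ 0)
    (ha : ∀ n, poch (a + 1) n ≠ 0) (n : ℕ) :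
    opH a N (hahn a a N n) = C ((n : ℝ) * (n + 2 * a + 1)) * hahn a a N n := by
  rw [hahn_eq_sum a N n.lt_succ_self, apply_sum_bp (T := opH a N) (by simp) (opH_bp a N)
    (by rw [cH, if_neg (by omega)]), Finset.mul_sum]
  refine Finset.sum_congr rfl fun j _ => ?_
  rw [← mul_assoc, ← C_mul]
  congr 2
  have := cH_succ_right hN ha n j
  push_cast
  linear_combination this

lemma degree_hahn_of_poch_ne_zero {a N : ℝ} (hN : ∀ n, poch (2 + a + a + N) n ≠ 0)
    (ha : ∀ n, poch (a + 1) n ≠ 0) (h2 : ∀ n, poch (a + a + 1) n ≠ 0) (n : ℕ) :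
    (hahn a a N n).degree = n := by
  rw [hahn_eq_sum a N n.lt_succ_self, Finset.sum_range_succ]
  have h0 : cH a N n n ≠ 0 := by
    rw [cH, if_pos le_rfl, Nat.sub_self, poch_zero, one_mul]
    refine div_ne_zero (h2 _) (mul_ne_zero (mul_ne_zero (mul_ne_zero (hN _) (ha _)) ?_) ?_) <;>
    exact_mod_cast Nat.factorial_ne_zero _
  rw [degree_add_eq_right_of_degree_lt, degree_C_mul h0, degree_bp]
  rw [degree_C_mul h0, degree_bp]
  refine (degree_sum_le _ _).trans_lt ((Finset.sup_lt_iff (WithBot.bot_lt_coe n)).2 fun j hj => ?_)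
  rw [← smul_eq_C_mul]
  exact (degree_smul_le _ _).trans_lt (by rw [degree_bp]; exact Nat.cast_lt.2 (Finset.mem_range.1 hj))

lemma Generic.poch_two_aN_ne {a N : ℝ} (hg : Generic a N) (n : ℕ) : poch (2 + a + a + N) n ≠ 0 :=
  poch_ne_zero (fun k hk => hg.two_aN_ne (k - 2) (by push_cast; linarith)) _

lemma Generic.poch_a_ne {a N : ℝ} (hg : Generic a N) (n : ℕ) : poch (a + 1) n ≠ 0 :=
  poch_ne_zero (fun k hk => hg.a_ne (k - 1) (by push_cast; linarith)) _

lemma opH_hahn {a N : ℝ} (hg : Generic a N) (n : ℕ) :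
    opH a N (hahn a a N n) = C ((n : ℝ) * (n + 2 * a + 1)) * hahn a a N n :=
  opH_hahn_of_poch_ne_zero hg.poch_two_aN_ne hg.poch_a_ne n

lemma degree_hahn {a N : ℝ} (hg : Generic a N) (n : ℕ) : (hahn a a N n).degree = n :=
  degree_hahn_of_poch_ne_zero hg.poch_two_aN_ne hg.poch_a_ne
    (poch_ne_zero fun k hk => hg.two_a_ne (k - 1) (by push_cast; linarith)) n

lemma wE_succ {a N : ℝ} (hg : Generic a N) (n : ℕ) :
    wE a N (n + 1 : ℕ) * (2 * a + N + n + 2) = wE a N n * (n - N) := by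
  have h1 : (n : ℝ) - N ≠ 0 := fun h => hg.N_ne n (by push_cast; linarith)
  have h2 : (n : ℝ) + 2 * a + N + 2 ≠ 0 := fun h => hg.two_aN_ne (-n - 2) (by push_cast; linarith)
  have h3 : Real.Gamma (n + 2 * a + N + 2) ≠ 0 := Real.Gamma_ne_zero fun m h =>
    hg.two_aN_ne (-n - 2 - m) (by push_cast; linarith)
  rw [wE_eq, wE_eq, show ((n + 1 : ℕ) : ℝ) - N = n - N + 1 by push_cast; ring,
    show ((n + 1 : ℕ) : ℝ) + 2 * a + N + 2 = n + 2 * a + N + 2 + 1 by push_cast; ring,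
    Real.Gamma_add_one h1, Real.Gamma_add_one h2]
  field_simp
  ring

lemma wE_ne_zero {a N : ℝ} (hg : Generic a N) (n : ℕ) : wE a N n ≠ 0 := by
  rw [wE_eq]
  refine div_ne_zero (Real.Gamma_ne_zero fun m h => hg.N_ne (n + m) (by push_cast; linarith))
    (Real.Gamma_ne_zero fun m h => hg.two_aN_ne (-n - 2 - m) (by push_cast; linarith))

/-- The weight of a row at the integer `n`. -/
def eRow (a N : ℝ) (b : Bool) (n : ℕ) : ℝ := if b then wE a N n else 1

lemma eRow_ne_zero {a N : ℝ} (hg : Generic a N) (b : Bool) (n : ℕ) : eRow a N b n ≠ 0 := by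
  rw [eRow]; split_ifs
  · exact wE_ne_zero hg n
  · exact one_ne_zero

/-- The Hahn polynomials, normalized for the rows with weight `eRow a N b`. -/
def gH (a N : ℝ) (b : Bool) (n : ℕ) : ℝ[X] := C (eRow a N b n)⁻¹ * hahn a a N n

lemma gH_eq_sum (a N : ℝ) (b : Bool) {n m : ℕ} (h : n < m) :
    gH a N b n = ∑ j ∈ Finset.range m, C ((eRow a N b n)⁻¹ * cH a N n j) * bp j := by
  rw [gH, hahn_eq_sum a N h, Finset.mul_sum]
  exact Finset.sum_congr rfl fun j _ => by rw [C_mul, mul_assoc]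

lemma opD1_apply (a : ℝ) (p : ℝ[X]) :
    opD1 a p = C ((2 * a + 1) / 2) * p + X * bwd p := rfl

lemma opD2_apply (a N : ℝ) (p : ℝ[X]) :
    opD2 a N p = C ((2 * a + 1) / 2) * p + (X - C N) * fwd p := rfl

lemma opD3_apply (a : ℝ) (p : ℝ[X]) :
    opD3 a p = C ((2 * a + 1) / 2) * p + (X + C (a + 1)) * fwd p := rfl

lemma opD4_apply (a N : ℝ) (p : ℝ[X]) :
    opD4 a N p = C ((2 * a + 1) / 2) * p + (X - C (a + N + 1)) * bwd p := rfl

/-- The relation `T (g_{n+1} - δ g_n) = s_{n+1} g_{n+1} + δ s_n g_n` with `s_n = n + a + 1/2`,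
which holds for each of `𝒟₁, …, 𝒟₄`. -/
def FirstOrder (a δ : ℝ) (g : ℕ → ℝ[X]) (T : Module.End ℝ ℝ[X]) : Prop :=
  ∀ n : ℕ, T (g (n + 1) - C δ * g n) =
    C (n + 1 + a + 1 / 2) * g (n + 1) + C (δ * (n + a + 1 / 2)) * g n

lemma firstOrder_opD1 {a N : ℝ} (hg : Generic a N) :
    FirstOrder a 1 (gH a N true) (opD1 a) := by
  intro n
  have hT : ∀ j, opD1 a (bp j) = C ((2 * a + 1) / 2 + j) * bp j + C 0 * bp (j - 1) := fun j => by
    rw [opD1_apply, X_mul_bwd_bp, C_0, C_add]; ring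
  rw [gH_eq_sum a N true (n + 1).lt_succ_self, gH_eq_sum a N true (n.lt_succ_self.trans
    (n + 1).lt_succ_self), C_1, one_mul, ← Finset.sum_sub_distrib, Finset.mul_sum, Finset.mul_sum,
    ← Finset.sum_add_distrib]
  simp only [← sub_mul, ← C_sub]
  rw [apply_sum_bp (T := opD1 a) (β := fun _ => 0) rfl hT (by simp [cH])]
  refine Finset.sum_congr rfl fun j _ => ?_
  rw [← mul_assoc, ← mul_assoc, ← C_mul, ← C_mul, ← add_mul, ← C_add]
  congr 2
  have h1 := cH_succ_left hg n j
  have h2 := wE_succ hg n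
  have h3 : 2 * a + N + n + 2 ≠ 0 := fun h => hg.two_aN_ne (-n - 2) (by push_cast; linarith)
  have h4 := wE_ne_zero hg n
  have h5 := wE_ne_zero hg (n + 1)
  simp only [eRow, if_true, zero_mul, add_zero]
  have h6 : (n + 1 - j) * cH a N (n + 1) j * wE a N n =
      -((2 * a + n + 1 + j) * cH a N n j * wE a N (n + 1 : ℕ)) := by
    refine mul_left_cancel₀ h3 ?_
    linear_combination wE a N n * h1 + (2 * a + n + 1 + j) * cH a N n j * h2
  have h7 : (n + 1 - j) * ((wE a N (n + 1 : ℕ))⁻¹ * cH a N (n + 1) j) =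
      -((2 * a + n + 1 + j) * ((wE a N n)⁻¹ * cH a N n j)) := by
    field_simp
    linear_combination h6
  linear_combination -h7

lemma firstOrder_opD3 {a N : ℝ} (hg : Generic a N) :
    FirstOrder a (-1) (gH a N false) (opD3 a) := by
  intro n
  have hT : ∀ j, opD3 a (bp j) = C ((2 * a + 1) / 2 + j) * bp j +
      C (-((j : ℝ) * (j + a))) * bp (j - 1) := fun j => by
    have := mul_fwd_bp (-(a + 1)) j
    rw [C_neg, sub_neg_eq_add] at this
    rw [opD3_apply, this, C_add, show (j : ℝ) - 1 - -(a + 1) = j + a by ring]; ring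
  rw [gH_eq_sum a N false (n + 1).lt_succ_self, gH_eq_sum a N false (n.lt_succ_self.trans
    (n + 1).lt_succ_self), C_neg, C_1, neg_one_mul, sub_neg_eq_add, ← Finset.sum_add_distrib,
    Finset.mul_sum, Finset.mul_sum, ← Finset.sum_add_distrib]
  simp only [← add_mul, ← C_add]
  rw [apply_sum_bp (T := opD3 a) (by simp) hT (by simp [cH])]
  refine Finset.sum_congr rfl fun j _ => ?_
  rw [← mul_assoc, ← mul_assoc, ← C_mul, ← C_mul, ← add_mul, ← C_add]
  congr 2
  have h1 := cH_succ_left hg n j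
  have h2 := cH_succ_right hg.poch_two_aN_ne hg.poch_a_ne n j
  have h3 := cH_succ_right hg.poch_two_aN_ne hg.poch_a_ne (n + 1) j
  have h4 : N - j ≠ 0 := fun h => hg.N_ne j (by push_cast; linarith)
  simp only [eRow, Bool.false_eq_true, if_false, inv_one, one_mul]
  refine mul_left_cancel₀ h4 ?_
  push_cast at *
  linear_combination -h1 - h2 - h3

/-- The reflection `x ↦ N - x`. -/
def refl (N : ℝ) : ℝ[X] →ₗ[ℝ] ℝ[X] := (aeval (C N - X)).toLinearMap

lemma eval_refl (N : ℝ) (p : ℝ[X]) (x : ℝ) : (refl N p).eval x = p.eval (N - x) := by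
  change (p.comp (C N - X)).eval x = _
  simp

lemma eval_fwd (p : ℝ[X]) (x : ℝ) : (fwd p).eval x = p.eval (x + 1) - p.eval x := by
  rw [fwd_apply, eval_sub, eval_shift]

lemma eval_bwd (p : ℝ[X]) (x : ℝ) : (bwd p).eval x = p.eval x - p.eval (x - 1) := by
  rw [bwd_apply, eval_sub, eval_shift, sub_eq_add_neg x]

lemma fwd_refl (N : ℝ) (p : ℝ[X]) : fwd (refl N p) = -refl N (bwd p) := by
  refine Polynomial.funext fun x => ?_
  rw [eval_fwd, eval_neg, eval_refl, eval_refl, eval_refl, eval_bwd,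
    show N - (x + 1) = N - x - 1 by ring]
  ring

lemma bwd_refl (N : ℝ) (p : ℝ[X]) : bwd (refl N p) = -refl N (fwd p) := by
  refine Polynomial.funext fun x => ?_
  rw [eval_bwd, eval_neg, eval_refl, eval_refl, eval_refl, eval_fwd,
    show N - (x - 1) = N - x + 1 by ring]
  ring

lemma refl_mul (N : ℝ) (p q : ℝ[X]) : refl N (p * q) = refl N p * refl N q :=
  map_mul (aeval (C N - X)) p q

lemma refl_C (N c : ℝ) : refl N (C c) = C c := aeval_C _ _

lemma refl_X (N : ℝ) : refl N X = C N - X := aeval_X _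

lemma opH_refl (a N : ℝ) (p : ℝ[X]) : opH a N (refl N p) = refl N (opH a N p) := by
  have h : ∀ p q, refl N (p + q) = refl N p + refl N q := map_add _
  rw [opH_apply, opH_apply, fwd_refl, bwd_refl, map_sub, refl_mul, refl_mul, refl_mul, refl_mul,
    h, map_sub, map_sub, refl_C, refl_C, refl_C, refl_X]
  simp only [C_add, C_1]; ring

lemma opD2_refl (a N : ℝ) (p : ℝ[X]) : opD2 a N (refl N p) = refl N (opD1 a p) := by
  rw [opD2_apply, opD1_apply, fwd_refl, map_add, refl_mul, refl_mul, refl_C, refl_X]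
  ring

lemma opD4_refl (a N : ℝ) (p : ℝ[X]) : opD4 a N (refl N p) = refl N (opD3 a p) := by
  have h : ∀ p q, refl N (p + q) = refl N p + refl N q := map_add _
  rw [opD4_apply, opD3_apply, bwd_refl, h, refl_mul, refl_mul, h, refl_C, refl_C, refl_X]
  simp only [C_add, C_1]; ring

lemma refl_hahn {a N : ℝ} (hg : Generic a N) (n : ℕ) :
    refl N (hahn a a N n) = C ((-1) ^ n) * hahn a a N n := by
  refine sub_eq_zero.1 (eq_zero_of_opH_eq (N := N) hg.two_a_ne (n := n) ?_ ?_)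
  · have h1 : (hahn a a N n).natDegree = n :=
      natDegree_eq_of_degree_eq_some (degree_hahn hg n)
    have h2 := leadLe_of_natDegree h1.le
    have h3 := h2.comp_X_add_C N
    have h4 : refl N (hahn a a N n) = ((hahn a a N n).comp (X + C N)).comp (-X) := by
      change (hahn a a N n).comp (C N - X) = _
      rw [comp_assoc]; congr 1; simp; ring
    rw [degree_lt_iff_coeff_zero]
    intro i hi
    rw [coeff_sub, h4, coeff_comp_neg_X, coeff_C_mul]
    rcases hi.eq_or_lt with rfl | hi
    · rw [h3.coeff_eq, sub_self]
    · rw [h3.1 i (by exact_mod_cast hi), h2.1 i (by exact_mod_cast hi)]; ring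
  · rw [map_sub, opH_refl, map_C_mul, opH_hahn hg, refl_mul, refl_C]; ring

lemma refl_gH {a N : ℝ} (hg : Generic a N) (b : Bool) (n : ℕ) :
    refl N (gH a N b n) = C ((-1) ^ n) * gH a N b n := by
  rw [gH, refl_mul, refl_C, refl_hahn hg]; ring

lemma FirstOrder.refl {a N δ : ℝ} (hg : Generic a N) {b : Bool} {S T : Module.End ℝ ℝ[X]}
    (hS : FirstOrder a δ (gH a N b) S) (hT : ∀ p, T (refl N p) = refl N (S p)) :
    FirstOrder a (-δ) (gH a N b) T := by
  intro n
  have h1 : ((-1 : ℝ) ^ n) * (-1) ^ n = 1 := by rw [← mul_pow]; norm_num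
  have h2 : gH a N b (n + 1) - C (-δ) * gH a N b n =
      KrallHahn.refl N (C ((-1) ^ (n + 1)) * (gH a N b (n + 1) - C δ * gH a N b n)) := by
    rw [refl_mul, map_sub, refl_mul, refl_C, refl_C, refl_gH hg, refl_gH hg]
    have h3 : C ((-1 : ℝ) ^ n) * C ((-1) ^ n) = 1 := by rw [← C_mul, h1, C_1]
    rw [pow_succ, C_mul, C_neg, C_neg, C_1]
    linear_combination (-gH a N b (n + 1) - C δ * gH a N b n) * h3
  rw [h2, hT, map_C_mul, hS n, refl_mul, map_add, refl_mul, refl_mul, refl_C, refl_C, refl_C,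
    refl_gH hg, refl_gH hg]
  have h3 : C ((-1 : ℝ) ^ n) * C ((-1) ^ n) = 1 := by rw [← C_mul, h1, C_1]
  rw [pow_succ, C_mul, C_neg, C_1, neg_mul δ, C_neg]
  linear_combination (C (n + 1 + a + 1 / 2) * gH a N b (n + 1) -
    C (δ * (n + a + 1 / 2)) * gH a N b n) * h3

lemma firstOrder_opD2 {a N : ℝ} (hg : Generic a N) :
    FirstOrder a (-1) (gH a N true) (opD2 a N) :=
  (firstOrder_opD1 hg).refl hg (opD2_refl a N)

lemma firstOrder_opD4 {a N : ℝ} (hg : Generic a N) :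
    FirstOrder a 1 (gH a N false) (opD4 a N) := by
  have := (firstOrder_opD3 hg).refl hg (opD4_refl a N)
  rwa [neg_neg] at this

lemma FirstOrder.add {a : ℝ} {g : ℕ → ℝ[X]} {S T : Module.End ℝ ℝ[X]} (hS : FirstOrder a 1 g S)
    (hT : FirstOrder a (-1) g T) (n : ℕ) : (S + T) (g (n + 2) - g n) =
      C (2 * (n + 2 + a + 1 / 2)) * g (n + 2) + C (2 * (n + a + 1 / 2)) * g n := by
  have h1 := hS n
  have h2 := hS (n + 1)
  have h3 := hT n
  have h4 := hT (n + 1)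
  have h5 : (S + T) (g (n + 2) - g n) = S (g (n + 1) - C 1 * g n) +
      S (g (n + 1 + 1) - C 1 * g (n + 1)) + T (g (n + 1 + 1) - C (-1) * g (n + 1)) -
      T (g (n + 1) - C (-1) * g n) := by
    rw [LinearMap.add_apply]
    have h : ∀ (T : Module.End ℝ ℝ[X]) c p q, T (p - C c * q) = T p - C c * T q :=
      fun T c p q => by rw [map_sub, map_C_mul]
    rw [h, h, h, h, map_sub, map_sub, C_neg, C_1]
    ring
  rw [h5, h1, h2, h3, h4]
  simp only [C_add, C_mul, C_neg, C_1, C_eq_natCast, C_ofNat, Nat.cast_add, Nat.cast_one]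
  ring

lemma opK_gH {a N : ℝ} (hg : Generic a N) (b : Bool) (n : ℕ) :
    opK a N b (gH a N b (n + 2) - gH a N b n) =
      C (2 * (n + 2 + a + 1 / 2)) * gH a N b (n + 2) + C (2 * (n + a + 1 / 2)) * gH a N b n := by
  cases b
  · rw [opK, if_neg (by simp), add_comm]
    exact (firstOrder_opD4 hg).add (firstOrder_opD3 hg) n
  · rw [opK, if_pos rfl]
    exact (firstOrder_opD1 hg).add (firstOrder_opD2 hg) n

/-! ### Eigenfunctions of large degree -/

/-- The sign of `i - j`. -/
def sg (i j : ℕ) : ℝ := if j < i then 1 else if i < j then -1 else 0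

lemma sg_succ_right (i j : ℕ) :
    sg i (j + 1) - sg i j = -(if i = j then 1 else 0) - if i = j + 1 then 1 else 0 := by
  simp only [sg]
  split_ifs <;> first | omega | norm_num

/-- Summation by parts for an operator that is known on the differences `g_j - g_{j+1}`. -/
lemma apply_sum_of_diff {T : Module.End ℝ ℝ[X]} {g r : ℕ → ℝ[X]} {M : ℕ}
    (hT : ∀ j < M, T (g j - g (j + 1)) = r j + r (j + 1)) {x : ℕ → ℝ}
    (hx : ∑ j ∈ Finset.range (M + 1), x j = 0) :
    T (∑ j ∈ Finset.range (M + 1), C (x j) * g j) =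
      ∑ i ∈ Finset.range (M + 1), C (∑ j ∈ Finset.range (M + 1), sg i j * x j) * r i := by
  set Q : ℕ → ℝ[X] := fun j => ∑ i ∈ Finset.range (M + 1), C (sg i j) * r i with hQ
  have h1 : ∀ j ≤ M, T (g j) = Q j + (T (g 0) - Q 0) := by
    intro j
    induction j with
    | zero => intro _; ring
    | succ j ih =>
      intro hj
      have h2 := hT j hj
      rw [map_sub, ih (by omega)] at h2
      have h3 : Q (j + 1) - Q j = -r j - r (j + 1) := by
        rw [hQ]
        simp only
        rw [← Finset.sum_sub_distrib]
        simp only [← sub_mul, ← C_sub, sg_succ_right]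
        simp only [C_sub, C_neg, sub_mul, neg_mul, Finset.sum_sub_distrib, Finset.sum_neg_distrib,
          apply_ite C, C_1, C_0, ite_mul, one_mul, zero_mul, Finset.sum_ite_eq', Finset.mem_range]
        rw [if_pos (by omega), if_pos (by omega)]
      linear_combination -h3 - h2
  rw [map_sum]
  have h2 : ∀ j ∈ Finset.range (M + 1), T (C (x j) * g j) =
      C (x j) * Q j + C (x j) * (T (g 0) - Q 0) := fun j hj => by
    rw [map_C_mul, h1 j (Nat.lt_succ_iff.1 (Finset.mem_range.1 hj))]; ring
  rw [Finset.sum_congr rfl h2, Finset.sum_add_distrib, ← Finset.sum_mul, ← map_sum, hx, C_0,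
    zero_mul, add_zero]
  simp only [hQ, Finset.mul_sum, map_sum, Finset.sum_mul]
  rw [Finset.sum_comm]
  refine Finset.sum_congr rfl fun i _ => Finset.sum_congr rfl fun j _ => ?_
  rw [C_mul]; ring

/-- The sign with which the window `k` enters at the index `i`. -/
def wSgn (i k : ℕ) : ℝ := if i ≤ k then 1 else -1

/-- Inside the window that contains the indices `i - k, …, i - k + M - 1`, the vector `V` selects
the index `i`; the relation allows to change the signs outside the window to zero. -/
lemma sum_window {M : ℕ} {φ : Fin M → ℕ → ℝ} {c : ℕ → ℝ}
    (h0 : ∀ h, ∑ j ∈ Finset.range (M + 1), c j * φ h j = 0) {A : Matrix (Fin M) (Fin M) ℝ}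
    {V : Fin M → ℝ} {k : Fin M} (hV : ∀ l, ∑ h, V h * A h l = if l = k then 1 else 0) {i : ℕ}
    (hi : i ≤ M) (hA : ∀ h (l : Fin M), ∀ j ≤ M, (l : ℕ) + i = k + j → A h l = φ h j) :
    ∑ h, V h * ∑ j ∈ Finset.range (M + 1), sg i j * (c j * φ h j) = wSgn i k * c i := by
  have h1 : ∀ h, ∑ j ∈ Finset.range (M + 1), sg i j * (c j * φ h j) =
      ∑ j ∈ Finset.range (M + 1), (sg i j + wSgn i k) * (c j * φ h j) := fun h => by
    simp only [add_mul, Finset.sum_add_distrib]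
    rw [← Finset.mul_sum _ _ (wSgn i k), h0, mul_zero, add_zero]
  simp only [h1, Finset.mul_sum]
  rw [Finset.sum_comm]
  have h2 : ∀ j ∈ Finset.range (M + 1),
      ∑ h, V h * ((sg i j + wSgn i k) * (c j * φ h j)) =
        if j = i then wSgn i k * c i else 0 := by
    intro j hj
    have hj' := Nat.lt_succ_iff.1 (Finset.mem_range.1 hj)
    have hk := k.2
    by_cases hl : i ≤ k + j ∧ k + j - i < M
    · have e1 : ∀ h, A h ⟨k + j - i, hl.2⟩ = φ h j := fun h => hA h _ j hj' (by
        simp only; omega)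
      have e2 := hV ⟨k + j - i, hl.2⟩
      simp only [e1] at e2
      have e3 : ∑ h, V h * ((sg i j + wSgn i k) * (c j * φ h j)) =
          (sg i j + wSgn i k) * c j * ∑ h, V h * φ h j := by
        rw [Finset.mul_sum]; exact Finset.sum_congr rfl fun h _ => by ring
      rw [e3, e2]
      by_cases hji : j = i
      · subst hji
        rw [if_pos (by ext; simp), if_pos rfl, sg, if_neg (lt_irrefl _), if_neg (lt_irrefl _)]
        ring
      · rw [if_neg (fun h => hji (by have := congrArg Fin.val h; simp only at this; omega)),
          if_neg hji, mul_zero]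
    · have e1 : sg i j + wSgn i k = 0 := by
        simp only [sg, wSgn]
        split_ifs <;> first | omega | norm_num
      rw [if_neg (by rintro rfl; omega)]
      exact Finset.sum_eq_zero fun h _ => by rw [e1]; ring
  rw [Finset.sum_congr rfl h2, Finset.sum_ite_eq', if_pos (Finset.mem_range.2 (by omega))]

/-- The eigenvalue contributions of the windows telescope. -/
lemma sum_wSgn_sub {M i : ℕ} (hi : i < M) (u : ℕ → ℝ) :
    ∑ k ∈ Finset.range M, wSgn i k * u (k + 1) - ∑ k ∈ Finset.range M, wSgn (i + 1) k * u k =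
      u 0 + u M := by
  obtain ⟨m, rfl⟩ : ∃ m, M = m + 1 := ⟨M - 1, by omega⟩
  rw [Finset.sum_range_succ, Finset.sum_range_succ' (fun k => wSgn (i + 1) k * u k)]
  have h1 : ∀ k, wSgn (i + 1) (k + 1) = wSgn i k := fun k => by simp [wSgn]
  simp only [h1]
  have h2 : wSgn i m = 1 := if_pos (by omega)
  have h3 : wSgn (i + 1) 0 = -1 := if_neg (by omega)
  rw [h2, h3]; ring

/-- The value at the integer `n` of the weighted row `h`. -/
def rowVal (a N : ℝ) (F G : Finset ℕ) (h : Fin (cnt F + cnt G)) (n : ℕ) : ℝ :=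
  eRow a N (bRow F G h) n * (polyR a N F G h).eval (n * (n + 2 * a + 1))

lemma fMat_eq_rowVal {a N : ℝ} {F G : Finset ℕ} {t : ℝ} {l : Fin (cnt F + cnt G)} {n : ℕ}
    (h : t = n + 2 * (l : ℕ)) (i : Fin (cnt F + cnt G)) :
    fMat (N + a + 1) (bRow F G) (psiRow a N F G) (t + a + 1 / 2) i l = rowVal a N F G i n := by
  subst h
  rw [fMat, Matrix.of_apply, show (n : ℝ) + 2 * (l : ℕ) + a + 1 / 2 - 2 * (l : ℕ) =
    n + a + 1 / 2 by ring, eval_psiRow]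
  rfl

/-- The values of `M̃_h`, in terms of the inverses of the window matrices. -/
lemma IsMt.eval_eq {a N : ℝ} {F G : Finset ℕ} (hg : gCore a N F G ≠ 0)
    {μ : Fin (cnt F + cnt G) → ℝ[X]} (hμ : ∀ i, IsMt a N F G i (μ i)) :
    ∀ᶠ x in atTop, (∀ k : Fin (cnt F + cnt G), IsUnit (fMat (N + a + 1) (bRow F G)
        (psiRow a N F G) (x + 2 * (k : ℕ) + a + 1 / 2)).det) ∧
      ∀ i, 2 * (x + a + 1 / 2) * (μ i).eval (x * (x + 2 * a + 1)) =
        -1 / 2 * ∑ k : Fin (cnt F + cnt G), (rhsP a N F G).eval (x + 1 + 2 * (k : ℕ)) *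
          ((fMat (N + a + 1) (bRow F G) (psiRow a N F G)
            (x + 2 * (k : ℕ) + a + 1 / 2))⁻¹ k i *
              if bRow F G i then wE a N x else 1) := by
  have hdet : ∀ᶠ x in atTop, ∀ k : Fin (cnt F + cnt G),
      (fhatP (N + a + 1) _ (bRow F G) (psiRow a N F G)).det.eval
        (x + (a + 1 / 2 - ((cnt F + cnt G : ℕ) - 1) + 2 * (k : ℕ))) ≠ 0 :=
    eventually_all.2 fun k => (tendsto_atTop_add_const_right _ _ (tendsto_id (α := ℝ))).eventually
      (eventually_det_ne_zero hg)
  filter_upwards [hdet, eventually_all.2 hμ,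
    eventually_gt_atTop (4 * (cnt F + cnt G : ℕ) + |N + a + 1| + 2 - a - 1 / 2)] with x hd hx hx'
  have hc : ∀ k : Fin (cnt F + cnt G), 2 * ((cnt F + cnt G : ℕ) : ℝ) + |N + a + 1| + 2 <
      x + a + 1 / 2 - ((cnt F + cnt G : ℕ) - 1) + 2 * (k : ℕ) := fun k => by
    have h1 : (0 : ℝ) ≤ (k : ℕ) := Nat.cast_nonneg _
    have h2 : (0 : ℝ) ≤ (cnt F + cnt G : ℕ) := Nat.cast_nonneg _
    linarith
  have key := fun i k => tF_eq (N + a + 1) (bRow F G) (psiRow a N F G) i k (hc k) (by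
    convert hd k using 2; ring)
  have e1 : ∀ k : Fin (cnt F + cnt G), x + a + 1 / 2 - (((cnt F + cnt G : ℕ) : ℝ) - 1) +
      2 * (k : ℕ) + (cnt F + cnt G : ℕ) - 1 = x + 2 * (k : ℕ) + a + 1 / 2 := fun k => by ring
  refine ⟨fun k => by rw [← e1]; exact (key k k).1, fun i => ?_⟩
  have h1 := hx i
  rw [mVal, ← Fin.sum_univ_eq_sum_range (fun k => tF (N + a + 1) (bRow F G) (psiRow a N F G) i k
    (x + a + 1 / 2 - ((cnt F + cnt G : ℕ) - 1) + 2 * k)) (cnt F + cnt G)] at h1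
  rw [show x * (x + 2 * a + 1) = x * (x + (2 * a + 1)) by ring]
  have h2 : 2 * (x + a + 1 / 2) * (μ i).eval (x * (x + (2 * a + 1))) =
    -(-2 * (x + a + 1 / 2) * (μ i).eval (x * (x + (2 * a + 1)))) := by ring
  rw [h2, ← h1, Finset.mul_sum, Finset.mul_sum, ← Finset.sum_neg_distrib]
  refine Finset.sum_congr rfl fun k _ => ?_
  rw [(key i k).2, e1, eval_rhsP, show x + 1 + 2 * ((k : ℕ) : ℝ) + a + 1 / 2 -
      ((cnt F + cnt G : ℕ) : ℝ) = x + a + 1 / 2 - (((cnt F + cnt G : ℕ) : ℝ) - 1) + 2 * (k : ℕ) by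
    ring, show x + 2 * ((k : ℕ) : ℝ) + a + 1 / 2 - 2 * ((k : ℕ) : ℝ) = x + a + 1 / 2 by ring, gCore]
  simp only [wE]
  ring

lemma aeval_opH_hahn {a N : ℝ} (hg : Generic a N) (p : ℝ[X]) (n : ℕ) :
    aeval (opH a N) p (hahn a a N n) = C (p.eval ((n : ℝ) * (n + 2 * a + 1))) * hahn a a N n := by
  have h : ∀ q : ℝ[X], (opH a N) (C (q.eval ((n : ℝ) * (n + 2 * a + 1))) * hahn a a N n) =
      C (q.eval ((n : ℝ) * (n + 2 * a + 1)) * ((n : ℝ) * (n + 2 * a + 1))) * hahn a a N n :=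
    fun q => by rw [map_C_mul, opH_hahn hg, ← mul_assoc, ← C_mul]
  induction p using Polynomial.induction_on' with
  | add p q hp hq => rw [map_add, LinearMap.add_apply, hp, hq, eval_add, C_add]; ring
  | monomial k c =>
    rw [aeval_monomial, eval_monomial, Module.End.mul_apply]
    have h1 : ∀ k, ((opH a N) ^ k) (hahn a a N n) =
        C (((n : ℝ) * (n + 2 * a + 1)) ^ k) * hahn a a N n := by
      intro k
      induction k with
      | zero => simp
      | succ k ih =>
        rw [pow_succ', Module.End.mul_apply, ih, map_C_mul, opH_hahn hg, pow_succ,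
          ← mul_assoc, ← C_mul]
    rw [h1, Module.algebraMap_end_apply, smul_eq_C_mul, C_mul]; ring

/-- For large `n` there is an eigenfunction of degree `n` that is a combination of
`h_n, h_{n-2}, …, h_{n-2M}`; its coefficients are those of a linear relation between consecutive
columns of row values. -/
lemma exists_eigenfunction {a N : ℝ} {F G : Finset ℕ} (hgen : Generic a N)
    (hg : gCore a N F G ≠ 0) {μ : Fin (cnt F + cnt G) → ℝ[X]} (hμ : ∀ i, IsMt a N F G i (μ i))
    {P : ℝ[X]} (hP : IsPS a N F G P) :
    ∃ n₀, 2 * (cnt F + cnt G) ≤ n₀ ∧ ∀ n, n₀ ≤ n → ∃ (c : ℕ → ℝ) (e : ℝ), c 0 = 1 ∧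
      (∀ h, ∑ j ∈ Finset.range (cnt F + cnt G + 1), c j * rowVal a N F G h (n - 2 * j) = 0) ∧
      opSR a N F G μ P (∑ j ∈ Finset.range (cnt F + cnt G + 1), C (c j) * hahn a a N (n - 2 * j)) =
        C e * ∑ j ∈ Finset.range (cnt F + cnt G + 1), C (c j) * hahn a a N (n - 2 * j) := by
  obtain ⟨x₀, hx₀⟩ := eventually_atTop.1 ((IsMt.eval_eq hg hμ).and
    (eventually_isUnit_fMat hg (-2 + a + 1 / 2)))
  refine ⟨⌈x₀⌉₊ + 2 * (cnt F + cnt G), by omega, fun n hn => ?_⟩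
  have hn2 : 2 * (cnt F + cnt G) ≤ n := by omega
  have hnx : ∀ j ≤ (cnt F + cnt G), x₀ ≤ (n - 2 * j : ℕ) := fun j hj =>
    (Nat.le_ceil x₀).trans (by exact_mod_cast (show ⌈x₀⌉₊ ≤ n - 2 * j by omega))
  have hcast : ∀ j ≤ (cnt F + cnt G), ((n - 2 * j : ℕ) : ℝ) = n - 2 * j := fun j hj => by
    rw [Nat.cast_sub (by omega)]; push_cast; ring
  obtain ⟨c, hc0, hc⟩ : ∃ c : ℕ → ℝ, c 0 = 1 ∧
      ∀ h, ∑ j ∈ Finset.range (cnt F + cnt G + 1), c j * rowVal a N F G h (n - 2 * j) = 0 := by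
    have h1 := (hx₀ n (by simpa using hnx 0 (by omega))).2
    set A := fMat (N + a + 1) (bRow F G) (psiRow a N F G) (n + (-2 + a + 1 / 2)) with hA
    set v := A⁻¹.mulVec fun h => rowVal a N F G h n with hv
    have h2 : A.mulVec v = fun h => rowVal a N F G h n := by
      rw [hv, Matrix.mulVec_mulVec, Matrix.mul_nonsing_inv _ h1, Matrix.one_mulVec]
    refine ⟨fun j => if j = 0 then 1 else if h : j - 1 < (cnt F + cnt G) then -v ⟨j - 1, h⟩ else 0, if_pos rfl,
      fun h => ?_⟩
    have h3 := congrFun h2 h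
    rw [Matrix.mulVec, dotProduct] at h3
    rw [Finset.sum_range_succ']
    simp only
    rw [if_pos trivial, one_mul, Nat.mul_zero, Nat.sub_zero, ← h3,
      ← Fin.sum_univ_eq_sum_range (fun j => (if j + 1 = 0 then (1 : ℝ) else
        if h : j + 1 - 1 < (cnt F + cnt G) then -v ⟨j + 1 - 1, h⟩ else 0) * rowVal a N F G h (n - 2 * (j + 1))) (cnt F + cnt G),
      ← Finset.sum_add_distrib]
    refine Finset.sum_eq_zero fun l _ => ?_
    have h4 : A h l = rowVal a N F G h (n - 2 * ((l : ℕ) + 1)) := by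
      rw [hA, ← fMat_eq_rowVal (l := l) (t := n - 2) (by
        rw [hcast _ (by have := l.2; omega)]; push_cast; ring)]
      congr 1; ring
    simp only [Nat.add_sub_cancel, Nat.add_eq_zero_iff, one_ne_zero, and_false, if_false, l.2,
      dif_pos, h4]
    ring
  refine ⟨c, ?_⟩
  set k : ℕ → ℕ := fun j => n - 2 * j with hk
  set s : ℕ → ℝ := fun j => (k j : ℝ) + a + 1 / 2 with hs
  set x : Fin (cnt F + cnt G) → ℕ → ℝ := fun h j => c j * rowVal a N F G h (k j) with hx
  set lam : ℕ → ℝ := fun i => 1 / 2 * P.eval ((k i : ℝ) * (k i + 2 * a + 1)) -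
    1 / 2 * ∑ l ∈ Finset.range (cnt F + cnt G), wSgn i l * (rhsP a N F G).eval ((k i : ℝ) + 1 + 2 * l) with hlam
  have hconst : ∀ i ≤ (cnt F + cnt G), lam i = lam 0 := by
    intro i
    induction i with
    | zero => intro _; rfl
    | succ i ih =>
      intro hi
      rw [← ih (by omega)]
      have h1 := hP (k i)
      have h2 := sum_wSgn_sub (M := cnt F + cnt G) (i := i) (by omega)
        (fun l => (rhsP a N F G).eval (k i - 1 + 2 * l))
      have h3 : (k (i + 1) : ℝ) = k i - 2 := by
        simp only [hk]; rw [hcast _ hi, hcast _ (by omega)]; push_cast; ring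
      have h4 : ∀ l : ℕ, (k i : ℝ) - 1 + 2 * ((l + 1 : ℕ) : ℝ) = k i + 1 + 2 * l := fun l => by
        push_cast; ring
      simp only [h4] at h2
      simp only [hlam]
      rw [h3, show (k i : ℝ) - 2 + 1 = k i - 1 by ring, show ((k i : ℝ) - 2) * (k i - 2 + 2 * a + 1)
        = (k i - 2) * (k i - 2 + (2 * a + 1)) by ring, show ((k i : ℝ)) * (k i + 2 * a + 1)
        = k i * (k i + (2 * a + 1)) by ring]
      rw [show (k i : ℝ) - 1 + 2 * ((0 : ℕ) : ℝ) = k i - 1 by push_cast; ring,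
        show (k i : ℝ) - 1 + 2 * ((cnt F + cnt G : ℕ) : ℝ) =
          k i + 2 * (cnt F + cnt G : ℕ) - 1 by ring] at h2
      linear_combination -1 / 2 * h1 + 1 / 2 * h2
  -- The coefficient at `h_{n-2i}`.
  have hcoef : ∀ i ≤ (cnt F + cnt G), 1 / 2 * (c i * P.eval ((k i : ℝ) * (k i + 2 * a + 1))) +
      ∑ h, (eRow a N (bRow F G h) (k i))⁻¹ * ((∑ j ∈ Finset.range (cnt F + cnt G + 1), sg i j * x h j) *
        (2 * s i * (μ h).eval ((k i : ℝ) * (k i + 2 * a + 1)))) = lam 0 * c i := by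
    intro i hi
    obtain ⟨⟨hu, hm⟩, -⟩ := hx₀ _ (hnx i hi)
    rw [← hconst i hi]
    set V : Fin (cnt F + cnt G) → Fin (cnt F + cnt G) → ℝ := fun l h => (fMat (N + a + 1) (bRow F G) (psiRow a N F G)
      ((k i : ℝ) + 2 * (l : ℕ) + a + 1 / 2))⁻¹ l h with hV
    have hwin : ∀ l : Fin (cnt F + cnt G), ∑ h, V l h * ∑ j ∈ Finset.range (cnt F + cnt G + 1), sg i j * x h j =
        wSgn i l * c i := by
      intro l
      refine sum_window (φ := fun h j => rowVal a N F G h (k j)) hc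
        (A := fMat (N + a + 1) (bRow F G) (psiRow a N F G) ((k i : ℝ) + 2 * (l : ℕ) + a + 1 / 2))
        (fun l' => ?_) hi (fun h (l' : Fin (cnt F + cnt G)) j hj hl => fMat_eq_rowVal ?_ h)
      · have := congrFun (congrFun (Matrix.nonsing_inv_mul _ (hu l)) l) l'
        rw [Matrix.mul_apply, Matrix.one_apply] at this
        rw [this]; simp only [eq_comm]
      · simp only [hk]
        rw [hcast _ hi, hcast _ hj]
        have : ((l' : ℕ) : ℝ) + i = (l : ℕ) + j := by exact_mod_cast hl
        linear_combination (-2 : ℝ) * this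
    have h1 : ∀ h, (eRow a N (bRow F G h) (k i))⁻¹ * ((∑ j ∈ Finset.range (cnt F + cnt G + 1), sg i j * x h j) *
        (2 * s i * (μ h).eval ((k i : ℝ) * (k i + 2 * a + 1)))) =
        ∑ l : Fin (cnt F + cnt G), -1 / 2 * (rhsP a N F G).eval ((k i : ℝ) + 1 + 2 * (l : ℕ)) *
          (V l h * ∑ j ∈ Finset.range (cnt F + cnt G + 1), sg i j * x h j) := by
      intro h
      simp only [hs]
      rw [hm h]
      have h2 := eRow_ne_zero hgen (bRow F G h) (k i)
      rw [Finset.mul_sum, Finset.mul_sum, Finset.mul_sum]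
      refine Finset.sum_congr rfl fun l _ => ?_
      simp only [hV]
      change _ * (_ * (_ * (_ * (_ * eRow a N (bRow F G h) (k i))))) = _
      change _ = -1 / 2 * eval (((n - 2 * i : ℕ) : ℝ) + 1 + 2 * (l : ℕ)) (rhsP a N F G) *
        ((fMat (N + a + 1) (bRow F G) (psiRow a N F G)
          (((n - 2 * i : ℕ) : ℝ) + 2 * (l : ℕ) + a + 1 / 2))⁻¹ l h * _)
      field_simp
    rw [Finset.sum_congr rfl fun h _ => h1 h, Finset.sum_comm]
    simp only [← Finset.mul_sum, hwin]
    simp only [hlam]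
    rw [Fin.sum_univ_eq_sum_range (fun l => -1 / 2 * (rhsP a N F G).eval ((k i : ℝ) + 1 + 2 * (l : ℕ)) *
      (wSgn i l * c i)) (cnt F + cnt G), sub_mul, Finset.mul_sum, Finset.sum_mul,
      sub_eq_add_neg, ← Finset.sum_neg_distrib]
    congr 1
    · ring
    · exact Finset.sum_congr rfl fun l _ => by ring
  refine ⟨lam 0, hc0, hc, ?_⟩
  have hK : ∀ h, opK a N (bRow F G h) (aeval (opH a N) (polyR a N F G h)
      (∑ j ∈ Finset.range (cnt F + cnt G + 1), C (c j) * hahn a a N (k j))) =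
      ∑ i ∈ Finset.range (cnt F + cnt G + 1), C ((∑ j ∈ Finset.range (cnt F + cnt G + 1), sg i j * x h j) *
        (2 * s i * (eRow a N (bRow F G h) (k i))⁻¹)) * hahn a a N (k i) := by
    intro h
    have h1 : aeval (opH a N) (polyR a N F G h)
        (∑ j ∈ Finset.range (cnt F + cnt G + 1), C (c j) * hahn a a N (k j)) =
        ∑ j ∈ Finset.range (cnt F + cnt G + 1), C (x h j) * gH a N (bRow F G h) (k j) := by
      rw [map_sum]
      refine Finset.sum_congr rfl fun j _ => ?_
      rw [map_C_mul, aeval_opH_hahn hgen, gH, ← mul_assoc, ← mul_assoc, ← C_mul, ← C_mul]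
      congr 2
      simp only [hx, rowVal]
      have := eRow_ne_zero hgen (bRow F G h) (k j)
      field_simp
    rw [h1, apply_sum_of_diff (r := fun i => C (2 * s i) * gH a N (bRow F G h) (k i))
      (fun j hj => ?_) (hc h)]
    · refine Finset.sum_congr rfl fun i _ => ?_
      rw [gH]
      simp only [C_mul]; ring
    · have h2 : k j = k (j + 1) + 2 := by simp only [hk]; omega
      have h3 := opK_gH hgen (bRow F G h) (k (j + 1))
      rw [h2, h3]
      simp only [hs]
      rw [h2]; push_cast; rfl
  rw [opSR, LinearMap.add_apply, LinearMap.smul_apply, LinearMap.sum_apply, map_sum]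
  simp only [Module.End.mul_apply]
  have hK' : ∀ h, aeval (opH a N) (μ h) (opK a N (bRow F G h) (aeval (opH a N) (polyR a N F G h)
      (∑ j ∈ Finset.range (cnt F + cnt G + 1), C (c j) * hahn a a N (k j)))) = _ := fun h => by
    rw [hK h, map_sum]
  rw [Finset.sum_congr rfl fun h _ => hK' h, Finset.sum_comm, Finset.smul_sum, ← Finset.sum_add_distrib, Finset.mul_sum]
  refine Finset.sum_congr rfl fun i hi => ?_
  rw [← mul_assoc, ← C_mul, ← hcoef i (Nat.lt_succ_iff.1 (Finset.mem_range.1 hi)), C_add, add_mul,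
    map_sum, Finset.sum_mul]
  congr 1
  · rw [map_C_mul, aeval_opH_hahn hgen, smul_eq_C_mul]
    simp only [C_mul]; ring
  · refine Finset.sum_congr rfl fun h _ => ?_
    rw [map_C_mul, aeval_opH_hahn hgen]
    simp only [C_mul]; ring

/-! ### Pearson equations -/

/-- The functional `f ↦ Φ (g f)`. -/
def mulF (g : ℝ[X]) (Φ : ℝ[X] →ₗ[ℝ] ℝ) : ℝ[X] →ₗ[ℝ] ℝ := Φ ∘ₗ LinearMap.mulLeft ℝ g

lemma mulF_apply (g : ℝ[X]) (Φ : ℝ[X] →ₗ[ℝ] ℝ) (f : ℝ[X]) : mulF g Φ f = Φ (g * f) := rfl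

lemma apply_C_mul (Φ : ℝ[X] →ₗ[ℝ] ℝ) (c : ℝ) (f : ℝ[X]) : Φ (C c * f) = c * Φ f := by
  rw [← smul_eq_C_mul, map_smul, smul_eq_mul]

/-- The first-order difference equation `Φ (α(x) f(x + ε)) = Φ (β(x) f(x))` of a functional. -/
def Pearson (Φ : ℝ[X] →ₗ[ℝ] ℝ) (ε : ℝ) (α β : ℝ[X]) : Prop := ∀ f, Φ (α * shift ε f) = Φ (β * f)

lemma shift_shift (c d : ℝ) (f : ℝ[X]) : shift c (shift d f) = shift (c + d) f :=
  Polynomial.funext fun x => by simp only [eval_shift]; congr 1; ring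

lemma shift_zero_apply (f : ℝ[X]) : shift 0 f = f :=
  Polynomial.funext fun x => by rw [eval_shift, add_zero]

lemma shift_X_sub_C (c r : ℝ) : shift c (X - C r) = X - C (r - c) :=
  Polynomial.funext fun x => by rw [eval_shift]; simp; ring

lemma Pearson.symm {Φ : ℝ[X] →ₗ[ℝ] ℝ} {ε : ℝ} {α β : ℝ[X]} (h : Pearson Φ ε α β) :
    Pearson Φ (-ε) β α := fun f => by
  rw [← h, shift_shift, add_neg_cancel, shift_zero_apply]

/-- The product of `X - (ρ + ε u)` for `u < p`. -/
def fam (ρ ε : ℝ) (p : ℕ) : ℝ[X] := ∏ u ∈ Finset.range p, (X - C (ρ + ε * u))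

lemma fam_shift (ρ ε : ℝ) (p : ℕ) :
    (X - C (ρ + ε * (p - 1))) * shift ε (fam ρ ε p) = (X - C (ρ - ε)) * fam ρ ε p := by
  induction p with
  | zero =>
    have : shift ε (1 : ℝ[X]) = 1 := Polynomial.funext fun x => by rw [eval_shift]; simp
    rw [fam, Finset.prod_range_zero, this, Nat.cast_zero]; congr 3; ring
  | succ p ih =>
    have h1 : fam ρ ε (p + 1) = fam ρ ε p * (X - C (ρ + ε * p)) := Finset.prod_range_succ _ _
    rw [h1, shift_mul, shift_X_sub_C, show ρ + ε * p - ε = ρ + ε * (p - 1) by ring,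
      Nat.cast_succ, add_sub_cancel_right]
    linear_combination (X - C (ρ + ε * p)) * ih

/-- Multiplication of a functional by a family of linear factors moves a factor of its Pearson
equation from one end of the family to the other. -/
lemma Pearson.fam {Φ : ℝ[X] →ₗ[ℝ] ℝ} {ε ρ : ℝ} {p : ℕ} {γ β : ℝ[X]}
    (h : Pearson Φ ε ((X - C (ρ + ε * (p - 1))) * γ) β) :
    Pearson (mulF (fam ρ ε p) Φ) ε ((X - C (ρ - ε)) * γ) β := fun f => by
  rw [mulF_apply, mulF_apply, show KrallHahn.fam ρ ε p * (β * f) = β * (KrallHahn.fam ρ ε p * f)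
    by ring, ← h, shift_mul]
  congr 1
  linear_combination -γ * shift ε f * fam_shift ρ ε p

lemma exists_bwd_eq (g : ℝ[X]) : ∃ f, bwd f = g := by
  obtain ⟨e, he⟩ := exists_sum_of_degree (m := (shift 1 g).natDegree + 1) (fun j _ => degree_bp j)
    (degree_le_natDegree.trans_lt (by exact_mod_cast Nat.lt_succ_self _))
  refine ⟨∑ j ∈ Finset.range ((shift 1 g).natDegree + 1), C (e j * -(j + 1 : ℝ)⁻¹) * bp (j + 1), ?_⟩
  have h1 : ∀ f, bwd f = shift (-1) (fwd f) := fun f => by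
    rw [bwd_apply, fwd_apply, map_sub, shift_shift, neg_add_cancel, shift_zero_apply]
  have h2 : fwd (∑ j ∈ Finset.range ((shift 1 g).natDegree + 1),
      C (e j * -(j + 1 : ℝ)⁻¹) * bp (j + 1)) = shift 1 g := by
    rw [map_sum]
    conv_rhs => rw [he]
    refine Finset.sum_congr rfl fun j _ => ?_
    rw [map_C_mul, fwd_bp, ← mul_assoc, ← C_mul]
    congr 2
    have : (j : ℝ) + 1 ≠ 0 := by positivity
    field_simp
  rw [h1, h2, shift_shift, neg_add_cancel, shift_zero_apply]

/-- A functional that vanishes on the range of `opH a N` satisfies the Pearson equation of the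
Hahn weight. -/
lemma pearson_of_opH {a N : ℝ} {L : ℝ[X] →ₗ[ℝ] ℝ} (hL : ∀ f, L (opH a N f) = 0) :
    Pearson L 1 ((X + C (a + 1)) * (X - C N)) (X * (X - C (a + N + 1))) := by
  intro g
  obtain ⟨f, rfl⟩ := exists_bwd_eq g
  have h1 : shift 1 (bwd f) = fwd f := by
    rw [bwd_apply, fwd_apply, map_sub, shift_shift, add_neg_cancel, shift_zero_apply]
  rw [h1, ← sub_eq_zero, ← map_sub, ← opH_apply, hL]

/-- The Pearson equation of the Hahn weight makes `opH a N` symmetric. -/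
lemma Pearson.opH_symm {a N : ℝ} {Φ : ℝ[X] →ₗ[ℝ] ℝ}
    (h : Pearson Φ 1 ((X + C (a + 1)) * (X - C N)) (X * (X - C (a + N + 1)))) (f g : ℝ[X]) :
    Φ (opH a N f * g) = Φ (f * opH a N g) := by
  have h1 : ∀ f g : ℝ[X], Φ ((X + C (a + 1)) * (X - C N) * (shift 1 f * g)) =
      Φ (X * (X - C (a + N + 1)) * (f * shift (-1) g)) := fun f g => by
    rw [← h, shift_mul, shift_shift, add_neg_cancel, shift_zero_apply]
  have h2 := h1 f g
  have h3 := h1 g f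
  have e1 : opH a N f * g = (X + C (a + 1)) * (X - C N) * (shift 1 f * g) +
      X * (X - C (a + N + 1)) * (g * shift (-1) f) -
      ((X + C (a + 1)) * (X - C N) + X * (X - C (a + N + 1))) * (f * g) := by
    rw [opH_apply, fwd_apply, bwd_apply]; ring
  have e2 : f * opH a N g = (X + C (a + 1)) * (X - C N) * (shift 1 g * f) +
      X * (X - C (a + N + 1)) * (f * shift (-1) g) -
      ((X + C (a + 1)) * (X - C N) + X * (X - C (a + N + 1))) * (f * g) := by
    rw [opH_apply, fwd_apply, bwd_apply]; ring
  rw [e1, e2, map_sub Φ, map_sub Φ, map_add Φ, map_add Φ, h2, h3]; ring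

lemma Pearson.hahn_mul {a N : ℝ} (hg : Generic a N) {Φ : ℝ[X] →ₗ[ℝ] ℝ}
    (h : Pearson Φ 1 ((X + C (a + 1)) * (X - C N)) (X * (X - C (a + N + 1)))) {n : ℕ} {g : ℝ[X]}
    (hd : g.degree < n) : Φ (hahn a a N n * g) = 0 := by
  obtain ⟨e, rfl⟩ := exists_sum_of_degree
    (fun j _ => degree_hahn hg j) hd
  rw [Finset.mul_sum, map_sum]
  refine Finset.sum_eq_zero fun j hj => ?_
  have hj' : j < n := Finset.mem_range.1 hj
  have h1 := h.opH_symm (hahn a a N n) (hahn a a N j)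
  rw [opH_hahn hg, opH_hahn hg, mul_assoc, mul_left_comm (hahn a a N n), apply_C_mul, apply_C_mul,
    ← sub_eq_zero, ← sub_mul] at h1
  rw [mul_left_comm, apply_C_mul]
  rcases mul_eq_zero.1 h1 with h2 | h2
  · have h3 : ((n : ℝ) - j) * (n + j + 2 * a + 1) = 0 := by linear_combination h2
    rcases mul_eq_zero.1 h3 with h4 | h4
    · have : (n : ℝ) = j := by linarith
      exact absurd (Nat.cast_injective this) hj'.ne'
    · exact absurd (show 2 * a = ((-(n + j + 1) : ℤ) : ℝ) by push_cast; linarith) (hg.two_a_ne _)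
  · rw [h2, mul_zero]

/-! ### Functionals with one linear factor omitted -/

/-- The product of `X - (ρ + ε v)` for `v < p`, `v ≠ u`. -/
def famE (ρ ε : ℝ) (p u : ℕ) : ℝ[X] := ∏ v ∈ (Finset.range p).erase u, (X - C (ρ + ε * v))

lemma mul_famE (ρ ε : ℝ) {p u : ℕ} (hu : u < p) :
    (X - C (ρ + ε * u)) * famE ρ ε p u = fam ρ ε p :=
  Finset.mul_prod_erase (Finset.range p) (fun v : ℕ => X - C (ρ + ε * v)) (Finset.mem_range.2 hu)

lemma famE_shift (ρ ε : ℝ) {p u : ℕ} (hu : u + 1 < p) :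
    (X - C (ρ + ε * (p - 1))) * shift ε (famE ρ ε p (u + 1)) =
      (X - C (ρ - ε)) * famE ρ ε p u := by
  have h1 := fam_shift ρ ε p
  rw [← mul_famE ρ ε hu] at h1
  rw [shift_mul, shift_X_sub_C, mul_famE ρ ε hu, ← mul_famE ρ ε (Nat.lt_of_succ_lt hu)] at h1
  refine mul_left_cancel₀ (X_sub_C_ne_zero (ρ + ε * u)) ?_
  rw [show ρ + ε * (u + 1 : ℕ) - ε = ρ + ε * u by push_cast; ring] at h1
  linear_combination h1

lemma famE_zero_shift (ρ ε : ℝ) {p : ℕ} (hp : 0 < p) :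
    (X - C (ρ + ε * (p - 1))) * shift ε (famE ρ ε p 0) = (X - C ρ) * famE ρ ε p 0 := by
  have h1 := fam_shift ρ ε p
  rw [← mul_famE ρ ε hp, shift_mul, shift_X_sub_C, Nat.cast_zero, mul_zero, add_zero] at h1
  refine mul_left_cancel₀ (X_sub_C_ne_zero (ρ - ε)) ?_
  linear_combination h1

/-- A functional `Θ` with the Pearson equation that makes `H` symmetric for `fam ρ ε p · Θ`. -/
structure Chain (Θ : ℝ[X] →ₗ[ℝ] ℝ) (H : Module.End ℝ ℝ[X]) (ρ ε α β₁ β₂ : ℝ) (p : ℕ) : Prop where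
  pearson : Pearson Θ ε ((X - C (ρ + ε * (p - 1))) * (X - C α)) ((X - C β₁) * (X - C β₂))
  apply_eq : ∀ f, H f = (X - C (ρ - ε)) * (X - C α) * (shift ε f - f) +
    (X - C β₁) * (X - C β₂) * (shift (-ε) f - f)

section Chain

variable {Θ : ℝ[X] →ₗ[ℝ] ℝ} {H : Module.End ℝ ℝ[X]} {ρ ε α β₁ β₂ : ℝ} {p : ℕ}

lemma Chain.up (h : Chain Θ H ρ ε α β₁ β₂ p) {u : ℕ} (hu : u + 1 < p) (f : ℝ[X]) :
    Θ (famE ρ ε p u * ((X - C (ρ - ε)) * (X - C α) * shift ε f)) =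
      Θ (famE ρ ε p (u + 1) * ((X - C β₁) * (X - C β₂) * f)) := by
  rw [mul_left_comm (famE ρ ε p (u + 1)), ← h.pearson, shift_mul]
  congr 1
  linear_combination -(X - C α) * shift ε f * famE_shift ρ ε hu

lemma Chain.down (h : Chain Θ H ρ ε α β₁ β₂ p) {u : ℕ} (hu : u + 1 < p) (f : ℝ[X]) :
    Θ (famE ρ ε p (u + 1) * ((X - C β₁) * (X - C β₂) * shift (-ε) f)) =
      Θ (famE ρ ε p u * ((X - C (ρ - ε)) * (X - C α) * f)) := by
  rw [← h.up hu, shift_shift, add_neg_cancel, shift_zero_apply]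

lemma Chain.down_zero (h : Chain Θ H ρ ε α β₁ β₂ p) (hp : 0 < p) (f : ℝ[X]) :
    Θ (famE ρ ε p 0 * ((X - C β₁) * (X - C β₂) * f)) =
      Θ (famE ρ ε p 0 * ((X - C ρ) * (X - C α) * shift ε f)) := by
  rw [mul_left_comm (famE ρ ε p 0), ← h.pearson, shift_mul]
  congr 1
  linear_combination (X - C α) * shift ε f * famE_zero_shift ρ ε hp

/-- At the end of the chain, `H` acts like a first-order operator. -/
lemma Chain.zero (h : Chain Θ H ρ ε α β₁ β₂ p) (hp : 0 < p) (f : ℝ[X]) :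
    Θ (famE ρ ε p 0 * H f) = Θ (famE ρ ε p 0 * (C ε * (X - C α) * (shift ε f - f))) := by
  have h1 := h.down_zero hp (shift (-ε) f - f)
  rw [map_sub, shift_shift, add_neg_cancel, shift_zero_apply] at h1
  rw [h.apply_eq, mul_add, map_add, h1, ← map_add, C_sub]
  congr 1
  ring

/-- The recurrence between the functionals with consecutive omitted factors. -/
lemma Chain.recurrence (h : Chain Θ H ρ ε α β₁ β₂ p) {u : ℕ} (hu : u + 1 < p) (f : ℝ[X]) :
    (ρ + ε * (u + 1) - β₁) * (ρ + ε * (u + 1) - β₂) * Θ (famE ρ ε p (u + 1) * f) =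
      Θ (famE ρ ε p u * H f) + ((ρ + ε * u - (ρ - ε)) * (ρ + ε * u - α) +
        (ρ + ε * u - β₁) * (ρ + ε * u - β₂)) * Θ (famE ρ ε p u * f) -
        (ρ + ε * (u - 1) - (ρ - ε)) * (ρ + ε * (u - 1) - α) * Θ (famE ρ ε p (u - 1) * f) := by
  -- A quadratic factor is its value at the omitted point plus a multiple of the omitted factor.
  have hq : ∀ v < p, ∀ r₁ r₂ : ℝ, ∀ g, Θ (famE ρ ε p v * ((X - C r₁) * (X - C r₂) * g)) =
      (ρ + ε * v - r₁) * (ρ + ε * v - r₂) * Θ (famE ρ ε p v * g) +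
        Θ (fam ρ ε p * (X * g)) + (ρ + ε * v - r₁ - r₂) * Θ (fam ρ ε p * g) := by
    intro v hv r₁ r₂ g
    have h1 : famE ρ ε p v * ((X - C r₁) * (X - C r₂) * g) =
        C ((ρ + ε * v - r₁) * (ρ + ε * v - r₂)) * (famE ρ ε p v * g) + fam ρ ε p * (X * g) +
          C (ρ + ε * v - r₁ - r₂) * (fam ρ ε p * g) := by
      rw [← mul_famE ρ ε hv]
      simp only [C_mul, C_sub, C_add]
      ring
    rw [h1, map_add Θ, map_add Θ, apply_C_mul, apply_C_mul]
  have hu' : u < p := Nat.lt_of_succ_lt hu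
  have e1 : famE ρ ε p u * ((X - C (ρ - ε)) * (X - C α) * (shift ε f - f) +
      (X - C β₁) * (X - C β₂) * (shift (-ε) f - f)) =
      famE ρ ε p u * ((X - C (ρ - ε)) * (X - C α) * shift ε f) +
      famE ρ ε p u * ((X - C β₁) * (X - C β₂) * shift (-ε) f) -
      famE ρ ε p u * ((X - C (ρ - ε)) * (X - C α) * f) -
      famE ρ ε p u * ((X - C β₁) * (X - C β₂) * f) := by ring
  rw [h.apply_eq, e1, map_sub Θ, map_sub Θ, map_add Θ, h.up hu, hq _ hu β₁, hq _ hu' (ρ - ε),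
    hq _ hu' β₁ β₂ f]
  cases u with
  | zero =>
    rw [h.down_zero hu', shift_shift, add_neg_cancel, shift_zero_apply, hq 0 hu' ρ]
    push_cast
    ring
  | succ u =>
    rw [h.down hu', hq _ (by omega) (ρ - ε), Nat.add_sub_cancel]
    push_cast
    ring

end Chain

/-! ### The recurrence of the dual Hahn polynomials -/

/-- The basis in which `polyY` is defined. -/
def eY (a : ℝ) (j : ℕ) : ℝ[X] := ∏ i ∈ Finset.range j, (X - C (((i : ℝ) - 2 * a) * (i + 1)))

/-- The coefficient of `polyY a N u` at `eY a j`. -/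
def dY (a N : ℝ) (u j : ℕ) : ℝ := (u.choose j : ℝ) / (poch (1 - a) j * poch (-2 * a - N) j)

lemma poch_neg_natCast (u j : ℕ) :
    (-1) ^ j * poch (-(u : ℝ)) j = (j.factorial : ℝ) * u.choose j := by
  rw [← Nat.cast_mul, ← Nat.descFactorial_eq_factorial_mul_choose]
  induction j with
  | zero => simp [poch_zero]
  | succ j ih =>
    have h1 : (-1 : ℝ) ^ (j + 1) * poch (-(u : ℝ)) (j + 1) =
        ((-1) ^ j * poch (-(u : ℝ)) j) * ((u : ℝ) - j) := by
      rw [pow_succ, poch_succ]; ring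
    rw [h1, ih, Nat.descFactorial_succ, Nat.cast_mul, mul_comm]
    rcases le_or_gt j u with h | h
    · rw [Nat.cast_sub h]
    · rw [Nat.descFactorial_eq_zero_iff_lt.2 h]; simp

lemma polyY_eq_sum (a N : ℝ) {u m : ℕ} (h : u < m) :
    polyY a N u = ∑ j ∈ Finset.range m, C (dY a N u j) * eY a j := by
  have h1 : ∑ j ∈ Finset.range m, C (dY a N u j) * eY a j =
      ∑ j ∈ Finset.range (u + 1), C (dY a N u j) * eY a j := by
    refine (Finset.sum_subset (Finset.range_subset_range.2 h) fun j _ hj => ?_).symm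
    rw [dY, Nat.choose_eq_zero_of_lt (by simpa using hj), Nat.cast_zero, zero_div, C_0, zero_mul]
  rw [h1, polyY, dualHahn, ← coe_compRingHom_apply, map_sum]
  refine Finset.sum_congr rfl fun j _ => ?_
  rw [map_mul, map_prod]
  congr 1
  · rw [coe_compRingHom_apply, C_comp]
    congr 1
    have h2 := poch_neg_natCast u j
    have h3 : (j.factorial : ℝ) ≠ 0 := by exact_mod_cast Nat.factorial_ne_zero j
    rw [dY, h2, show -a + 1 = 1 - a by ring, show -(2 * a + N) = -2 * a - N by ring,
      mul_comm _ (u.choose j : ℝ), mul_div_mul_right _ _ h3]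
  · refine Finset.prod_congr rfl fun i _ => ?_
    rw [coe_compRingHom_apply, sub_comp, X_comp, C_comp, add_sub_assoc, ← C_sub, sub_eq_add_neg X,
      ← C_neg]
    congr 2; ring

/-- The three-term relation of the polynomials `Y_u`. -/
lemma X_mul_polyY {a N : ℝ} (ha : ∀ j, poch (1 - a) j ≠ 0) (hN : ∀ j, poch (-2 * a - N) j ≠ 0)
    (u : ℕ) : X * polyY a N u = C ((u + 1 - a) * (u - 2 * a - N)) * polyY a N (u + 1) -
      C ((u + 1 - a) * (u - 2 * a - N) + u * (u - a - N - 1) + 2 * a) * polyY a N u +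
      C (u * (u - a - N - 1)) * polyY a N (u - 1) := by
  have hsum : ∀ m, ∑ j ∈ Finset.range m, C (dY a N u j) * (X * eY a j) =
      ∑ j ∈ Finset.range m, C ((if j = 0 then 0 else dY a N u (j - 1)) +
        ((j : ℝ) - 2 * a) * (j + 1) * dY a N u j) * eY a j +
        (if m = 0 then 0 else C (dY a N u (m - 1)) * eY a m) := by
    intro m
    induction m with
    | zero => simp
    | succ m ih =>
      rw [Finset.sum_range_succ, ih, Finset.sum_range_succ, if_neg (Nat.succ_ne_zero m),
        Nat.add_sub_cancel]
      have h1 : eY a (m + 1) = eY a m * (X - C (((m : ℝ) - 2 * a) * (m + 1))) :=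
        Finset.prod_range_succ _ _
      rw [h1]
      split_ifs with h0
      · rw [zero_add]; simp only [C_mul, C_sub]; ring
      · simp only [C_mul, C_sub, C_add]; ring
  have h1 := hsum (u + 2)
  rw [if_neg (by omega), show u + 2 - 1 = u + 1 by omega, dY, Nat.choose_succ_self, Nat.cast_zero,
    zero_div, C_0, zero_mul, add_zero] at h1
  rw [polyY_eq_sum a N (show u < u + 2 by omega), polyY_eq_sum a N (show u + 1 < u + 2 by omega),
    polyY_eq_sum a N (show u - 1 < u + 2 by omega), Finset.mul_sum, Finset.mul_sum, Finset.mul_sum,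
    Finset.mul_sum, ← Finset.sum_sub_distrib, ← Finset.sum_add_distrib]
  rw [Finset.sum_congr rfl fun j _ => mul_left_comm X (C (dY a N u j)) (eY a j), h1]
  refine Finset.sum_congr rfl fun j _ => ?_
  rw [← mul_assoc, ← mul_assoc, ← mul_assoc, ← C_mul, ← C_mul, ← C_mul, ← sub_mul, ← add_mul,
    ← C_sub, ← C_add]
  congr 2
  have e1 : (u : ℝ) * (u - 1).choose j = (u - j) * u.choose j := by
    rcases u with _ | u
    · rcases j with _ | j <;> simp
    · rw [Nat.add_sub_cancel]
      have := Nat.add_one_mul_choose_eq u j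
      rcases le_or_gt j (u + 1) with h | h
      · have h2 := Nat.choose_mul_succ_eq u j
        have h3 : ((u.choose j * (u + 1) : ℕ) : ℝ) = ((u + 1).choose j * (u + 1 - j) : ℕ) := by
          rw [h2]
        rw [Nat.cast_mul, Nat.cast_mul, Nat.cast_sub h] at h3
        linear_combination h3
      · rw [Nat.choose_eq_zero_of_lt h, Nat.choose_eq_zero_of_lt (by omega)]; simp
  rcases j with _ | j
  · simp only [dY, poch_zero, Nat.choose_zero_right, if_true, Nat.cast_zero, Nat.cast_one]
    ring
  · have e2 : ((u + 1).choose (j + 1) : ℝ) = u.choose j + u.choose (j + 1) := by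
      exact_mod_cast Nat.choose_succ_succ u j
    have e3 : ((j : ℝ) + 1) * u.choose (j + 1) = (u - j) * u.choose j := by
      have h2 := Nat.choose_succ_right_eq u j
      have h3 : ((u.choose (j + 1) * (j + 1) : ℕ) : ℝ) = (u.choose j * (u - j) : ℕ) := by rw [h2]
      rcases le_or_gt j u with h | h
      · rw [Nat.cast_mul, Nat.cast_mul, Nat.cast_sub h] at h3
        push_cast at h3
        linear_combination h3
      · rw [Nat.choose_eq_zero_of_lt h, Nat.choose_eq_zero_of_lt (by omega)]; simp
    have h1 := ha (j + 1)
    have h2 := hN (j + 1)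
    rw [poch_succ (1 - a) j] at h1
    rw [poch_succ (-2 * a - N) j] at h2
    have h3 := left_ne_zero_of_mul h1
    have h4 := right_ne_zero_of_mul h1
    have h5 := left_ne_zero_of_mul h2
    have h6 := right_ne_zero_of_mul h2
    rw [if_neg (Nat.succ_ne_zero j), Nat.add_sub_cancel]
    simp only [dY, poch_succ (1 - a) j, poch_succ (-2 * a - N) j]
    rw [e2]
    push_cast at e1 ⊢
    generalize poch (1 - a) j = p₁ at *
    generalize poch (-2 * a - N) j = p₂ at *
    have e4 : ∀ x : ℝ, x / (p₁ * p₂) = x * ((1 - a + j) * (-2 * a - N + j)) /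
        (p₁ * (1 - a + j) * (p₂ * (-2 * a - N + j))) := fun x => by
      rw [mul_mul_mul_comm p₁, mul_div_mul_right _ _ (mul_ne_zero h4 h6)]
    rw [e4]
    generalize p₁ * (1 - a + j) * (p₂ * (-2 * a - N + j)) = D
    linear_combination ((j + u + 1 - 3 * a - N) * e3 - (u - a - N - 1) * e1) / D

lemma mul_aeval_apply (H : Module.End ℝ ℝ[X]) (p f : ℝ[X]) :
    aeval H (X * p) f = aeval H p (H f) := by
  rw [mul_comm, map_mul, aeval_X]; rfl

lemma aeval_C_mul_apply (H : Module.End ℝ ℝ[X]) (c : ℝ) (p f : ℝ[X]) :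
    aeval H (C c * p) f = C c * aeval H p f := by
  rw [map_mul, aeval_C, Module.End.mul_apply, Module.algebraMap_end_apply, smul_eq_C_mul]

lemma aeval_add_apply (H : Module.End ℝ ℝ[X]) (p q f : ℝ[X]) :
    aeval H (p + q) f = aeval H p f + aeval H q f := by
  rw [map_add]; rfl

lemma aeval_sub_apply (H : Module.End ℝ ℝ[X]) (p q f : ℝ[X]) :
    aeval H (p - q) f = aeval H p f - aeval H q f := by
  rw [map_sub]; rfl

/-- If polynomials `y_u` satisfy the recurrence of a chain, the functional with the factor `u`
omitted is obtained from the one with the factor `0` omitted by means of `y_u(H)`. -/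
lemma Chain.eq_aeval {Θ : ℝ[X] →ₗ[ℝ] ℝ} {H : Module.End ℝ ℝ[X]} {ρ ε α β₁ β₂ : ℝ} {p : ℕ}
    (h : Chain Θ H ρ ε α β₁ β₂ p) {y : ℕ → ℝ[X]} (h0 : y 0 = 1)
    (hne : ∀ u : ℕ, (ρ + ε * (u + 1) - β₁) * (ρ + ε * (u + 1) - β₂) ≠ 0)
    (hy : ∀ u : ℕ, X * y u = C ((ρ + ε * (u + 1) - β₁) * (ρ + ε * (u + 1) - β₂)) * y (u + 1) -
      C ((ρ + ε * u - (ρ - ε)) * (ρ + ε * u - α) + (ρ + ε * u - β₁) * (ρ + ε * u - β₂)) * y u +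
      C ((ρ + ε * (u - 1) - (ρ - ε)) * (ρ + ε * (u - 1) - α)) * y (u - 1)) {u : ℕ} (hu : u < p)
    (f : ℝ[X]) : Θ (famE ρ ε p u * f) = Θ (famE ρ ε p 0 * aeval H (y u) f) := by
  induction u using Nat.strong_induction_on generalizing f with
  | _ u ih =>
    cases u with
    | zero => rw [h0, map_one]; rfl
    | succ u =>
      have h1 := h.recurrence hu f
      have h2 := congrArg (fun q => Θ (famE ρ ε p 0 * aeval H q f)) (hy u)
      simp only [aeval_add_apply, aeval_sub_apply, mul_aeval_apply, aeval_C_mul_apply, mul_add, mul_sub, mul_left_comm (famE ρ ε p 0),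
        map_add Θ, map_sub Θ, apply_C_mul] at h2
      rw [ih u (by omega) (by omega), ih u (by omega) (by omega),
        ih (u - 1) (by omega) (by omega)] at h1
      refine mul_left_cancel₀ (hne u) ?_
      linear_combination h1 + h2

/-- The end of a chain does not distinguish the polynomials `g_n` and `g_{n-2}`. -/
lemma Chain.gH_add_two {Θ : ℝ[X] →ₗ[ℝ] ℝ} {a N ρ ε α β₁ β₂ : ℝ} {p : ℕ} (hg : Generic a N)
    (h : Chain Θ (opH a N) ρ ε α β₁ β₂ p) (hp : 0 < p) {T : Module.End ℝ ℝ[X]}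
    (hT : ∀ f, T f = C ((2 * a + 1) / 2) * f + C ε * (X - C α) * (shift ε f - f)) {δ : ℝ}
    (hδ : δ * δ = 1) {b : Bool} (hF : FirstOrder a δ (gH a N b) T) (n : ℕ) :
    Θ (famE ρ ε p 0 * gH a N b (n + 2)) = Θ (famE ρ ε p 0 * gH a N b n) := by
  have h1 : ∀ n, Θ (famE ρ ε p 0 * gH a N b (n + 1)) = δ * Θ (famE ρ ε p 0 * gH a N b n) := by
    intro n
    have h2 := h.zero hp (gH a N b (n + 1) - C δ * gH a N b n)
    have h3 : C ε * (X - C α) * (shift ε (gH a N b (n + 1) - C δ * gH a N b n) -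
        (gH a N b (n + 1) - C δ * gH a N b n)) = T (gH a N b (n + 1) - C δ * gH a N b n) -
        C ((2 * a + 1) / 2) * (gH a N b (n + 1) - C δ * gH a N b n) := by rw [hT]; ring
    have h4 : ∀ k, opH a N (gH a N b k) = C ((k : ℝ) * (k + 2 * a + 1)) * gH a N b k := fun k => by
      rw [gH, map_C_mul, opH_hahn hg, mul_left_comm]
    rw [h3, hF n, map_sub (opH a N), map_C_mul, h4, h4] at h2
    simp only [mul_add, mul_sub, mul_left_comm (famE ρ ε p 0), map_add Θ, map_sub Θ,
      apply_C_mul] at h2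
    have h5 : ((n : ℝ) + 1) * (n + 2 * a + 1) ≠ 0 := mul_ne_zero (by positivity) fun h =>
      hg.two_a_ne (-n - 1) (by push_cast; linarith)
    refine mul_left_cancel₀ h5 ?_
    push_cast at h2
    linear_combination h2
  rw [h1, h1, ← mul_assoc, hδ, one_mul]

/-- The orthogonality conditions of the combinations of `h_n, h_{n-2}, …` whose coefficients
annihilate a row. -/
lemma Chain.sum_eq_zero {Θ : ℝ[X] →ₗ[ℝ] ℝ} {a N ρ ε α β₁ β₂ : ℝ} {p : ℕ} (hg : Generic a N)
    (h : Chain Θ (opH a N) ρ ε α β₁ β₂ p) {T : Module.End ℝ ℝ[X]}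
    (hT : ∀ f, T f = C ((2 * a + 1) / 2) * f + C ε * (X - C α) * (shift ε f - f)) {δ : ℝ}
    (hδ : δ * δ = 1) {b : Bool} (hF : FirstOrder a δ (gH a N b) T) {y : ℕ → ℝ[X]} (h0 : y 0 = 1)
    (hne : ∀ u : ℕ, (ρ + ε * (u + 1) - β₁) * (ρ + ε * (u + 1) - β₂) ≠ 0)
    (hy : ∀ u : ℕ, X * y u = C ((ρ + ε * (u + 1) - β₁) * (ρ + ε * (u + 1) - β₂)) * y (u + 1) -
      C ((ρ + ε * u - (ρ - ε)) * (ρ + ε * u - α) + (ρ + ε * u - β₁) * (ρ + ε * u - β₂)) * y u +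
      C ((ρ + ε * (u - 1) - (ρ - ε)) * (ρ + ε * (u - 1) - α)) * y (u - 1)) {u : ℕ} (hu : u < p)
    {n M : ℕ} (hn : 2 * M ≤ n) {c : ℕ → ℝ} (hc : ∑ j ∈ Finset.range (M + 1), c j *
      (eRow a N b (n - 2 * j) * (y u).eval (((n - 2 * j : ℕ) : ℝ) *
        ((n - 2 * j : ℕ) + 2 * a + 1))) = 0) :
    Θ (famE ρ ε p u * ∑ j ∈ Finset.range (M + 1), C (c j) * hahn a a N (n - 2 * j)) = 0 := by
  have h1 : ∀ j ≤ M, Θ (famE ρ ε p 0 * gH a N b (n - 2 * j)) = Θ (famE ρ ε p 0 * gH a N b n) := by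
    intro j
    induction j with
    | zero => intro _; rfl
    | succ j ih =>
      intro hj
      rw [← ih (by omega), show n - 2 * j = n - 2 * (j + 1) + 2 by omega,
        h.gH_add_two hg (by omega) hT hδ hF]
  have h2 : ∀ j ≤ M, Θ (famE ρ ε p u * (C (c j) * hahn a a N (n - 2 * j))) = c j *
      (eRow a N b (n - 2 * j) * (y u).eval (((n - 2 * j : ℕ) : ℝ) *
        ((n - 2 * j : ℕ) + 2 * a + 1))) * Θ (famE ρ ε p 0 * gH a N b n) := by
    intro j hj
    have h3 : hahn a a N (n - 2 * j) = C (eRow a N b (n - 2 * j)) * gH a N b (n - 2 * j) := by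
      rw [gH, ← mul_assoc, ← C_mul, mul_inv_cancel₀ (eRow_ne_zero hg _ _), C_1, one_mul]
    rw [h.eq_aeval h0 hne hy hu, map_C_mul, aeval_opH_hahn hg, h3,
      mul_left_comm (famE ρ ε p 0), apply_C_mul, mul_left_comm (famE ρ ε p 0), apply_C_mul,
      mul_left_comm (famE ρ ε p 0), apply_C_mul, h1 j hj]
    ring
  rw [Finset.mul_sum, map_sum, Finset.sum_congr rfl fun j hj =>
    h2 j (Nat.lt_succ_iff.1 (Finset.mem_range.1 hj)), ← Finset.sum_mul, hc, zero_mul]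

lemma exists_node_eq {F : Finset ℕ} {u : ℕ} (hu : u ∈ invol F) : ∃ r, node F r = u := by
  have h := Finset.range_orderEmbOfFin (invol F) rfl
  have : u ∈ Set.range ((invol F).orderEmbOfFin rfl) := by rw [h]; exact hu
  exact this

lemma eRow_polyY_relation {a N : ℝ} {F G : Finset ℕ} {n : ℕ} {c : ℕ → ℝ}
    (hc : ∀ h, ∑ j ∈ Finset.range (cnt F + cnt G + 1), c j * rowVal a N F G h (n - 2 * j) = 0)
    {u : ℕ} (hu : u ∈ invol F) : ∑ j ∈ Finset.range (cnt F + cnt G + 1), c j *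
      (eRow a N true (n - 2 * j) * (polyY a N u).eval (((n - 2 * j : ℕ) : ℝ) *
        ((n - 2 * j : ℕ) + 2 * a + 1))) = 0 := by
  obtain ⟨r, rfl⟩ := exists_node_eq hu
  have := hc (Fin.castAdd _ r)
  simpa only [rowVal, bRow, polyR, Fin.append_left] using this

lemma eRow_polyZ_relation {a N : ℝ} {F G : Finset ℕ} {n : ℕ} {c : ℕ → ℝ}
    (hc : ∀ h, ∑ j ∈ Finset.range (cnt F + cnt G + 1), c j * rowVal a N F G h (n - 2 * j) = 0)
    {u : ℕ} (hu : u ∈ invol G) : ∑ j ∈ Finset.range (cnt F + cnt G + 1), c j *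
      (eRow a N false (n - 2 * j) * (polyZ a N u).eval (((n - 2 * j : ℕ) : ℝ) *
        ((n - 2 * j : ℕ) + 2 * a + 1))) = 0 := by
  obtain ⟨r, rfl⟩ := exists_node_eq hu
  have := hc (Fin.natAdd _ r)
  simpa only [rowVal, bRow, polyR, Fin.append_right] using this

lemma polyZ_eq (a N : ℝ) (u : ℕ) : polyZ a N u = polyY a (-2 - N - 2 * a) u := by
  rw [polyZ, polyY, show 2 * a + (-2 - N - 2 * a) = -2 - N by ring]

lemma polyY_zero (a N : ℝ) : polyY a N 0 = 1 := by
  simp [polyY, dualHahn, poch_zero]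

/-- A functional that vanishes on `C f` for small degrees and on the quotients of `C` by its
linear factors vanishes on all polynomials of small degree. -/
lemma eq_zero_of_prod {ι : Type*} [DecidableEq ι] {T : Finset ι} {v : ι → ℝ}
    (hv : Set.InjOn v T) {E : ℝ[X] →ₗ[ℝ] ℝ} {m : ℕ}
    (h1 : ∀ f : ℝ[X], f.degree < m → E ((∏ i ∈ T, (X - C (v i))) * f) = 0)
    (h2 : ∀ i ∈ T, E (∏ j ∈ T.erase i, (X - C (v j))) = 0) {g : ℝ[X]}
    (hg : g.degree < (m + T.card : ℕ)) : E g = 0 := by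
  set P := ∏ i ∈ T, (X - C (v i)) with hP
  have hmon : P.Monic := monic_prod_of_monic _ _ fun i _ => monic_X_sub_C _
  have hdeg : P.degree = T.card := by
    rw [hP, degree_prod]; simp [degree_X_sub_C]
  have h3 : E (g %ₘ P) = 0 := by
    have h4 : (g %ₘ P).degree < T.card := by rw [← hdeg]; exact degree_modByMonic_lt g hmon
    rw [Lagrange.eq_interpolate hv h4, Lagrange.interpolate_apply, map_sum]
    refine Finset.sum_eq_zero fun i hi => ?_
    have h5 : Lagrange.basis T v i = C (∏ j ∈ T.erase i, (v i - v j)⁻¹) *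
        ∏ j ∈ T.erase i, (X - C (v j)) := by
      rw [Lagrange.basis, map_prod, ← Finset.prod_mul_distrib]; rfl
    rw [h5, apply_C_mul, apply_C_mul, h2 i hi, mul_zero, mul_zero]
  have h6 : E (P * (g /ₘ P)) = 0 := by
    refine h1 _ ?_
    by_cases h0 : g /ₘ P = 0
    · rw [h0, degree_zero]; exact WithBot.bot_lt_coe _
    · have h7 : T.card ≤ g.natDegree := by
        by_contra! h8
        exact h0 ((divByMonic_eq_zero_iff hmon).2 (by
          rw [hdeg]; exact degree_le_natDegree.trans_lt (by exact_mod_cast h8)))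
      have hg0 : g ≠ 0 := by rintro rfl; simp at h0
      have h8 := natDegree_divByMonic g hmon
      rw [natDegree_eq_of_degree_eq_some hdeg] at h8
      rw [degree_eq_natDegree hg0, Nat.cast_lt] at hg
      rw [degree_eq_natDegree h0, Nat.cast_lt, h8]
      omega
  rw [← modByMonic_add_div g P, map_add, h3, h6, add_zero]

/-! ### Orthogonality with respect to the Krall–Hahn functional -/

lemma prod_range_maxSucc {R : Type*} [CommMonoid R] {F : Finset ℕ} (hF : ∀ f ∈ F, 0 < f)
    (g : ℕ → R) : (∏ f ∈ F, g (maxSucc F - 1 - f)) * ∏ u ∈ invol F, g u =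
      ∏ u ∈ Finset.range (maxSucc F), g u := by
  rcases F.eq_empty_or_nonempty with rfl | hne
  · simp [invol, maxSucc]
  set p := F.sup id with hp
  have hpm : p ∈ F := by
    obtain ⟨f, hf, h⟩ := Finset.exists_mem_eq_sup F hne id
    rw [hp, h]; exact hf
  have hle : ∀ f ∈ F, f ≤ p := fun f hf => Finset.le_sup (f := id) hf
  have hs : maxSucc F = p + 1 := le_antisymm
    (Finset.sup_le fun f hf => Nat.succ_le_succ (hle f hf))
    (Finset.le_sup (f := fun f => f + 1) hpm)
  have hinj : Set.InjOn (fun f => p - f) F := fun f hf f' hf' h => by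
    have h1 := hle f hf
    have h2 := hle f' hf'
    simp only at h; omega
  have hun : F.image (fun f => p - f) ∪ invol F = Finset.range (p + 1) := by
    ext x
    simp only [invol, ← hp, Finset.mem_union, Finset.mem_sdiff, Finset.mem_Icc, Finset.mem_image,
      Finset.mem_range]
    constructor
    · rintro (⟨f, hf, rfl⟩ | ⟨h, -⟩) <;> omega
    · intro hx
      by_cases h : ∃ f ∈ F, p - f = x
      · exact Or.inl h
      · refine Or.inr ⟨⟨?_, by omega⟩, h⟩
        by_contra h0
        exact h ⟨p, hpm, by omega⟩
  have hdis : Disjoint (F.image (fun f => p - f)) (invol F) := Finset.disjoint_sdiff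
  rw [hs, ← hun, Finset.prod_union hdis, Finset.prod_image hinj, Nat.add_sub_cancel]

lemma lt_maxSucc_of_mem_invol {F : Finset ℕ} {u : ℕ} (hu : u ∈ invol F) : u < maxSucc F := by
  have h1 := (Finset.mem_Icc.1 (Finset.mem_sdiff.1 hu).1).2
  rcases F.eq_empty_or_nonempty with rfl | hne
  · simp [invol] at hu
  obtain ⟨f, hf, h⟩ := Finset.exists_mem_eq_sup F hne id
  rw [h] at h1
  exact Nat.lt_of_le_of_lt h1 (Finset.le_sup (f := fun f => f + 1) hf)

/-- The part of `fam ρ ε (max F + 1)` that belongs to `F`. -/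
def famF (ρ ε : ℝ) (F : Finset ℕ) : ℝ[X] :=
  ∏ f ∈ F, (X - C (ρ + ε * (maxSucc F - 1 - f)))

/-- The part of `fam ρ ε (max F + 1)` that belongs to `I(F)`. -/
def famI (ρ ε : ℝ) (F : Finset ℕ) : ℝ[X] := ∏ u ∈ invol F, (X - C (ρ + ε * u))

lemma famF_mul_famI (ρ ε : ℝ) {F : Finset ℕ} (hF : ∀ f ∈ F, 0 < f) :
    famF ρ ε F * famI ρ ε F = fam ρ ε (maxSucc F) := by
  rw [fam, ← prod_range_maxSucc hF fun u => X - C (ρ + ε * (u : ℝ)), famF, famI]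
  congr 1
  refine Finset.prod_congr rfl fun f hf => ?_
  have h1 : f + 1 ≤ maxSucc F := Finset.le_sup (f := fun f => f + 1) hf
  rw [show maxSucc F - 1 - f = maxSucc F - (f + 1) by omega, Nat.cast_sub h1]
  push_cast
  congr 3; ring

lemma shift_krallFactor (a N : ℝ) (F G : Finset ℕ) :
    shift (maxSucc G) (krallFactor (a - maxSucc F - maxSucc G) (N + 2 * maxSucc G) F G) =
      C ((-1) ^ F.card * (-1) ^ G.card) * (famF (-a) 1 F * famF (a + N) (-1) F *
        (famF (N + 1) 1 G * famF (-1) (-1) G)) := by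
  refine Polynomial.funext fun x => ?_
  rw [eval_shift]
  simp only [krallFactor, famF, eval_mul, eval_prod, eval_sub, eval_add, eval_C, eval_X]
  rw [← Finset.prod_const, ← Finset.prod_const, ← Finset.prod_mul_distrib,
    ← Finset.prod_mul_distrib, mul_mul_mul_comm, ← Finset.prod_mul_distrib,
    ← Finset.prod_mul_distrib]
  congr 1 <;> exact Finset.prod_congr rfl fun f _ => by ring

section Families

variable {Φ : ℝ[X] →ₗ[ℝ] ℝ} {ρ₁ ρ₂ ρ₃ ρ₄ : ℝ} {p s : ℕ}

/-- The Pearson equation of a functional to which four families of linear factors can be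
multiplied, two in each direction. -/
def PearsonFour (Φ : ℝ[X] →ₗ[ℝ] ℝ) (ρ₁ ρ₂ ρ₃ ρ₄ : ℝ) (p s : ℕ) : Prop :=
  Pearson Φ 1 ((X - C (ρ₁ + 1 * (p - 1))) * (X - C (ρ₃ + 1 * (s - 1))))
    ((X - C (ρ₂ + -1 * (p - 1))) * (X - C (ρ₄ + -1 * (s - 1))))

lemma Pearson.comm_left {ε : ℝ} {α α' β : ℝ[X]} (h : Pearson Φ ε (α * α') β) :
    Pearson Φ ε (α' * α) β := by rwa [mul_comm]

lemma Pearson.of_symm {ε : ℝ} {α β : ℝ[X]} (h : Pearson Φ (-ε) β α) : Pearson Φ ε α β := by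
  have := h.symm
  rwa [neg_neg] at this

lemma PearsonFour.first (h : PearsonFour Φ ρ₁ ρ₂ ρ₃ ρ₄ p s) :
    Pearson (mulF (fam ρ₄ (-1) s) (mulF (fam ρ₂ (-1) p) (mulF (fam ρ₃ 1 s) Φ))) 1
      ((X - C (ρ₁ + 1 * (p - 1))) * (X - C (ρ₃ - 1))) ((X - C (ρ₂ - -1)) * (X - C (ρ₄ - -1))) :=
  (Pearson.comm_left (Pearson.fam h.comm_left)).symm.fam.comm_left.fam.comm_left.of_symm

lemma PearsonFour.second (h : PearsonFour Φ ρ₁ ρ₂ ρ₃ ρ₄ p s) :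
    Pearson (mulF (fam ρ₄ (-1) s) (mulF (fam ρ₃ 1 s) (mulF (fam ρ₁ 1 p) Φ))) (-1)
      ((X - C (ρ₂ + -1 * (p - 1))) * (X - C (ρ₄ - -1))) ((X - C (ρ₁ - 1)) * (X - C (ρ₃ - 1))) :=
  (Pearson.comm_left (Pearson.fam (Pearson.comm_left (Pearson.fam h)))).symm.comm_left.fam.comm_left

lemma PearsonFour.third (h : PearsonFour Φ ρ₁ ρ₂ ρ₃ ρ₄ p s) :
    Pearson (mulF (fam ρ₄ (-1) s) (mulF (fam ρ₂ (-1) p) (mulF (fam ρ₁ 1 p) Φ))) 1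
      ((X - C (ρ₃ + 1 * (s - 1))) * (X - C (ρ₁ - 1))) ((X - C (ρ₂ - -1)) * (X - C (ρ₄ - -1))) :=
  (Pearson.comm_left (Pearson.fam h)).symm.fam.comm_left.fam.comm_left.of_symm

lemma PearsonFour.fourth (h : PearsonFour Φ ρ₁ ρ₂ ρ₃ ρ₄ p s) :
    Pearson (mulF (fam ρ₂ (-1) p) (mulF (fam ρ₃ 1 s) (mulF (fam ρ₁ 1 p) Φ))) (-1)
      ((X - C (ρ₄ + -1 * (s - 1))) * (X - C (ρ₂ - -1))) ((X - C (ρ₁ - 1)) * (X - C (ρ₃ - 1))) :=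
  (Pearson.comm_left (Pearson.fam (Pearson.comm_left (Pearson.fam h)))).symm.fam.comm_left

lemma PearsonFour.all (h : PearsonFour Φ ρ₁ ρ₂ ρ₃ ρ₄ p s) :
    Pearson (mulF (fam ρ₁ 1 p) (mulF (fam ρ₄ (-1) s) (mulF (fam ρ₂ (-1) p) (mulF (fam ρ₃ 1 s) Φ))))
      1 ((X - C (ρ₁ - 1)) * (X - C (ρ₃ - 1))) ((X - C (ρ₂ - -1)) * (X - C (ρ₄ - -1))) :=
  h.first.fam

end Families

/-- The translate of the Hahn functional with parameters `a - p - s`, `N + 2 s` satisfies the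
Pearson equation that the factors of the Krall–Hahn weight transform into the one of the Hahn
weight with parameters `a`, `N`. -/
lemma pearsonFour_shift {a N : ℝ} {p s : ℕ} {L : ℝ[X] →ₗ[ℝ] ℝ}
    (hL : Pearson L 1 ((X + C (a - p - s + 1)) * (X - C (N + 2 * s)))
      (X * (X - C (a - p - s + (N + 2 * s) + 1)))) :
    PearsonFour (L ∘ₗ shift (-s)) (-a) (a + N) (N + 1) (-1) p s := by
  intro f
  have h1 := hL (shift (-s) f)
  simp only [LinearMap.comp_apply]
  rw [shift_mul, shift_mul, shift_mul, shift_mul, shift_X_sub_C, shift_X_sub_C, shift_X_sub_C,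
    shift_X_sub_C, shift_shift, add_comm (-(s : ℝ)) 1, ← shift_shift]
  convert h1 using 2
  · rw [← sub_neg_eq_add X, ← C_neg]
    congr 3 <;> ring_nf
  · congr 1
    rw [mul_comm]
    congr 1
    · rw [show (-1 : ℝ) + -1 * (s - 1) - -s = 0 by ring, C_0, sub_zero]
    · congr 2; ring

variable {a N : ℝ}

lemma Generic.dual (hg : Generic a N) :
    (∀ j, poch (1 - a) j ≠ 0) ∧ (∀ j, poch (-2 * a - N) j ≠ 0) ∧
      ∀ j, poch (-2 * a - (-2 - N - 2 * a)) j ≠ 0 :=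
  ⟨poch_ne_zero fun k hk => hg.a_ne (1 - k) (by push_cast; linarith),
    poch_ne_zero fun k hk => hg.two_aN_ne (-k) (by push_cast; linarith),
    poch_ne_zero fun k hk => hg.N_ne (k - 2) (by push_cast; linarith)⟩

section

variable {F G : Finset ℕ} {Λ : ℝ[X] →ₗ[ℝ] ℝ} {n u : ℕ} {c : ℕ → ℝ}

lemma orth_first (hg : Generic a N)
    (h : PearsonFour Λ (-a) (a + N) (N + 1) (-1) (maxSucc F) (maxSucc G))
    (hn : 2 * (cnt F + cnt G) ≤ n)
    (hc : ∀ h, ∑ j ∈ Finset.range (cnt F + cnt G + 1), c j * rowVal a N F G h (n - 2 * j) = 0)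
    (hu : u ∈ invol F) :
    mulF (fam (-1) (-1) (maxSucc G)) (mulF (fam (a + N) (-1) (maxSucc F))
      (mulF (fam (N + 1) 1 (maxSucc G)) Λ)) (famE (-a) 1 (maxSucc F) u *
        ∑ j ∈ Finset.range (cnt F + cnt G + 1), C (c j) * hahn a a N (n - 2 * j)) = 0 := by
  refine Chain.sum_eq_zero (α := N) (β₁ := a + N + 1) (β₂ := 0) (T := opD2 a N) hg
    ⟨?_, fun f => ?_⟩ (fun f => ?_) (by norm_num) (firstOrder_opD2 hg) (polyY_zero a N)
    (fun u => ?_) (fun u => ?_) (lt_maxSucc_of_mem_invol hu) hn (eRow_polyY_relation hc hu)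
  · convert h.first using 3 <;> congr 1 <;> ring
  · rw [opH_apply, fwd_apply, bwd_apply]; simp only [C_sub, C_neg, C_1, C_0, C_add]; ring
  · rw [opD2_apply, fwd_apply, C_1, one_mul]
  · refine mul_ne_zero (fun h => hg.two_aN_ne u (by push_cast; linarith)) fun h =>
      hg.a_ne (u + 1) (by push_cast; linarith)
  · rw [X_mul_polyY hg.dual.1 hg.dual.2.1]; congr 1; congr 1
    all_goals congr 2; ring

lemma orth_second (hg : Generic a N)
    (h : PearsonFour Λ (-a) (a + N) (N + 1) (-1) (maxSucc F) (maxSucc G))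
    (hn : 2 * (cnt F + cnt G) ≤ n)
    (hc : ∀ h, ∑ j ∈ Finset.range (cnt F + cnt G + 1), c j * rowVal a N F G h (n - 2 * j) = 0)
    (hu : u ∈ invol F) :
    mulF (fam (-1) (-1) (maxSucc G)) (mulF (fam (N + 1) 1 (maxSucc G))
      (mulF (fam (-a) 1 (maxSucc F)) Λ)) (famE (a + N) (-1) (maxSucc F) u *
        ∑ j ∈ Finset.range (cnt F + cnt G + 1), C (c j) * hahn a a N (n - 2 * j)) = 0 := by
  refine Chain.sum_eq_zero (α := 0) (β₁ := -a - 1) (β₂ := N) (T := opD1 a) hg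
    ⟨?_, fun f => ?_⟩ (fun f => ?_) (by norm_num) (firstOrder_opD1 hg) (polyY_zero a N)
    (fun u => ?_) (fun u => ?_) (lt_maxSucc_of_mem_invol hu) hn (eRow_polyY_relation hc hu)
  · convert h.second using 3 <;> congr 1 <;> ring
  · rw [opH_apply, fwd_apply, bwd_apply, neg_neg]
    simp only [C_sub, C_neg, C_1, C_0, C_add]; ring
  · rw [opD1_apply, bwd_apply, C_neg, C_1, C_0]; ring
  · refine mul_ne_zero (fun h => hg.two_aN_ne u (by push_cast; linarith)) fun h =>
      hg.a_ne (u + 1) (by push_cast; linarith)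
  · rw [X_mul_polyY hg.dual.1 hg.dual.2.1]; congr 1; congr 1
    all_goals congr 2; ring

lemma orth_third (hg : Generic a N)
    (h : PearsonFour Λ (-a) (a + N) (N + 1) (-1) (maxSucc F) (maxSucc G))
    (hn : 2 * (cnt F + cnt G) ≤ n)
    (hc : ∀ h, ∑ j ∈ Finset.range (cnt F + cnt G + 1), c j * rowVal a N F G h (n - 2 * j) = 0)
    (hu : u ∈ invol G) :
    mulF (fam (-1) (-1) (maxSucc G)) (mulF (fam (a + N) (-1) (maxSucc F))
      (mulF (fam (-a) 1 (maxSucc F)) Λ)) (famE (N + 1) 1 (maxSucc G) u *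
        ∑ j ∈ Finset.range (cnt F + cnt G + 1), C (c j) * hahn a a N (n - 2 * j)) = 0 := by
  refine Chain.sum_eq_zero (α := -a - 1) (β₁ := a + N + 1) (β₂ := 0) (T := opD3 a)
    (y := polyY a (-2 - N - 2 * a)) hg
    ⟨?_, fun f => ?_⟩ (fun f => ?_) (by norm_num) (firstOrder_opD3 hg) (polyY_zero a _)
    (fun u => ?_) (fun u => ?_) (lt_maxSucc_of_mem_invol hu) hn (by
      rw [← polyZ_eq]; exact eRow_polyZ_relation hc hu)
  · convert h.third using 3 <;> congr 1 <;> ring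
  · rw [opH_apply, fwd_apply, bwd_apply]; simp only [C_sub, C_neg, C_1, C_0, C_add]; ring
  · rw [opD3_apply, fwd_apply, C_1]; simp only [C_sub, C_neg, C_1, C_add]; ring
  · refine mul_ne_zero (fun h => hg.a_ne (u + 1) (by push_cast; linarith)) fun h =>
      hg.N_ne (-u - 2) (by push_cast; linarith)
  · rw [X_mul_polyY hg.dual.1 hg.dual.2.2]; congr 1; congr 1
    all_goals congr 2; ring

lemma orth_fourth (hg : Generic a N)
    (h : PearsonFour Λ (-a) (a + N) (N + 1) (-1) (maxSucc F) (maxSucc G))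
    (hn : 2 * (cnt F + cnt G) ≤ n)
    (hc : ∀ h, ∑ j ∈ Finset.range (cnt F + cnt G + 1), c j * rowVal a N F G h (n - 2 * j) = 0)
    (hu : u ∈ invol G) :
    mulF (fam (a + N) (-1) (maxSucc F)) (mulF (fam (N + 1) 1 (maxSucc G))
      (mulF (fam (-a) 1 (maxSucc F)) Λ)) (famE (-1) (-1) (maxSucc G) u *
        ∑ j ∈ Finset.range (cnt F + cnt G + 1), C (c j) * hahn a a N (n - 2 * j)) = 0 := by
  refine Chain.sum_eq_zero (α := a + N + 1) (β₁ := -a - 1) (β₂ := N) (T := opD4 a N)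
    (y := polyY a (-2 - N - 2 * a)) hg
    ⟨?_, fun f => ?_⟩ (fun f => ?_) (by norm_num) (firstOrder_opD4 hg) (polyY_zero a _)
    (fun u => ?_) (fun u => ?_) (lt_maxSucc_of_mem_invol hu) hn (by
      rw [← polyZ_eq]; exact eRow_polyZ_relation hc hu)
  · convert h.fourth using 3 <;> congr 1 <;> ring
  · rw [opH_apply, fwd_apply, bwd_apply, neg_neg]
    simp only [C_sub, C_neg, C_1, C_add]; ring
  · rw [opD4_apply, bwd_apply, C_neg, C_1]; ring
  · refine mul_ne_zero (fun h => hg.a_ne (u + 1) (by push_cast; linarith)) fun h =>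
      hg.N_ne (-u - 2) (by push_cast; linarith)
  · rw [X_mul_polyY hg.dual.1 hg.dual.2.2]; congr 1; congr 1
    all_goals congr 2; ring

end

/-- The starting points of the four families of linear factors. -/
def rootStart (a N : ℝ) : Fin 4 → ℝ := ![-a, a + N, N + 1, -1]

/-- The directions of the four families of linear factors. -/
def rootDir : Fin 4 → ℝ := ![1, -1, 1, -1]

/-- The index sets of the linear factors that are missing in the Krall–Hahn weight. -/
def missing (F G : Finset ℕ) : Finset (Σ _ : Fin 4, ℕ) :=
  Finset.univ.sigma ![invol F, invol F, invol G, invol G]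

/-- The zeros of the linear factors. -/
def rootVal (a N : ℝ) (i : Σ _ : Fin 4, ℕ) : ℝ := rootStart a N i.1 + rootDir i.1 * i.2

lemma card_missing (F G : Finset ℕ) : (missing F G).card = 2 * (cnt F + cnt G) := by
  rw [missing, Finset.card_sigma, Fin.sum_univ_four]
  simp only [Matrix.cons_val]
  change cnt F + cnt F + cnt G + cnt G = _
  ring

lemma prod_missing (a N : ℝ) (F G : Finset ℕ) :
    ∏ i ∈ missing F G, (X - C (rootVal a N i)) = famI (-a) 1 F * famI (a + N) (-1) F *
      famI (N + 1) 1 G * famI (-1) (-1) G := by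
  rw [missing, Finset.prod_sigma, Fin.prod_univ_four]
  rfl

lemma rootVal_injective {a N : ℝ} (hg : Generic a N) : Function.Injective (rootVal a N) := by
  have key : ∀ (j k : Fin 4) (u v : ℕ), rootStart a N j + rootDir j * u =
      rootStart a N k + rootDir k * v → j = k := by
    intro j k u v h
    fin_cases j <;> fin_cases k <;> try rfl
    all_goals
      exfalso
      simp only [rootStart, rootDir, Fin.zero_eta, Fin.mk_one, Fin.reduceFinMk, Matrix.cons_val,
        one_mul, neg_mul] at h
    · exact hg.two_aN_ne (u + v) (by push_cast; linarith)
    · exact hg.aN_ne (u - v - 1) (by push_cast; linarith)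
    · exact hg.a_ne (u + v + 1) (by push_cast; linarith)
    · exact hg.two_aN_ne (u + v) (by push_cast; linarith)
    · exact hg.a_ne (u + v + 1) (by push_cast; linarith)
    · exact hg.aN_ne (u - v - 1) (by push_cast; linarith)
    · exact hg.aN_ne (v - u - 1) (by push_cast; linarith)
    · exact hg.a_ne (u + v + 1) (by push_cast; linarith)
    · exact hg.N_ne (-u - v - 2) (by push_cast; linarith)
    · exact hg.a_ne (u + v + 1) (by push_cast; linarith)
    · exact hg.aN_ne (v - u - 1) (by push_cast; linarith)
    · exact hg.N_ne (-u - v - 2) (by push_cast; linarith)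
  rintro ⟨j, u⟩ ⟨k, v⟩ h
  obtain rfl := key j k u v h
  have h1 : rootDir j * (u - v : ℝ) = 0 := by
    have h2 : rootStart a N j + rootDir j * u = rootStart a N j + rootDir j * v := h
    linear_combination h2
  have h2 : rootDir j ≠ 0 := by fin_cases j <;> simp [rootDir]
  have h3 := (mul_eq_zero.1 h1).resolve_left h2
  have h4 : u = v := Nat.cast_injective (sub_eq_zero.1 h3)
  rw [h4]

lemma mulF_four {K T A B D E q f : ℝ[X]} (h : K * T = A * (B * (D * E))) (Φ : ℝ[X] →ₗ[ℝ] ℝ) :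
    mulF (K * q) Φ (T * f) = mulF A (mulF B (mulF D (mulF E Φ))) (q * f) := by
  simp only [mulF_apply]
  rw [show K * q * (T * f) = E * (D * (B * (A * (q * f)))) by linear_combination q * f * h]

lemma mulF_erase {K T E q ψ : ℝ[X]} {r : ℝ} (h : (X - C r) * ψ = T) (hE : K * T = (X - C r) * E)
    (Φ : ℝ[X] →ₗ[ℝ] ℝ) : mulF (K * q) Φ ψ = Φ (E * q) := by
  rw [mulF_apply, show K * q * ψ = E * q from mul_left_cancel₀ (X_sub_C_ne_zero r)
    (by linear_combination K * q * h + q * hE)]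

lemma eq_mulF_of_famE {K T A A' B D E q ψ : ℝ[X]} {r : ℝ} (h : (X - C r) * ψ = T)
    (hE : K * T = A * (B * (D * E))) (hA : (X - C r) * A' = A) (Φ : ℝ[X] →ₗ[ℝ] ℝ) :
    mulF (K * q) Φ ψ = Φ (E * (D * (B * (A' * q)))) := by
  rw [mulF_erase h (E := A' * (B * (D * E))) (by rw [hE, ← hA]; ring),
    show A' * (B * (D * E)) * q = E * (D * (B * (A' * q))) by ring]

/-- The combinations of `h_n, h_{n-2}, …` whose coefficients annihilate all rows are orthogonal to
all polynomials of smaller degree with respect to the Krall–Hahn functional. -/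
lemma krall_orthogonal {a N : ℝ} (hg : Generic a N) {F G : Finset ℕ}
    (hF : ∀ f ∈ F, 0 < f) (hG : ∀ f ∈ G, 0 < f) {L : ℝ[X] →ₗ[ℝ] ℝ}
    (hL : ∀ f, L (opH (a - maxSucc F - maxSucc G) (N + 2 * maxSucc G) f) = 0) {n : ℕ} {c : ℕ → ℝ}
    (hn : 2 * (cnt F + cnt G) ≤ n)
    (hc : ∀ h, ∑ j ∈ Finset.range (cnt F + cnt G + 1), c j * rowVal a N F G h (n - 2 * j) = 0)
    {g : ℝ[X]} (hd : g.degree < n) :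
    L (krallFactor (a - maxSucc F - maxSucc G) (N + 2 * maxSucc G) F G * shift (-maxSucc G)
      ((∑ j ∈ Finset.range (cnt F + cnt G + 1), C (c j) * hahn a a N (n - 2 * j)) * g)) = 0 := by
  have hP := pearsonFour_shift (pearson_of_opH hL)
  set Λ := L ∘ₗ shift (-maxSucc G) with hΛ
  set q := ∑ j ∈ Finset.range (cnt F + cnt G + 1), C (c j) * hahn a a N (n - 2 * j) with hq
  set K := famF (-a) 1 F * famF (a + N) (-1) F * (famF (N + 1) 1 G * famF (-1) (-1) G) with hK
  have h1 : L (krallFactor (a - maxSucc F - maxSucc G) (N + 2 * maxSucc G) F G *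
      shift (-maxSucc G) (q * g)) = (-1) ^ F.card * (-1) ^ G.card * mulF (K * q) Λ g := by
    rw [mulF_apply, ← apply_C_mul, hΛ, LinearMap.comp_apply]
    congr 1
    have h2 := shift_krallFactor a N F G
    rw [← hK] at h2
    rw [← mul_assoc, ← mul_assoc, ← h2, mul_assoc, shift_mul _ (shift _ _), shift_shift,
      neg_add_cancel, shift_zero_apply]
  rw [h1]
  refine mul_eq_zero_of_right _ ?_
  set T := ∏ i ∈ missing F G, (X - C (rootVal a N i)) with hT
  have hfull : K * T = fam (-a) 1 (maxSucc F) * (fam (-1) (-1) (maxSucc G) *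
      (fam (a + N) (-1) (maxSucc F) * fam (N + 1) 1 (maxSucc G))) := by
    rw [hT, prod_missing, hK, ← famF_mul_famI _ _ hF, ← famF_mul_famI _ _ hF,
      ← famF_mul_famI _ _ hG, ← famF_mul_famI _ _ hG]
    ring
  refine eq_zero_of_prod (T := missing F G) (v := rootVal a N) (m := n - 2 * (cnt F + cnt G))
    (rootVal_injective hg).injOn (fun f hf => ?_) (fun i hi => ?_) (by
      rw [card_missing, Nat.sub_add_cancel hn]; exact hd)
  · have h2 := mulF_four (q := q) (f := f) hfull Λ
    have h3 : Pearson (mulF (fam (-a) 1 (maxSucc F)) (mulF (fam (-1) (-1) (maxSucc G))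
        (mulF (fam (a + N) (-1) (maxSucc F)) (mulF (fam (N + 1) 1 (maxSucc G)) Λ)))) 1
        ((X + C (a + 1)) * (X - C N)) (X * (X - C (a + N + 1))) := by
      convert hP.all using 1
      · rw [← sub_neg_eq_add X, ← C_neg]; congr 3 <;> ring
      · rw [sub_self, C_0, sub_zero, mul_comm, sub_neg_eq_add]
    rw [h2, hq, Finset.sum_mul, map_sum]
    refine Finset.sum_eq_zero fun j hj => ?_
    have hj' := Finset.mem_range.1 hj
    rw [mul_assoc, apply_C_mul, h3.hahn_mul hg, mul_zero]
    exact hf.trans_le (by exact_mod_cast (show n - 2 * (cnt F + cnt G) ≤ n - 2 * j by omega))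
  · obtain ⟨j, u⟩ := i
    have hu : u ∈ (![invol F, invol F, invol G, invol G] : Fin 4 → Finset ℕ) j :=
      (Finset.mem_sigma.1 hi).2
    have h2 := Finset.mul_prod_erase (missing F G) (fun i => X - C (rootVal a N i)) hi
    rw [← hT] at h2
    have hlt := fun (F : Finset ℕ) (hu : u ∈ invol F) => lt_maxSucc_of_mem_invol hu
    fin_cases j
    · replace hu : u ∈ invol F := hu
      have h4 := orth_first hg hP hn hc hu
      simp only [mulF_apply] at h4
      refine (eq_mulF_of_famE (r := -a + 1 * u) h2 hfull
        (mul_famE _ _ (hlt F hu)) Λ).trans h4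
    · replace hu : u ∈ invol F := hu
      have h4 := orth_second hg hP hn hc hu
      simp only [mulF_apply] at h4
      refine (eq_mulF_of_famE (r := a + N + -1 * u) h2 (by rw [hfull]; ring)
        (mul_famE _ _ (hlt F hu)) Λ).trans h4
    · replace hu : u ∈ invol G := hu
      have h4 := orth_third hg hP hn hc hu
      simp only [mulF_apply] at h4
      refine (eq_mulF_of_famE (r := N + 1 + 1 * u) h2 (by rw [hfull]; ring)
        (mul_famE _ _ (hlt G hu)) Λ).trans h4
    · replace hu : u ∈ invol G := hu
      have h4 := orth_fourth hg hP hn hc hu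
      simp only [mulF_apply] at h4
      refine (eq_mulF_of_famE (r := -1 + -1 * u) h2 (by rw [hfull]; ring)
        (mul_famE _ _ (hlt G hu)) Λ).trans h4

/-! ### Symmetry of a difference operator from its eigenfunctions of high degree -/

/-- The commutator of a bilinear form with the multiplication by `X`. -/
def adX : Module.End ℝ (ℝ[X] →ₗ[ℝ] ℝ[X] →ₗ[ℝ] ℝ) where
  toFun B := B ∘ₗ LinearMap.mulLeft ℝ X - B.compl₂ (LinearMap.mulLeft ℝ X)
  map_add' B B' := by ext; simp; ring
  map_smul' c B := by ext; simp; ring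

lemma adX_apply (B : ℝ[X] →ₗ[ℝ] ℝ[X] →ₗ[ℝ] ℝ) (f g : ℝ[X]) :
    adX B f g = B (X * f) g - B f (X * g) := rfl

/-- The bilinear form `f, g ↦ W (S f * T g)`. -/
def bilinW (W : ℝ[X] →ₗ[ℝ] ℝ) (S T : Module.End ℝ ℝ[X]) : ℝ[X] →ₗ[ℝ] ℝ[X] →ₗ[ℝ] ℝ :=
  ((LinearMap.mul ℝ ℝ[X]).compl₁₂ S T).compr₂ W

lemma bilinW_apply (W : ℝ[X] →ₗ[ℝ] ℝ) (S T : Module.End ℝ ℝ[X]) (f g : ℝ[X]) :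
    bilinW W S T f g = W (S f * T g) := rfl

lemma adX_bilinW_left (W : ℝ[X] →ₗ[ℝ] ℝ) (h : ℝ[X]) (l : ℝ) :
    adX (bilinW W (mulBy h * shift l) 1) = l • bilinW W (mulBy h * shift l) 1 := by
  refine LinearMap.ext fun f => LinearMap.ext fun g => ?_
  have h1 : shift l X = X + C l := by rw [shift_apply, X_comp]
  rw [adX_apply, LinearMap.smul_apply, LinearMap.smul_apply, bilinW_apply, bilinW_apply,
    bilinW_apply, ← map_sub, smul_eq_mul, ← apply_C_mul]
  simp only [Module.End.mul_apply, mulBy_apply, Module.End.one_apply, shift_mul, h1]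
  congr 1; ring

lemma adX_bilinW_right (W : ℝ[X] →ₗ[ℝ] ℝ) (h : ℝ[X]) (l : ℝ) :
    adX (bilinW W 1 (mulBy h * shift l)) = (-l) • bilinW W 1 (mulBy h * shift l) := by
  refine LinearMap.ext fun f => LinearMap.ext fun g => ?_
  have h1 : shift l X = X + C l := by rw [shift_apply, X_comp]
  rw [adX_apply, LinearMap.smul_apply, LinearMap.smul_apply, bilinW_apply, bilinW_apply,
    bilinW_apply, ← map_sub, smul_eq_mul, ← apply_C_mul]
  simp only [Module.End.mul_apply, mulBy_apply, Module.End.one_apply, shift_mul, h1, C_neg]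
  congr 1; ring

lemma aeval_apply_of_eq_smul {E : Type*} [AddCommGroup E] [Module ℝ E] {T : Module.End ℝ E} {l : ℝ}
    {v : E} (h : T v = l • v) (p : ℝ[X]) : aeval T p v = p.eval l • v := by
  induction p using Polynomial.induction_on' with
  | add p q hp hq => rw [map_add, LinearMap.add_apply, hp, hq, eval_add, add_smul]
  | monomial n c =>
    have h1 : ∀ n : ℕ, (T ^ n) v = l ^ n • v := fun n => by
      induction n with
      | zero => simp
      | succ n ih => rw [pow_succ', Module.End.mul_apply, ih, map_smul, h, smul_smul, pow_succ]
    rw [aeval_monomial, eval_monomial, Module.End.mul_apply, h1, Module.algebraMap_end_apply,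
      smul_smul]

lemma aeval_X_sub_C_mul {E : Type*} [AddCommGroup E] [Module ℝ E] (T : Module.End ℝ E) (c : ℝ)
    (p : ℝ[X]) (v : E) : aeval T ((X - C c) * p) v = aeval T p (T v - c • v) := by
  rw [mul_comm, map_mul, Module.End.mul_apply, map_sub, aeval_X, aeval_C,
    LinearMap.sub_apply, Module.algebraMap_end_apply]

/-- A sum of eigenvectors vanishes if it lies in a set on which the operator, minus any scalar, acts
injectively. -/
lemma eq_zero_of_sum_eigenvectors {E : Type*} [AddCommGroup E] [Module ℝ E] {T : Module.End ℝ E}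
    {V : E → Prop} (hV : ∀ v (c : ℝ), V v → V (T v - c • v))
    (hV0 : ∀ v (c : ℝ), V v → T v - c • v = 0 → v = 0)
    {S : Finset ℤ} {v w : ℤ → E} (hv : ∀ l, T (v l) = (l : ℝ) • v l)
    (hw : ∀ l, T (w l) = (-l : ℝ) • w l) {x : E} (hx : V x) (hxs : x = ∑ l ∈ S, (v l - w l)) :
    x = 0 := by
  have h1 : aeval T (∏ l ∈ S, ((X - C (l : ℝ)) * (X - C (-l : ℝ)))) x = 0 := by
    rw [hxs, map_sum]
    refine Finset.sum_eq_zero fun l hl => ?_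
    rw [map_sub, aeval_apply_of_eq_smul (hv l), aeval_apply_of_eq_smul (hw l), eval_prod,
      eval_prod, Finset.prod_eq_zero hl (by simp), Finset.prod_eq_zero hl (by simp), zero_smul,
      zero_smul, sub_zero]
  clear hxs
  induction S using Finset.induction_on generalizing x with
  | empty => simpa using h1
  | insert l S hl ih =>
    rw [Finset.prod_insert hl, mul_assoc, aeval_X_sub_C_mul, aeval_X_sub_C_mul] at h1
    exact hV0 _ _ hx (hV0 _ _ (hV _ _ hx) (ih (hV _ _ (hV _ _ hx)) h1))

/-- The functionals `B(f, ·)` are represented by polynomials of bounded degree. -/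
def IsFiniteForm (W : ℝ[X] →ₗ[ℝ] ℝ) (B : ℝ[X] →ₗ[ℝ] ℝ[X] →ₗ[ℝ] ℝ) : Prop :=
  ∃ (d : ℕ) (γ : ℝ[X] → ℝ[X]), (∀ f, (γ f).natDegree ≤ d) ∧ ∀ f g, B f g = W (γ f * g)

lemma IsFiniteForm.adX_sub {W : ℝ[X] →ₗ[ℝ] ℝ} {B : ℝ[X] →ₗ[ℝ] ℝ[X] →ₗ[ℝ] ℝ}
    (h : IsFiniteForm W B) (c : ℝ) : IsFiniteForm W ((adX B - c • B)) := by
  obtain ⟨d, γ, h1, h2⟩ := h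
  refine ⟨d + 1, fun f => γ (X * f) - (X + C c) * γ f, fun f => ?_, fun f g => ?_⟩
  · refine (natDegree_sub_le _ _).trans (max_le ((h1 _).trans d.le_succ) ?_)
    refine natDegree_mul_le.trans ?_
    rw [natDegree_X_add_C]; have := h1 f; omega
  · rw [LinearMap.sub_apply, LinearMap.sub_apply,
      adX_apply, LinearMap.smul_apply, LinearMap.smul_apply, h2, h2, h2, smul_eq_mul,
      ← apply_C_mul, ← map_sub, ← map_sub]
    congr 1; ring

lemma IsFiniteForm.eq_zero {W : ℝ[X] →ₗ[ℝ] ℝ} (hW : ∀ γ, (∀ g, W (γ * g) = 0) → γ = 0)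
    {B : ℝ[X] →ₗ[ℝ] ℝ[X] →ₗ[ℝ] ℝ} (h : IsFiniteForm W B) {c : ℝ}
    (hc : (adX B - c • B) = 0) : B = 0 := by
  obtain ⟨d, γ, h1, h2⟩ := h
  have h3 : ∀ f, γ (X * f) = (X + C c) * γ f := fun f => by
    rw [← sub_eq_zero]
    refine hW _ fun g => ?_
    have h4 := LinearMap.congr_fun (LinearMap.congr_fun hc f) g
    rw [LinearMap.sub_apply, LinearMap.sub_apply,
      adX_apply, LinearMap.smul_apply, LinearMap.smul_apply, h2, h2, h2, smul_eq_mul,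
      ← apply_C_mul, ← map_sub, ← map_sub] at h4
    refine Eq.trans ?_ h4
    congr 1; ring
  have h4 : ∀ n f, γ (X ^ n * f) = (X + C c) ^ n * γ f := fun n f => by
    induction n with
    | zero => simp
    | succ n ih => rw [pow_succ', mul_assoc, h3, ih, pow_succ', mul_assoc]
  refine LinearMap.ext fun f => LinearMap.ext fun g => ?_
  have h5 : γ f = 0 := by
    by_contra hne
    have h6 := h1 (X ^ (d + 1) * f)
    rw [h4, natDegree_mul (pow_ne_zero _ (X_add_C_ne_zero c)) hne, natDegree_pow,
      natDegree_X_add_C] at h6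
    omega
  rw [h2, h5, zero_mul, map_zero]; rfl

lemma eq_zero_of_low_of_high {Φ : ℝ[X] →ₗ[ℝ] ℝ} {n₀ : ℕ} {q : ℕ → ℝ[X]}
    (hq : ∀ k, n₀ ≤ k → (q k).degree = k) (h1 : ∀ f : ℝ[X], f.degree < n₀ → Φ f = 0)
    (h2 : ∀ k, n₀ ≤ k → Φ (q k) = 0) (f : ℝ[X]) : Φ f = 0 := by
  obtain ⟨e, he⟩ := exists_sum_of_degree (q := fun j => if n₀ ≤ j then q j else X ^ j)
    (m := f.natDegree + 1) (fun j _ => by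
      split_ifs with h
      · exact hq j h
      · exact degree_X_pow j)
    (degree_le_natDegree.trans_lt (by exact_mod_cast Nat.lt_succ_self _))
  rw [he, map_sum]
  refine Finset.sum_eq_zero fun j _ => ?_
  rw [apply_C_mul]
  split_ifs with h
  · rw [h2 j h, mul_zero]
  · rw [h1 _ (by rw [degree_X_pow]; exact_mod_cast not_le.1 h), mul_zero]

/-- A functional that vanishes on the orthogonal polynomials of degree at least `n₀` is represented
by a polynomial: the form `f, g ↦ W (f * g)` is nondegenerate on the polynomials of degree less than
`n₀`. -/
lemma exists_repr {W : ℝ[X] →ₗ[ℝ] ℝ} (hW : ∀ γ, (∀ g, W (γ * g) = 0) → γ = 0) {n₀ : ℕ}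
    {q : ℕ → ℝ[X]} (hq : ∀ k, n₀ ≤ k → (q k).degree = k)
    (horth : ∀ k, n₀ ≤ k → ∀ g : ℝ[X], g.degree < k → W (q k * g) = 0) {Φ : ℝ[X] →ₗ[ℝ] ℝ}
    (hΦ : ∀ k, n₀ ≤ k → Φ (q k) = 0) :
    ∃ γ : ℝ[X], γ.natDegree ≤ n₀ ∧ ∀ g, Φ g = W (γ * g) := by
  have : Module.Finite ℝ (degreeLT ℝ n₀) := Module.Finite.equiv (degreeLTEquiv ℝ n₀).symm
  let T : degreeLT ℝ n₀ →ₗ[ℝ] Module.Dual ℝ (degreeLT ℝ n₀) :=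
    ((bilinW W 1 1).compl₂ (degreeLT ℝ n₀).subtype) ∘ₗ (degreeLT ℝ n₀).subtype
  have hT : ∀ γ g, T γ g = W ((γ : ℝ[X]) * g) := fun γ g => rfl
  have hhigh : ∀ γ : degreeLT ℝ n₀, ∀ k, n₀ ≤ k → W ((γ : ℝ[X]) * q k) = 0 := fun γ k hk => by
    rw [mul_comm]
    exact horth k hk _ ((mem_degreeLT.1 γ.2).trans_le (by exact_mod_cast hk))
  have hinj : Function.Injective T := by
    rw [← LinearMap.ker_eq_bot, LinearMap.ker_eq_bot']
    intro γ hγ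
    refine Subtype.ext (hW _ fun g => eq_zero_of_low_of_high (Φ := mulF γ W) hq
      (fun f hf => ?_) (hhigh γ) g)
    exact LinearMap.congr_fun hγ ⟨f, mem_degreeLT.2 hf⟩
  obtain ⟨γ, hγ⟩ := (LinearMap.injective_iff_surjective_of_finrank_eq_finrank
    Subspace.dual_finrank_eq.symm).1 hinj (Φ ∘ₗ (degreeLT ℝ n₀).subtype)
  refine ⟨γ, natDegree_le_of_degree_le (mem_degreeLT.1 γ.2).le, fun g => ?_⟩
  rw [← sub_eq_zero]
  refine eq_zero_of_low_of_high (Φ := Φ - mulF γ W) hq (fun f hf => ?_) (fun k hk => ?_) g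
  · have h1 := LinearMap.congr_fun hγ ⟨f, mem_degreeLT.2 hf⟩
    rw [hT] at h1
    rw [LinearMap.sub_apply, mulF_apply, h1]
    exact sub_self _
  · rw [LinearMap.sub_apply, mulF_apply, hhigh γ k hk, hΦ k hk, sub_zero]

/-- A difference operator that preserves the polynomials of degree less than `n₀` is symmetric as
soon as it has orthogonal eigenfunctions of all degrees `k ≥ n₀`: the defect of symmetry is a form
of finite rank, and the eigenvalues of `adX` on it are those of a difference operator, which do not
occur on forms of finite rank. -/
lemma symm_of_eigenfunctions {W : ℝ[X] →ₗ[ℝ] ℝ} (hW : ∀ γ, (∀ g, W (γ * g) = 0) → γ = 0)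
    {T : Module.End ℝ ℝ[X]} {k : ℤ} (hT : HasOrder T k) {n₀ : ℕ}
    (hdeg : ∀ f : ℝ[X], f.degree < n₀ → (T f).degree < n₀) {q : ℕ → ℝ[X]} {e : ℕ → ℝ}
    (hq : ∀ k, n₀ ≤ k → (q k).degree = k)
    (horth : ∀ k, n₀ ≤ k → ∀ g : ℝ[X], g.degree < k → W (q k * g) = 0)
    (he : ∀ k, n₀ ≤ k → T (q k) = C (e k) * q k) (f g : ℝ[X]) : W (T f * g) = W (f * T g) := by
  obtain ⟨s, r, h, -, -, -, hTs, -⟩ := hT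
  set B := bilinW W T 1 - bilinW W 1 T with hB
  have hBa : ∀ f g, B f g = W (T f * g) - W (f * T g) := fun f g => rfl
  have hBq : ∀ f k, n₀ ≤ k → B f (q k) = 0 := by
    intro f k hk
    refine eq_zero_of_low_of_high (Φ := B.flip (q k)) hq (fun f hf => ?_) (fun j hj => ?_) f
    · have hk' : (n₀ : WithBot ℕ) ≤ k := by exact_mod_cast hk
      rw [LinearMap.flip_apply, hBa, he k hk, mul_left_comm, apply_C_mul, mul_comm, mul_comm f,
        horth k hk _ (hf.trans_le hk'), horth k hk _ ((hdeg f hf).trans_le hk'), mul_zero, sub_zero]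
    · rw [LinearMap.flip_apply, hBa, he k hk, he j hj, mul_left_comm, apply_C_mul, mul_assoc,
        apply_C_mul]
      rcases lt_trichotomy j k with hjk | rfl | hjk
      · rw [mul_comm (q j), horth k hk _ (by rw [hq j hj]; exact_mod_cast hjk)]; simp
      · rw [sub_self]
      · rw [horth j hj _ (by rw [hq k hk]; exact_mod_cast hjk)]; simp
  have hfin : IsFiniteForm W B := by
    choose γ h1 h2 using fun f => exists_repr hW hq horth (Φ := B f) (hBq f)
    exact ⟨n₀, γ, h1, h2⟩
  have hsum : B = ∑ l ∈ Finset.Icc s r, (bilinW W (mulBy (h l) * shift (l : ℝ)) 1 -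
      bilinW W 1 (mulBy (h l) * shift (l : ℝ))) := by
    refine LinearMap.ext fun f => LinearMap.ext fun g => ?_
    rw [hBa, hTs]
    simp only [LinearMap.sum_apply, LinearMap.sub_apply, bilinW_apply, Module.End.one_apply,
      Finset.sum_sub_distrib, Finset.sum_mul, Finset.mul_sum, map_sum]
  have hB0 := eq_zero_of_sum_eigenvectors (V := IsFiniteForm W) (fun _ c h => h.adX_sub c)
    (fun _ _ h => h.eq_zero hW) (fun l => adX_bilinW_left W (h l) l)
    (fun l => adX_bilinW_right W (h l) l) hfin hsum
  rw [← sub_eq_zero, ← hBa, hB0]; rfl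

/-! ### Operators that preserve degrees -/

/-- The operator does not raise degrees. -/
def PreservesDegree (T : Module.End ℝ ℝ[X]) : Prop :=
  ∀ (m : ℕ) (f : ℝ[X]), f.degree < m → (T f).degree < m

lemma PreservesDegree.add {S T : Module.End ℝ ℝ[X]} (hS : PreservesDegree S)
    (hT : PreservesDegree T) : PreservesDegree (S + T) := fun m f hf =>
  (degree_add_le _ _).trans_lt (max_lt (hS m f hf) (hT m f hf))

lemma PreservesDegree.mul {S T : Module.End ℝ ℝ[X]} (hS : PreservesDegree S)
    (hT : PreservesDegree T) : PreservesDegree (S * T) := fun m f hf => hS m _ (hT m f hf)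

lemma PreservesDegree.smul {T : Module.End ℝ ℝ[X]} (hT : PreservesDegree T) (c : ℝ) :
    PreservesDegree (c • T) := fun m f hf => (degree_smul_le _ _).trans_lt (hT m f hf)

lemma PreservesDegree.one : PreservesDegree 1 := fun _ _ hf => hf

lemma PreservesDegree.sum {ι : Type*} {s : Finset ι} {T : ι → Module.End ℝ ℝ[X]}
    (h : ∀ i ∈ s, PreservesDegree (T i)) : PreservesDegree (∑ i ∈ s, T i) := by
  classical
  induction s using Finset.induction_on with
  | empty => exact fun m f _ => by simp
  | insert i s hi ih =>
    rw [Finset.sum_insert hi]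
    exact (h i (Finset.mem_insert_self _ _)).add
      (ih fun j hj => h j (Finset.mem_insert_of_mem hj))

lemma PreservesDegree.aeval {T : Module.End ℝ ℝ[X]} (hT : PreservesDegree T) (p : ℝ[X]) :
    PreservesDegree (aeval T p) := by
  rw [aeval_eq_sum_range]
  refine PreservesDegree.sum fun i _ => PreservesDegree.smul ?_ _
  clear * - hT
  induction i with
  | zero => rw [pow_zero]; exact PreservesDegree.one
  | succ i ih => rw [pow_succ]; exact ih.mul hT

lemma preservesDegree_opH (a N : ℝ) : PreservesDegree (opH a N) := by
  intro m f hf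
  have h1 := degree_opH_sub_lt a N hf.le
  have h2 : (C ((m : ℝ) * (m + 2 * a + 1)) * f).degree < m := by
    rw [← smul_eq_C_mul]; exact (degree_smul_le _ _).trans_lt hf
  simpa using (degree_add_le _ _).trans_lt (max_lt h1 h2)

lemma degree_mul_shift_sub {p : ℝ[X]} (hp : p.natDegree ≤ 1) (c : ℝ) {m : ℕ} {f : ℝ[X]}
    (hf : f.degree < m) : (p * (shift c f - f)).degree < m := by
  by_cases h0 : shift c f - f = 0
  · rw [h0, mul_zero, degree_zero]; exact WithBot.bot_lt_coe _
  have hf0 : f ≠ 0 := by rintro rfl; simp at h0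
  have h1 : (shift c f).degree = f.degree := degree_taylor _ _
  have h2 := degree_sub_lt_left h1 (fun h => hf0 ((taylor_eq_zero c f).1 h)) (leadingCoeff_taylor _ _)
  have h3 : (shift c f - f).natDegree < f.natDegree := natDegree_lt_natDegree h0 (h1 ▸ h2)
  have h4 := (natDegree_lt_iff_degree_lt hf0).2 hf
  refine degree_le_natDegree.trans_lt ?_
  have h5 : (p * (shift c f - f)).natDegree < m := natDegree_mul_le.trans_lt (by omega)
  exact_mod_cast h5

lemma preservesDegree_fwd (r : ℝ) : PreservesDegree (mulBy (X - C r) * fwd) := fun _ _ hf =>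
  degree_mul_shift_sub (natDegree_X_sub_C r).le 1 hf

lemma preservesDegree_bwd (r : ℝ) : PreservesDegree (mulBy (X - C r) * bwd) := fun m f hf => by
  have h1 := degree_mul_shift_sub (natDegree_X_sub_C r).le (-1) hf
  rw [← degree_neg, ← mul_neg, neg_sub] at h1
  exact h1

lemma preservesDegree_opK (a N : ℝ) (b : Bool) : PreservesDegree (opK a N b) := by
  have h0 : PreservesDegree (mulBy (C ((2 * a + 1) / 2))) := by
    rw [mulBy_C]; exact PreservesDegree.one.smul _
  have h1 := preservesDegree_bwd 0
  have h2 := preservesDegree_fwd (-(a + 1))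
  rw [C_0, sub_zero] at h1
  rw [C_neg, sub_neg_eq_add] at h2
  rw [opK]
  split_ifs
  · exact (h0.add h1).add (h0.add (preservesDegree_fwd N))
  · exact (h0.add h2).add (h0.add (preservesDegree_bwd _))

lemma preservesDegree_opSR (a N : ℝ) (F G : Finset ℕ) (μ : Fin (cnt F + cnt G) → ℝ[X]) (P : ℝ[X]) :
    PreservesDegree (opSR a N F G μ P) := by
  have h := preservesDegree_opH a N
  exact ((h.aeval P).smul _).add (PreservesDegree.sum fun i _ =>
    ((h.aeval _).mul (preservesDegree_opK a N _)).mul (h.aeval _))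

/-! ### Nondegeneracy of the Hahn functional -/

/-- The zeros of `d` cannot be shifted indefinitely, so that `A` vanishes at a shifted zero. -/
lemma exists_aeval_eq_zero_add {d A : ℝ[X]} (hd : d ≠ 0) {ε : ℝ} (hε : ε ≠ 0)
    (h : d ∣ A * shift ε d) {z : ℂ} (hz : aeval z d = 0) :
    ∃ m : ℕ, aeval (z + m * ε) A = 0 := by
  by_contra! hA
  have h1 : ∀ m : ℕ, aeval (z + m * ε) d = 0 := by
    intro m
    induction m with
    | zero => simpa using hz
    | succ m ih =>
      obtain ⟨e, he⟩ := h
      have h2 := congrArg (aeval (z + m * ε)) he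
      rw [map_mul, map_mul, ih, zero_mul, shift_apply, aeval_comp] at h2
      have h3 := (mul_eq_zero.1 h2).resolve_left (hA m)
      rw [← h3]
      refine congrArg (fun w => aeval w d) ?_
      simp; ring
  have h2 : (d.map (algebraMap ℝ ℂ)) ≠ 0 :=
    (Polynomial.map_ne_zero_iff (algebraMap ℝ ℂ).injective).2 hd
  refine h2 (eq_zero_of_infinite_isRoot _ (Set.Infinite.mono (s := Set.range fun m : ℕ => z + m * (ε : ℂ)) ?_
    (Set.infinite_range_of_injective fun m n hmn => ?_)))
  · rintro _ ⟨m, rfl⟩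
    rw [Set.mem_ofPred_eq, IsRoot, eval_map_algebraMap, h1]
  · have h3 : (m : ℂ) * ε = n * ε := add_left_cancel hmn
    exact_mod_cast mul_right_cancel₀ (by exact_mod_cast hε) h3

/-- For generic parameters the Pearson equation implies nondegeneracy: the generator of the ideal
of the polynomials `f` with `f L = 0` has no zeros, as the zeros could be shifted up to a zero of
one coefficient of the equation and down to a zero of the other. -/
lemma Pearson.nondegenerate {a N : ℝ} (hg : Generic a N) {L : ℝ[X] →ₗ[ℝ] ℝ}
    (h : Pearson L 1 ((X + C (a + 1)) * (X - C N)) (X * (X - C (a + N + 1)))) (hL : L 1 ≠ 0)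
    {γ : ℝ[X]} (hγ : ∀ g, L (γ * g) = 0) : γ = 0 := by
  let I : Ideal ℝ[X] :=
    { carrier := {f | ∀ g, L (f * g) = 0}
      add_mem' := fun {f f'} hf hf' g => by rw [add_mul, map_add, hf, hf', add_zero]
      zero_mem' := fun g => by rw [zero_mul, map_zero]
      smul_mem' := fun c f hf g => by rw [smul_eq_mul, mul_comm c, mul_assoc, hf] }
  have hI : ∀ f, f ∈ I ↔ ∀ g, L (f * g) = 0 := fun f => Iff.rfl
  set d := Submodule.IsPrincipal.generator I with hd
  have hdvd : ∀ f, f ∈ I → d ∣ f := fun f hf => (Submodule.IsPrincipal.mem_iff_generator_dvd I).1 hf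
  have hdI : ∀ g, L (d * g) = 0 := (hI d).1 (Submodule.IsPrincipal.generator_mem I)
  have hup : d ∣ ((X + C (a + 1)) * (X - C N)) * shift 1 d := hdvd _ ((hI _).2 fun g => by
    have h1 := h (d * shift (-1) g)
    rw [shift_mul, shift_shift, add_neg_cancel, shift_zero_apply] at h1
    rw [mul_assoc, h1, mul_left_comm, hdI])
  have hdown : d ∣ (X * (X - C (a + N + 1))) * shift (-1) d := hdvd _ ((hI _).2 fun g => by
    have h1 := h.symm (d * shift 1 g)
    rw [shift_mul, shift_shift, neg_add_cancel, shift_zero_apply] at h1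
    rw [mul_assoc, h1, mul_left_comm, hdI])
  by_contra hne
  have hd0 : d ≠ 0 := fun h0 => hne (zero_dvd_iff.1 (h0 ▸ hdvd γ ((hI γ).2 hγ)))
  by_cases hdeg : d.degree = 0
  · obtain ⟨c, hc, hcd⟩ : ∃ c : ℝ, c ≠ 0 ∧ d = C c := by
      refine ⟨d.coeff 0, fun h0 => hd0 ?_, eq_C_of_degree_eq_zero hdeg⟩
      rw [eq_C_of_degree_eq_zero hdeg, h0, C_0]
    have h1 := hdI 1
    rw [hcd, apply_C_mul] at h1
    exact hL ((mul_eq_zero.1 h1).resolve_left hc)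
  obtain ⟨z, hz⟩ := IsAlgClosed.exists_aeval_eq_zero ℂ d hdeg
  obtain ⟨m, hm⟩ := exists_aeval_eq_zero_add hd0 one_ne_zero hup hz
  obtain ⟨k, hk⟩ := exists_aeval_eq_zero_add hd0 (by norm_num) hdown hz
  have e1 : z + m + (a + 1) = 0 ∨ z + m - N = 0 := by simpa using hm
  have e2 : z - k = 0 ∨ z - k - (a + N + 1) = 0 := by simpa [← sub_eq_add_neg] using hk
  have key : ∀ (x : ℝ) (i : ℤ), (x : ℂ) = i → x = i := fun x i hx => by exact_mod_cast hx
  rcases e1 with e1 | e1 <;> rcases e2 with e2 | e2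
  · exact hg.a_ne (-m - k - 1) (key _ _ (by push_cast; linear_combination e1 - e2))
  · exact hg.two_aN_ne (-m - k - 2) (key _ _ (by push_cast; linear_combination e1 - e2))
  · exact hg.N_ne (m + k) (key _ _ (by push_cast; linear_combination -e1 + e2))
  · exact hg.a_ne (-m - k - 1) (key _ _ (by push_cast; linear_combination e1 - e2))

lemma krallFactor_ne_zero (a N : ℝ) (F G : Finset ℕ) : krallFactor a N F G ≠ 0 := by
  have h : ∀ c : ℝ, C c - X ≠ (0 : ℝ[X]) := fun c h0 =>
    X_sub_C_ne_zero c (by rw [← neg_sub, h0, neg_zero])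
  exact mul_ne_zero (Finset.prod_ne_zero_iff.2 fun f _ => mul_ne_zero (h _) (X_add_C_ne_zero _))
    (Finset.prod_ne_zero_iff.2 fun f _ => mul_ne_zero (h _) (X_sub_C_ne_zero _))

lemma Generic.hat {a N : ℝ} (h : Generic a N) (i j : ℕ) : Generic (a - i - j) (N + 2 * j) where
  a_ne k hk := h.a_ne (k + i + j) (by push_cast; linarith)
  N_ne k hk := h.N_ne (k - 2 * j) (by push_cast; linarith)
  aN_ne k hk := h.aN_ne (k + i - j) (by push_cast; linarith)
  two_a_ne k hk := h.two_a_ne (k + 2 * i + 2 * j) (by push_cast; linarith)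
  two_aN_ne k hk := h.two_aN_ne (k + 2 * i) (by push_cast; linarith)

/-! ### Symmetry for generic parameters -/

/-- The Krall–Hahn functional, in the variable of the difference operator. -/
def krallF (a N : ℝ) (F G : Finset ℕ) (L : ℝ[X] →ₗ[ℝ] ℝ) : ℝ[X] →ₗ[ℝ] ℝ :=
  mulF (krallFactor (a - maxSucc F - maxSucc G) (N + 2 * maxSucc G) F G) L ∘ₗ shift (-maxSucc G)

lemma krallF_apply (a N : ℝ) (F G : Finset ℕ) (L : ℝ[X] →ₗ[ℝ] ℝ) (f : ℝ[X]) :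
    krallF a N F G L f = L (krallFactor (a - maxSucc F - maxSucc G) (N + 2 * maxSucc G) F G *
      shift (-maxSucc G) f) := rfl

lemma Generic.dualHahnDefined_polyY {a N : ℝ} (h : Generic a N) (u : ℕ) :
    DualHahnDefined (-a) (2 * a + N) u :=
  ⟨poch_ne_zero (fun k hk => h.a_ne (1 - k) (by push_cast; linarith)) _,
    poch_ne_zero (fun k hk => h.two_aN_ne (-k) (by push_cast; linarith)) _⟩

lemma Generic.dualHahnDefined_polyZ {a N : ℝ} (h : Generic a N) (u : ℕ) :
    DualHahnDefined (-a) (-2 - N) u :=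
  ⟨poch_ne_zero (fun k hk => h.a_ne (1 - k) (by push_cast; linarith)) _,
    poch_ne_zero (fun k hk => h.N_ne (k - 2) (by push_cast; linarith)) _⟩

/-- For generic parameters `D_S` is symmetric for the Krall–Hahn functional, as its eigenfunctions of
large degree are orthogonal. -/
lemma opSR_symm_of_generic {a N : ℝ} (hg : Generic a N) {F G : Finset ℕ}
    (hF : ∀ f ∈ F, 0 < f) (hG : ∀ f ∈ G, 0 < f) {μ : Fin (cnt F + cnt G) → ℝ[X]}
    (hμ : ∀ i, IsMt a N F G i (μ i)) {P : ℝ[X]} (hP : IsPS a N F G P) {L : ℝ[X] →ₗ[ℝ] ℝ}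
    (hL : ∀ f, L (opH (a - maxSucc F - maxSucc G) (N + 2 * maxSucc G) f) = 0) (hL1 : L 1 ≠ 0)
    (f g : ℝ[X]) : krallF a N F G L (opSR a N F G μ P f * g) =
      krallF a N F G L (f * opSR a N F G μ P g) := by
  obtain ⟨D, hD, -, hk⟩ := exists_degD hF hG
  obtain ⟨l, hl, hlead⟩ := exists_leadLe_gCore (fun u _ => hg.dualHahnDefined_polyY u)
    (fun u _ => hg.dualHahnDefined_polyZ u) (fun u _ v _ h => hg.aN_ne (u - v - 1)
      (by push_cast; linarith)) hD
  have hcore := hlead.ne_zero hl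
  have hord : HasOrder (opSR a N F G μ P) (2 * (D + 1)) := by
    refine hasOrder_opSR (fun i => ?_) (hP.natDegree_eq hlead hl)
    obtain ⟨q, h1, h2⟩ := exists_isMt a N hD hk i
    rw [(hμ i).unique h2]
    have := hk i
    omega
  obtain ⟨n₀, hn₀, h⟩ := exists_eigenfunction hg hcore hμ hP
  choose! c e hc0 hrow heig using h
  refine symm_of_eigenfunctions (fun γ hγ => ?_) hord (preservesDegree_opSR a N F G μ P n₀)
    (q := fun k => ∑ j ∈ Finset.range (cnt F + cnt G + 1), C (c k j) * hahn a a N (k - 2 * j))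
    (fun k hk => ?_) (fun k hk g hd => ?_) heig f g
  · have h1 := Pearson.nondegenerate (hg.hat (maxSucc F) (maxSucc G)) (pearson_of_opH hL) hL1
      (γ := krallFactor (a - maxSucc F - maxSucc G) (N + 2 * maxSucc G) F G *
        shift (-maxSucc G) γ) (fun g => by
        have h2 := hγ (shift (maxSucc G) g)
        rwa [krallF_apply, shift_mul, shift_shift, neg_add_cancel, shift_zero_apply,
          ← mul_assoc] at h2)
    exact (taylor_eq_zero _ γ).1 ((mul_eq_zero.1 h1).resolve_left (krallFactor_ne_zero _ _ _ _))
  · have hdh := degree_hahn hg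
    rw [Finset.sum_range_succ', hc0 k hk, C_1, one_mul, mul_zero, Nat.sub_zero,
      degree_add_eq_right_of_degree_lt, hdh]
    rw [hdh]
    refine (degree_sum_le _ _).trans_lt ((Finset.sup_lt_iff (WithBot.bot_lt_coe _)).2 fun j hj => ?_)
    rw [← smul_eq_C_mul]
    refine (degree_smul_le _ _).trans_lt ?_
    have := Finset.mem_range.1 hj
    rw [hdh]; exact_mod_cast (show k - 2 * (j + 1) < k by omega)
  · exact krall_orthogonal hg hF hG hL (hn₀.trans hk) (hrow k hk) hd

/-! ### Coefficientwise limits of polynomials -/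

/-- Coefficientwise convergence of polynomials of bounded degree. -/
def TendstoPoly (f : ℕ → ℝ[X]) (g : ℝ[X]) : Prop :=
  (∃ B, (∀ n, (f n).natDegree < B) ∧ g.natDegree < B) ∧
    ∀ k, Tendsto (fun n => (f n).coeff k) atTop (𝓝 (g.coeff k))

namespace TendstoPoly

variable {f f' : ℕ → ℝ[X]} {g g' : ℝ[X]}

protected lemma const (g : ℝ[X]) : TendstoPoly (fun _ => g) g :=
  ⟨⟨g.natDegree + 1, fun _ => Nat.lt_succ_self _, Nat.lt_succ_self _⟩, fun _ => tendsto_const_nhds⟩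

protected lemma C {c : ℕ → ℝ} {d : ℝ} (h : Tendsto c atTop (𝓝 d)) :
    TendstoPoly (fun n => C (c n)) (C d) := by
  refine ⟨⟨1, fun _ => by simp, by simp⟩, fun k => ?_⟩
  simp only [coeff_C]
  split_ifs
  · exact h
  · exact tendsto_const_nhds

protected lemma add (h : TendstoPoly f g) (h' : TendstoPoly f' g') :
    TendstoPoly (fun n => f n + f' n) (g + g') := by
  obtain ⟨⟨B, h1, h2⟩, h3⟩ := h
  obtain ⟨⟨B', h1', h2'⟩, h3'⟩ := h'
  refine ⟨⟨max B B', fun n => ?_, ?_⟩, fun k => ?_⟩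
  · exact (natDegree_add_le _ _).trans_lt (max_lt_max (h1 n) (h1' n))
  · exact (natDegree_add_le _ _).trans_lt (max_lt_max h2 h2')
  · simp only [coeff_add]; exact (h3 k).add (h3' k)

protected lemma mul (h : TendstoPoly f g) (h' : TendstoPoly f' g') :
    TendstoPoly (fun n => f n * f' n) (g * g') := by
  obtain ⟨⟨B, h1, h2⟩, h3⟩ := h
  obtain ⟨⟨B', h1', h2'⟩, h3'⟩ := h'
  refine ⟨⟨B + B', fun n => ?_, ?_⟩, fun k => ?_⟩
  · exact natDegree_mul_le.trans_lt (add_lt_add (h1 n) (h1' n))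
  · exact natDegree_mul_le.trans_lt (add_lt_add h2 h2')
  · simp only [coeff_mul]
    exact tendsto_finsetSum _ fun p _ => (h3 p.1).mul (h3' p.2)

protected lemma sub (h : TendstoPoly f g) (h' : TendstoPoly f' g') :
    TendstoPoly (fun n => f n - f' n) (g - g') := by
  have h1 := h.add ((TendstoPoly.const (C (-1))).mul h')
  simpa only [C_neg, C_1, neg_one_mul, ← sub_eq_add_neg] using h1

protected lemma sum {ι : Type*} {s : Finset ι} {f : ι → ℕ → ℝ[X]} {g : ι → ℝ[X]}
    (h : ∀ i ∈ s, TendstoPoly (f i) (g i)) :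
    TendstoPoly (fun n => ∑ i ∈ s, f i n) (∑ i ∈ s, g i) := by
  classical
  induction s using Finset.induction_on with
  | empty => simpa using TendstoPoly.const 0
  | insert i s hi ih =>
    simp only [Finset.sum_insert hi]
    exact (h i (Finset.mem_insert_self _ _)).add
      (ih fun j hj => h j (Finset.mem_insert_of_mem hj))

protected lemma prod {ι : Type*} {s : Finset ι} {f : ι → ℕ → ℝ[X]} {g : ι → ℝ[X]}
    (h : ∀ i ∈ s, TendstoPoly (f i) (g i)) :
    TendstoPoly (fun n => ∏ i ∈ s, f i n) (∏ i ∈ s, g i) := by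
  classical
  induction s using Finset.induction_on with
  | empty => simpa using TendstoPoly.const 1
  | insert i s hi ih =>
    simp only [Finset.prod_insert hi]
    exact (h i (Finset.mem_insert_self _ _)).mul
      (ih fun j hj => h j (Finset.mem_insert_of_mem hj))

protected lemma pow (h : TendstoPoly f g) (k : ℕ) : TendstoPoly (fun n => f n ^ k) (g ^ k) := by
  have := TendstoPoly.prod (s := Finset.range k) (f := fun _ => f) (g := fun _ => g) fun _ _ => h
  simpa using this

lemma exists_sum (h : TendstoPoly f g) : ∃ B, (∀ n, f n = ∑ k ∈ Finset.range B,
    C ((f n).coeff k) * X ^ k) ∧ g = ∑ k ∈ Finset.range B, C (g.coeff k) * X ^ k := by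
  obtain ⟨⟨B, h1, h2⟩, -⟩ := h
  exact ⟨B, fun n => (f n).as_sum_range_C_mul_X_pow' (h1 n), g.as_sum_range_C_mul_X_pow' h2⟩

/-- A sequence of operations that is linear converges if it converges on the powers of `X`. -/
lemma map {T : ℕ → ℝ[X] →ₗ[ℝ] ℝ[X]} {S : ℝ[X] →ₗ[ℝ] ℝ[X]}
    (hT : ∀ k, TendstoPoly (fun n => T n (X ^ k)) (S (X ^ k))) (h : TendstoPoly f g) :
    TendstoPoly (fun n => T n (f n)) (S g) := by
  obtain ⟨B, h1, h2⟩ := h.exists_sum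
  have h3 : ∀ (T : ℝ[X] →ₗ[ℝ] ℝ[X]) (c : ℕ → ℝ), T (∑ k ∈ Finset.range B, C (c k) * X ^ k) =
      ∑ k ∈ Finset.range B, C (c k) * T (X ^ k) := fun T c => by
    rw [map_sum]; exact Finset.sum_congr rfl fun k _ => map_C_mul _ _ _
  have h4 : ∀ n, T n (f n) = ∑ k ∈ Finset.range B, C ((f n).coeff k) * T n (X ^ k) :=
    fun n => by conv_lhs => rw [h1 n, h3]
  simp only [h4]
  rw [h2, h3]
  exact TendstoPoly.sum fun k _ => (TendstoPoly.C (h.2 k)).mul (hT k)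

lemma linearMap (T : ℝ[X] →ₗ[ℝ] ℝ[X]) (h : TendstoPoly f g) :
    TendstoPoly (fun n => T (f n)) (T g) :=
  TendstoPoly.map (T := fun _ => T) (fun _ => TendstoPoly.const _) h

protected lemma comp (h : TendstoPoly f g) (h' : TendstoPoly f' g') :
    TendstoPoly (fun n => (f n).comp (f' n)) (g.comp g') :=
  TendstoPoly.map (T := fun n => (Polynomial.aeval (f' n) : ℝ[X] →ₐ[ℝ] ℝ[X]).toLinearMap)
    (S := (Polynomial.aeval g' : ℝ[X] →ₐ[ℝ] ℝ[X]).toLinearMap) (fun k => by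
      simp only [AlgHom.toLinearMap_apply, map_pow, aeval_X]; exact h'.pow k) h

lemma apply {Φ : ℕ → ℝ[X] →ₗ[ℝ] ℝ} {Ψ : ℝ[X] →ₗ[ℝ] ℝ}
    (hΦ : ∀ k, Tendsto (fun n => Φ n (X ^ k)) atTop (𝓝 (Ψ (X ^ k)))) (h : TendstoPoly f g) :
    Tendsto (fun n => Φ n (f n)) atTop (𝓝 (Ψ g)) := by
  obtain ⟨B, h1, h2⟩ := h.exists_sum
  have h3 : ∀ (T : ℝ[X] →ₗ[ℝ] ℝ) (c : ℕ → ℝ), T (∑ k ∈ Finset.range B, C (c k) * X ^ k) =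
      ∑ k ∈ Finset.range B, c k * T (X ^ k) := fun T c => by
    rw [map_sum]; exact Finset.sum_congr rfl fun k _ => apply_C_mul _ _ _
  have h4 : ∀ n, Φ n (f n) = ∑ k ∈ Finset.range B, (f n).coeff k * Φ n (X ^ k) :=
    fun n => by conv_lhs => rw [h1 n, h3]
  simp only [h4]
  rw [h2, h3]
  exact tendsto_finsetSum _ fun k _ => (h.2 k).mul (hΦ k)

protected lemma eval (h : TendstoPoly f g) {x : ℕ → ℝ} {y : ℝ} (hx : Tendsto x atTop (𝓝 y)) :
    Tendsto (fun n => (f n).eval (x n)) atTop (𝓝 (g.eval y)) :=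
  apply (Φ := fun n => leval (x n)) (Ψ := leval y) (fun k => by simpa using hx.pow k) h

lemma of_eval {B : ℕ} (hf : ∀ n, (f n).natDegree ≤ B) {x₀ : ℝ}
    (h : ∀ x, x₀ < x → Tendsto (fun n => (f n).eval x) atTop (𝓝 (g.eval x))) :
    TendstoPoly f g := by
  obtain ⟨q, h1, h2, h3⟩ := exists_poly_of_tendsto hf h
  obtain rfl := poly_eq_of_large x₀ h2
  exact ⟨⟨B + 1, fun n => Nat.lt_succ_of_le (hf n), Nat.lt_succ_of_le h1⟩, h3⟩

end TendstoPoly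

/-! ### Limits of operators -/

/-- Convergence of operators, uniform with respect to the degree. -/
def TendstoOp (T : ℕ → Module.End ℝ ℝ[X]) (S : Module.End ℝ ℝ[X]) : Prop :=
  ∀ f g, TendstoPoly f g → TendstoPoly (fun n => T n (f n)) (S g)

namespace TendstoOp

variable {T T' : ℕ → Module.End ℝ ℝ[X]} {S S' : Module.End ℝ ℝ[X]}

protected lemma const (S : Module.End ℝ ℝ[X]) : TendstoOp (fun _ => S) S :=
  fun _ _ h => h.linearMap S

protected lemma mulBy {f : ℕ → ℝ[X]} {g : ℝ[X]} (h : TendstoPoly f g) :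
    TendstoOp (fun n => mulBy (f n)) (mulBy g) := fun _ _ h' => h.mul h'

protected lemma add (h : TendstoOp T S) (h' : TendstoOp T' S') :
    TendstoOp (fun n => T n + T' n) (S + S') := fun f g hf => (h f g hf).add (h' f g hf)

protected lemma sub (h : TendstoOp T S) (h' : TendstoOp T' S') :
    TendstoOp (fun n => T n - T' n) (S - S') := fun f g hf => (h f g hf).sub (h' f g hf)

protected lemma mul (h : TendstoOp T S) (h' : TendstoOp T' S') :
    TendstoOp (fun n => T n * T' n) (S * S') := fun f g hf => h _ _ (h' f g hf)

protected lemma sum {ι : Type*} {s : Finset ι} {T : ι → ℕ → Module.End ℝ ℝ[X]}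
    {S : ι → Module.End ℝ ℝ[X]} (h : ∀ i ∈ s, TendstoOp (T i) (S i)) :
    TendstoOp (fun n => ∑ i ∈ s, T i n) (∑ i ∈ s, S i) := fun f g hf => by
  simp only [LinearMap.sum_apply]
  exact TendstoPoly.sum fun i hi => h i hi f g hf

protected lemma pow (h : TendstoOp T S) (k : ℕ) : TendstoOp (fun n => T n ^ k) (S ^ k) := by
  induction k with
  | zero => exact TendstoOp.const 1
  | succ k ih => simp only [pow_succ]; exact ih.mul h

protected lemma aeval (h : TendstoOp T S) {p : ℕ → ℝ[X]} {q : ℝ[X]} (hp : TendstoPoly p q) :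
    TendstoOp (fun n => aeval (T n) (p n)) (aeval S q) := by
  obtain ⟨B, h1, h2⟩ := hp.exists_sum
  have h3 : ∀ (T : Module.End ℝ ℝ[X]) (c : ℕ → ℝ),
      aeval T (∑ k ∈ Finset.range B, C (c k) * X ^ k) =
        ∑ k ∈ Finset.range B, mulBy (C (c k)) * T ^ k := fun T c => by
    rw [map_sum]
    refine Finset.sum_congr rfl fun k _ => ?_
    rw [map_mul, aeval_C, map_pow, aeval_X, mulBy_C, Algebra.algebraMap_eq_smul_one]
  have h4 : ∀ n, aeval (T n) (p n) = ∑ k ∈ Finset.range B, mulBy (C ((p n).coeff k)) * T n ^ k :=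
    fun n => by conv_lhs => rw [h1 n, h3]
  simp only [h4]
  rw [h2, h3]
  exact TendstoOp.sum fun k _ => (TendstoOp.mulBy (TendstoPoly.C (hp.2 k))).mul (h.pow k)

end TendstoOp

/-! ### Continuity of the construction in the parameters -/

lemma Tendsto.poch {z : ℕ → ℝ} {w : ℝ} (h : Tendsto z atTop (𝓝 w)) (j : ℕ) :
    Tendsto (fun n => poch (z n) j) atTop (𝓝 (poch w j)) :=
  ((ascPochhammer ℝ j).continuous.tendsto w).comp h

lemma poch_ne_zero_of_le {z : ℝ} {j n : ℕ} (h : j ≤ n) (hz : poch z n ≠ 0) : poch z j ≠ 0 := by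
  obtain ⟨k, rfl⟩ := Nat.exists_eq_add_of_le h
  rw [poch_add] at hz
  exact left_ne_zero_of_mul hz

lemma tendsto_dualHahn {α β M : ℕ → ℝ} {α₀ β₀ M₀ : ℝ} (hα : Tendsto α atTop (𝓝 α₀))
    (hβ : Tendsto β atTop (𝓝 β₀)) (hM : Tendsto M atTop (𝓝 M₀)) {u : ℕ}
    (h : DualHahnDefined α₀ M₀ u) :
    TendstoPoly (fun n => dualHahn (α n) (β n) (M n) u) (dualHahn α₀ β₀ M₀ u) := by
  refine TendstoPoly.sum fun j hj => (TendstoPoly.C ?_).mul (TendstoPoly.prod fun i _ =>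
    (TendstoPoly.const X).sub (TendstoPoly.C (((hα.add hβ).add_const 1).add_const (i : ℝ)
      |>.const_mul (i : ℝ))))
  have hj' : j ≤ u := Nat.lt_succ_iff.1 (Finset.mem_range.1 hj)
  refine Tendsto.div tendsto_const_nhds (((Tendsto.poch (hα.add_const 1) j).mul
    (Tendsto.poch hM.neg j)).mul_const _) ?_
  exact mul_ne_zero (mul_ne_zero (poch_ne_zero_of_le hj' h.1) (poch_ne_zero_of_le hj' h.2))
    (by exact_mod_cast Nat.factorial_ne_zero j)

section

variable {a N : ℝ} {F G : Finset ℕ} {as Ns : ℕ → ℝ}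

lemma tendsto_polyR (ha : Tendsto as atTop (𝓝 a)) (hN : Tendsto Ns atTop (𝓝 N))
    (hY : ∀ u ∈ invol F, DualHahnDefined (-a) (2 * a + N) u)
    (hZ : ∀ v ∈ invol G, DualHahnDefined (-a) (-2 - N) v) (i : Fin (cnt F + cnt G)) :
    TendstoPoly (fun n => polyR (as n) (Ns n) F G i) (polyR a N F G i) := by
  have h1 : TendstoPoly (fun n => X + C (2 * as n)) (X + C (2 * a)) :=
    (TendstoPoly.const X).add (TendstoPoly.C (ha.const_mul 2))
  refine Fin.addCases (fun r => ?_) (fun r => ?_) i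
  · simp only [polyR, Fin.append_left]
    exact (tendsto_dualHahn ha.neg ha.neg ((ha.const_mul 2).add hN) (hY _ (node_mem F r))).comp h1
  · simp only [polyR, Fin.append_right]
    exact (tendsto_dualHahn ha.neg ha.neg (hN.const_sub (-2)) (hZ _ (node_mem G r))).comp h1

lemma tendsto_psiRow (ha : Tendsto as atTop (𝓝 a)) (hN : Tendsto Ns atTop (𝓝 N))
    (hY : ∀ u ∈ invol F, DualHahnDefined (-a) (2 * a + N) u)
    (hZ : ∀ v ∈ invol G, DualHahnDefined (-a) (-2 - N) v) (i : Fin (cnt F + cnt G)) :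
    TendstoPoly (fun n => psiRow (as n) (Ns n) F G i) (psiRow a N F G i) :=
  (tendsto_polyR ha hN hY hZ i).comp
    ((TendstoPoly.const X).sub (TendstoPoly.C ((ha.add_const _).pow 2)))

lemma tendsto_eval_pochP {α : ℕ → ℝ} {β : ℝ} (h : Tendsto α atTop (𝓝 β)) (n : ℕ) (c : ℝ) :
    Tendsto (fun k => (pochP (α k) n).eval c) atTop (𝓝 ((pochP β n).eval c)) := by
  simp only [eval_pochP]
  exact Tendsto.poch (h.const_add c) n

variable {ν : ℝ} {νs : ℕ → ℝ} {M : ℕ} {b : Fin M → Bool} {ψ : Fin M → ℝ[X]}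
  {ψs : ℕ → Fin M → ℝ[X]}

lemma tendsto_eval_ehP (hν : Tendsto νs atTop (𝓝 ν)) (j : ℕ) (c : ℝ) :
    Tendsto (fun n => (ehP (νs n) M j).eval c) atTop (𝓝 ((ehP ν M j).eval c)) := by
  simp only [ehP, eval_mul]
  exact (tendsto_eval_pochP (hν.const_sub _) _ c).mul
    (tendsto_eval_pochP ((hν.const_add _).sub_const _) _ c)

lemma tendsto_eval_ppP (hν : Tendsto νs atTop (𝓝 ν)) (m : ℕ) (c : ℝ) :
    Tendsto (fun n => (ppP (νs n) M m).eval c) atTop (𝓝 ((ppP ν M m).eval c)) := by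
  simp only [ppP, eval_prod, eval_mul]
  exact tendsto_finsetProd _ fun i _ => (tendsto_eval_pochP (hν.const_sub _) _ c).mul
    (tendsto_eval_pochP ((hν.const_add _).sub_const _) _ c)

lemma tendsto_eval_fhatP (hν : Tendsto νs atTop (𝓝 ν))
    (hψ : ∀ i, TendstoPoly (fun n => ψs n i) (ψ i)) (c : ℝ) :
    Tendsto (fun n => (evalRingHom c).mapMatrix (fhatP (νs n) M b (ψs n))) atTop
      (𝓝 ((evalRingHom c).mapMatrix (fhatP ν M b ψ))) := by
  refine tendsto_pi_nhds.2 fun i => tendsto_pi_nhds.2 fun j => ?_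
  simp only [RingHom.mapMatrix_apply, Matrix.map_apply, fhatP, Matrix.of_apply, coe_evalRingHom,
    eval_mul, eval_comp]
  refine Tendsto.mul ?_ ((hψ i).eval tendsto_const_nhds)
  split_ifs
  · exact tendsto_eval_ehP hν j c
  · exact tendsto_const_nhds

lemma tendsto_eval_gP (hν : Tendsto νs atTop (𝓝 ν))
    (hψ : ∀ i, TendstoPoly (fun n => ψs n i) (ψ i)) {c : ℝ} (hc : 2 * M + |ν| + 2 < c) :
    Tendsto (fun n => (gP (νs n) M b (ψs n)).eval c) atTop (𝓝 ((gP ν M b ψ).eval c)) := by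
  have hpp := tendsto_eval_ppP (M := M) hν (nU b) c
  have hp0 : (ppP ν M (nU b)).eval c ≠ 0 := (eval_ppP_pos (nU_le b) hc).ne'
  have hq0 : (qqP M).eval c ≠ 0 := (eval_qqP_pos (by
    have := abs_nonneg ν; have : (0 : ℝ) ≤ M := Nat.cast_nonneg _; linarith)).ne'
  have h1 : ∀ (ν : ℝ) (ψ : Fin M → ℝ[X]), (ppP ν M (nU b)).eval c ≠ 0 → (gP ν M b ψ).eval c =
      ((evalRingHom c).mapMatrix (fhatP ν M b ψ)).det /
        ((qqP M).eval c * (ppP ν M (nU b)).eval c) := fun ν ψ h => by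
    rw [← RingHom.map_det, det_fhatP_eq_gP, coe_evalRingHom, eval_mul, eval_mul,
      mul_div_cancel_left₀ _ (mul_ne_zero hq0 h)]
  rw [h1 _ _ hp0]
  refine Tendsto.congr' ((hpp.eventually_ne hp0).mono fun n hn => (h1 _ _ hn).symm) ?_
  refine Tendsto.div ?_ (hpp.const_mul _) (mul_ne_zero hq0 hp0)
  exact ((continuous_id.matrix_det.tendsto _).comp (tendsto_eval_fhatP hν hψ c))

lemma tendsto_tF (hν : Tendsto νs atTop (𝓝 ν))
    (hψ : ∀ i, TendstoPoly (fun n => ψs n i) (ψ i)) (i : Fin M) (k : ℕ) {c : ℝ}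
    (hc : 2 * M + |ν| + 2 < c) :
    Tendsto (fun n => tF (νs n) b (ψs n) i k c) atTop (𝓝 (tF ν b ψ i k c)) := by
  have hpp := tendsto_eval_ppP (M := M) hν (nU b) c
  have hp0 : (ppP ν M (nU b)).eval c ≠ 0 := (eval_ppP_pos (nU_le b) hc).ne'
  have hq0 : (qqP M).eval c ≠ 0 := (eval_qqP_pos (by
    have := abs_nonneg ν; have : (0 : ℝ) ≤ M := Nat.cast_nonneg _; linarith)).ne'
  simp only [tF]
  split_ifs with h hb
  · refine Tendsto.div (Tendsto.mul (Tendsto.const_mul c ?_) (tendsto_eval_ehP hν k c))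
      (hpp.const_mul _) (mul_ne_zero hq0 hp0)
    have h1 := (continuous_id.matrix_adjugate.tendsto _).comp (tendsto_eval_fhatP (b := b) hν hψ c)
    have h2 := tendsto_pi_nhds.1 (tendsto_pi_nhds.1 h1 ⟨k, h⟩) i
    simp only [Function.comp, id, ← RingHom.map_adjugate] at h2
    exact h2
  · refine Tendsto.div (Tendsto.mul (Tendsto.const_mul c ?_) tendsto_const_nhds)
      (hpp.const_mul _) (mul_ne_zero hq0 hp0)
    have h1 := (continuous_id.matrix_adjugate.tendsto _).comp (tendsto_eval_fhatP (b := b) hν hψ c)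
    have h2 := tendsto_pi_nhds.1 (tendsto_pi_nhds.1 h1 ⟨k, h⟩) i
    simp only [Function.comp, id, ← RingHom.map_adjugate] at h2
    exact h2
  · exact tendsto_const_nhds

lemma tendsto_gCore (ha : Tendsto as atTop (𝓝 a)) (hN : Tendsto Ns atTop (𝓝 N))
    (hψ : ∀ i, TendstoPoly (fun n => psiRow (as n) (Ns n) F G i) (psiRow a N F G i)) {D : ℕ}
    (hD : degG (bRow F G) (kRow F G) = D) :
    TendstoPoly (fun n => gCore (as n) (Ns n) F G) (gCore a N F G) := by
  refine TendstoPoly.of_eval (fun n => (leadLe_gW _ (leadLe_psiRow _ _ F G) hD).natDegree_le)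
    (x₀ := (2 * (cnt F + cnt G : ℕ) + |N + a + 1| + 2) ^ 2) fun x hx => ?_
  have hx0 : 0 ≤ x := (sq_nonneg _).trans hx.le
  have h1 := tendsto_eval_gP (b := bRow F G) ((hN.add ha).add_const 1) hψ
    (c := √x) (Real.lt_sqrt_of_sq_lt hx)
  simp only [← eval_gW, Real.sq_sqrt hx0] at h1
  exact h1

lemma tendsto_isMt (ha : Tendsto as atTop (𝓝 a)) (hN : Tendsto Ns atTop (𝓝 N))
    (hψ : ∀ i, TendstoPoly (fun n => psiRow (as n) (Ns n) F G i) (psiRow a N F G i)) {D : ℕ}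
    (hD : degG (bRow F G) (kRow F G) = D) (hk : ∀ i, kRow F G i ≤ D) {i : Fin (cnt F + cnt G)}
    {p : ℕ → ℝ[X]} {q : ℝ[X]} (hp : ∀ n, IsMt (as n) (Ns n) F G i (p n))
    (hq : IsMt a N F G i q) : TendstoPoly p q := by
  have h1 : ∀ {a N : ℝ} {p : ℝ[X]}, IsMt a N F G i p → ∃ μ : ℝ[X], μ.natDegree ≤ D - kRow F G i ∧
      (∀ z, 4 * (cnt F + cnt G : ℕ) + |N + a + 1| + 2 < z →
        ∑ j ∈ Finset.range (cnt F + cnt G), tF (N + a + 1) (bRow F G) (psiRow a N F G) i j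
          (z - ((cnt F + cnt G : ℕ) - 1) + 2 * j) = z * μ.eval (z ^ 2)) ∧
      p = C (-(1 / 4) * kapG (cnt F + cnt G)) * μ.comp (X + C ((a + 1 / 2) ^ 2)) := by
    intro a N p hp
    obtain ⟨μ, h2, h3⟩ := exists_sum_tF (N + a + 1) (bRow F G) (ψ := psiRow a N F G)
      (fun i => (leadLe_psiRow a N F G i).natDegree_le) i (e := D - kRow F G i) (by
        rw [hD, Nat.cast_sub (hk i)])
    refine ⟨μ, h2, h3, hp.unique ?_⟩
    filter_upwards [eventually_gt_atTop
      (4 * (cnt F + cnt G : ℕ) + |N + a + 1| + 2 - a - 1 / 2)] with x hx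
    rw [mVal, h3 (x + a + 1 / 2) (by linarith)]
    simp only [eval_mul, eval_comp, eval_add, eval_X, eval_C]
    rw [show x * (x + (2 * a + 1)) + (a + 1 / 2) ^ 2 = (x + a + 1 / 2) ^ 2 by ring]
    ring
  choose μs hμ1 hμ2 hμ3 using fun n => h1 (hp n)
  obtain ⟨μ, hμ4, hμ5, rfl⟩ := h1 hq
  have hν : Tendsto (fun n => Ns n + as n + 1) atTop (𝓝 (N + a + 1)) := (hN.add ha).add_const 1
  have h2 : TendstoPoly μs μ := by
    refine TendstoPoly.of_eval hμ1 (x₀ := (4 * (cnt F + cnt G : ℕ) + |N + a + 1| + 3) ^ 2)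
      fun x hx => ?_
    have hx0 : 0 ≤ x := (sq_nonneg _).trans hx.le
    have hz : 4 * (cnt F + cnt G : ℕ) + |N + a + 1| + 3 < √x := Real.lt_sqrt_of_sq_lt hx
    have hc0 : (0 : ℝ) ≤ (cnt F + cnt G : ℕ) := Nat.cast_nonneg _
    have hz0 : √x ≠ 0 := by
      have := abs_nonneg (N + a + 1)
      intro h; rw [h] at hz; linarith
    have h3 : μ.eval x = (∑ j ∈ Finset.range (cnt F + cnt G), tF (N + a + 1) (bRow F G)
        (psiRow a N F G) i j (√x - ((cnt F + cnt G : ℕ) - 1) + 2 * j)) / √x := by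
      rw [hμ5 _ (by linarith), mul_div_cancel_left₀ _ hz0, Real.sq_sqrt hx0]
    rw [h3]
    refine Tendsto.congr' ?_ (Tendsto.div_const (tendsto_finsetSum _ fun j _ =>
      tendsto_tF hν hψ i j (by
        have : (0 : ℝ) ≤ j := Nat.cast_nonneg _
        linarith)) _)
    have h4 : ∀ᶠ n in atTop, |Ns n + as n + 1| < |N + a + 1| + 1 :=
      hν.abs.eventually_lt_const (by linarith)
    filter_upwards [h4] with n hn
    rw [hμ2 n _ (by linarith), mul_div_cancel_left₀ _ hz0, Real.sq_sqrt hx0]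
  rw [funext hμ3]
  exact (TendstoPoly.const _).mul (h2.comp ((TendstoPoly.const X).add
    (TendstoPoly.C ((ha.add_const _).pow 2))))

/-- The right-hand side of the equation of `P_S`, as an odd polynomial. -/
def psRhs (a N : ℝ) (F G : Finset ℕ) : ℝ[X] :=
  C (kapG (cnt F + cnt G)) *
    ((X - C ((cnt F + cnt G : ℕ) : ℝ)) * (gCore a N F G).comp ((X - C ((cnt F + cnt G : ℕ) : ℝ)) ^ 2) +
      (X + C ((cnt F + cnt G : ℕ) : ℝ)) * (gCore a N F G).comp ((X + C ((cnt F + cnt G : ℕ) : ℝ)) ^ 2))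

/-- The equation of `P_S` determines the divided difference of `P_S`, as a polynomial in the square of
the shifted variable. -/
lemma isPS_iff {P : ℝ[X]} : IsPS a N F G P ↔
    dW (P.comp (X - C ((a + 1 / 2) ^ 2))) = C (1 / 4) * oddPart (psRhs a N F G) := by
  have hodd : ∀ z, (psRhs a N F G).eval (-z) = -(psRhs a N F G).eval z := fun z => by
    simp only [psRhs, eval_mul, eval_add, eval_sub, eval_X, eval_C, eval_comp, eval_pow]
    rw [show (-z - ((cnt F + cnt G : ℕ) : ℝ)) ^ 2 = (z + (cnt F + cnt G : ℕ)) ^ 2 by ring,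
      show (-z + ((cnt F + cnt G : ℕ) : ℝ)) ^ 2 = (z - (cnt F + cnt G : ℕ)) ^ 2 by ring]
    ring
  have h1 : ∀ y, 4 * y * (dW (P.comp (X - C ((a + 1 / 2) ^ 2)))).eval (y ^ 2) =
      P.eval ((y + 1 - a - 1 / 2) * (y + 1 - a - 1 / 2 + (2 * a + 1))) -
        P.eval ((y + 1 - a - 1 / 2 - 2) * (y + 1 - a - 1 / 2 - 2 + (2 * a + 1))) := fun y => by
    rw [eval_dW, eval_comp, eval_comp]
    simp only [eval_sub, eval_X, eval_C]
    congr 2 <;> ring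
  have h2 : ∀ y, (psRhs a N F G).eval y = (rhsP a N F G).eval (y + 1 - a - 1 / 2 - 1) +
      (rhsP a N F G).eval (y + 1 - a - 1 / 2 + 2 * (cnt F + cnt G : ℕ) - 1) := fun y => by
    rw [eval_rhsP, eval_rhsP, psRhs]
    simp only [eval_mul, eval_add, eval_sub, eval_X, eval_C, eval_comp, eval_pow]
    rw [show y + 1 - a - 1 / 2 - 1 + a + 1 / 2 - ((cnt F + cnt G : ℕ) : ℝ) =
        y - (cnt F + cnt G : ℕ) by ring,
      show y + 1 - a - 1 / 2 + 2 * ((cnt F + cnt G : ℕ) : ℝ) - 1 + a + 1 / 2 -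
        ((cnt F + cnt G : ℕ) : ℝ) = y + (cnt F + cnt G : ℕ) by ring]
    ring
  constructor
  · intro h
    refine poly_eq_of_large 0 fun x hx => ?_
    have h3 := h1 (√x)
    have h5 : √x ≠ 0 := (Real.sqrt_pos.2 hx).ne'
    rw [h, ← h2, eval_oddPart hodd, Real.sq_sqrt hx.le] at h3
    rw [eval_mul, eval_C]
    refine mul_left_cancel₀ (mul_ne_zero four_ne_zero h5) ?_
    rw [h3]; ring
  · intro h x
    have h3 := h1 (x + a - 1 / 2)
    rw [h, eval_mul, eval_C] at h3
    have h4 := eval_oddPart hodd (x + a - 1 / 2)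
    rw [h2] at h4
    rw [show x + a - 1 / 2 + 1 - a - 1 / 2 = x by ring] at h3 h4
    linear_combination -h3 - h4

lemma tendsto_oddPart {f : ℕ → ℝ[X]} {g : ℝ[X]} (h : TendstoPoly f g) :
    TendstoPoly (fun n => oddPart (f n)) (oddPart g) := by
  let T : ℝ[X] →ₗ[ℝ] ℝ[X] :=
    { toFun := oddPart
      map_add' := oddPart_add
      map_smul' := fun c p => by
        rw [smul_eq_C_mul, oddPart_C_mul, RingHom.id_apply, smul_eq_C_mul] }
  exact h.linearMap T

/-- A polynomial `P_S` is the limit of polynomials `P_S` for the approximating parameters. -/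
lemma exists_isPS_tendsto (ha : Tendsto as atTop (𝓝 a))
    (hg : TendstoPoly (fun n => gCore (as n) (Ns n) F G) (gCore a N F G)) {P : ℝ[X]}
    (hP : IsPS a N F G P) :
    ∃ Ps : ℕ → ℝ[X], (∀ n, IsPS (as n) (Ns n) F G (Ps n)) ∧ TendstoPoly Ps P := by
  have hf : TendstoPoly (fun n => C (1 / 4) * oddPart (psRhs (as n) (Ns n) F G))
      (C (1 / 4) * oddPart (psRhs a N F G)) := by
    refine (TendstoPoly.const _).mul (tendsto_oddPart ((TendstoPoly.const _).mul
      (((TendstoPoly.const _).mul ?_).add ((TendstoPoly.const _).mul ?_))))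
    · exact hg.comp (TendstoPoly.const _)
    · exact hg.comp (TendstoPoly.const _)
  set Q : ℕ → ℝ[X] := fun n => P.comp (X - C ((a + 1 / 2) ^ 2)) +
    dWInv (C (1 / 4) * oddPart (psRhs (as n) (Ns n) F G) -
      C (1 / 4) * oddPart (psRhs a N F G)) with hQ
  refine ⟨fun n => (Q n).comp (X + C ((as n + 1 / 2) ^ 2)), fun n => isPS_iff.2 ?_, ?_⟩
  · have h1 : (X + C ((as n + 1 / 2) ^ 2)).comp (X - C ((as n + 1 / 2) ^ 2)) = X := by
      rw [add_comp, X_comp, C_comp, sub_add_cancel]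
    rw [comp_assoc, h1, comp_X, hQ, dW_add, isPS_iff.1 hP, dW_dWInv, add_sub_cancel]
  · have h2 := ((TendstoPoly.const (P.comp (X - C ((a + 1 / 2) ^ 2)))).add
      ((hf.sub (TendstoPoly.const (C (1 / 4) * oddPart (psRhs a N F G)))).linearMap dWInv)).comp
      ((TendstoPoly.const X).add (TendstoPoly.C ((ha.add_const (1 / 2)).pow 2)))
    rwa [sub_self, map_zero, add_zero, comp_assoc, sub_comp, X_comp, C_comp, add_sub_cancel_right,
      comp_X] at h2

lemma tendsto_opH (ha : Tendsto as atTop (𝓝 a)) (hN : Tendsto Ns atTop (𝓝 N)) :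
    TendstoOp (fun n => opH (as n) (Ns n)) (opH a N) := by
  have hX := TendstoPoly.const X
  exact ((TendstoOp.mulBy ((hX.add (TendstoPoly.C (ha.add_const 1))).mul
    (hX.sub (TendstoPoly.C hN)))).mul (TendstoOp.const fwd)).sub
    ((TendstoOp.mulBy (hX.mul (hX.sub (TendstoPoly.C ((ha.add hN).add_const 1))))).mul
      (TendstoOp.const bwd))

lemma tendsto_opK (ha : Tendsto as atTop (𝓝 a)) (hN : Tendsto Ns atTop (𝓝 N)) (b : Bool) :
    TendstoOp (fun n => opK (as n) (Ns n) b) (opK a N b) := by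
  have hX := TendstoPoly.const X
  have h0 : TendstoOp (fun n => mulBy (C ((2 * as n + 1) / 2))) (mulBy (C ((2 * a + 1) / 2))) :=
    TendstoOp.mulBy (TendstoPoly.C (((ha.const_mul 2).add_const 1).div_const 2))
  cases b
  · exact (h0.add ((TendstoOp.mulBy (hX.add (TendstoPoly.C (ha.add_const 1)))).mul
      (TendstoOp.const fwd))).add (h0.add ((TendstoOp.mulBy (hX.sub (TendstoPoly.C
        ((ha.add hN).add_const 1)))).mul (TendstoOp.const bwd)))
  · exact (h0.add ((TendstoOp.mulBy hX).mul (TendstoOp.const bwd))).add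
      (h0.add ((TendstoOp.mulBy (hX.sub (TendstoPoly.C hN))).mul (TendstoOp.const fwd)))

lemma tendsto_opSR (ha : Tendsto as atTop (𝓝 a)) (hN : Tendsto Ns atTop (𝓝 N))
    (hR : ∀ i, TendstoPoly (fun n => polyR (as n) (Ns n) F G i) (polyR a N F G i))
    {μs : ℕ → Fin (cnt F + cnt G) → ℝ[X]} {μ : Fin (cnt F + cnt G) → ℝ[X]}
    (hμ : ∀ i, TendstoPoly (fun n => μs n i) (μ i)) {Ps : ℕ → ℝ[X]} {P : ℝ[X]}
    (hP : TendstoPoly Ps P) :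
    TendstoOp (fun n => opSR (as n) (Ns n) F G (μs n) (Ps n)) (opSR a N F G μ P) := by
  have hH := tendsto_opH ha hN
  have h1 : ∀ T : Module.End ℝ ℝ[X], (1 / 2 : ℝ) • T = mulBy (C (1 / 2)) * T := fun T => by
    rw [mulBy_C, smul_one_mul]
  simp only [opSR, h1]
  exact ((TendstoOp.const _).mul (hH.aeval hP)).add (TendstoOp.sum fun i _ =>
    ((hH.aeval (hμ i)).mul (tendsto_opK ha hN _)).mul (hH.aeval (hR i)))

end

/-! ### The moments of the Hahn functional -/

/-- The basis `bp` of the space of polynomials. -/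
def bpBasis : Module.Basis ℕ ℝ ℝ[X] :=
  Polynomial.Sequence.basis ⟨bp, degree_bp⟩ fun i =>
    (leadingCoeff_ne_zero.2 (Polynomial.Sequence.ne_zero _ i)).isUnit

lemma bpBasis_apply (j : ℕ) : bpBasis j = bp j := Polynomial.Sequence.basis_eq_self _ _ j

/-- The functional with given values on the basis `bp`. -/
def momF (m : ℕ → ℝ) : ℝ[X] →ₗ[ℝ] ℝ := bpBasis.constr ℝ m

lemma momF_bp (m : ℕ → ℝ) (j : ℕ) : momF m (bp j) = m j := by
  rw [← bpBasis_apply, momF, Module.Basis.constr_basis]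

lemma eq_zero_of_bp {Φ : ℝ[X] →ₗ[ℝ] ℝ} (h : ∀ j, Φ (bp j) = 0) : Φ = 0 :=
  bpBasis.ext fun j => by rw [bpBasis_apply, h]; rfl

lemma tendsto_of_bp {Φ : ℕ → ℝ[X] →ₗ[ℝ] ℝ} {Ψ : ℝ[X] →ₗ[ℝ] ℝ}
    (h : ∀ j, Tendsto (fun n => Φ n (bp j)) atTop (𝓝 (Ψ (bp j)))) (f : ℝ[X]) :
    Tendsto (fun n => Φ n f) atTop (𝓝 (Ψ f)) := by
  obtain ⟨e, he⟩ := exists_sum_of_degree (m := f.natDegree + 1) (fun j _ => degree_bp j)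
    (degree_le_natDegree.trans_lt (by exact_mod_cast Nat.lt_succ_self _))
  rw [he]
  simp only [map_sum, apply_C_mul]
  exact tendsto_finsetSum _ fun j _ => (h j).const_mul _

/-- The moment of order `j` of the Hahn functional of mass `c` with respect to the basis `bp`. -/
def hahnMoment (a N c : ℝ) (j : ℕ) : ℝ :=
  c * ∏ i ∈ Finset.range j, ((i - N) * (i + a + 1) / (i + 2 * a + 2))

lemma hahnMoment_succ (a N c : ℝ) (j : ℕ) : hahnMoment a N c (j + 1) =
    hahnMoment a N c j * ((j - N) * (j + a + 1) / (j + 2 * a + 2)) := by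
  rw [hahnMoment, Finset.prod_range_succ, ← mul_assoc]; rfl

lemma momF_opH {a N : ℝ} (h : ∀ j : ℕ, (j : ℝ) + 2 * a + 2 ≠ 0) (c : ℝ) (f : ℝ[X]) :
    momF (hahnMoment a N c) (opH a N f) = 0 := by
  have h1 : momF (hahnMoment a N c) ∘ₗ opH a N = 0 := eq_zero_of_bp fun j => by
    rw [LinearMap.comp_apply, opH_bp, map_add, apply_C_mul, apply_C_mul, momF_bp, momF_bp]
    cases j with
    | zero => simp
    | succ j =>
      rw [Nat.add_sub_cancel, hahnMoment_succ]
      have := h j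
      push_cast
      field_simp
      ring
  exact LinearMap.congr_fun h1 f

lemma moment_rec {a N : ℝ} {L : ℝ[X] →ₗ[ℝ] ℝ} (hL : ∀ f, L (opH a N f) = 0) (j : ℕ) :
    ((j : ℝ) + 2 * a + 2) * L (bp (j + 1)) = (j - N) * (j + a + 1) * L (bp j) := by
  have h1 := hL (bp (j + 1))
  rw [opH_bp, map_add, apply_C_mul, apply_C_mul, Nat.add_sub_cancel] at h1
  have h2 : ((j : ℝ) + 1) ≠ 0 := by positivity
  refine mul_left_cancel₀ h2 ?_
  push_cast at h1
  linear_combination h1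

lemma moment_eq {a N : ℝ} {L : ℝ[X] →ₗ[ℝ] ℝ} (hL : ∀ f, L (opH a N f) = 0) {j : ℕ}
    (h : ∀ i < j, (i : ℝ) + 2 * a + 2 ≠ 0) : L (bp j) = hahnMoment a N (L 1) j := by
  induction j with
  | zero => rw [bp_zero, hahnMoment, Finset.prod_range_zero, mul_one]
  | succ j ih =>
    rw [hahnMoment_succ, ← ih fun i hi => h i (hi.trans j.lt_succ_self)]
    have h1 := moment_rec hL j
    have h2 := h j j.lt_succ_self
    rw [← mul_div_assoc, eq_div_iff h2]
    linear_combination h1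

/-- The Hahn functional vanishes on the range of `opH`: in the discrete case by summation by parts,
otherwise because `opH h_n` is a multiple of `h_n`, and is zero for `n = 0`. -/
lemma IsHahnFunctional.apply_opH {a N : ℝ} {L : ℝ[X] →ₗ[ℝ] ℝ} (h : IsHahnFunctional a a N L)
    (f : ℝ[X]) : L (opH a N f) = 0 := by
  rcases h with ⟨M, rfl, -, -, hL⟩ | ⟨-, h1, h2, h3⟩
  · set w : ℕ → ℝ := fun x => (M.choose x : ℝ) * poch (a + 1) x * poch (a + 1) (M - x) with hw
    have hpe : ∀ x ∈ Finset.range M, w x * ((x + a + 1) * (x - M)) =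
        w (x + 1) * ((x + 1 : ℕ) * ((x + 1 : ℕ) - (a + M + 1))) := by
      intro x hx
      obtain ⟨k, rfl⟩ := Nat.exists_eq_add_of_lt (Finset.mem_range.1 hx)
      have h1 := Nat.choose_succ_right_eq (x + k + 1) x
      rw [show x + k + 1 - x = k + 1 by omega] at h1
      have h2 : ((x + k + 1).choose (x + 1) : ℝ) * (x + 1) = (x + k + 1).choose x * (k + 1) := by
        exact_mod_cast h1
      simp only [hw]
      rw [show x + k + 1 - x = k + 1 by omega, show x + k + 1 - (x + 1) = k by omega, poch_succ,
        poch_succ]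
      push_cast
      linear_combination (poch (a + 1) x * (a + 1 + x) * poch (a + 1) k * (a + 1 + k)) * h2
    have hB : ∀ x : ℕ, (opH a M f).eval (x : ℝ) =
        (x + a + 1) * (x - M) * (f.eval ((x : ℝ) + 1) - f.eval (x : ℝ)) -
          x * (x - (a + M + 1)) * (f.eval (x : ℝ) - f.eval ((x : ℝ) + -1)) := fun x => by
      rw [opH_apply, fwd_apply, bwd_apply]
      simp only [eval_sub, eval_mul, eval_add, eval_X, eval_C, eval_shift]
      ring
    rw [hL]
    change ∑ x ∈ Finset.range (M + 1), w x * _ = 0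
    simp only [hB, mul_sub (w _), Finset.sum_sub_distrib]
    rw [Finset.sum_range_succ, Finset.sum_range_succ' (fun x : ℕ =>
      w x * (x * (x - (a + M + 1)) * (f.eval (x : ℝ) - f.eval ((x : ℝ) + -1)))), sub_self, mul_zero,
      zero_mul, mul_zero, add_zero, Nat.cast_zero, zero_mul, zero_mul, mul_zero, add_zero, sub_eq_zero]
    refine Finset.sum_congr rfl fun x hx => ?_
    rw [← mul_assoc, hpe x hx, ← mul_assoc]
    push_cast
    rw [add_neg_cancel_right]; ring
  · have hp : ∀ z : ℝ, (∀ i : ℕ, 1 ≤ i → z ≠ -i) → ∀ n, poch (z + 1) n ≠ 0 := fun z hz n => by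
      rw [poch_eq_prod, Finset.prod_ne_zero_iff]
      intro i _ h0
      exact hz (i + 1) (by omega) (by push_cast; linarith)
    have ha := hp a fun i hi => (h1 i hi).1
    have h2a := hp (a + a) fun i hi => (h1 i hi).2.2.1
    have hN := hp (a + a + N + 1) fun i hi => (h1 i hi).2.2.2
    rw [show a + a + N + 1 + 1 = 2 + a + a + N by ring] at hN
    have hdeg := degree_hahn_of_poch_ne_zero hN ha h2a
    obtain ⟨c, hc, hc0⟩ : ∃ c : ℝ, c ≠ 0 ∧ hahn a a N 0 = C c := by
      refine ⟨(hahn a a N 0).coeff 0, coeff_ne_zero_of_eq_degree (by simpa using hdeg 0),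
        eq_C_of_degree_le_zero (hdeg 0).le⟩
    obtain ⟨e, he⟩ := exists_sum_of_degree (fun j _ => hdeg j) (f := f) (m := f.natDegree + 1)
      (degree_le_natDegree.trans_lt (by exact_mod_cast Nat.lt_succ_self _))
    rw [he, map_sum, map_sum]
    refine Finset.sum_eq_zero fun j _ => ?_
    rw [map_C_mul, apply_C_mul, opH_hahn_of_poch_ne_zero hN ha, apply_C_mul]
    rcases Nat.eq_zero_or_pos j with rfl | hj
    · simp
    · have h4 := h2 j 0 hj.ne'
      rw [hc0, mul_comm, apply_C_mul] at h4
      rw [(mul_eq_zero.1 h4).resolve_left hc, mul_zero, mul_zero]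

/-- A zero of the denominator of a moment occurs only for a measure on finitely many points, and there
only for the moments that vanish. -/
lemma IsHahnFunctional.bp_cases {a N : ℝ} {L : ℝ[X] →ₗ[ℝ] ℝ} (h : IsHahnFunctional a a N L)
    (j : ℕ) : (∃ M < j, N = (M : ℕ) ∧ L (bp j) = 0) ∨ ∀ i < j, (i : ℝ) + 2 * a + 2 ≠ 0 := by
  rcases h with ⟨M, rfl, -, h2, hL⟩ | ⟨-, h1, -, -⟩
  · rcases lt_or_ge M j with hM | hM
    · refine Or.inl ⟨M, hM, rfl, ?_⟩
      rw [hL]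
      refine Finset.sum_eq_zero fun x hx => ?_
      have hx' := Finset.mem_range.1 hx
      have h3 : (bp j).eval (x : ℝ) = 0 := by
        rw [bp, ← coe_evalRingHom, map_poch, poch_eq_prod]
        exact Finset.prod_eq_zero (Finset.mem_range.2 (show x < j by omega)) (by simp)
      rw [h3, mul_zero]
    · refine Or.inr fun i hi h0 => h2 (i + 2) (by omega) (by omega) ?_
      push_cast; linarith
  · refine Or.inr fun i hi h0 => (h1 (i + 2) (by omega)).2.2.1 ?_
    push_cast; linarith

lemma IsHahnFunctional.eq_zero {a N : ℝ} {L : ℝ[X] →ₗ[ℝ] ℝ} (h : IsHahnFunctional a a N L)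
    (h1 : L 1 = 0) : L = 0 := eq_zero_of_bp fun j => by
  rcases h.bp_cases j with ⟨M, -, -, h2⟩ | h2
  · exact h2
  · rw [moment_eq h.apply_opH h2, h1, hahnMoment, zero_mul]

/-- At most one factor of the denominator of a moment vanishes in the limit, and then to the first
order. -/
lemma tendsto_cube_mul_prod_inv {t : ℕ → ℝ} (ht : Tendsto t atTop (𝓝 0)) (ht0 : ∀ n, t n ≠ 0)
    (a : ℝ) (j : ℕ) :
    Tendsto (fun n => t n ^ 3 * ∏ i ∈ Finset.range j, ((i : ℝ) + 2 * (a + t n) + 2)⁻¹) atTop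
      (𝓝 0) := by
  have hlim : ∀ i : ℕ, Tendsto (fun n => (i : ℝ) + 2 * (a + t n) + 2) atTop
      (𝓝 (i + 2 * a + 2)) := fun i => by
    simpa using (((ht.const_add a).const_mul 2).const_add (i : ℝ)).add_const 2
  have hprod : ∀ S : Finset ℕ, (∀ i ∈ S, (i : ℝ) + 2 * a + 2 ≠ 0) → ∃ l,
      Tendsto (fun n => ∏ i ∈ S, ((i : ℝ) + 2 * (a + t n) + 2)⁻¹) atTop (𝓝 l) := fun S hS =>
    ⟨_, tendsto_finsetProd _ fun i hi => (hlim i).inv₀ (hS i hi)⟩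
  by_cases h : ∃ i ∈ Finset.range j, (i : ℝ) + 2 * a + 2 = 0
  · obtain ⟨i₀, hi₀, h0⟩ := h
    obtain ⟨l, hl⟩ := hprod ((Finset.range j).erase i₀) fun i hi h1 =>
      (Finset.mem_erase.1 hi).1 (by exact_mod_cast (show (i : ℝ) = i₀ by linarith))
    have h2 := ((ht.pow 2).div_const 2).mul hl
    rw [zero_pow two_ne_zero, zero_div, zero_mul] at h2
    refine h2.congr fun n => ?_
    rw [← Finset.mul_prod_erase _ _ hi₀, show (i₀ : ℝ) + 2 * (a + t n) + 2 = 2 * t n by linarith]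
    have := ht0 n
    field_simp
  · push Not at h
    obtain ⟨l, hl⟩ := hprod _ h
    simpa using (ht.pow 3).mul hl

lemma IsHahnFunctional.tendsto_moment {a N : ℝ} {L : ℝ[X] →ₗ[ℝ] ℝ} (h : IsHahnFunctional a a N L)
    {t : ℕ → ℝ} (ht : Tendsto t atTop (𝓝 0)) (ht0 : ∀ n, t n ≠ 0) (j : ℕ) :
    Tendsto (fun n => hahnMoment (a + t n) (N + t n ^ 3) (L 1) j) atTop (𝓝 (L (bp j))) := by
  have ha : Tendsto (fun n => a + t n) atTop (𝓝 a) := by simpa using ht.const_add a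
  have hN : Tendsto (fun n => N + t n ^ 3) atTop (𝓝 N) := by simpa using (ht.pow 3).const_add N
  have hnum : ∀ i : ℕ, Tendsto (fun n => ((i : ℝ) - (N + t n ^ 3)) * (i + (a + t n) + 1)) atTop
      (𝓝 ((i - N) * (i + a + 1))) := fun i =>
    (hN.const_sub _).mul ((ha.const_add _).add_const 1)
  rcases h.bp_cases j with ⟨M, hM, rfl, h2⟩ | h2
  · rw [h2]
    have h3 := ((tendsto_finsetProd ((Finset.range j).erase M) fun i _ => hnum i).mul
      ((ha.const_add (M : ℝ)).add_const 1)).mul (tendsto_cube_mul_prod_inv ht ht0 a j)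
    have h4 := h3.const_mul (-(L 1))
    rw [mul_zero, mul_zero] at h4
    refine h4.congr fun n => ?_
    have h5 : ∏ i ∈ Finset.range j, (((i : ℝ) - (M + t n ^ 3)) * (i + (a + t n) + 1) /
        (i + 2 * (a + t n) + 2)) =
        (∏ i ∈ Finset.range j, (((i : ℝ) - (M + t n ^ 3)) * (i + (a + t n) + 1))) *
          ∏ i ∈ Finset.range j, ((i : ℝ) + 2 * (a + t n) + 2)⁻¹ := by
      simp only [div_eq_mul_inv]
      exact Finset.prod_mul_distrib
    rw [hahnMoment, h5, ← Finset.mul_prod_erase (Finset.range j)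
      (fun i : ℕ => ((i : ℝ) - (M + t n ^ 3)) * (i + (a + t n) + 1)) (Finset.mem_range.2 hM)]
    ring
  · rw [moment_eq h.apply_opH h2]
    exact (tendsto_finsetProd _ fun i hi => (hnum i).div
      (((ha.const_mul 2).const_add (i : ℝ)).add_const 2)
      (h2 i (Finset.mem_range.1 hi))).const_mul _

/-- A curve of generic parameters. The parameter `N` moves by `t³`, so that a vanishing factor of the
numerator of a moment is smaller than a simple zero of the denominator. -/
lemma exists_generic_path (a N : ℝ) : ∃ t : ℕ → ℝ, Tendsto t atTop (𝓝 0) ∧ (∀ n, t n ≠ 0) ∧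
    ∀ n, Generic (a + t n) (N + t n ^ 3) := by
  have h3 : StrictMono fun t : ℝ => t ^ 3 := (by decide : Odd 3).strictMono_pow
  have hc : ∀ f : ℝ → ℝ, StrictMono f → (f ⁻¹' Set.range (fun k : ℤ => (k : ℝ))).Countable :=
    fun f hf => (Set.countable_range _).preimage_of_injOn hf.injective.injOn
  have m1 : StrictMono fun t : ℝ => a + t := fun x y h => by simpa using h
  have m2 : StrictMono fun t : ℝ => N + t ^ 3 := fun x y h => by simpa using h3 h
  obtain ⟨t, ht, ht0⟩ := exists_seq_notMem (((((hc _ m1).union (hc _ m2)).union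
    (hc _ (m1.add m2))).union (hc _ (m1.add m1))).union ((hc _ ((m1.add m1).add m2)).union
      (Set.countable_singleton 0)))
  refine ⟨t, ht0, fun n h0 => ht n (by simp [h0]), fun n => ⟨fun k hk => ht n ?_, fun k hk => ht n ?_,
    fun k hk => ht n ?_, fun k hk => ht n ?_, fun k hk => ht n ?_⟩⟩
  · exact .inl <| .inl <| .inl <| .inl ⟨k, hk.symm⟩
  · exact .inl <| .inl <| .inl <| .inr ⟨k, hk.symm⟩
  · exact .inl <| .inl <| .inr ⟨k, hk.symm⟩
  · exact .inl <| .inr ⟨k, hk.symm.trans (two_mul _)⟩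
  · exact .inr <| .inl ⟨k, hk.symm.trans (by rw [two_mul])⟩

/-! ### The Krall–Hahn polynomials as eigenfunctions -/

lemma tendsto_krallFactor {as Ns : ℕ → ℝ} {a N : ℝ} (ha : Tendsto as atTop (𝓝 a))
    (hN : Tendsto Ns atTop (𝓝 N)) (F G : Finset ℕ) :
    TendstoPoly (fun n => krallFactor (as n) (Ns n) F G) (krallFactor a N F G) := by
  have hX := TendstoPoly.const X
  refine TendstoPoly.mul (TendstoPoly.prod fun f _ => ?_) (TendstoPoly.prod fun f _ => ?_)
  · exact ((TendstoPoly.C (((ha.add hN).add_const 1).add_const _)).sub hX).mul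
      (hX.add (TendstoPoly.C ((ha.add_const 1).add_const _)))
  · exact ((TendstoPoly.C (hN.sub_const _)).sub hX).mul (TendstoPoly.const _)

/-- The operator `D_S` is symmetric for the Krall–Hahn functional: the parameters are approximated
by generic ones along a curve on which the moments converge. -/
lemma opSR_symm {a N : ℝ} {F G : Finset ℕ}
    (hF : ∀ f ∈ F, 0 < f) (hG : ∀ f ∈ G, 0 < f)
    (hY : ∀ u ∈ invol F, DualHahnDefined (-a) (2 * a + N) u)
    (hZ : ∀ v ∈ invol G, DualHahnDefined (-a) (-2 - N) v)
    {μ : Fin (cnt F + cnt G) → ℝ[X]} (hμ : ∀ i, IsMt a N F G i (μ i)) {P : ℝ[X]}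
    (hP : IsPS a N F G P) {L : ℝ[X] →ₗ[ℝ] ℝ}
    (hL : IsHahnFunctional (a - maxSucc F - maxSucc G) (a - maxSucc F - maxSucc G)
      (N + 2 * maxSucc G) L) (hL1 : L 1 ≠ 0) (f g : ℝ[X]) :
    krallF a N F G L (opSR a N F G μ P f * g) = krallF a N F G L (f * opSR a N F G μ P g) := by
  obtain ⟨t, ht, ht0, hgen⟩ := exists_generic_path a N
  obtain ⟨D, hD, -, hk⟩ := exists_degD hF hG
  have ha : Tendsto (fun n => a + t n) atTop (𝓝 a) := by simpa using ht.const_add a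
  have hN : Tendsto (fun n => N + t n ^ 3) atTop (𝓝 N) := by simpa using (ht.pow 3).const_add N
  have hψ := tendsto_psiRow ha hN hY hZ
  choose μs _ hμs using fun n => exists_isMt (a + t n) (N + t n ^ 3) hD hk
  obtain ⟨Ps, hPs, hPlim⟩ := exists_isPS_tendsto ha (tendsto_gCore ha hN hψ hD) hP
  have hop := tendsto_opSR ha hN (tendsto_polyR ha hN hY hZ)
    (fun i => tendsto_isMt ha hN hψ hD hk (fun n => hμs n i) (hμ i)) hPlim
  have ha' : ∀ n, a + t n - maxSucc F - maxSucc G = a - maxSucc F - maxSucc G + t n :=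
    fun n => by ring
  have hN' : ∀ n, N + t n ^ 3 + 2 * maxSucc G = N + 2 * maxSucc G + t n ^ 3 := fun n => by ring
  set Ls : ℕ → ℝ[X] →ₗ[ℝ] ℝ := fun n => momF (hahnMoment (a + t n - maxSucc F - maxSucc G)
    (N + t n ^ 3 + 2 * maxSucc G) (L 1)) with hLs
  have hLlim : ∀ f, Tendsto (fun n => Ls n f) atTop (𝓝 (L f)) := tendsto_of_bp fun j => by
    simp only [hLs, momF_bp, ha', hN']
    exact hL.tendsto_moment ht ht0 j
  have hW : ∀ {h : ℕ → ℝ[X]} {h' : ℝ[X]}, TendstoPoly h h' → Tendsto (fun n =>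
      krallF (a + t n) (N + t n ^ 3) F G (Ls n) (h n)) atTop (𝓝 (krallF a N F G L h')) := by
    intro h h' hh
    simp only [krallF_apply]
    exact TendstoPoly.apply (fun k => hLlim _) ((tendsto_krallFactor
      ((ha.sub_const _).sub_const _) (hN.add_const _) F G).mul (hh.linearMap _))
  have hsymm : ∀ n, krallF (a + t n) (N + t n ^ 3) F G (Ls n)
      (f * opSR (a + t n) (N + t n ^ 3) F G (μs n) (Ps n) g) =
      krallF (a + t n) (N + t n ^ 3) F G (Ls n)
      (opSR (a + t n) (N + t n ^ 3) F G (μs n) (Ps n) f * g) := fun n => by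
    refine (opSR_symm_of_generic (hgen n) hF hG (hμs n) (hPs n)
      (fun f => momF_opH (fun j h0 => ?_) _ f) ?_ f g).symm
    · exact ((hgen n).hat (maxSucc F) (maxSucc G)).two_a_ne (-j - 2) (by push_cast; linarith)
    · rw [← bp_zero, momF_bp, hahnMoment, Finset.prod_range_zero, mul_one, bp_zero]
      exact hL1
  have h1 := hW ((hop _ f (TendstoPoly.const f)).mul (TendstoPoly.const g))
  have h2 := hW ((TendstoPoly.const f).mul (hop _ g (TendstoPoly.const g)))
  exact tendsto_nhds_unique h1 (h2.congr hsymm)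

/-- A symmetric operator that does not raise degrees has the orthogonal polynomials as
eigenfunctions. -/
lemma exists_eigenvalue_of_symm {W : ℝ[X] →ₗ[ℝ] ℝ} {T : Module.End ℝ ℝ[X]}
    (hT : PreservesDegree T) (hsymm : ∀ f g, W (T f * g) = W (f * T g)) {n : ℕ} {q : ℕ → ℝ[X]}
    (hdeg : ∀ k ≤ n, (q k).degree = k) (horth : ∀ k ≤ n, ∀ l ≤ n, k ≠ l → W (q k * q l) = 0)
    (hnorm : ∀ k ≤ n, W (q k * q k) ≠ 0) {k : ℕ} (hk : k ≤ n) : ∃ c : ℝ, T (q k) = c • q k := by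
  have hrep : ∀ j ≤ n, ∃ e : ℕ → ℝ, T (q j) = ∑ i ∈ Finset.range (j + 1), C (e i) * q i :=
    fun j hj => exists_sum_of_degree (fun i hi => hdeg i (by omega))
      (hT (j + 1) _ (by rw [hdeg j hj]; exact_mod_cast j.lt_succ_self))
  obtain ⟨e, he⟩ := hrep k hk
  have h0 : ∀ j < k, e j = 0 := by
    intro j hj
    have hjn : j ≤ n := hj.le.trans hk
    have h1 : W (T (q k) * q j) = e j * W (q j * q j) := by
      rw [he, Finset.sum_mul, map_sum, Finset.sum_eq_single j]
      · rw [mul_assoc, apply_C_mul]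
      · intro i hi hij
        have := Finset.mem_range.1 hi
        rw [mul_assoc, apply_C_mul, horth i (by omega) j hjn hij, mul_zero]
      · intro h; exact absurd (Finset.mem_range.2 (by omega)) h
    have h2 : W (q k * T (q j)) = 0 := by
      obtain ⟨e', he'⟩ := hrep j hjn
      rw [he', Finset.mul_sum, map_sum]
      refine Finset.sum_eq_zero fun i hi => ?_
      have := Finset.mem_range.1 hi
      rw [mul_left_comm, apply_C_mul, horth k hk i (by omega) (by omega), mul_zero]
    rw [hsymm, h2] at h1
    exact (mul_eq_zero.1 h1.symm).resolve_right (hnorm j hjn)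
  refine ⟨e k, ?_⟩
  rw [he, Finset.sum_range_succ, Finset.sum_eq_zero fun j hj => by
    rw [h0 j (Finset.mem_range.1 hj), C_0, zero_mul], zero_add, smul_eq_C_mul]

lemma eigenfunction_opSR {a N : ℝ} {F G : Finset ℕ}
    (hF : ∀ f ∈ F, 0 < f) (hG : ∀ f ∈ G, 0 < f)
    (hY : ∀ u ∈ invol F, DualHahnDefined (-a) (2 * a + N) u)
    (hZ : ∀ v ∈ invol G, DualHahnDefined (-a) (-2 - N) v)
    {μ : Fin (cnt F + cnt G) → ℝ[X]} (hμ : ∀ i, IsMt a N F G i (μ i)) {P : ℝ[X]}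
    (hP : IsPS a N F G P) {L : ℝ[X] →ₗ[ℝ] ℝ}
    (hL : IsHahnFunctional (a - maxSucc F - maxSucc G) (a - maxSucc F - maxSucc G)
      (N + 2 * maxSucc G) L) {n : ℕ} {p : ℕ → ℝ[X]}
    (hp : IsOrthogonalUpTo (fun g => L (krallFactor (a - maxSucc F - maxSucc G)
      (N + 2 * maxSucc G) F G * g)) n p) {k : ℕ} (hk : k ≤ n) :
    ∃ c : ℝ, opSR a N F G μ P (shift (maxSucc G) (p k)) = c • shift (maxSucc G) (p k) := by
  obtain ⟨h1, h2, h3⟩ := hp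
  have hL1 : L 1 ≠ 0 := fun h0 => h3 0 (Nat.zero_le n) (by rw [hL.eq_zero h0]; rfl)
  have hW : ∀ f g, krallF a N F G L (shift (maxSucc G) f * shift (maxSucc G) g) =
      L (krallFactor (a - maxSucc F - maxSucc G) (N + 2 * maxSucc G) F G * (f * g)) := fun f g => by
    rw [krallF_apply, shift_mul, shift_shift, shift_shift, neg_add_cancel, shift_zero_apply,
      shift_zero_apply]
  refine exists_eigenvalue_of_symm (preservesDegree_opSR a N F G μ P)
    (opSR_symm hF hG hY hZ hμ hP hL hL1) (q := fun k => shift (maxSucc G) (p k)) (n := n)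
    (fun k hk => ?_) (fun k hk l hl hkl => ?_) (fun k hk => ?_) hk
  · rw [shift, degree_taylor, h1 k hk]
  · rw [hW]; exact h2 k hk l hl hkl
  · rw [hW]; exact h3 k hk

end

end KrallHahn

open KrallHahn in
theorem theorem2 (a N : ℝ) (F G : Finset ℕ)
    (hF : ∀ f ∈ F, 0 < f) (hG : ∀ f ∈ G, 0 < f)
    (hY : ∀ u ∈ invol F, DualHahnDefined (-a) (2 * a + N) u)
    (hZ : ∀ v ∈ invol G, DualHahnDefined (-a) (-2 - N) v)
    (hUV : ∀ u ∈ invol F, ∀ v ∈ invol G, (v : ℝ) - u + a + N + 1 ≠ 0) :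
    omega a N F G RatFunc.X ≠ 0 ∧
    (∃! R : Polynomial ℝ, SolvesR a N F G R) ∧
    ∀ R : Polynomial ℝ, SolvesR a N F G R →
      HypPoly a N F G (sFun a N F G R) ∧
      (∃ Mt : Fin (size F G) → Polynomial ℝ, HypM a N F G (sFun a N F G R) Mt) ∧
      (∃ P : Polynomial ℝ, HypP a N F G (sFun a N F G R) P) ∧
      ∀ (Mt : Fin (size F G) → Polynomial ℝ) (P : Polynomial ℝ),
        HypM a N F G (sFun a N F G R) Mt → HypP a N F G (sFun a N F G R) P →
        HasOrder (opS a N F G Mt P)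
          (2 * (∑ f ∈ F, (f : ℤ) + ∑ f ∈ G, (f : ℤ)
            - (F.card.choose 2 : ℤ) - (G.card.choose 2 : ℤ) + 1)) ∧
        ∀ (a' N' : ℝ), a' = a - maxSucc F - maxSucc G → N' = N + 2 * maxSucc G →
          ∀ L : Polynomial ℝ →ₗ[ℝ] ℝ, IsHahnFunctional a' a' N' L →
            ∀ (n : ℕ) (p : ℕ → Polynomial ℝ),
              IsOrthogonalUpTo (fun g => L (krallFactor a' N' F G * g)) n p →
              ∀ k ≤ n, ∃ c : ℝ,
                opS a N F G Mt P (shift (maxSucc G) (p k)) =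
                  c • shift (maxSucc G) (p k) := by
  obtain ⟨D, hD, hD', hk⟩ := exists_degD hF hG
  obtain ⟨l, hl, hlead⟩ := exists_leadLe_gCore hY hZ hUV hD
  have hg := hlead.ne_zero hl
  refine ⟨omega_ne_zero hg (s := 0) (by simpa using Ev.X), existsUnique_solvesR a N F G,
    fun R hR => ⟨hypPoly hg R, ?_, exists_hypP hg hR, fun Mt P hMt hP => ?_⟩⟩
  · choose μ _ hμ using exists_isMt a N hD hk
    exact ⟨fun h => μ (baseRow F G h), (hypM_iff hg hR _).2 fun h => hμ _⟩
  obtain ⟨μ, hμ, hop⟩ := exists_opS_eq ((hypM_iff hg hR Mt).1 hMt) P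
  have hPS := hP.isPS hg hR
  rw [hop, ← hD']
  refine ⟨hasOrder_opSR (fun i => ?_) (hPS.natDegree_eq hlead hl), ?_⟩
  · obtain ⟨q, h1, h2⟩ := exists_isMt a N hD hk i
    rw [(hμ i).unique h2]
    have := hk i
    omega
  · rintro a' N' rfl rfl L hL n p hp k hk
    exact eigenfunction_opSR hF hG hY hZ hμ hPS hL hp hk
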